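/- **Setting.** Let $G$ be a Lie group and $M$ an analytic manifold (both finite-dimensional, Hausdorff, second countable), and let $G$ act on $M$ from the left such that $g\mapsto g\cdot x$ and $x\mapsto g\cdot x$ are analytic for all $x\in M$, $g\in G$. Assume that the action is *sated*: for no $x\in M$ are there two different points $y,z\in M\setminus\{x\}$ and a sequence $(g_n)\subseteq G$ with $\lim_n g_n\cdot y=x=\lim_n g_n\cdot z$. Intervals are connected subsets of $\mathbb R$ with non-empty interior. An analytic diffeomorphism between intervals is a bijection that extends to an analytic diffeomorphism between open intervals. Let $I=(i',i)$ with $-\infty\le i'<i\le\infty$, let $\gamma\colon I\to M$ be an analytic immersion, $G_\gamma=\{g\in G: g\cdot\gamma=\gamma\}$ and $[g]=gG_\gamma$. **Relations.** * For intervals $D,D'\subseteq I$, $g\cdot\gamma|_D$ and $\gamma|_{D'}$ *overlap* if $g\cdot\gamma(J)=\gamma(J')$ for non-empty open intervals $J\subseteq D$, $J'\subseteq D'$ on which $\gamma$ is an embedding. They overlap *w.r.t.* an analytic diffeomorphism $\rho\colon J\to J'$ if, for such $J,J'$, $g\cdot\gamma|_J=\gamma\circ\rho$; then $\overline\rho$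 denotes the maximal analytic immersive extension of $\rho$ to an open interval. * An interval $D\subseteq I$ is *free* ($\gamma|_D$ is a *free segment*) if $g\cdot\gamma|_D=\gamma|_D$ for each $g\in G$ for which $g\cdot\gamma|_D$ and $\gamma|_D$ overlap. It is *maximal* if it is free and not properly contained in a free interval $D'\subseteq I$. The curve $\gamma$ is *free* if some interval $D\subseteq I$ is free. * For $\tau\in I$, $g\cdot\gamma|_{(i',\tau]}\rightsquigarrow\gamma|_{[\tau,i)}$ w.r.t. $\mu$ means that $\mu\colon B\to B'$ is an analytic diffeomorphism with $g\cdot\gamma|_B=\gamma\circ\mu$ and $\mu(\tau)=\tau$, where either $B=(i',\tau]$, $B'=[\tau,i)$, or $B=(j',\tau]$ with $i'<j'<\tau$, $B'=[\tau,i)$, or $B=(i',\tau]$, $B'=[\tau,j)$ with $\tau<j<i$. * For $D=[a,b]$ and an interval $D'$ that is compact or half-open, $g\cdot\gamma|_D\rightsquigarrow_\pm\gamma|_{D'}$ w.r.t. $\mu$ means that $\mu\colon B\to D'$ is an analytic diffeomorphism with $g\cdot\gamma|_B=\gamma\circ\mu$ and: if $D'=[a',b']$, then $B=D$ and $\mu(a)=a'$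 (for $+$), resp. $\mu(a)=b'$ (for $-$); if $D'$ has only a left boundary point $a'\in D'$, then $B=[a,j)$, $a<j\le b$, $\mu(a)=a'$ (for $+$), resp. $B=(j,b]$, $a\le j<b$, $\mu(b)=a'$ (for $-$); if $D'$ has only a right boundary point $b'\in D'$, then $B=(j,b]$, $a\le j<b$, $\mu(b)=b'$ (for $+$), resp. $B=[a,j)$, $a<j\le b$, $\mu(a)=b'$ (for $-$). Write $\rightsquigarrow$ if $\rightsquigarrow_+$ or $\rightsquigarrow_-$ holds. **Decompositions.** * For $\tau\in I$ with $(i',\tau]$ and $[\tau,i)$ free, a *$\tau$-decomposition* is a class $[g]\ne[e]$ with $g\cdot\gamma|_{(i',\tau]}\rightsquigarrow\gamma|_{[\tau,i)}$ w.r.t. some $\mu$. It is *faithful* if, whenever $g'\cdot\gamma|_{(i',\tau]}$ and $\gamma$ overlap w.r.t. $\rho$, either $[g']=[e]$ and $\overline\rho|_{(i',\tau]}=\mathrm{id}$, or $[g']=[g]$ and $\overline\rho|_{\mathrm{dom}\,\mu}=\mu$. * For $A\subseteq I$ compact and free, an *$A$-decomposition* is a pair $(\{a_n\}_{n\in\mathfrak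 n},\{[g_n]\}_{n\in\mathfrak n})$ with $\mathfrak n=\{n\in\mathbb Z\setminus\{0\}:\mathfrak n_-\le n\le\mathfrak n_+\}$ for some $-\infty\le\mathfrak n_-<0<\mathfrak n_+\le\infty$, with $a_n\in I$ strictly increasing in $n$ and $g_n\in G$, such that $A=A_0$, $[g_{\pm1}]\ne[e]$, and $g_n\cdot\gamma|_A\rightsquigarrow\gamma|_{A_n}$ w.r.t. some $\mu_n$ for all $n\in\mathfrak n$. Here $A_0=[a_{-1},a_1]$, $A_n=[a_{n-1},a_n]$ for $\mathfrak n_-<n\le-1$, $A_n=[a_n,a_{n+1}]$ for $1\le n<\mathfrak n_+$, $A_{\mathfrak n_-}=(i',a_{\mathfrak n_-}]$ if $\mathfrak n_-\neq-\infty$, and $A_{\mathfrak n_+}=[a_{\mathfrak n_+},i)$ if $\mathfrak n_+\ne\infty$. Put $g_0=e$, $\mu_0=\mathrm{id}_A$. The decomposition is *faithful* if, whenever $g\cdot\gamma|_A$ and $\gamma$ overlap w.r.t. $\rho$, there is a unique $n\in\mathfrak n\sqcup\{0\}$ with $[g]=[g_n]$ and $\overline\rho|_{\mathrm{dom}\,\mu_n}=\mu_n$.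 Let $h_n=g_ng_{n-1}^{-1}$ for $n\ge1$ and $h_n=g_ng_{n+1}^{-1}$ for $n\le-1$ ($n\in\mathfrak n$). * $A$ is *positive* (resp. *negative*) if it has an $A$-decomposition with $g_{\pm1}\cdot\gamma|_A\rightsquigarrow_+\gamma|_{A_{\pm1}}$ (resp. $\rightsquigarrow_-$) for both $g_1$ and $g_{-1}$. The curve $\gamma$ is *positive* (resp. *negative*) if it has some positive (resp. negative) interval. **Theorem.** Assume that $\gamma$ is free but not a free segment. Then exactly one of the following holds: $\gamma$ has a $\tau$-decomposition for some $\tau\in I$, or $\gamma$ has a compact maximal interval. 1. If $[g]$ is a $\tau$-decomposition of $\gamma$, then $\tau$ and $[g]$ are unique, $[g]$ is faithful, and $(i',\tau]$, $[\tau,i)$ are precisely the maximal intervals. 2. Each compact maximal interval $A$ admits a unique $A$-decomposition; it is faithful, and $I=\bigcup_{n\in\mathfrak n\sqcup\{0\}}A_n$. 3. If there is a compact maximal interval, then $\gamma$ is either positive or negative, and not both. 4. Let $\gamma$ be positive. Then each compact maximal interval is positive. There is a unique class $[h]\neq[e]$ such that $[h_n]=[h^{\mathrm{sign}(n)}]$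 for each $n\in\mathfrak n$, for the decomposition of each positive interval $A$; moreover then $[g_n]=[h^n]$ and $h^n\cdot\gamma|_A\rightsquigarrow_+\gamma|_{A_n}$ for all $n\in\mathfrak n$. Each $t\in I$ is contained in the interior of some positive interval. More precisely, for each positive $A$ with its decomposition, each $A_n$ with $\mathfrak n_-<n<\mathfrak n_+$ is positive; for $\mathfrak n_-<n\le0$ and $b'\in\mathrm{int}\,A_{n-1}$ there is $b\in\mathrm{int}\,A_n$ with $[b',b]$ positive; and for $0\le n<\mathfrak n_+$ and $b\in\mathrm{int}\,A_{n+1}$ there is $b'\in\mathrm{int}\,A_n$ with $[b',b]$ positive. 5. Let $\gamma$ be negative. Then each compact maximal interval is negative. For each negative $A$ with its decomposition, the intervals $A_n$, $n\in\mathfrak n\sqcup\{0\}$, are precisely the maximal intervals; and for all $n\in\mathfrak n$ we have $g_n\cdot\gamma|_A\rightsquigarrow_+\gamma|_{A_n}$ if $n$ is even, $g_n\cdot\gamma|_A\rightsquigarrow_-\gamma|_{A_n}$ if $n$ is odd, and $$[g_n]=[g_{\sigma(\mathrm{sign}(n))}\cdots g_{\sigma(n)}],$$ a product of $|n|$ factors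 whose indices are the values of $\sigma$ at $\mathrm{sign}(n),2\,\mathrm{sign}(n),\dots,n$, where $\sigma(n)=(-1)^{n-1}$ for $n>0$ and $\sigma(n)=(-1)^n$ for $n<0$. -/

import Mathlib

open Set Filter Topology
open scoped Manifold ContDiff

namespace FreeCurve

/-! ### Intervals, analytic diffeomorphisms between intervals -/

/-- An interval: a connected subset of `ℝ` with non-empty interior. -/
def IsInterval (D : Set ℝ) : Prop := D.OrdConnected ∧ (interior D).Nonempty

/-- A (non-empty) open interval, bounded or not. -/
def IsOpenInterval (J : Set ℝ) : Prop := IsInterval J ∧ IsOpen J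

/-- `ρ` restricts to an analytic diffeomorphism of the interval `D` onto the interval `D'`, i.e.
`ρ : D → D'` is a bijection which extends to an analytic diffeomorphism `σ : O → O'`
(with analytic inverse `σ'`) between open intervals `O ⊇ D` and `O' ⊇ D'`. -/
def IsAnalyticDiffeo (ρ : ℝ → ℝ) (D D' : Set ℝ) : Prop :=
  IsInterval D ∧ IsInterval D' ∧ BijOn ρ D D' ∧
    ∃ (O O' : Set ℝ) (σ σ' : ℝ → ℝ), IsOpenInterval O ∧ IsOpenInterval O' ∧ D ⊆ O ∧ D' ⊆ O' ∧
      AnalyticOnNhd ℝ σ O ∧ AnalyticOnNhd ℝ σ' O' ∧ MapsTo σ O O' ∧ MapsTo σ' O' O ∧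
      InvOn σ' σ O O' ∧ EqOn σ ρ D

/-- For an analytic diffeomorphism `ρ` defined on the open interval `J`, and a map `μ` on an
interval `B`: the maximal analytic immersive extension of `ρ` is defined on all of `B` and
coincides with `μ` there. (The maximal extension is the union of all analytic immersive
extensions to open intervals, so this means that one of these extensions is defined on `B` and
equals `μ` on `B`.) -/
def MaxExtensionEq (ρ : ℝ → ℝ) (J : Set ℝ) (μ : ℝ → ℝ) (B : Set ℝ) : Prop :=
  ∃ (O : Set ℝ) (σ : ℝ → ℝ), IsOpenInterval O ∧ J ⊆ O ∧ AnalyticOnNhd ℝ σ O ∧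
    (∀ t ∈ O, deriv σ t ≠ 0) ∧ EqOn σ ρ J ∧ B ⊆ O ∧ EqOn σ μ B

/-! ### Sated actions -/

/-- The action of `G` on `M` is sated: no point `x` is the common limit of `gₙ • y` and `gₙ • z`
for two different points `y, z ≠ x`. -/
def IsSated (G M : Type*) [TopologicalSpace M] [SMul G M] : Prop :=
  ∀ x : M, ¬ ∃ y z : M, y ≠ z ∧ y ≠ x ∧ z ≠ x ∧
    ∃ g : ℕ → G, Tendsto (fun n => g n • y) atTop (𝓝 x) ∧ Tendsto (fun n => g n • z) atTop (𝓝 x)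

/-! ### Curves. A curve on `D` is a map `γ : ℝ → M` of which only the values on `D` matter. -/

/-- `γ` is an analytic immersion on the open interval `I`. -/
def IsAnalyticImmersion {E M : Type*} [NormedAddCommGroup E] [NormedSpace ℝ E]
    [TopologicalSpace M] [ChartedSpace E M] (γ : ℝ → M) (I : Set ℝ) : Prop :=
  ContMDiffOn 𝓘(ℝ, ℝ) 𝓘(ℝ, E) ω γ I ∧
    ∀ t ∈ I, Function.Injective (mfderiv 𝓘(ℝ, ℝ) 𝓘(ℝ, E) γ t)

section Overlap

variable {M : Type*} [TopologicalSpace M]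

/-- `γ|_D` and `γ'|_{D'}` overlap: `γ(J) = γ'(J')` for non-empty open intervals `J ⊆ D` and
`J' ⊆ D'` on which `γ` and `γ'` are embeddings. -/
def Overlap (γ : ℝ → M) (D : Set ℝ) (γ' : ℝ → M) (D' : Set ℝ) : Prop :=
  ∃ J J' : Set ℝ, IsOpenInterval J ∧ IsOpenInterval J' ∧ J ⊆ D ∧ J' ⊆ D' ∧
    IsEmbedding (J.domRestrict γ) ∧ IsEmbedding (J'.domRestrict γ') ∧ γ '' J = γ' '' J'

/-- `γ|_D` and `γ'|_{D'}` overlap with respect to the analytic diffeomorphism `ρ : J → J'`. -/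
def OverlapWrt (γ : ℝ → M) (D : Set ℝ) (γ' : ℝ → M) (D' : Set ℝ)
    (ρ : ℝ → ℝ) (J J' : Set ℝ) : Prop :=
  IsOpenInterval J ∧ IsOpenInterval J' ∧ J ⊆ D ∧ J' ⊆ D' ∧
    IsEmbedding (J.domRestrict γ) ∧ IsEmbedding (J'.domRestrict γ') ∧
    IsAnalyticDiffeo ρ J J' ∧ ∀ t ∈ J, γ t = γ' (ρ t)

end Overlap

section Related

variable {M : Type*}

/-- `γ|_B = γ' ∘ μ` for the analytic diffeomorphism `μ : B → B'`. -/
def RelatedBy (γ γ' : ℝ → M) (B B' : Set ℝ) (μ : ℝ → ℝ) : Prop :=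
  IsAnalyticDiffeo μ B B' ∧ ∀ t ∈ B, γ t = γ' (μ t)

/-- `γ|_{(i',τ]} ⇝ γ'|_{[τ,i)}` with respect to `μ : B → B'`, for `I = (i',i)`: here `μ` fixes `τ`,
and `B` is all of `(i',τ]` or `B'` is all of `[τ,i)`. -/
def HalfRelated (γ γ' : ℝ → M) (I : Set ℝ) (τ : ℝ) (B : Set ℝ) (μ : ℝ → ℝ) : Prop :=
  ∃ B' : Set ℝ, RelatedBy γ γ' B B' μ ∧ μ τ = τ ∧
    ((B = I ∩ Iic τ ∧ B' = I ∩ Ici τ) ∨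
     (∃ j ∈ I, j < τ ∧ B = Ioc j τ ∧ B' = I ∩ Ici τ) ∨
     (∃ j ∈ I, τ < j ∧ B = I ∩ Iic τ ∧ B' = Ico τ j))

/-- `D'` contains its left but not its right boundary point. -/
def IsRightOpen (D' : Set ℝ) (c : ℝ) : Prop := IsLeast D' c ∧ ∀ x, ¬ IsGreatest D' x

/-- `D'` contains its right but not its left boundary point. -/
def IsLeftOpen (D' : Set ℝ) (c : ℝ) : Prop := IsGreatest D' c ∧ ∀ x, ¬ IsLeast D' x

/-- `γ|_D ⇝₊ γ'|_{D'}` with respect to the orientation preserving `μ : B → D'`,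
for `D = [a,b]` compact and `D'` compact or half-open:
* `D' = [a',b']`, `B = D`, `μ a = a'`;
* `D' = [a',b')`, `B = [a,j)`, `μ a = a'`;
* `D' = (a',b']`, `B = (j,b]`, `μ b = b'`. -/
def RelatedPosWrt (γ γ' : ℝ → M) (D D' B : Set ℝ) (μ : ℝ → ℝ) : Prop :=
  RelatedBy γ γ' B D' μ ∧ ∃ a b : ℝ, a < b ∧ D = Icc a b ∧
    ((∃ a' b', D' = Icc a' b' ∧ B = D ∧ μ a = a') ∨
     (∃ a' j, IsRightOpen D' a' ∧ a < j ∧ j ≤ b ∧ B = Ico a j ∧ μ a = a') ∨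
     (∃ b' j, IsLeftOpen D' b' ∧ a ≤ j ∧ j < b ∧ B = Ioc j b ∧ μ b = b'))

/-- `γ|_D ⇝₋ γ'|_{D'}` with respect to the orientation reversing `μ : B → D'`,
for `D = [a,b]` compact and `D'` compact or half-open:
* `D' = [a',b']`, `B = D`, `μ a = b'`;
* `D' = [a',b')`, `B = (j,b]`, `μ b = a'`;
* `D' = (a',b']`, `B = [a,j)`, `μ a = b'`. -/
def RelatedNegWrt (γ γ' : ℝ → M) (D D' B : Set ℝ) (μ : ℝ → ℝ) : Prop :=
  RelatedBy γ γ' B D' μ ∧ ∃ a b : ℝ, a < b ∧ D = Icc a b ∧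
    ((∃ a' b', D' = Icc a' b' ∧ B = D ∧ μ a = b') ∨
     (∃ a' j, IsRightOpen D' a' ∧ a ≤ j ∧ j < b ∧ B = Ioc j b ∧ μ b = a') ∨
     (∃ b' j, IsLeftOpen D' b' ∧ a < j ∧ j ≤ b ∧ B = Ico a j ∧ μ a = b'))

/-- `γ|_D ⇝₊ γ'|_{D'}`. -/
def RelatedPos (γ γ' : ℝ → M) (D D' : Set ℝ) : Prop := ∃ B μ, RelatedPosWrt γ γ' D D' B μ

/-- `γ|_D ⇝₋ γ'|_{D'}`. -/
def RelatedNeg (γ γ' : ℝ → M) (D D' : Set ℝ) : Prop := ∃ B μ, RelatedNegWrt γ γ' D D' B μ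

end Related

/-! ### Stabilizers, free segments and maximal intervals -/

section Free

variable (G : Type*) [Group G] {M : Type*} [MulAction G M]

/-- The stabilizer `G_γ = {g | g • γ = γ}` of the curve `γ|_D`. -/
def curveStabilizer (γ : ℝ → M) (D : Set ℝ) : Subgroup G where
  carrier := {g | ∀ t ∈ D, g • γ t = γ t}
  one_mem' := fun t _ => one_smul G (γ t)
  mul_mem' := fun {g h} hg hh t ht => by rw [mul_smul, hh t ht, hg t ht]
  inv_mem' := fun {g} hg t ht => by rw [inv_smul_eq_iff, hg t ht]

variable {G} in
/-- The class `[g] = g G_γ` for the curve `γ` defined on `I`. -/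
def cls (γ : ℝ → M) (I : Set ℝ) (g : G) : G ⧸ curveStabilizer G γ I := QuotientGroup.mk g

variable [TopologicalSpace M]

/-- The interval `D` is free with respect to `γ`, i.e. `γ|_D` is a free segment
(for an analytic immersion `γ` defined on an open interval containing `D`). -/
def IsFreeSegment (γ : ℝ → M) (D : Set ℝ) : Prop :=
  IsInterval D ∧
    ∀ g : G, Overlap (fun t => g • γ t) D γ D → ∀ t ∈ D, g • γ t = γ t

/-- The curve `γ` on `I` is free: some restriction of it to an interval is a free segment. -/
def IsFreeCurve (γ : ℝ → M) (I : Set ℝ) : Prop := ∃ D ⊆ I, IsFreeSegment G γ D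

/-- `A` is maximal among the intervals in `I` that are free with respect to `γ`. -/
def IsMaximalInterval (γ : ℝ → M) (I A : Set ℝ) : Prop :=
  A ⊆ I ∧ IsFreeSegment G γ A ∧ ∀ A' ⊆ I, IsFreeSegment G γ A' → A ⊆ A' → A' = A

end Free

/-! ### Decompositions -/

section TauDecomposition

variable {G : Type*} [Group G] {M : Type*} [MulAction G M] [TopologicalSpace M]

/-- The class `[g]` is a `τ`-decomposition of the curve `γ` on `I = (i',i)`. -/
def IsTauDecomposition (γ : ℝ → M) (I : Set ℝ) (τ : ℝ) (g : G) : Prop :=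
  τ ∈ I ∧ IsFreeSegment G γ (I ∩ Iic τ) ∧ IsFreeSegment G γ (I ∩ Ici τ) ∧
    cls γ I g ≠ cls γ I 1 ∧ ∃ B μ, HalfRelated (fun t => g • γ t) γ I τ B μ

/-- A `τ`-decomposition `[g]` is faithful: a translate of `γ|_{(i',τ]}` can overlap `γ` only
trivially, or in the way given by `[g]` and its diffeomorphism `μ`. -/
def IsFaithfulTau (γ : ℝ → M) (I : Set ℝ) (τ : ℝ) (g : G) : Prop :=
  ∀ (g' : G) (ρ : ℝ → ℝ) (J J' : Set ℝ),
    OverlapWrt (fun t => g' • γ t) (I ∩ Iic τ) γ I ρ J J' →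
      (cls γ I g' = cls γ I 1 ∧ MaxExtensionEq ρ J id (I ∩ Iic τ)) ∨
      (cls γ I g' = cls γ I g ∧
        ∃ B μ, HalfRelated (fun t => g • γ t) γ I τ B μ ∧ MaxExtensionEq ρ J μ B)

end TauDecomposition

/-- The data of a family of splitting points `aₙ` and group elements `gₙ`, for
`n ∈ 𝔫 = {n ∈ ℤ | n ≠ 0, lo ≤ n ≤ hi}`, where `lo` may be `-∞` and `hi` may be `∞`. Only the values
of `pt` and `elt` on `𝔫` matter. -/
structure Splitting (G : Type*) where
  lo : WithBot ℤ
  hi : WithTop ℤ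
  pt : ℤ → ℝ
  elt : ℤ → G

namespace Splitting

variable {G : Type*} (d : Splitting G)

/-- The index set `𝔫`. -/
def index : Set ℤ := {n | n ≠ 0 ∧ d.lo ≤ (n : WithBot ℤ) ∧ (n : WithTop ℤ) ≤ d.hi}

/-- The index set `𝔫 ⊔ {0}`. -/
def index₀ : Set ℤ := insert 0 d.index

/-- The splitting points form a decomposition of the open interval `I`. -/
def IsDecompositionOf (I : Set ℝ) : Prop :=
  d.lo < 0 ∧ 0 < d.hi ∧ (∀ n ∈ d.index, d.pt n ∈ I) ∧ StrictMonoOn d.pt d.index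

open Classical in
/-- The intervals `Aₙ`, for `n ∈ 𝔫 ⊔ {0}`: `A₀ = [a₋₁, a₁]`, `Aₙ = [aₙ₋₁, aₙ]` for `lo < n ≤ -1`,
`Aₙ = [aₙ, aₙ₊₁]` for `1 ≤ n < hi`, and the outer ones are `I ∩ (-∞, a_lo]` and `I ∩ [a_hi, ∞)`. -/
noncomputable def piece (I : Set ℝ) (n : ℤ) : Set ℝ :=
  if n = 0 then Icc (d.pt (-1)) (d.pt 1)
  else if n < 0 then
    (if d.lo = (n : WithBot ℤ) then I ∩ Iic (d.pt n) else Icc (d.pt (n - 1)) (d.pt n))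
  else
    (if d.hi = (n : WithTop ℤ) then I ∩ Ici (d.pt n) else Icc (d.pt n) (d.pt (n + 1)))

variable [Group G]

/-- The elements `gₙ`, with `g₀ = e`. -/
def elt₀ (n : ℤ) : G := if n = 0 then 1 else d.elt n

/-- The elements `h_{±1} = g_{±1}`, `hₙ = gₙ gₙ₊₁⁻¹` for `n ≤ -2`, `hₙ = gₙ gₙ₋₁⁻¹` for `n ≥ 2`
(this is `gₙ` for `n = ±1`, as `g₀ = e`). -/
def step (n : ℤ) : G :=
  if n < 0 then d.elt₀ n * (d.elt₀ (n + 1))⁻¹ else d.elt₀ n * (d.elt₀ (n - 1))⁻¹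

/-- `σ(n) = (-1)^(n-1)` for `n > 0` and `σ(n) = (-1)^n` for `n < 0`. -/
def altSign (n : ℤ) : ℤ := if 0 < n then (-1) ^ (n - 1).natAbs else (-1) ^ n.natAbs

/-- The product `g_{σ(sign n)} ⋯ g_{σ(n)}` with `|n|` factors, the indices running through
`sign n, 2 sign n, …, n`. -/
def altProd (n : ℤ) : G :=
  ((List.range n.natAbs).map fun k : ℕ => d.elt (altSign (n.sign * ((k : ℤ) + 1)))).prod

end Splitting

section ADecomposition

variable {G : Type*} [Group G] {M : Type*} [MulAction G M] [TopologicalSpace M]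

/-- `({aₙ}, {[gₙ]})` is an `A`-decomposition of the curve `γ` on `I`, for `A` compact and free. -/
def IsADecomposition (γ : ℝ → M) (I A : Set ℝ) (d : Splitting G) : Prop :=
  A ⊆ I ∧ IsCompact A ∧ IsFreeSegment G γ A ∧ d.IsDecompositionOf I ∧ A = d.piece I 0 ∧
    cls γ I (d.elt 1) ≠ cls γ I 1 ∧ cls γ I (d.elt (-1)) ≠ cls γ I 1 ∧
    ∀ n ∈ d.index, RelatedPos (fun t => d.elt n • γ t) γ A (d.piece I n) ∨
      RelatedNeg (fun t => d.elt n • γ t) γ A (d.piece I n)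

/-- `μ : B → Aₙ` is the diffeomorphism `μₙ` of an `A`-decomposition, where `μ₀ = id_A`. -/
def IsTransition (γ : ℝ → M) (I A : Set ℝ) (d : Splitting G) (n : ℤ)
    (B : Set ℝ) (μ : ℝ → ℝ) : Prop :=
  (n = 0 ∧ B = A ∧ EqOn μ id A) ∨
  (n ≠ 0 ∧ (RelatedPosWrt (fun t => d.elt n • γ t) γ A (d.piece I n) B μ ∨
    RelatedNegWrt (fun t => d.elt n • γ t) γ A (d.piece I n) B μ))

/-- An `A`-decomposition is faithful: each overlap of a translate of `γ|_A` with `γ` is given by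
`[gₙ]` and `μₙ` for a unique `n ∈ 𝔫 ⊔ {0}`. -/
def IsFaithful (γ : ℝ → M) (I A : Set ℝ) (d : Splitting G) : Prop :=
  ∀ (g : G) (ρ : ℝ → ℝ) (J J' : Set ℝ),
    OverlapWrt (fun t => g • γ t) A γ I ρ J J' →
      ∃! n : ℤ, n ∈ d.index₀ ∧ cls γ I g = cls γ I (d.elt₀ n) ∧
        ∃ B μ, IsTransition γ I A d n B μ ∧ MaxExtensionEq ρ J μ B

/-- Two families `({aₙ}, {[gₙ]})` and `({a'ₙ}, {[g'ₙ]})` are the same. -/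
def SameDecomposition (γ : ℝ → M) (I : Set ℝ) (d d' : Splitting G) : Prop :=
  d'.lo = d.lo ∧ d'.hi = d.hi ∧
    ∀ n ∈ d.index, d'.pt n = d.pt n ∧ cls γ I (d'.elt n) = cls γ I (d.elt n)

variable (G)

/-- `A` is positive: it has an `A`-decomposition with `g_{±1} • γ|_A ⇝₊ γ|_{A_{±1}}`. -/
def IsPositiveInterval (γ : ℝ → M) (I A : Set ℝ) : Prop :=
  ∃ d : Splitting G, IsADecomposition γ I A d ∧
    RelatedPos (fun t => d.elt 1 • γ t) γ A (d.piece I 1) ∧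
    RelatedPos (fun t => d.elt (-1) • γ t) γ A (d.piece I (-1))

/-- `A` is negative: it has an `A`-decomposition with `g_{±1} • γ|_A ⇝₋ γ|_{A_{±1}}`. -/
def IsNegativeInterval (γ : ℝ → M) (I A : Set ℝ) : Prop :=
  ∃ d : Splitting G, IsADecomposition γ I A d ∧
    RelatedNeg (fun t => d.elt 1 • γ t) γ A (d.piece I 1) ∧
    RelatedNeg (fun t => d.elt (-1) • γ t) γ A (d.piece I (-1))

/-- The curve `γ` on `I` is positive: it admits some positive interval. -/
def IsPositiveCurve (γ : ℝ → M) (I : Set ℝ) : Prop := ∃ A, IsPositiveInterval G γ I A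

/-- The curve `γ` on `I` is negative: it admits some negative interval. -/
def IsNegativeCurve (γ : ℝ → M) (I : Set ℝ) : Prop := ∃ A, IsNegativeInterval G γ I A

variable {G}

/-- `[h] ≠ [e]`, and `[hₙ] = [h^{sign n}]` for the elements `hₙ` of each `A`-decomposition that
belongs to a positive interval `A`. -/
def IsShiftClass (γ : ℝ → M) (I : Set ℝ) (h : G) : Prop :=
  cls γ I h ≠ cls γ I 1 ∧
    ∀ (A : Set ℝ) (d : Splitting G), IsPositiveInterval G γ I A → IsADecomposition γ I A d →
      ∀ n ∈ d.index, cls γ I (d.step n) = cls γ I (h ^ n.sign)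

end ADecomposition

end FreeCurve

open FreeCurve

/-!
Let `γ` be free, but not a free segment. The relations between `γ` and its translates are studied
through germs: `f` is a germ for `g` at `s` if it is analytic with `f' s ≠ 0` and `g • γ = γ ∘ f`
near `s` (`FreeCurve.Germ`). The only analytic input is local: near a common point of two immersed
analytic curves there is a single candidate for a reparametrization of the one into the other, which
works on a whole neighborhood as soon as it works somewhere nearby
(`FreeCurve.exists_local_comparison`). Hence each germ has a maximal continuation `F`, defined on an
open interval, whose graph is closed in `I × I` (`FreeCurve.Setting.exists_comp`). Such an `F` is
called a transition here. It is strictly monotone, is determined by `g` and a single value, and on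
its way leaves every box in `I × I` (`FreeCurve.IsComp.exit`).

Satedness enters in one form only: the elements of `G` cannot shrink a fixed piece of the curve to a
point of the curve (`FreeCurve.Setting.not_shrink`). Consequently an increasing transition with a
fixed point is the identity (`FreeCurve.IsComp.eqOn_id_of_fixed`), whereas a decreasing transition
always has a fixed point and reflects the curve there.

Freeness of `D` means that each germ from an interior point to an interior point of `D` belongs to
an element of the stabilizer (`FreeCurve.Setting.isFreeSegment_iff`). As `γ` is not a free segment,
such a germ is even the identity: otherwise a translation along the curve would belong to the neutral
element and have a fundamental domain in `D`, and `γ` would be free as a whole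
(`FreeCurve.Setting.germ_trivial`). So transitions out of `D` that agree at a value are equal
(`FreeCurve.IsComp.eq_of_eq`), and this is the source of all uniqueness statements.

Let `A` be a maximal interval that has a right end `b` in `I`. Some translate of `A` begins at `b`,
since otherwise disjoint translates of `A` would accumulate at `b`, contradicting satedness
(`FreeCurve.Setting.exists_right_neighbor`). If the transition is decreasing, then it is a
reflection in `b`; if it is increasing, then `A` is followed by a shifted copy of itself.

For compact `A = [a, b]` there are such neighbors on both sides. Composing a transition with those
to the neighbors gives the next translate, and so on; the resulting translates cover `I`, because
they cannot shrink to a point, and are unique (`FreeCurve.Setting.exists_tiles`,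
`FreeCurve.Tiles.cover`, `FreeCurve.Tiles.unique`). This tiling is the decomposition of `A`, and it
is faithful as every transition out of `A` meets the interior of some tile
(`FreeCurve.Tiles.isFaithful`).

If one of the neighbors of `A` is increasing, then a transition `F` moves all points of its domain to
the right with `[a, F a] = A`. All the intervals `[x, F x]` are then free, by cutting and pasting
along `F` (`FreeCurve.IsComp.freeOn_Icc`), and they are the compact maximal intervals; the elements
of the decomposition are the powers of the one for `F` (`FreeCurve.PosShift.tile`). If both neighbors
are decreasing, then `a` and `b` are reflection points, hence so are all the splitting points, the
translates alternate in orientation, and no free interval passes a splitting point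
(`FreeCurve.Tiles.alternate`, `FreeCurve.Tiles.isMaximalInterval_iff`). The two cases exclude each
other, since in the first one each point is interior to a free interval, and no reflection point is
(`FreeCurve.PosShift.not_isReflectionPoint`).

If there is no compact maximal interval, then a maximal interval has only one end `τ` in `I`. There
the curve has to be reflected, as an increasing transition would produce free intervals
`[x, F x]`; and the other side of `τ` is free as well (`FreeCurve.FreeOn.exists_freeSides`). The
decompositions at `τ` are the reflections at such a point.

Statements about left ends are obtained from those about right ends by reversing the curve
(`FreeCurve.Setting.mirror`).
-/

namespace FreeCurve

open scoped Pointwise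

/-! ### Analytic curves in a chart -/

/-- An analytic curve with non-vanishing velocity has an analytic left inverse near each point:
invert a coordinate whose derivative does not vanish. -/
lemma exists_analytic_leftInverse {E : Type*} [NormedAddCommGroup E] [NormedSpace ℝ E]
    {u : ℝ → E} {t : ℝ} (hu : AnalyticAt ℝ u t) (hu' : deriv u t ≠ 0) :
    ∃ ψ : E → ℝ, AnalyticAt ℝ ψ (u t) ∧ ψ (u t) = t ∧ ∀ᶠ y in 𝓝 t, ψ (u y) = y := by
  obtain ⟨l, -, hl⟩ := exists_dual_vector ℝ (deriv u t) (norm_ne_zero_iff.2 hu')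
  have hf : AnalyticAt ℝ (fun y => l (u y)) t := (l.analyticAt _).comp hu
  have hd : HasDerivAt (fun y => l (u y)) (l (deriv u t)) t :=
    l.hasFDerivAt.comp_hasDerivAt t hu.differentiableAt.hasDerivAt
  have hf' : deriv (fun y => l (u y)) t ≠ 0 := by
    rw [hd.deriv, hl]
    simpa using hu'
  have hinv := hf.analyticAt_localInverse hf'
  refine ⟨fun x => hf.hasStrictDerivAt.localInverse _ _ _ hf' (l x), ?_, ?_, ?_⟩
  · exact hinv.comp_of_eq (l.analyticAt _) rfl
  · exact HasStrictFDerivAt.localInverse_apply_image ..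
  · exact HasStrictFDerivAt.eventually_left_inverse ..

section Manifold

variable {EM : Type*} [NormedAddCommGroup EM] [NormedSpace ℝ EM] {M : Type*} [TopologicalSpace M]
  [ChartedSpace EM M]

lemma IsAnalyticImmersion.contMDiffAt {γ : ℝ → M} {I : Set ℝ}
    (hγ : IsAnalyticImmersion (E := EM) γ I) (hI : IsOpen I) {t : ℝ} (ht : t ∈ I) :
    ContMDiffAt 𝓘(ℝ, ℝ) 𝓘(ℝ, EM) ω γ t :=
  (hγ.1 t ht).contMDiffAt (hI.mem_nhds ht)

/-- In the chart at `γ t`, an analytic immersion is an analytic curve with non-vanishing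
velocity. -/
lemma IsAnalyticImmersion.analyticAt_chart [CompleteSpace EM] {γ : ℝ → M} {I : Set ℝ}
    (hγ : IsAnalyticImmersion (E := EM) γ I) (hI : IsOpen I) {t : ℝ} (ht : t ∈ I) :
    AnalyticAt ℝ (fun y => extChartAt 𝓘(ℝ, EM) (γ t) (γ y)) t ∧
      deriv (fun y => extChartAt 𝓘(ℝ, EM) (γ t) (γ y)) t ≠ 0 := by
  have h := hγ.contMDiffAt hI ht
  have hA := (contMDiffAt_iff.1 h).2
  have hA' : ContDiffAt ℝ ω (fun y => extChartAt 𝓘(ℝ, EM) (γ t) (γ y)) t := by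
    simpa [Function.comp_def, contDiffWithinAt_univ, chartAt_self_eq] using hA
  refine ⟨hA'.analyticAt, fun h0 => ?_⟩
  have hinj := hγ.2 t ht
  have hmd : MDifferentiableAt 𝓘(ℝ, ℝ) 𝓘(ℝ, EM) γ t := h.mdifferentiableAt (by simp)
  obtain ⟨L, hL, hd⟩ : ∃ L : ℝ →L[ℝ] EM,
      (∀ v : ℝ, mfderiv 𝓘(ℝ, ℝ) 𝓘(ℝ, EM) γ t v = L v) ∧
        HasFDerivWithinAt (fun y => extChartAt 𝓘(ℝ, EM) (γ t) (γ y)) L univ t := by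
    refine ⟨mfderiv 𝓘(ℝ, ℝ) 𝓘(ℝ, EM) γ t, fun _ => rfl, ?_⟩
    have := hmd.hasMFDerivAt.2
    simp only [writtenInExtChartAt, Function.comp_def, chartAt_self_eq, mfld_simps] at this ⊢
    exact this
  have h2 : L 1 = 0 := by
    rw [← h0]
    exact (hasFDerivWithinAt_univ.1 hd).hasDerivAt.deriv.symm
  have h3 := (hL 1).trans (h2.trans ((map_zero L).symm.trans (hL 0).symm))
  have : (1 : ℝ) = 0 := hinj h3
  exact one_ne_zero this

/-- The translate of an analytic immersion by an analytic action is an analytic immersion. -/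
lemma IsAnalyticImmersion.smul {G : Type*} [Group G] [MulAction G M]
    (hM : ∀ g : G, ContMDiff 𝓘(ℝ, EM) 𝓘(ℝ, EM) ω (fun x : M => g • x))
    {γ : ℝ → M} {I : Set ℝ} (hI : IsOpen I)
    (hγ : IsAnalyticImmersion (E := EM) γ I) (g : G) :
    IsAnalyticImmersion (E := EM) (fun t => g • γ t) I := by
  refine ⟨(hM g).comp_contMDiffOn hγ.1, fun t ht => ?_⟩
  have hd := (hγ.contMDiffAt hI ht).mdifferentiableAt (by simp)
  have hg : ∀ (g : G) (x : M), MDifferentiableAt 𝓘(ℝ, EM) 𝓘(ℝ, EM) (fun x : M => g • x) x :=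
    fun g x => (hM g x).mdifferentiableAt (by simp)
  have h1 : mfderiv 𝓘(ℝ, ℝ) 𝓘(ℝ, EM) γ t =
      (mfderiv 𝓘(ℝ, EM) 𝓘(ℝ, EM) (fun x : M => g⁻¹ • x) (g • γ t)).comp
        (mfderiv 𝓘(ℝ, ℝ) 𝓘(ℝ, EM) (fun t => g • γ t) t) := by
    have hd' : MDifferentiableAt 𝓘(ℝ, ℝ) 𝓘(ℝ, EM) (fun t => g • γ t) t :=
      (hg g (γ t)).comp t hd
    rw [← mfderiv_comp t (hg g⁻¹ (g • γ t)) hd']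
    congr 1
    ext x
    simp
  have hi := hγ.2 t ht
  rw [h1] at hi
  intro x y hxy
  apply hi
  exact congrArg (mfderiv 𝓘(ℝ, EM) 𝓘(ℝ, EM) (fun x : M => g⁻¹ • x) (g • γ t)) hxy

/-- The local comparison of two analytic immersions through a common point: there is only one
candidate `ρ` for a reparametrization of the one into the other, it is analytic, and it relates
the curves on a whole neighborhood as soon as it does so somewhere nearby. -/
lemma exists_local_comparison [CompleteSpace EM] {c γ : ℝ → M} {I : Set ℝ} (hI : IsOpen I)
    (hc : IsAnalyticImmersion (E := EM) c I) (hγ : IsAnalyticImmersion (E := EM) γ I)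
    {s t : ℝ} (hs : s ∈ I) (ht : t ∈ I) (hst : c s = γ t) :
    ∃ ρ : ℝ → ℝ, AnalyticAt ℝ ρ s ∧ ρ s = t ∧
      (∀ᶠ p : ℝ × ℝ in 𝓝 (s, t), c p.1 = γ p.2 → ρ p.1 = p.2) ∧
      (∃ δ > 0, ∀ x ∈ Metric.ball s δ, (∀ᶠ y in 𝓝 x, c y = γ (ρ y)) →
        ∀ y ∈ Metric.ball s δ, c y = γ (ρ y)) ∧
      ((∀ᶠ y in 𝓝 s, c y = γ (ρ y)) → deriv ρ s ≠ 0) := by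
  set φ := extChartAt 𝓘(ℝ, EM) (γ t) with hφ
  obtain ⟨hu, hu'⟩ := hγ.analyticAt_chart hI ht
  obtain ⟨hv, hv'⟩ := hc.analyticAt_chart hI hs
  simp only [hst] at hv hv'
  rw [← hφ] at hu hu' hv hv'
  obtain ⟨ψ, hψ, hψt, hψu⟩ := exists_analytic_leftInverse hu hu'
  have hρ : AnalyticAt ℝ (fun x => ψ (φ (c x))) s :=
    hψ.comp_of_eq hv (by rw [hst])
  have hρs : ψ (φ (c s)) = t := by rw [hst, hψt]
  -- the only candidate is `γ⁻¹ ∘ c`, with the local analytic left inverse of `γ` in the chart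
  refine ⟨fun x => ψ (φ (c x)), hρ, hρs, ?_, ?_, ?_⟩
  · have := (continuous_snd.tendsto (s, t)).eventually hψu
    filter_upwards [this] with p hp h
    rw [h, hp]
  · have hsrc : ∀ z, z = γ t → φ.source ∈ 𝓝 z := by
      rintro z rfl
      exact extChartAt_source_mem_nhds _
    have e1 : ∀ᶠ x in 𝓝 s, c x ∈ φ.source :=
      (hc.contMDiffAt hI hs).continuousAt.eventually (hsrc _ hst)
    have e2 : ∀ᶠ x in 𝓝 s, γ (ψ (φ (c x))) ∈ φ.source := by
      have : ContinuousAt (fun x => γ (ψ (φ (c x)))) s :=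
        ContinuousAt.comp (f := fun x => ψ (φ (c x))) (g := γ)
          (by simpa only [hρs] using (hγ.contMDiffAt hI ht).continuousAt) hρ.continuousAt
      exact this.eventually (hsrc _ (by simp only [hρs]))
    have e3 : ∀ᶠ x in 𝓝 s, AnalyticAt ℝ (fun x => φ (c x)) x := hv.eventually_analyticAt
    have e4 : ∀ᶠ x in 𝓝 s, AnalyticAt ℝ (fun x => φ (γ (ψ (φ (c x))))) x := by
      have : AnalyticAt ℝ (fun x => φ (γ (ψ (φ (c x))))) s :=
        AnalyticAt.comp_of_eq (f := fun x => ψ (φ (c x))) hu hρ hρs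
      exact this.eventually_analyticAt
    obtain ⟨δ, hδ, hball⟩ := Metric.eventually_nhds_iff_ball.1 (e1.and (e2.and (e3.and e4)))
    refine ⟨δ, hδ, fun x hx hxe y hy => ?_⟩
    -- identity theorem for `c` and `γ ∘ ρ` in the chart at `γ t`
    have := AnalyticOnNhd.eqOn_of_preconnected_of_eventuallyEq
      (f := fun x => φ (c x)) (g := fun x => φ (γ (ψ (φ (c x)))))
      (fun z hz => (hball z hz).2.2.1) (fun z hz => (hball z hz).2.2.2)
      (convex_ball s δ).isPreconnected hx (hxe.mono fun z hz => by simp only [← hz])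
    exact φ.injOn (hball y hy).1 (hball y hy).2.1 (this hy)
  · intro h h0
    apply hv'
    -- a zero of `deriv ρ` would be a zero of the velocity of `c = γ ∘ ρ`
    have hd : HasDerivAt (fun x => φ (γ (ψ (φ (c x))))) ((0 : ℝ) • deriv (fun y => φ (γ y)) t) s := by
      have h1 : HasDerivAt (fun x => ψ (φ (c x))) 0 s := by
        simpa only [h0] using hρ.differentiableAt.hasDerivAt
      exact HasDerivAt.scomp_of_eq (h := fun x => ψ (φ (c x))) s hu.differentiableAt.hasDerivAt h1 hρs.symm
    have : (fun x => φ (c x)) =ᶠ[𝓝 s] fun x => φ (γ (ψ (φ (c x)))) :=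
      h.mono fun z hz => by simp only [← hz]
    rw [this.deriv_eq, hd.deriv, zero_smul]

end Manifold

/-! ### Germs of transitions and their maximal continuations -/

/-- What the combinatorial part of the argument needs of an analytic immersion `γ` of an open
interval `I`, in a form that is visibly invariant under reversing the curve. The field `compare` is
the local comparison of `γ` with its translates: near a common point there is a single candidate
for a reparametrization. -/
structure Setting (G : Type*) [Group G] {M : Type*} [TopologicalSpace M] [MulAction G M]
    (γ : ℝ → M) (I : Set ℝ) : Prop where
  isOpen : IsOpen I
  ordConnected : I.OrdConnected
  nonempty : I.Nonempty
  cont : ∀ t ∈ I, ContinuousAt γ t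
  act : ∀ g : G, Continuous (fun x : M => g • x)
  sated : IsSated G M
  compare : ∀ (g : G) (s t : ℝ), s ∈ I → t ∈ I → g • γ s = γ t →
    ∃ ρ : ℝ → ℝ, AnalyticAt ℝ ρ s ∧ ρ s = t ∧
      (∀ᶠ p : ℝ × ℝ in 𝓝 (s, t), g • γ p.1 = γ p.2 → ρ p.1 = p.2) ∧
      (∃ δ > 0, ∀ x ∈ Metric.ball s δ, (∀ᶠ y in 𝓝 x, g • γ y = γ (ρ y)) →
        ∀ y ∈ Metric.ball s δ, g • γ y = γ (ρ y)) ∧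
      ((∀ᶠ y in 𝓝 s, g • γ y = γ (ρ y)) → deriv ρ s ≠ 0)

/-- `f` is near `s ∈ I` an analytic diffeomorphism into `I` with `g • γ = γ ∘ f`. -/
def Germ {G : Type*} [Group G] {M : Type*} [MulAction G M] (γ : ℝ → M) (I : Set ℝ)
    (g : G) (f : ℝ → ℝ) (s : ℝ) : Prop :=
  s ∈ I ∧ f s ∈ I ∧ AnalyticAt ℝ f s ∧ deriv f s ≠ 0 ∧ ∀ᶠ x in 𝓝 s, g • γ x = γ (f x)

/-- The pairs `(s, t)` such that some germ for `g` takes `s` to `t`. -/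
def Rel {G : Type*} [Group G] {M : Type*} [MulAction G M] (γ : ℝ → M) (I : Set ℝ)
    (g : G) : Set (ℝ × ℝ) :=
  {p | ∃ f, Germ γ I g f p.1 ∧ f p.1 = p.2}

/-- `F` on the open interval `O` is a maximal analytic continuation inside `I` of a germ for `g`.
Maximality is expressed by the graph being closed in `I × I`. -/
structure IsComp {G : Type*} [Group G] {M : Type*} [MulAction G M] (γ : ℝ → M) (I : Set ℝ)
    (g : G) (F : ℝ → ℝ) (O : Set ℝ) : Prop where
  isOpen : IsOpen O
  ordConnected : O.OrdConnected
  nonempty : O.Nonempty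
  germ : ∀ x ∈ O, Germ γ I g F x
  closed : ∀ s ∈ I, ∀ t ∈ I, (s, t) ∈ closure ((fun x => (x, F x)) '' O) → s ∈ O

section Basic

variable {G : Type*} [Group G] {M : Type*} [MulAction G M] {γ : ℝ → M} {I : Set ℝ} {g k : G}
  {f f' e : ℝ → ℝ} {s t : ℝ}

lemma Germ.mem (h : Germ γ I g f s) : s ∈ I := h.1
lemma Germ.map_mem (h : Germ γ I g f s) : f s ∈ I := h.2.1
lemma Germ.analyticAt (h : Germ γ I g f s) : AnalyticAt ℝ f s := h.2.2.1
lemma Germ.deriv_ne (h : Germ γ I g f s) : deriv f s ≠ 0 := h.2.2.2.1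
lemma Germ.eq (h : Germ γ I g f s) : ∀ᶠ x in 𝓝 s, g • γ x = γ (f x) := h.2.2.2.2
lemma Germ.continuousAt (h : Germ γ I g f s) : ContinuousAt f s := h.analyticAt.continuousAt

lemma Germ.congr (h : Germ γ I g f s) (hf : f =ᶠ[𝓝 s] f') : Germ γ I g f' s := by
  refine ⟨h.mem, hf.eq_of_nhds ▸ h.map_mem, h.analyticAt.congr hf, hf.deriv_eq ▸ h.deriv_ne, ?_⟩
  filter_upwards [h.eq, hf] with x hx hx'
  rw [hx, hx']

lemma Germ.congr_elt (h : Germ γ I g f s) (hI : IsOpen I) (hk : ∀ t ∈ I, g • γ t = k • γ t) :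
    Germ γ I k f s := by
  refine ⟨h.mem, h.map_mem, h.analyticAt, h.deriv_ne, ?_⟩
  filter_upwards [h.eq, hI.mem_nhds h.mem] with x hx hx'
  rw [← hk x hx', hx]

lemma Germ.id (hs : s ∈ I) : Germ γ I (1 : G) id s :=
  ⟨hs, hs, analyticAt_id, by simp, by simp⟩

lemma Germ.comp (he : Germ γ I k e (f s)) (h : Germ γ I g f s) :
    Germ γ I (k * g) (fun x => e (f x)) s := by
  refine ⟨h.mem, he.map_mem, he.analyticAt.comp h.analyticAt, ?_, ?_⟩
  · have := HasDerivAt.comp s he.analyticAt.differentiableAt.hasDerivAt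
      h.analyticAt.differentiableAt.hasDerivAt
    rw [show deriv (fun x => e (f x)) s = _ from this.deriv]
    exact mul_ne_zero he.deriv_ne h.deriv_ne
  · filter_upwards [h.eq, h.continuousAt.eventually he.eq] with x hx hx'
    rw [mul_smul, hx, hx']

lemma Germ.eventually (h : Germ γ I g f s) (hI : IsOpen I) : ∀ᶠ x in 𝓝 s, Germ γ I g f x := by
  have hd : ∀ᶠ x in 𝓝 s, deriv f x ≠ 0 :=
    h.analyticAt.deriv.continuousAt.eventually_ne h.deriv_ne
  filter_upwards [hI.mem_nhds h.mem, h.continuousAt.eventually (hI.mem_nhds h.map_mem),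
    h.analyticAt.eventually_analyticAt, hd, h.eq.eventually_nhds] with x h1 h2 h3 h4 h5
  exact ⟨h1, h2, h3, h4, h5⟩

lemma eqOn_of_germs {O : Set ℝ} (hO : O.OrdConnected) (h : ∀ x ∈ O, Germ γ I g f x)
    (h' : ∀ x ∈ O, Germ γ I k f' x) (hs : s ∈ O) (he : f =ᶠ[𝓝 s] f') : EqOn f f' O :=
  AnalyticOnNhd.eqOn_of_preconnected_of_eventuallyEq (fun x hx => (h x hx).analyticAt)
    (fun x hx => (h' x hx).analyticAt) hO.isPreconnected hs he

variable [TopologicalSpace M] (S : Setting G γ I)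
include S

namespace Setting

/-- A continuous local reparametrization of a translate is a germ: it agrees with the only
candidate of the local comparison, which is analytic with non-vanishing derivative. -/
lemma germ_of_continuousAt {r : ℝ → ℝ} (hs : s ∈ I) (hr : r s ∈ I) (hc : ContinuousAt r s)
    (h : ∀ᶠ x in 𝓝 s, g • γ x = γ (r x)) : Germ γ I g r s := by
  obtain ⟨ρ, hρ, -, hu, -, hd⟩ := S.compare g s (r s) hs hr h.self_of_nhds
  have hp : Tendsto (fun x => (x, r x)) (𝓝 s) (𝓝 (s, r s)) :=
    continuousAt_id.prodMk hc
  have he : ρ =ᶠ[𝓝 s] r := by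
    filter_upwards [hp.eventually hu, h] with x hx hx'
    exact hx hx'
  refine ⟨hs, hr, hρ.congr he, ?_, h⟩
  rw [← he.deriv_eq]
  apply hd
  filter_upwards [h, he] with x hx hx'
  rw [hx, hx']

/-- A germ for `g` at `s` is determined by its value at `s`. -/
lemma germ_unique (h : Germ γ I g f s) (h' : Germ γ I g f' s) (hf : f s = f' s) :
    f =ᶠ[𝓝 s] f' := by
  obtain ⟨ρ, -, -, hu, -⟩ := S.compare g s (f s) h.mem h.map_mem h.eq.self_of_nhds
  have hp : Tendsto (fun x => (x, f x)) (𝓝 s) (𝓝 (s, f s)) :=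
    continuousAt_id.prodMk h.continuousAt
  have hp' : Tendsto (fun x => (x, f' x)) (𝓝 s) (𝓝 (s, f s)) := by
    rw [hf]
    exact continuousAt_id.prodMk h'.continuousAt
  filter_upwards [hp.eventually hu, hp'.eventually hu, h.eq, h'.eq] with x h1 h2 h3 h4
  rw [← h1 h3, ← h2 h4]

lemma germ_inv (h : Germ γ I g f s) : ∃ f' : ℝ → ℝ, Germ γ I g⁻¹ f' (f s) ∧ f' (f s) = s ∧
    (∀ᶠ x in 𝓝 s, f' (f x) = x) ∧ ∀ᶠ y in 𝓝 (f s), f (f' y) = y := by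
  have hinv := h.analyticAt.analyticAt_localInverse h.deriv_ne
  set f' := h.analyticAt.hasStrictDerivAt.localInverse _ _ _ h.deriv_ne with hf'
  have h1 : f' (f s) = s := HasStrictFDerivAt.localInverse_apply_image ..
  have h2 : ∀ᶠ x in 𝓝 s, f' (f x) = x := HasStrictFDerivAt.eventually_left_inverse ..
  have h3 : ∀ᶠ y in 𝓝 (f s), f (f' y) = y := HasStrictFDerivAt.eventually_right_inverse ..
  refine ⟨f', S.germ_of_continuousAt h.map_mem (h1.symm ▸ h.mem) hinv.continuousAt ?_, h1, h2, h3⟩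
  have h4 : ∀ᶠ y in 𝓝 (f s), g • γ (f' y) = γ (f (f' y)) := by
    have : Tendsto f' (𝓝 (f s)) (𝓝 s) := by
      simpa only [h1] using hinv.continuousAt.tendsto
    exact this.eventually h.eq
  filter_upwards [h3, h4] with y hy hy'
  rw [inv_smul_eq_iff, hy', hy]

/-- The relation given by the germs is closed in `I × I`, and near each point of its closure it is
the graph of a single analytic function. -/
lemma rel_closed [T2Space M] (hs : s ∈ I) (ht : t ∈ I) (hst : (s, t) ∈ closure (Rel γ I g)) :
    ∃ ρ : ℝ → ℝ, Germ γ I g ρ s ∧ ρ s = t ∧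
      ∀ᶠ p : ℝ × ℝ in 𝓝 (s, t), p ∈ Rel γ I g → ρ p.1 = p.2 := by
  have hfr : ∃ᶠ p in 𝓝 (s, t), p ∈ Rel γ I g := mem_closure_iff_frequently.1 hst
  have hc1 : Tendsto (fun p : ℝ × ℝ => g • γ p.1) (𝓝 (s, t)) (𝓝 (g • γ s)) :=
    ((S.act g).tendsto _).comp ((S.cont s hs).tendsto.comp (continuous_fst.tendsto (s, t)))
  have hc2 : Tendsto (fun p : ℝ × ℝ => γ p.2) (𝓝 (s, t)) (𝓝 (γ t)) :=
    (S.cont t ht).tendsto.comp (continuous_snd.tendsto (s, t))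
  have heq : g • γ s = γ t := by
    by_contra hne
    obtain ⟨U, V, hU, hV, hsU, htV, hUV⟩ := t2_separation hne
    obtain ⟨p, ⟨f, hf, hfp⟩, h1, h2⟩ := (hfr.and_eventually
      ((hc1.eventually (hU.mem_nhds hsU)).and (hc2.eventually (hV.mem_nhds htV)))).exists
    rw [hf.eq.self_of_nhds, hfp] at h1
    exact hUV.le_bot ⟨h1, h2⟩
  obtain ⟨ρ, hρ, hρs, hu, ⟨δ, hδ, hball⟩, -⟩ := S.compare g s t hs ht heq
  have hball' : ∀ᶠ p : ℝ × ℝ in 𝓝 (s, t), p.1 ∈ Metric.ball s δ :=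
    (continuous_fst.tendsto (s, t)).eventually (Metric.ball_mem_nhds s hδ)
  -- a germ close to `(s, t)` agrees with the candidate `ρ`, which therefore relates the curves up
  -- to `s`
  obtain ⟨p, ⟨f, hf, hfp⟩, h1, h2⟩ := (hfr.and_eventually (hu.eventually_nhds.and hball')).exists
  have hp : Tendsto (fun x => (x, f x)) (𝓝 p.1) (𝓝 p) := by
    have : Tendsto (fun x => (x, f x)) (𝓝 p.1) (𝓝 (p.1, f p.1)) :=
      continuousAt_id.prodMk hf.continuousAt
    rwa [hfp] at this
  have hx : ∀ᶠ y in 𝓝 p.1, g • γ y = γ (ρ y) := by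
    filter_upwards [hp.eventually h1, hf.eq] with y hy hy'
    rw [hy', hy hy']
  have hall := hball p.1 h2 hx
  refine ⟨ρ, S.germ_of_continuousAt hs (hρs ▸ ht) hρ.continuousAt ?_, hρs, ?_⟩
  · filter_upwards [Metric.ball_mem_nhds s hδ] with y hy using hall y hy
  · filter_upwards [hu] with p hp
    rintro ⟨f, hf, hfp⟩
    apply hp
    rw [hf.eq.self_of_nhds, hfp]

end Setting

/-- Each germ has a maximal continuation. -/
lemma Setting.exists_comp [T2Space M] (h : Germ γ I g f s) :
    ∃ F O, IsComp γ I g F O ∧ s ∈ O ∧ F =ᶠ[𝓝 s] f := by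
  classical
  -- `O` is the union of the domains of all continuations of the germ to open intervals; by the
  -- identity theorem they agree with each other and fit together to `F`
  set P : Set ℝ → (ℝ → ℝ) → Prop := fun U F =>
    IsOpen U ∧ U.OrdConnected ∧ s ∈ U ∧ (∀ x ∈ U, Germ γ I g F x) ∧ F s = f s with hP
  have agree : ∀ U F U' F', P U F → P U' F' → EqOn F F' (U ∩ U') := by
    rintro U F U' F' ⟨-, h2, h3, h4, h5⟩ ⟨-, h2', h3', h4', h5'⟩
    exact eqOn_of_germs (h2.inter h2') (fun x hx => h4 x hx.1) (fun x hx => h4' x hx.2) ⟨h3, h3'⟩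
      (S.germ_unique (h4 s h3) (h4' s h3') (h5.trans h5'.symm))
  obtain ⟨U₀, hU₀⟩ : ∃ U, P U f := by
    obtain ⟨δ, hδ, hb⟩ := Metric.eventually_nhds_iff_ball.1 (h.eventually S.isOpen)
    refine ⟨Metric.ball s δ, Metric.isOpen_ball, ?_, Metric.mem_ball_self hδ, hb, rfl⟩
    rw [Real.ball_eq_Ioo]
    exact ordConnected_Ioo
  set O : Set ℝ := {x | ∃ U F, P U F ∧ x ∈ U} with hO
  set F : ℝ → ℝ := fun x => if hx : ∃ U F, P U F ∧ x ∈ U then hx.choose_spec.choose x else 0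
    with hF
  have hFeq : ∀ U F', P U F' → EqOn F F' U := by
    intro U F' hUF x hx
    have hx' : ∃ U F, P U F ∧ x ∈ U := ⟨U, F', hUF, hx⟩
    simp only [hF, dif_pos hx']
    exact agree _ _ _ _ hx'.choose_spec.choose_spec.1 hUF
      ⟨hx'.choose_spec.choose_spec.2, hx⟩
  have hOpen : IsOpen O := by
    rw [isOpen_iff_mem_nhds]
    rintro x ⟨U, F', hUF, hx⟩
    filter_upwards [hUF.1.mem_nhds hx] with y hy using ⟨U, F', hUF, hy⟩
  have hOrd : O.OrdConnected := by
    have hpre : IsPreconnected O := by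
      refine isPreconnected_of_forall s ?_
      rintro y ⟨U, F', hUF, hy⟩
      exact ⟨U, fun z hz => ⟨U, F', hUF, hz⟩, hUF.2.2.1, hy, hUF.2.1.isPreconnected⟩
    exact hpre.ordConnected
  have hG : ∀ x ∈ O, Germ γ I g F x := by
    rintro x ⟨U, F', hUF, hx⟩
    refine (hUF.2.2.2.1 x hx).congr ?_
    filter_upwards [hUF.1.mem_nhds hx] with y hy using (hFeq U F' hUF hy).symm
  have hsO : s ∈ O := ⟨U₀, f, hU₀, hU₀.2.2.1⟩
  have hFs : F s = f s := hFeq U₀ f hU₀ hU₀.2.2.1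
  refine ⟨F, O, ⟨hOpen, hOrd, ⟨s, hsO⟩, hG, fun a ha b hb hab => ?_⟩, hsO, ?_⟩
  · have hsub : (fun x => (x, F x)) '' O ⊆ Rel γ I g := by
      rintro _ ⟨x, hx, rfl⟩
      exact ⟨F, hG x hx, rfl⟩
    obtain ⟨ρ, hρ, hρa, hu⟩ := S.rel_closed ha hb (closure_mono hsub hab)
    obtain ⟨δ, hδ, hball⟩ := Metric.eventually_nhds_iff_ball.1 (hρ.eventually S.isOpen)
    have hbd : ∀ᶠ p : ℝ × ℝ in 𝓝 (a, b), p.1 ∈ Metric.ball a δ :=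
      (continuous_fst.tendsto (a, b)).eventually (Metric.ball_mem_nhds a hδ)
    obtain ⟨_, ⟨x, hx, rfl⟩, hxb, hxu⟩ :=
      ((mem_closure_iff_frequently.1 hab).and_eventually (hbd.and hu)).exists
    have hbo : (Metric.ball a δ).OrdConnected := by
      rw [Real.ball_eq_Ioo]
      exact ordConnected_Ioo
    have heq : EqOn ρ F (Metric.ball a δ ∩ O) :=
      eqOn_of_germs (hbo.inter hOrd) (fun y hy => hball y hy.1) (fun y hy => hG y hy.2)
        ⟨hxb, hx⟩ (S.germ_unique (hball x hxb) (hG x hx) (hxu (hsub ⟨x, hx, rfl⟩)))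
    -- the germ `ρ` at the limit `(a, b)` of the graph continues `F` across `a`
    set F₁ : ℝ → ℝ := fun y => if y ∈ O then F y else ρ y with hF₁
    have hF₁O : EqOn F₁ F O := fun y hy => if_pos hy
    have hF₁b : EqOn F₁ ρ (Metric.ball a δ) := by
      intro y hy
      by_cases hyO : y ∈ O
      · rw [hF₁O hyO, heq ⟨hy, hyO⟩]
      · exact if_neg hyO
    refine ⟨O ∪ Metric.ball a δ, F₁, ⟨hOpen.union Metric.isOpen_ball, ?_, Or.inl hsO, ?_, ?_⟩,
      Or.inr (Metric.mem_ball_self hδ)⟩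
    · exact (IsPreconnected.union x hx hxb hOrd.isPreconnected hbo.isPreconnected).ordConnected
    · rintro y (hy | hy)
      · refine (hG y hy).congr ?_
        filter_upwards [hOpen.mem_nhds hy] with z hz using (hF₁O hz).symm
      · refine (hball y hy).congr ?_
        filter_upwards [Metric.isOpen_ball.mem_nhds hy] with z hz using (hF₁b hz).symm
    · rw [hF₁O hsO, hFs]
  · exact S.germ_unique (hG s hsO) h hFs

end Basic

section Comp

variable {G : Type*} [Group G] {M : Type*} [MulAction G M] {γ : ℝ → M} {I : Set ℝ} {g k : G}
  {F : ℝ → ℝ} {O : Set ℝ} {s t x : ℝ}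

namespace IsComp

lemma subset (h : IsComp γ I g F O) : O ⊆ I := fun x hx => (h.germ x hx).mem

lemma mapsTo (h : IsComp γ I g F O) : MapsTo F O I := fun x hx => (h.germ x hx).map_mem

lemma continuousOn (h : IsComp γ I g F O) : ContinuousOn F O :=
  fun x hx => (h.germ x hx).continuousAt.continuousWithinAt

lemma smul_eq (h : IsComp γ I g F O) (hx : x ∈ O) : g • γ x = γ (F x) :=
  (h.germ x hx).eq.self_of_nhds

lemma congr_elt (h : IsComp γ I g F O) (hI : IsOpen I) (hk : ∀ t ∈ I, g • γ t = k • γ t) :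
    IsComp γ I k F O :=
  ⟨h.isOpen, h.ordConnected, h.nonempty, fun x hx => (h.germ x hx).congr_elt hI hk, h.closed⟩

lemma strictMonoOn_or_strictAntiOn (h : IsComp γ I g F O) :
    StrictMonoOn F O ∨ StrictAntiOn F O := by
  have hc : Convex ℝ O := h.ordConnected.convex
  have hd : ContinuousOn (deriv F) O := fun x hx =>
    (h.germ x hx).analyticAt.deriv.continuousAt.continuousWithinAt
  have hs := h.ordConnected.isPreconnected.image _ hd
  -- the derivative of `F` is continuous without zeros on the interval `O`
  obtain ⟨x₀, hx₀⟩ := h.nonempty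
  rcases lt_or_gt_of_ne (h.germ x₀ hx₀).deriv_ne with h0 | h0
  · right
    refine strictAntiOn_of_deriv_neg hc h.continuousOn fun x hx => ?_
    rw [h.isOpen.interior_eq] at hx
    by_contra hx0
    obtain ⟨y, hy, hy0⟩ := hs.ordConnected.out ⟨x₀, hx₀, rfl⟩ ⟨x, hx, rfl⟩
      ⟨h0.le, not_lt.1 hx0⟩
    exact (h.germ y hy).deriv_ne hy0
  · left
    refine strictMonoOn_of_deriv_pos hc h.continuousOn fun x hx => ?_
    rw [h.isOpen.interior_eq] at hx
    by_contra hx0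
    obtain ⟨y, hy, hy0⟩ := hs.ordConnected.out ⟨x, hx, rfl⟩ ⟨x₀, hx₀, rfl⟩
      ⟨not_lt.1 hx0, h0.le⟩
    exact (h.germ y hy).deriv_ne hy0

lemma injOn (h : IsComp γ I g F O) : InjOn F O := by
  rcases h.strictMonoOn_or_strictAntiOn with h | h
  · exact h.injOn
  · exact h.injOn

lemma image_mem_nhds (h : IsComp γ I g F O) {U : Set ℝ} (hx : x ∈ O) (hU : U ∈ 𝓝 x) :
    F '' U ∈ 𝓝 (F x) := by
  have := (h.germ x hx).analyticAt.hasStrictDerivAt.map_nhds_eq (h.germ x hx).deriv_ne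
  rw [← this]
  exact image_mem_map hU

lemma isOpen_image (h : IsComp γ I g F O) {U : Set ℝ} (hU : IsOpen U) (hUO : U ⊆ O) :
    IsOpen (F '' U) := by
  rw [isOpen_iff_mem_nhds]
  rintro _ ⟨x, hx, rfl⟩
  exact h.image_mem_nhds (hUO hx) (hU.mem_nhds hx)

lemma ordConnected_image (h : IsComp γ I g F O) {U : Set ℝ} (hU : U.OrdConnected) (hUO : U ⊆ O) :
    (F '' U).OrdConnected :=
  (hU.isPreconnected.image _ (h.continuousOn.mono hUO)).ordConnected

/-- A maximal continuation is defined at a point of `I` as soon as its values near this point do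
not leave a compact subset of `I`. -/
lemma mem_of_frequently (h : IsComp γ I g F O) (hx : x ∈ I) {K : Set ℝ} (hK : IsCompact K)
    (hKI : K ⊆ I) (hf : ∃ᶠ y in 𝓝 x, y ∈ O ∧ F y ∈ K) : x ∈ O := by
  set l := 𝓝 x ⊓ 𝓟 {y | y ∈ O ∧ F y ∈ K} with hl
  have : NeBot l := frequently_iff_neBot.1 hf
  have hle : map F l ≤ 𝓟 K := by
    rw [le_principal_iff, mem_map]
    exact mem_inf_of_right fun y hy => hy.2
  obtain ⟨t, htK, ht⟩ := hK hle
  have ht' : MapClusterPt t l F := ht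
  refine h.closed x hx t (hKI htK) ?_
  rw [mem_closure_iff_frequently, (nhds_prod_eq : 𝓝 (x, t) = _)]
  rw [Filter.frequently_iff]
  intro U hU
  obtain ⟨V, hV, W, hW, hVW⟩ := mem_prod_iff.1 hU
  have h1 := mapClusterPt_iff_frequently.1 ht' W hW
  have h2 : ∀ᶠ y in l, y ∈ V ∧ y ∈ O := by
    filter_upwards [mem_inf_of_left hV, mem_inf_of_right (mem_principal_self _)] with y h1 h2
    exact ⟨h1, h2.1⟩
  obtain ⟨y, hyW, hyV, hyO⟩ := (h1.and_eventually h2).exists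
  exact ⟨(y, F y), hVW ⟨hyV, hyW⟩, y, hyO, rfl⟩

/-- A maximal continuation reaches a point `x` of `I` if on the way from `s` to `x` its values
stay in a compact subset of `I`. -/
lemma mem_of_compact (h : IsComp γ I g F O) (hI : I.OrdConnected) (hs : s ∈ O) (hx : x ∈ I)
    {K : Set ℝ} (hK : IsCompact K) (hKI : K ⊆ I) (hF : ∀ y ∈ O, y ∈ uIcc s x → F y ∈ K) :
    x ∈ O := by
  have key : uIcc s x ⊆ O := by
    refine isPreconnected_uIcc.subset_of_closure_inter_subset h.isOpen
      ⟨s, left_mem_uIcc, hs⟩ ?_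
    rintro y ⟨hyO, hy⟩
    by_contra hyn
    have hyI : y ∈ I := hI.uIcc_subset (h.subset hs) hx hy
    refine hyn (h.mem_of_frequently hyI hK hKI ?_)
    have hfr := mem_closure_iff_frequently.1 hyO
    have hne : s ≠ y := fun h => hyn (h ▸ hs)
    rcases lt_or_gt_of_ne hne with hlt | hlt
    · refine (hfr.and_eventually (lt_mem_nhds hlt)).mono fun z hz => ⟨hz.1, hF z hz.1 ?_⟩
      have : z < y := by
        by_contra hzy
        exact hyn (h.ordConnected.out hs hz.1 ⟨hlt.le, not_lt.1 hzy⟩)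
      have hyx : y ≤ max s x := hy.2
      rw [mem_uIcc]
      rcases le_max_iff.1 hyx with h1 | h1
      · exact absurd h1 (not_le.2 hlt)
      · exact Or.inl ⟨hz.2.le, this.le.trans h1⟩
    · refine (hfr.and_eventually (gt_mem_nhds hlt)).mono fun z hz => ⟨hz.1, hF z hz.1 ?_⟩
      have : y < z := by
        by_contra hzy
        exact hyn (h.ordConnected.out hz.1 hs ⟨not_lt.1 hzy, hlt.le⟩)
      have hyx : min s x ≤ y := hy.1
      rw [mem_uIcc]
      rcases min_le_iff.1 hyx with h1 | h1
      · exact absurd h1 (not_le.2 hlt)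
      · exact Or.inr ⟨h1.trans this.le, hz.2.le⟩
  exact key right_mem_uIcc

/-- The graph of a maximal continuation leaves each box in `I × I`: on its way from `s` to `x`
it is either defined all the way or attains the value `t`. -/
lemma exit (h : IsComp γ I g F O) (hI : I.OrdConnected) (hs : s ∈ O) (hx : x ∈ I) (ht : t ∈ I)
    (hside : (F s ≤ t ∧ ∀ y ∈ O, y ∈ uIcc s x → F s ≤ F y) ∨
      (t ≤ F s ∧ ∀ y ∈ O, y ∈ uIcc s x → F y ≤ F s)) :
    x ∈ O ∨ ∃ y ∈ O, y ∈ uIcc s x ∧ F y = t := by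
  by_contra! hcon
  obtain ⟨hxO, hcon⟩ := hcon
  refine hxO (h.mem_of_compact hI hs hx (K := uIcc (F s) t) isCompact_uIcc
    (hI.uIcc_subset (h.mapsTo hs) ht) fun y hy hyx => ?_)
  -- if `F` leaves the compact box between `F s` and `t`, then it takes the value `t` on the way
  by_contra hyn
  have hsub : uIcc s y ⊆ O := h.ordConnected.uIcc_subset hs hy
  have hiv := intermediate_value_uIcc (h.continuousOn.mono hsub)
  have htm : t ∈ uIcc (F s) (F y) := by
    rw [mem_uIcc] at hyn ⊢
    push Not at hyn
    rcases hside with ⟨h1, h2⟩ | ⟨h1, h2⟩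
    · exact Or.inl ⟨h1, (hyn.1 (h2 y hy hyx)).le⟩
    · right
      refine ⟨?_, h1⟩
      by_contra h3
      exact absurd (hyn.2 (not_le.1 h3).le) (not_lt.2 (h2 y hy hyx))
  obtain ⟨z, hz, hzt⟩ := hiv htm
  exact hcon z (hsub hz) (uIcc_subset_uIcc left_mem_uIcc hyx hz) hzt

end IsComp

lemma mem_curveStabilizer : g ∈ curveStabilizer G γ I ↔ ∀ t ∈ I, g • γ t = γ t := Iff.rfl

lemma cls_eq_iff : cls γ I g = cls γ I k ↔ ∀ t ∈ I, g • γ t = k • γ t := by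
  rw [cls, cls, QuotientGroup.eq, mem_curveStabilizer]
  refine forall₂_congr fun t _ => ?_
  rw [mul_smul, inv_smul_eq_iff, eq_comm]

lemma cls_eq_one_iff : cls γ I g = cls γ I 1 ↔ g ∈ curveStabilizer G γ I := by
  rw [cls_eq_iff, mem_curveStabilizer]
  simp

lemma cls_eq_iff_inv_mul_mem : cls γ I g = cls γ I k ↔ g⁻¹ * k ∈ curveStabilizer G γ I :=
  QuotientGroup.eq

/-- A germ only depends on the class of the group element. -/
lemma Germ.congr_cls (h : Germ γ I g f s) (hI : IsOpen I) (hk : cls γ I g = cls γ I k) :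
    Germ γ I k f s :=
  h.congr_elt hI (cls_eq_iff.1 hk)

variable [TopologicalSpace M] (S : Setting G γ I)
include S

lemma Setting.mem_Icc_subset (hs : s ∈ I) (ht : t ∈ I) : Icc s t ⊆ I := S.ordConnected.out hs ht

/-- Maximal continuations that agree at one point coincide, domains included. -/
lemma IsComp.unique (h : IsComp γ I g F O) (h' : IsComp γ I k F' O')
    (hk : cls γ I g = cls γ I k) (hs : s ∈ O) (hs' : s ∈ O') (hF : F s = F' s) :
    O = O' ∧ EqOn F F' O := by
  have key : ∀ {F F' O O'}, IsComp γ I g F O → IsComp γ I g F' O' → s ∈ O → s ∈ O' →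
      F s = F' s → O ⊆ O' ∧ EqOn F F' (O ∩ O') := by
    intro F F' O O' h h' hs hs' hF
    have heq : EqOn F F' (O ∩ O') := eqOn_of_germs (h.ordConnected.inter h'.ordConnected)
      (fun x hx => h.germ x hx.1) (fun x hx => h'.germ x hx.2) ⟨hs, hs'⟩
      (S.germ_unique (h.germ s hs) (h'.germ s hs') hF)
    refine ⟨?_, heq⟩
    have := h.ordConnected.isPreconnected.subset_of_closure_inter_subset
      (h.isOpen.inter h'.isOpen) ⟨s, hs, hs, hs'⟩ ?_
    · exact this.trans inter_subset_right
    · rintro x ⟨hx, hxO⟩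
      refine ⟨hxO, h'.closed x (h.subset hxO) (F x) (h.mapsTo hxO) ?_⟩
      have hcw : ContinuousWithinAt (fun x => (x, F x)) (O ∩ O') x :=
        (continuousAt_id.prodMk (h.germ x hxO).continuousAt).continuousWithinAt
      refine closure_mono ?_ (hcw.mem_closure_image hx)
      rintro _ ⟨y, hy, rfl⟩
      exact ⟨y, hy.2, by simp only [heq hy]⟩
  have h'' := h'.congr_elt S.isOpen (cls_eq_iff.1 hk.symm)
  obtain ⟨h1, h2⟩ := key h h'' hs hs' hF
  obtain ⟨h3, -⟩ := key h'' h hs' hs hF.symm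
  obtain rfl := h1.antisymm h3
  exact ⟨rfl, by simpa using h2⟩

/-- The inverse of a maximal continuation is a maximal continuation. -/
lemma IsComp.inv (h : IsComp γ I g F O) :
    ∃ F', IsComp γ I g⁻¹ F' (F '' O) ∧ (∀ x ∈ O, F' (F x) = x) ∧ F' '' (F '' O) = O ∧
      ∀ y ∈ F '' O, F (F' y) = y := by
  have hinv : LeftInvOn (Function.invFunOn F O) F O := h.injOn.leftInvOn_invFunOn
  set F' := Function.invFunOn F O
  have him : F' '' (F '' O) = O := by
    rw [← image_comp]
    exact (image_congr fun x hx => hinv hx).trans (image_id _)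
  refine ⟨F', ⟨h.isOpen_image h.isOpen subset_rfl, h.ordConnected_image h.ordConnected subset_rfl,
    h.nonempty.image F, ?_, ?_⟩, hinv, him, ?_⟩
  · rintro _ ⟨x, hx, rfl⟩
    obtain ⟨f', hf', hfx, h1, h2⟩ := S.germ_inv (h.germ x hx)
    refine hf'.congr ?_
    have h3 : ∀ᶠ y in 𝓝 (F x), f' y ∈ O :=
      hf'.continuousAt.eventually (by rw [hfx]; exact h.isOpen.mem_nhds hx)
    filter_upwards [h2, h3] with y hy hy'
    rw [← hinv hy', hy]
  · intro t ht s hs hts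
    have hst : (s, t) ∈ closure ((fun x => (x, F x)) '' O) := by
      have hc : Continuous (Prod.swap : ℝ × ℝ → ℝ × ℝ) := continuous_swap
      have := image_closure_subset_closure_image hc (mem_image_of_mem _ hts)
      refine closure_mono ?_ this
      rintro _ ⟨_, ⟨_, ⟨x, hx, rfl⟩, rfl⟩, rfl⟩
      exact ⟨x, hx, by simp [hinv hx]⟩
    have hsO := h.closed s hs t ht hst
    refine ⟨s, hsO, ?_⟩
    -- the graph of `F` over a neighborhood of `s` has `F s` as its only limit above `s`
    have hcl : (s, t) ∈ closure {p : ℝ × ℝ | p.1 ∈ O ∧ F p.1 = p.2} := by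
      refine closure_mono ?_ hst
      rintro _ ⟨x, hx, rfl⟩
      exact ⟨hx, rfl⟩
    obtain ⟨u, hu, hul⟩ := mem_closure_iff_seq_limit.1 hcl
    have h1 : Tendsto (fun n => (u n).1) atTop (𝓝 s) := (continuous_fst.tendsto _).comp hul
    have h2 : Tendsto (fun n => (u n).2) atTop (𝓝 t) := (continuous_snd.tendsto _).comp hul
    refine tendsto_nhds_unique ((h.germ s hsO).continuousAt.tendsto.comp h1) (h2.congr fun n => ?_)
    exact (hu n).2.symm
  · rintro _ ⟨x, hx, rfl⟩
    rw [hinv hx]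

/-- An element that has the identity as a germ stabilizes the whole curve. -/
lemma Setting.mem_stabilizer_of_germ_id [T2Space M] (h : Germ γ I g f s) (hf : f =ᶠ[𝓝 s] id) :
    g ∈ curveStabilizer G γ I := by
  obtain ⟨F, O, hF, hs, hFf⟩ := S.exists_comp h
  have hid : EqOn F id O := eqOn_of_germs hF.ordConnected hF.germ
    (fun x hx => Germ.id (G := G) (hF.subset hx)) hs (hFf.trans hf)
  -- the graph of the identity stays in `I × I`, so the continuation is defined on all of `I`
  have hO : I ⊆ O := by
    refine S.ordConnected.isPreconnected.subset_of_closure_inter_subset hF.isOpen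
      ⟨s, h.mem, hs⟩ ?_
    rintro x ⟨hx, hxI⟩
    refine hF.closed x hxI x hxI ?_
    have hcw : ContinuousWithinAt (fun x : ℝ => (x, x)) O x := by fun_prop
    refine closure_mono ?_ (hcw.mem_closure_image hx)
    rintro _ ⟨y, hy, rfl⟩
    exact ⟨y, hy, by simp [hid hy]⟩
  intro t ht
  rw [hF.smul_eq (hO ht), hid (hO ht), id]

lemma Setting.isComp_id : IsComp γ I (1 : G) id I :=
  ⟨S.isOpen, S.ordConnected, S.nonempty, fun _ hx => Germ.id hx, fun _ hs _ _ _ => hs⟩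

/-- The elements that have a germ normalize the stabilizer of the curve. -/
lemma Setting.conj_mem [T2Space M] (h : Germ γ I g f s) (hk : k ∈ curveStabilizer G γ I) :
    g⁻¹ * k * g ∈ curveStabilizer G γ I := by
  have hid : Germ γ I (g⁻¹ * k * g) id s := by
    refine S.germ_of_continuousAt h.mem h.mem continuousAt_id ?_
    filter_upwards [h.eq, h.continuousAt.eventually (S.isOpen.mem_nhds h.map_mem)] with x hx hx'
    rw [mul_smul, mul_smul, hx, hk _ hx', ← hx, inv_smul_smul, id]
  exact S.mem_stabilizer_of_germ_id hid .rfl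

lemma Setting.conj_mem' [T2Space M] (h : Germ γ I g f s) (hk : k ∈ curveStabilizer G γ I) :
    g * k * g⁻¹ ∈ curveStabilizer G γ I := by
  obtain ⟨f', hf', -⟩ := S.germ_inv h
  simpa using S.conj_mem hf' hk

/-- Right multiplication by an element that has a germ is well defined on classes, since such an
element normalizes the stabilizer. -/
lemma Setting.cls_mul_right [T2Space M] (h : Germ γ I g f s) {p q : G}
    (hpq : cls γ I p = cls γ I q) : cls γ I (p * g) = cls γ I (q * g) := by
  rw [cls_eq_iff_inv_mul_mem] at hpq ⊢
  have := S.conj_mem h hpq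
  rwa [show (p * g)⁻¹ * (q * g) = g⁻¹ * (p⁻¹ * q) * g by group]

omit S in
omit [TopologicalSpace M] in
lemma cls_mul_left {p q : G} (hpq : cls γ I p = cls γ I q) :
    cls γ I (g * p) = cls γ I (g * q) := by
  rw [cls_eq_iff_inv_mul_mem] at hpq ⊢
  rwa [show (g * p)⁻¹ * (g * q) = p⁻¹ * q by group]

end Comp

/-! ### Reversing the curve -/

section Mirror

variable {G : Type*} [Group G] {M : Type*} [MulAction G M] {γ : ℝ → M} {I : Set ℝ} {g k : G}
  {F f : ℝ → ℝ} {O : Set ℝ} {s t x : ℝ}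

lemma tendsto_neg_nhds (s : ℝ) : Tendsto (fun x : ℝ => -x) (𝓝 (-s)) (𝓝 s) := by
  simpa using (continuous_neg.tendsto (-s) : Tendsto (fun x : ℝ => -x) _ _)

lemma analyticAt_mirror {f : ℝ → ℝ} (h : AnalyticAt ℝ f s) :
    AnalyticAt ℝ (fun x => -f (-x)) (-s) :=
  (h.comp_of_eq analyticAt_id.neg (by simp)).neg

lemma deriv_mirror (h : DifferentiableAt ℝ f s) : deriv (fun x => -f (-x)) (-s) = deriv f s := by
  have h1 : HasDerivAt f (deriv f s) (- -s) := by rw [neg_neg]; exact h.hasDerivAt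
  have := (h1.comp (-s) (hasDerivAt_neg (-s))).neg
  simpa [Function.comp_def] using this.deriv

lemma Germ.mirror (h : Germ γ I g f s) :
    Germ (fun t => γ (-t)) (-I) g (fun x => -f (-x)) (-s) := by
  refine ⟨by simpa using h.mem, by simpa using h.map_mem, analyticAt_mirror h.analyticAt, ?_, ?_⟩
  · rw [deriv_mirror h.analyticAt.differentiableAt]
    exact h.deriv_ne
  · filter_upwards [(tendsto_neg_nhds s).eventually h.eq] with x hx
    rw [hx, neg_neg]

lemma IsComp.mirror (h : IsComp γ I g F O) :
    IsComp (fun t => γ (-t)) (-I) g (fun x => -F (-x)) (-O) := by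
  refine ⟨h.isOpen.neg, ?_, h.nonempty.neg, fun x hx => ?_, fun s hs t ht hst => ?_⟩
  · refine ⟨fun x hx y hy z hz => ?_⟩
    exact h.ordConnected.out hy hx ⟨neg_le_neg hz.2, neg_le_neg hz.1⟩
  · simpa using (h.germ (-x) hx).mirror
  · refine h.closed (-s) hs (-t) ht ?_
    have hc : Continuous (fun p : ℝ × ℝ => -p) := continuous_neg
    have := image_closure_subset_closure_image hc (mem_image_of_mem _ hst)
    refine closure_mono ?_ this
    rintro _ ⟨_, ⟨x, hx, rfl⟩, rfl⟩
    exact ⟨-x, hx, by simp⟩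

lemma curveStabilizer_mirror :
    curveStabilizer G (fun t => γ (-t)) (-I) = curveStabilizer G γ I := by
  ext g
  rw [mem_curveStabilizer, mem_curveStabilizer]
  refine ⟨fun h t ht => ?_, fun h t ht => h _ ht⟩
  simpa using h (-t) (by simpa using ht)

lemma cls_mirror : cls (fun t => γ (-t)) (-I) g = cls (fun t => γ (-t)) (-I) k ↔
    cls γ I g = cls γ I k := by
  rw [cls_eq_iff_inv_mul_mem, cls_eq_iff_inv_mul_mem, curveStabilizer_mirror]

lemma strictMonoOn_mirror (h : StrictMonoOn F O) : StrictMonoOn (fun x => -F (-x)) (-O) :=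
  fun _ hx _ hy hxy => neg_lt_neg (h hy hx (neg_lt_neg hxy))

lemma strictAntiOn_mirror (h : StrictAntiOn F O) : StrictAntiOn (fun x => -F (-x)) (-O) :=
  fun _ hx _ hy hxy => neg_lt_neg (h hy hx (neg_lt_neg hxy))

lemma interior_neg_set (D : Set ℝ) : interior (-D) = -interior D := by
  simpa using ((Homeomorph.neg ℝ).preimage_interior D).symm

variable [TopologicalSpace M]

/-- The assumptions are invariant under reversing the curve. Thus each statement about right ends
has a counterpart for left ends. -/
lemma Setting.mirror (S : Setting G γ I) : Setting G (fun t => γ (-t)) (-I) := by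
  refine ⟨S.isOpen.neg, ?_, S.nonempty.neg, fun t ht => ?_, S.act, S.sated, ?_⟩
  · refine ⟨fun x hx y hy z hz => ?_⟩
    exact S.ordConnected.out hy hx ⟨neg_le_neg hz.2, neg_le_neg hz.1⟩
  · exact ContinuousAt.comp (f := fun t : ℝ => -t) (S.cont (-t) ht) continuous_neg.continuousAt
  · intro g s t hs ht hst
    obtain ⟨ρ, h1, h2, h3, ⟨δ, hδ, h4⟩, h5⟩ := S.compare g (-s) (-t) hs ht hst
    have hb : ∀ y, y ∈ Metric.ball s δ → -y ∈ Metric.ball (-s) δ := fun y hy => by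
      simpa [Real.dist_eq, abs_sub_comm, neg_add_eq_sub] using hy
    have hn : ∀ {x : ℝ} {p : ℝ → Prop}, (∀ᶠ y in 𝓝 x, p (-y)) → ∀ᶠ y in 𝓝 (-x), p y := by
      intro x p h
      filter_upwards [(tendsto_neg_nhds x).eventually h] with y hy
      simpa using hy
    refine ⟨fun x => -ρ (-x), ?_, by simp [h2], ?_, ⟨δ, hδ, fun x hx hxe y hy => ?_⟩, fun h => ?_⟩
    · simpa using analyticAt_mirror h1
    · have : Tendsto (fun p : ℝ × ℝ => -p) (𝓝 (s, t)) (𝓝 (-s, -t)) :=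
        (continuous_neg : Continuous fun p : ℝ × ℝ => -p).tendsto (s, t)
      filter_upwards [this.eventually h3] with p hp h
      have := hp h
      simp only [Prod.fst_neg, Prod.snd_neg] at this
      rw [this, neg_neg]
    · simpa using h4 (-x) (hb x hx) (hn (by simpa using hxe)) (-y) (hb y hy)
    · have := h5 (hn (by simpa using h))
      rw [← deriv_mirror h1.differentiableAt] at this
      simpa using this

end Mirror

/-! ### Consequences of satedness -/

section Sated

variable {G : Type*} [Group G] {M : Type*} [MulAction G M] [TopologicalSpace M] {γ : ℝ → M}
  {I : Set ℝ} {g : G} {F F' f : ℝ → ℝ} {O : Set ℝ} {s t x : ℝ}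

omit [TopologicalSpace M] in
lemma Germ.eventually_ne (h : Germ γ I g f s) (hI : IsOpen I) (p q : ℝ) :
    ∀ᶠ x in 𝓝[≠] s, Germ γ I g f x ∧ x ≠ p ∧ f x ≠ q := by
  have h1 : ∀ᶠ x in 𝓝[≠] s, f x ≠ q :=
    h.analyticAt.differentiableAt.hasDerivAt.eventually_ne h.deriv_ne
  have h2 : ∀ᶠ x in 𝓝[≠] s, x ≠ p :=
    (hasDerivAt_id s).eventually_ne one_ne_zero
  filter_upwards [h1, h2, eventually_nhdsWithin_of_eventually_nhds (h.eventually hI)]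
    with x h1 h2 h3 using ⟨h3, h2, h1⟩

lemma strictMonoOn_inverse (hF : StrictMonoOn F O) (h : ∀ x ∈ O, F' (F x) = x) :
    StrictMonoOn F' (F '' O) := by
  rintro _ ⟨x, hx, rfl⟩ _ ⟨y, hy, rfl⟩ hxy
  rw [h x hx, h y hy]
  exact (hF.lt_iff_lt hx hy).1 hxy

/-- A comparison at two points of the order between a continuous function and the identity yields a
fixed point in between. -/
lemma exists_fixed_of_le (hO : O.OrdConnected) (hF : ContinuousOn F O) (hs : s ∈ O) (ht : t ∈ O)
    (h1 : s ≤ F s) (h2 : F t ≤ t) : ∃ c ∈ O, c ∈ uIcc s t ∧ F c = c := by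
  have hsub : uIcc s t ⊆ O := hO.uIcc_subset hs ht
  have hc : ContinuousOn (fun x => F x - x) (uIcc s t) := (hF.mono hsub).sub continuousOn_id
  obtain ⟨c, hc, hc0⟩ := intermediate_value_uIcc hc (show (0 : ℝ) ∈ _ from
    mem_uIcc.2 (Or.inr ⟨by linarith, by linarith⟩))
  exact ⟨c, hsub hc, hc, by simp only at hc0; linarith⟩

lemma lt_or_gt_of_no_fixed (hO : O.OrdConnected) (hF : ContinuousOn F O)
    (h : ∀ c ∈ O, F c ≠ c) : (∀ x ∈ O, x < F x) ∨ ∀ x ∈ O, F x < x := by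
  by_contra! hcon
  obtain ⟨⟨x, hx, hx'⟩, y, hy, hy'⟩ := hcon
  obtain ⟨c, hc, -, hcc⟩ := exists_fixed_of_le hO hF hy hx hy' hx'
  exact h c hc hcc

variable (S : Setting G γ I)
include S

/-- An immersion is locally injective: compare the curve with itself. -/
lemma Setting.exists_injOn (ht : t ∈ I) : ∃ U ∈ 𝓝 t, InjOn γ U := by
  obtain ⟨ρ, -, -, hu, -⟩ := S.compare 1 t t ht ht (one_smul _ _)
  rw [nhds_prod_eq] at hu
  obtain ⟨pa, ha, pb, hb, hab⟩ := eventually_prod_iff.1 hu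
  refine ⟨{x | pa x ∧ pb x}, ha.and hb, fun x hx y hy hxy => ?_⟩
  exact (hab hx.1 hx.2 (one_smul _ _)).symm.trans (hab hx.1 hy.2 (by simpa using hxy))

/-- Satedness: no element of `G` moves a given non-trivial piece of `γ` into a small piece of `γ`
around `γ x`. -/
lemma Setting.not_shrink (hx : x ∈ I) {y z : ℝ} (hyz : y < z) (hI : Icc y z ⊆ I) :
    ∃ ε > 0, ∀ g : G, ¬ ∀ s ∈ Icc y z, ∃ t ∈ I, |t - x| < ε ∧ g • γ s = γ t := by
  by_contra! hcon
  obtain ⟨U, hU, hinj⟩ := S.exists_injOn (hI (left_mem_Icc.2 hyz.le))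
  obtain ⟨δ, hδ, hδU⟩ := Metric.mem_nhds_iff.1 hU
  set η := min δ (z - y) with hη
  have hη0 : 0 < η := lt_min hδ (sub_pos.2 hyz)
  have hmem : ∀ r ∈ Ioo 0 η, y + r ∈ U ∧ y + r ∈ Icc y z := fun r hr => by
    have h1 : r < δ := hr.2.trans_le (min_le_left _ _)
    have h2 : r < z - y := hr.2.trans_le (min_le_right _ _)
    refine ⟨hδU ?_, ⟨by linarith [hr.1], by linarith⟩⟩
    simp [abs_of_pos hr.1, h1]
  -- two points of `[y, z]` with different images, none of which is `γ x`
  obtain ⟨a, ha, b, hb, hab, hax, hbx⟩ : ∃ a ∈ Icc y z, ∃ b ∈ Icc y z,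
      γ a ≠ γ b ∧ γ a ≠ γ x ∧ γ b ≠ γ x := by
    have m1 := hmem (η / 2) ⟨by linarith, by linarith⟩
    have m2 := hmem (η / 3) ⟨by linarith, by linarith⟩
    have m3 := hmem (η / 4) ⟨by linarith, by linarith⟩
    have n12 : γ (y + η / 2) ≠ γ (y + η / 3) := fun h => by
      have := hinj m1.1 m2.1 h; linarith
    have n13 : γ (y + η / 2) ≠ γ (y + η / 4) := fun h => by
      have := hinj m1.1 m3.1 h; linarith
    have n23 : γ (y + η / 3) ≠ γ (y + η / 4) := fun h => by
      have := hinj m2.1 m3.1 h; linarith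
    by_cases h1 : γ (y + η / 2) = γ x
    · exact ⟨_, m2.2, _, m3.2, n23, h1 ▸ n12.symm, h1 ▸ n13.symm⟩
    · by_cases h2 : γ (y + η / 3) = γ x
      · exact ⟨_, m1.2, _, m3.2, n13, h1, h2 ▸ n23.symm⟩
      · exact ⟨_, m1.2, _, m2.2, n12, h1, h2⟩
  -- elements shrinking `[y, z]` to `γ x` take both points to `γ x` in the limit
  choose g hg using fun n : ℕ => hcon (1 / ((n : ℝ) + 1)) Nat.one_div_pos_of_nat
  have hlim : ∀ c ∈ Icc y z, Tendsto (fun n => g n • γ c) atTop (𝓝 (γ x)) := by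
    intro c hc
    choose t htI htx hgt using fun n => hg n c hc
    have : Tendsto t atTop (𝓝 x) := by
      rw [tendsto_iff_dist_tendsto_zero]
      refine squeeze_zero (fun _ => dist_nonneg) (fun n => ?_)
        (tendsto_one_div_add_atTop_nhds_zero_nat (𝕜 := ℝ))
      rw [Real.dist_eq]
      exact (htx n).le
    simp only [hgt]
    exact (S.cont x hx).tendsto.comp this
  exact S.sated (γ x) ⟨γ a, γ b, hab, hax, hbx, g, hlim a ha, hlim b hb⟩

/-- Satedness: an increasing transition does not contract a one-sided neighborhood to a fixed
point. -/
lemma IsComp.not_contracting (h : IsComp γ I g F O) (hm : StrictMonoOn F O) {c d : ℝ} (hcd : c < d)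
    (hO : Icc c d ⊆ O) (hc : F c = c) (hlt : ∀ x ∈ Ioc c d, F x < x) : False := by
  have hcO : c ∈ O := hO (left_mem_Icc.2 hcd.le)
  have hmaps : ∀ x ∈ Ioc c d, F x ∈ Ioc c d := fun x hx =>
    ⟨hc ▸ hm hcO (hO (Ioc_subset_Icc_self hx)) hx.1, (hlt x hx).le.trans hx.2⟩
  have hit : ∀ n, ∀ x ∈ Ioc c d, F^[n] x ∈ Ioc c d := by
    intro n
    induction n with
    | zero => exact fun x hx => hx
    | succ n ih =>
      intro x hx
      rw [Function.iterate_succ_apply']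
      exact hmaps _ (ih x hx)
  have hg : ∀ n, ∀ x ∈ Ioc c d, g ^ n • γ x = γ (F^[n] x) := by
    intro n
    induction n with
    | zero => simp
    | succ n ih =>
      intro x hx
      rw [pow_succ', mul_smul, ih x hx, Function.iterate_succ_apply',
        h.smul_eq (hO (Ioc_subset_Icc_self (hit n x hx)))]
  have hle : ∀ n, ∀ x ∈ Ioc c d, F^[n] x ≤ F^[n] d := by
    intro n
    induction n with
    | zero => exact fun x hx => hx.2
    | succ n ih =>
      intro x hx
      simp only [Function.iterate_succ_apply']
      exact hm.monotoneOn (hO (Ioc_subset_Icc_self (hit n x hx)))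
        (hO (Ioc_subset_Icc_self (hit n d (right_mem_Ioc.2 hcd)))) (ih x hx)
  have hanti : Antitone fun n => F^[n] d := antitone_nat_of_succ_le fun n => by
    rw [Function.iterate_succ_apply']
    exact (hlt _ (hit n d (right_mem_Ioc.2 hcd))).le
  have hdd := right_mem_Ioc.2 hcd
  obtain ⟨l, hl⟩ : ∃ l, Tendsto (fun n => F^[n] d) atTop (𝓝 l) :=
    ⟨_, tendsto_atTop_ciInf hanti ⟨c, by rintro _ ⟨n, rfl⟩; exact (hit n d hdd).1.le⟩⟩
  have hlI : l ∈ Icc c d := isClosed_Icc.mem_of_tendsto hl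
    (Eventually.of_forall fun n => Ioc_subset_Icc_self (hit n d hdd))
  have hFl : F l = l := by
    have h1 := (h.germ l (hO hlI)).continuousAt.tendsto.comp hl
    have h2 := hl.comp (tendsto_add_atTop_nat 1)
    refine tendsto_nhds_unique h1 (h2.congr fun n => ?_)
    simp [Function.iterate_succ_apply']
  -- the iterates `F^[n] d` decrease to a fixed point of `F`, and `c` is the only one in `[c, d]`
  have hlc : l = c := by
    by_contra hne
    exact absurd hFl (hlt l ⟨lt_of_le_of_ne hlI.1 (Ne.symm hne), hlI.2⟩).ne
  rw [hlc] at hl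
  -- thus the powers of `g` shrink the piece over the right half of `[c, d]` to `γ c`
  obtain ⟨ε, hε, hno⟩ := S.not_shrink (h.subset hcO) (y := (c + d) / 2) (z := d) (by linarith)
    fun x hx => h.subset (hO ⟨by linarith [hx.1], hx.2⟩)
  obtain ⟨n, hn⟩ := (hl.eventually (gt_mem_nhds (show c < c + ε by linarith))).exists
  refine hno (g ^ n) fun s hs => ?_
  have hs' : s ∈ Ioc c d := ⟨by linarith [hs.1], hs.2⟩
  have h1 := hit n s hs'
  refine ⟨F^[n] s, h.subset (hO (Ioc_subset_Icc_self h1)), ?_, hg n s hs'⟩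
  rw [abs_of_pos (by linarith [h1.1])]
  linarith [hle n s hs']

/-- Satedness: an increasing transition with a fixed point is the identity. -/
lemma IsComp.eqOn_id_of_fixed [T2Space M] (h : IsComp γ I g F O) (hm : StrictMonoOn F O) {c : ℝ}
    (hc : c ∈ O) (hcc : F c = c) : EqOn F id O := by
  rcases (h.germ c hc).analyticAt.eventually_eq_or_eventually_ne analyticAt_id with h1 | h1
  · exact eqOn_of_germs h.ordConnected h.germ (fun x hx => Germ.id (G := G) (h.subset hx)) hc h1
  exfalso
  -- by analyticity `c` is otherwise isolated among the fixed points, so that `F` or its inverse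
  -- contracts a right neighborhood of `c`
  have h2 : ∀ᶠ x in 𝓝[>] c, F x ≠ x :=
    h1.filter_mono (nhdsWithin_mono c fun x hx => ne_of_gt hx)
  have h3 : ∀ᶠ x in 𝓝[≥] c, x ∈ O :=
    eventually_nhdsWithin_of_eventually_nhds (h.isOpen.mem_nhds hc)
  obtain ⟨d₁, hd₁, hd₁'⟩ := mem_nhdsGT_iff_exists_Ioc_subset.1 h2
  obtain ⟨d₂, hd₂, hd₂'⟩ := mem_nhdsGE_iff_exists_Icc_subset.1 h3
  set d := min d₁ d₂
  have hcd : c < d := lt_min hd₁ hd₂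
  have hO : Icc c d ⊆ O := fun x hx => hd₂' ⟨hx.1, hx.2.trans (min_le_right _ _)⟩
  have hne : ∀ x ∈ Ioc c d, F x ≠ x := fun x hx => hd₁' ⟨hx.1, hx.2.trans (min_le_left _ _)⟩
  rcases lt_or_gt_of_no_fixed ordConnected_Ioc
    (h.continuousOn.mono (Ioc_subset_Icc_self.trans hO)) hne with hgt | hlt
  · obtain ⟨F', hF', hinv, -, -⟩ := h.inv S
    have hd := hgt d (right_mem_Ioc.2 hcd)
    have hdO := hO (right_mem_Icc.2 hcd.le)
    have hsurj : ∀ y ∈ Icc c d, ∃ x ∈ Icc c d, F x = y := fun y hy =>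
      intermediate_value_Icc hcd.le (h.continuousOn.mono hO)
        ⟨hcc.symm ▸ hy.1, hy.2.trans hd.le⟩
    refine hF'.not_contracting S (strictMonoOn_inverse hm hinv) hcd ?_ ?_ ?_
    · intro y hy
      obtain ⟨x, hx, rfl⟩ := hsurj y hy
      exact mem_image_of_mem _ (hO hx)
    · conv_lhs => rw [← hcc]
      exact hinv c hc
    · intro y hy
      obtain ⟨x, hx, rfl⟩ := hsurj y (Ioc_subset_Icc_self hy)
      rw [hinv x (hO hx)]
      refine hgt x ⟨lt_of_le_of_ne hx.1 ?_, hx.2⟩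
      rintro rfl
      exact absurd hy.1 (by rw [hcc]; exact lt_irrefl _)
  · exact h.not_contracting S hm hcd hO hcc hlt

omit S in
omit [TopologicalSpace M] in
/-- A decreasing transition has a fixed point between `s` and its image. -/
lemma IsComp.exists_fixed (h : IsComp γ I g F O) (hI : I.OrdConnected) (ha : StrictAntiOn F O)
    (hs : s ∈ O) : ∃ c ∈ O, c ∈ uIcc s (F s) ∧ F c = c := by
  -- `F` follows the way from `s` to `F s` either to its end or to a point with value `F s`; in both
  -- cases the order between `F` and the identity has changed
  rcases lt_trichotomy s (F s) with hlt | heq | hlt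
  · rcases h.exit hI hs (h.mapsTo hs) (h.subset hs) (Or.inr ⟨hlt.le, fun y hy hys =>
        ha.antitoneOn hs hy (by rw [uIcc_of_le hlt.le] at hys; exact hys.1)⟩) with
      h1 | ⟨y, hy, hys, hyF⟩
    · exact exists_fixed_of_le h.ordConnected h.continuousOn hs h1 hlt.le (ha hs h1 hlt).le
    · rw [uIcc_of_le hlt.le] at hys ⊢
      obtain ⟨c, hc, hcs, hcc⟩ := exists_fixed_of_le h.ordConnected h.continuousOn hs hy hlt.le
        (hyF.trans_le hys.1)
      rw [uIcc_of_le hys.1] at hcs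
      exact ⟨c, hc, ⟨hcs.1, hcs.2.trans hys.2⟩, hcc⟩
  · exact ⟨s, hs, left_mem_uIcc, heq.symm⟩
  · rcases h.exit hI hs (h.mapsTo hs) (h.subset hs) (Or.inl ⟨hlt.le, fun y hy hys =>
        ha.antitoneOn hy hs (by rw [uIcc_of_ge hlt.le] at hys; exact hys.2)⟩) with
      h1 | ⟨y, hy, hys, hyF⟩
    · obtain ⟨c, hc, hcs, hcc⟩ :=
        exists_fixed_of_le h.ordConnected h.continuousOn h1 hs (ha h1 hs hlt).le hlt.le
      exact ⟨c, hc, by rwa [uIcc_comm], hcc⟩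
    · rw [uIcc_of_ge hlt.le] at hys ⊢
      obtain ⟨c, hc, hcs, hcc⟩ := exists_fixed_of_le h.ordConnected h.continuousOn hy hs
        (hys.2.trans_eq hyF.symm) hlt.le
      rw [uIcc_of_le hys.2] at hcs
      exact ⟨c, hc, ⟨hys.1.trans hcs.1, hcs.2⟩, hcc⟩

end Sated

/-! ### Free intervals -/

/-- `D` is free, in terms of germs: only elements of the stabilizer have a germ from an interior
point of `D` to an interior point of `D`. -/
def FreeOn (G : Type*) [Group G] {M : Type*} [MulAction G M] (γ : ℝ → M) (I D : Set ℝ) : Prop :=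
  ∀ (g : G) (f : ℝ → ℝ) (s : ℝ), Germ γ I g f s → s ∈ interior D → f s ∈ interior D →
    g ∈ curveStabilizer G γ I

lemma ordConnected_interior {D : Set ℝ} (hD : D.OrdConnected) : (interior D).OrdConnected :=
  hD.convex.interior.ordConnected

lemma mem_interior_of_lt {D : Set ℝ} (hD : D.OrdConnected) {x y z : ℝ} (hx : x ∈ D) (hy : y ∈ D)
    (hxz : x < z) (hzy : z < y) : z ∈ interior D :=
  mem_interior_iff_mem_nhds.2 (mem_of_superset (Icc_mem_nhds hxz hzy) (hD.out hx hy))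

section Free

variable {G : Type*} [Group G] {M : Type*} [MulAction G M] {γ : ℝ → M} {I : Set ℝ} {g k : G}
  {F F' f : ℝ → ℝ} {O O' D D' : Set ℝ} {s t x : ℝ}

lemma FreeOn.mono (h : FreeOn G γ I D) (hD : D' ⊆ D) : FreeOn G γ I D' :=
  fun g f s hf hs hfs => h g f s hf (interior_mono hD hs) (interior_mono hD hfs)

lemma FreeOn.mirror (h : FreeOn G γ I D) : FreeOn G (fun t => γ (-t)) (-I) (-D) := by
  intro g f s hf hs hfs
  rw [interior_neg_set] at hs hfs
  rw [curveStabilizer_mirror]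
  have := hf.mirror
  simp only [neg_neg] at this
  exact h g _ (-s) this hs (by simpa using hfs)

lemma freeOn_mirror_iff : FreeOn G (fun t => γ (-t)) (-I) (-D) ↔ FreeOn G γ I D := by
  refine ⟨fun h => ?_, FreeOn.mirror⟩
  simpa using h.mirror

variable [TopologicalSpace M]

/-- A curve that is injective on a compact set restricts to embeddings of its subsets. -/
lemma isEmbedding_domRestrict [T2Space M] {c : ℝ → M} {K J : Set ℝ} (hK : IsCompact K)
    (hc : ContinuousOn c K) (hi : InjOn c K) (hJ : J ⊆ K) : IsEmbedding (J.domRestrict c) := by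
  have : CompactSpace K := isCompact_iff_compactSpace.1 hK
  have h1 : IsClosedEmbedding (K.domRestrict c) :=
    (continuousOn_iff_continuous_domRestrict.1 hc).isClosedEmbedding (injOn_iff_injective.1 hi)
  exact h1.isEmbedding.comp (IsEmbedding.inclusion hJ)

variable [T2Space M] (S : Setting G γ I)
include S

/-- A germ between interior points of a free segment gives an overlap, so that its element fixes
the segment and hence, by analyticity, the whole curve. -/
lemma Setting.freeOn_of_isFreeSegment (hD : IsFreeSegment G γ D) : FreeOn G γ I D := by
  intro g f s hf hs hfs
  obtain ⟨F, O, hF, hsO, hFf⟩ := S.exists_comp hf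
  rw [← hFf.eq_of_nhds] at hfs
  -- pass to small neighborhoods of `s` and `F s` on which `γ` is an embedding
  obtain ⟨U, hU, hUi⟩ := S.exists_injOn hf.mem
  obtain ⟨V, hV, hVi⟩ := S.exists_injOn (hF.mapsTo hsO)
  obtain ⟨δ, hδ, hδ'⟩ := Metric.nhds_basis_closedBall.mem_iff.1
    (inter_mem hU (S.isOpen.mem_nhds hf.mem))
  obtain ⟨η, hη, hη'⟩ := Metric.nhds_basis_closedBall.mem_iff.1
    (inter_mem hV (S.isOpen.mem_nhds (hF.mapsTo hsO)))
  have hW : ∀ᶠ x in 𝓝 s, x ∈ Metric.closedBall s δ ∧ x ∈ O ∧ x ∈ interior D ∧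
      F x ∈ interior D ∧ F x ∈ Metric.closedBall (F s) η := by
    have hc := (hF.germ s hsO).continuousAt
    filter_upwards [Metric.closedBall_mem_nhds s hδ, hF.isOpen.mem_nhds hsO,
      isOpen_interior.mem_nhds hs, hc.eventually (isOpen_interior.mem_nhds hfs),
      hc.eventually (Metric.closedBall_mem_nhds _ hη)] with x h1 h2 h3 h4 h5
    exact ⟨h1, h2, h3, h4, h5⟩
  obtain ⟨ε, hε, hb⟩ := Metric.eventually_nhds_iff_ball.1 hW
  set J := Metric.ball s ε
  have hJo : J.OrdConnected := by
    simp only [J, Real.ball_eq_Ioo]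
    exact ordConnected_Ioo
  have hJO : J ⊆ O := fun x hx => (hb x hx).2.1
  have hsJ : s ∈ J := Metric.mem_ball_self hε
  have hJ'o : IsOpen (F '' J) := hF.isOpen_image Metric.isOpen_ball hJO
  have hov : Overlap (fun t => g • γ t) D γ D := by
    refine ⟨J, F '' J, ⟨⟨hJo, ?_⟩, Metric.isOpen_ball⟩,
      ⟨⟨hF.ordConnected_image hJo hJO, ?_⟩, hJ'o⟩, fun x hx => interior_subset (hb x hx).2.2.1,
      ?_, ?_, ?_, ?_⟩
    · rw [Metric.isOpen_ball.interior_eq]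
      exact ⟨s, hsJ⟩
    · rw [hJ'o.interior_eq]
      exact ⟨F s, s, hsJ, rfl⟩
    · rintro _ ⟨x, hx, rfl⟩
      exact interior_subset (hb x hx).2.2.2.1
    · refine isEmbedding_domRestrict (isCompact_closedBall s δ) ?_ ?_ fun x hx => (hb x hx).1
      · exact fun x hx => ((S.act g).continuousAt.comp
          (S.cont x (hδ' hx).2)).continuousWithinAt
      · exact fun x hx y hy hxy => hUi (hδ' hx).1 (hδ' hy).1 (MulAction.injective g hxy)
    · refine isEmbedding_domRestrict (isCompact_closedBall (F s) η) ?_ ?_ ?_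
      · exact fun x hx => (S.cont x (hη' hx).2).continuousWithinAt
      · exact fun x hx y hy hxy => hVi (hη' hx).1 (hη' hy).1 hxy
      · rintro _ ⟨x, hx, rfl⟩
        exact (hb x hx).2.2.2.2
    · rw [image_image]
      exact image_congr fun x hx => hF.smul_eq (hJO hx)
  have hall := hD.2 g hov
  have hid : Germ γ I g id s := by
    refine S.germ_of_continuousAt hf.mem hf.mem continuousAt_id ?_
    filter_upwards [isOpen_interior.mem_nhds hs] with x hx using hall x (interior_subset hx)
  exact S.mem_stabilizer_of_germ_id hid .rfl

omit [T2Space M] in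
/-- Overlapping curves are related by a germ. -/
lemma Setting.exists_germ_of_overlap {D₁ D₂ : Set ℝ} (h₁ : D₁ ⊆ I) (h₂ : D₂ ⊆ I)
    (h : Overlap (fun t => g • γ t) D₁ γ D₂) :
    ∃ f s, Germ γ I g f s ∧ s ∈ interior D₁ ∧ f s ∈ interior D₂ := by
  classical
  obtain ⟨J, J', hJ, hJ', hJD, hJ'D, hE, hE', him⟩ := h
  have hr : range (J.domRestrict fun t => g • γ t) = range (J'.domRestrict γ) := by
    rw [Set.range_domRestrict, Set.range_domRestrict, him]
  -- the reparametrization is the inverse of the embedding `γ` on `J'`, after `g • γ` on `J`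
  set e := hE'.toHomeomorph.symm with he
  have hev : ∀ y, γ (e y) = y := fun y =>
    congrArg Subtype.val (hE'.toHomeomorph.apply_symm_apply y)
  set r₀ : J → ℝ := fun x => e ⟨g • γ x, hr ▸ ⟨x, rfl⟩⟩ with hr₀
  have hr₀c : Continuous r₀ := by
    refine continuous_subtype_val.comp (e.continuous.comp ?_)
    exact Continuous.subtype_mk hE.continuous _
  set r : ℝ → ℝ := fun x => if hx : x ∈ J then r₀ ⟨x, hx⟩ else 0 with hrdef
  obtain ⟨s, hs⟩ := hJ.1.2
  rw [hJ.2.interior_eq] at hs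
  have hrs : ∀ x (hx : x ∈ J), r x = r₀ ⟨x, hx⟩ := fun x hx => dif_pos hx
  have hrJ : ∀ x ∈ J, r x ∈ J' := fun x hx => by
    rw [hrs x hx]
    exact (e _).2
  have hc : ContinuousAt r s := by
    have : ContinuousOn r J := by
      rw [continuousOn_iff_continuous_domRestrict]
      convert hr₀c using 1
      ext x
      exact hrs x x.2
    exact this.continuousAt (hJ.2.mem_nhds hs)
  refine ⟨r, s, S.germ_of_continuousAt (h₁ (hJD hs)) (h₂ (hJ'D (hrJ s hs))) hc ?_,
    interior_maximal hJD hJ.2 hs, interior_maximal hJ'D hJ'.2 (hrJ s hs)⟩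
  filter_upwards [hJ.2.mem_nhds hs] with x hx
  rw [hrs x hx, hr₀, hev]

/-- Overlaps and germs are the same, so freeness can be expressed by germs. -/
lemma Setting.isFreeSegment_iff (hD : D ⊆ I) :
    IsFreeSegment G γ D ↔ IsInterval D ∧ FreeOn G γ I D := by
  refine ⟨fun h => ⟨h.1, S.freeOn_of_isFreeSegment h⟩, fun h => ⟨h.1, fun g hg t ht => ?_⟩⟩
  obtain ⟨f, s, hf, hs, hfs⟩ := S.exists_germ_of_overlap hD hD hg
  exact h.2 g f s hf hs hfs t (hD ht)

/-! ### Germs inside a free interval are trivial -/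

omit [T2Space M] in
/-- If a transition `F` belonging to the neutral element moves each point to the right, then
each point to the right of a fundamental domain `[x₀, F x₀]` has a germ into it. -/
lemma IsComp.exists_germ_right (h : IsComp γ I (1 : G) F O) (hm : StrictMonoOn F O)
    (hlt : ∀ x ∈ O, x < F x) {x₀ : ℝ} (hx₀ : x₀ ∈ O) (hD : Icc x₀ (F x₀) ⊆ interior D)
    {z : ℝ} (hz : z ∈ I) (hxz : x₀ ≤ z) :
    ∃ f, Germ γ I (1 : G) f z ∧ f z ∈ interior D := by
  by_contra hcon
  set Z : Set ℝ := {z | z ∈ I ∧ x₀ ≤ z ∧ ¬ ∃ f, Germ γ I (1 : G) f z ∧ f z ∈ interior D}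
  have hzZ : z ∈ Z := ⟨hz, hxz, hcon⟩
  have hbdd : BddBelow Z := ⟨x₀, fun y hy => hy.2.1⟩
  -- `c` is the infimum of the points without such a germ; it lies in `F '' O`, and its preimage
  -- `r < c` has such a germ, which gives one at `c`
  set c := sInf Z
  have hxc : x₀ ≤ c := le_csInf ⟨z, hzZ⟩ fun y hy => hy.2.1
  have hcz : c ≤ z := csInf_le hbdd hzZ
  have hcI : c ∈ I := S.ordConnected.out (h.subset hx₀) hz ⟨hxc, hcz⟩
  have hcl : c ∈ closure Z := csInf_mem_closure ⟨z, hzZ⟩ hbdd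
  have hno : ¬ ∃ f, Germ γ I (1 : G) f c ∧ f c ∈ interior D := by
    rintro ⟨f, hf, hfc⟩
    obtain ⟨y, hy, hyf, hyD⟩ := ((mem_closure_iff_frequently.1 hcl).and_eventually
      ((hf.eventually S.isOpen).and
        (hf.continuousAt.eventually (isOpen_interior.mem_nhds hfc)))).exists
    exact hy.2.2 ⟨f, hyf, hyD⟩
  have hFc : F x₀ < c := by
    by_contra hle
    exact hno ⟨id, Germ.id hcI, hD ⟨hxc, not_lt.1 hle⟩⟩
  obtain ⟨F', hF', hinv, -, hinv'⟩ := h.inv S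
  have hmono := strictMonoOn_inverse hm hinv
  have hFx₀ : F x₀ ∈ F '' O := ⟨x₀, hx₀, rfl⟩
  have hcO : c ∈ F '' O := by
    rcases hF'.exit S.ordConnected hFx₀ hcI hcI (Or.inl ⟨by rw [hinv x₀ hx₀]; exact hxc,
      fun y hy hys => hmono.monotoneOn hFx₀ hy (by rw [uIcc_of_le hFc.le] at hys; exact hys.1)⟩)
      with h1 | ⟨_, ⟨y, hyO, rfl⟩, hys, hyF⟩
    · exact h1
    · rw [uIcc_of_le hFc.le] at hys
      rw [hinv y hyO] at hyF
      exact absurd (hlt y hyO) (not_lt.2 (hys.2.trans_eq hyF.symm))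
  obtain ⟨r, hr, hrc⟩ := hcO
  have hrlt : r < c := hrc ▸ hlt r hr
  have hx₀r : x₀ < r := (hm.lt_iff_lt hx₀ hr).1 (hrc ▸ hFc)
  obtain ⟨f, hf, hfD⟩ : ∃ f, Germ γ I (1 : G) f r ∧ f r ∈ interior D := by
    by_contra hr'
    exact absurd (csInf_le hbdd ⟨h.subset hr, hx₀r.le, hr'⟩) (not_le.2 hrlt)
  have hF'c : F' c = r := by rw [← hrc, hinv r hr]
  refine hno ⟨fun x => f (F' x), ?_, by simpa only [hF'c] using hfD⟩
  have h1 := hF'.germ c ⟨r, hr, hrc⟩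
  have h2 := Germ.comp (f := F') (s := c) (by rwa [hF'c]) h1
  simpa using h2

omit [T2Space M] in
/-- The counterpart of `IsComp.exists_germ_right` to the left of the fundamental domain, for the
inverse of `F` and the reversed curve. -/
lemma IsComp.exists_germ_left (h : IsComp γ I (1 : G) F O) (hm : StrictMonoOn F O)
    (hlt : ∀ x ∈ O, x < F x) {x₀ : ℝ} (hx₀ : x₀ ∈ O) (hD : Icc x₀ (F x₀) ⊆ interior D)
    {z : ℝ} (hz : z ∈ I) (hxz : z ≤ F x₀) :
    ∃ f, Germ γ I (1 : G) f z ∧ f z ∈ interior D := by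
  obtain ⟨F', hF', hinv, -, -⟩ := h.inv S
  have hF'1 : IsComp γ I (1 : G) F' (F '' O) := by simpa using hF'
  have hmono := strictMonoOn_mirror (strictMonoOn_inverse hm hinv)
  have := hF'1.mirror.exists_germ_right S.mirror hmono (D := -D) (x₀ := -F x₀) (z := -z) ?_ ?_ ?_
    (by simpa using hz) (neg_le_neg hxz)
  · obtain ⟨f, hf, hfD⟩ := this
    rw [interior_neg_set] at hfD
    have := hf.mirror
    simp only [neg_neg] at this
    exact ⟨_, this, by simpa using hfD⟩
  · rintro x ⟨y, hy, hyx⟩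
    rw [← hyx, hinv y hy, lt_neg, ← hyx]
    exact hlt y hy
  · simpa using ⟨x₀, hx₀, rfl⟩
  · rw [interior_neg_set, neg_neg, hinv x₀ hx₀]
    intro x hx
    exact hD ⟨by linarith [hx.2], by linarith [hx.1]⟩

omit [T2Space M] in
/-- A transition for an element of the stabilizer that has a fixed point is the identity. -/
lemma IsComp.eqOn_id_of_eq (h : IsComp γ I g F O) (hg : g ∈ curveStabilizer G γ I) (hs : s ∈ O)
    (hFs : F s = s) : EqOn F id O :=
  (h.unique S S.isComp_id (cls_eq_one_iff.2 hg) hs (h.subset hs) hFs).2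

/-- If `γ` is not a free segment, then no germ maps an interior point of a free interval to another
one. Otherwise a fundamental domain of a translation belonging to the neutral element would
lie in the free interval. -/
lemma Setting.germ_trivial (hI : ¬ FreeOn G γ I I) (hD : FreeOn G γ I D) (hDo : D.OrdConnected)
    (h : Germ γ I g f s) (hs : s ∈ interior D) (hfs : f s ∈ interior D) :
    f =ᶠ[𝓝 s] id := by
  have hg := hD g f s h hs hfs
  by_cases hne : f s = s
  · have h1 := h.congr_cls S.isOpen (cls_eq_one_iff.2 hg)
    exact S.germ_unique h1 (Germ.id h.mem) hne
  exfalso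
  apply hI
  obtain ⟨F, O, hF, hsO, hFf⟩ := S.exists_comp (h.congr_cls S.isOpen (cls_eq_one_iff.2 hg))
  rw [← hFf.eq_of_nhds] at hne hfs
  -- a transition without fixed points is increasing and moves all points in the same direction
  have hfix : ∀ c ∈ O, F c ≠ c := fun c hc hcc =>
    hne (hF.eqOn_id_of_eq S (one_mem _) hc hcc hsO)
  have hm : StrictMonoOn F O := by
    rcases hF.strictMonoOn_or_strictAntiOn with hm | ha
    · exact hm
    · obtain ⟨c, hc, -, hcc⟩ := hF.exists_fixed S.ordConnected ha hsO
      exact absurd hcc (hfix c hc)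
  have hall : ∀ z ∈ I, ∃ f, Germ γ I (1 : G) f z ∧ f z ∈ interior D := by
    have key : ∀ F O s, IsComp γ I (1 : G) F O → StrictMonoOn F O → (∀ x ∈ O, x < F x) →
        s ∈ O → s ∈ interior D → F s ∈ interior D → ∀ z ∈ I, ∃ f, Germ γ I (1 : G) f z ∧
          f z ∈ interior D := by
      intro F O s hF hm hlt hsO hs hfs z hz
      have hsub : Icc s (F s) ⊆ interior D := (ordConnected_interior hDo).out hs hfs
      rcases le_total s z with hsz | hsz
      · exact hF.exists_germ_right S hm hlt hsO hsub hz hsz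
      · exact hF.exists_germ_left S hm hlt hsO hsub hz (hsz.trans (hlt s hsO).le)
    rcases lt_or_gt_of_no_fixed hF.ordConnected hF.continuousOn hfix with hlt | hlt
    · exact key F O s hF hm hlt hsO hs hfs
    · obtain ⟨F', hF', hinv, -, -⟩ := hF.inv S
      rw [inv_one] at hF'
      refine key F' _ (F s) hF' (strictMonoOn_inverse hm hinv) ?_ ⟨s, hsO, rfl⟩ hfs
        (by rwa [hinv s hsO])
      rintro _ ⟨x, hx, rfl⟩
      rw [hinv x hx]
      exact hlt x hx
  -- conjugated with germs into `D`, each germ becomes one between interior points of `D`; so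
  -- freeness of `D` makes all of `I` free
  intro g f s hf hs _
  obtain ⟨e₁, he₁, he₁D⟩ := hall s hf.mem
  obtain ⟨e₂, he₂, he₂D⟩ := hall (f s) hf.map_mem
  obtain ⟨e₁', he₁', hes, -, -⟩ := S.germ_inv he₁
  have h1 := Germ.comp (f := e₁') (s := e₁ s) (e := f) (by rwa [hes]) he₁'
  have h2 := Germ.comp (f := fun x => f (e₁' x)) (s := e₁ s) (e := e₂)
    (by simpa only [hes] using he₂) h1
  have := hD _ _ _ h2 he₁D (by simpa only [hes] using he₂D)
  simpa using this

/-- Transitions which map interior points of a free interval to the same point agree. -/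
lemma IsComp.eq_of_eq (hI : ¬ FreeOn G γ I I) (hD : FreeOn G γ I D) (hDo : D.OrdConnected)
    (h : IsComp γ I g F O) (h' : IsComp γ I k F' O') (hs : s ∈ O) (ht : t ∈ O')
    (hsD : s ∈ interior D) (htD : t ∈ interior D) (hst : F s = F' t) :
    s = t ∧ cls γ I g = cls γ I k ∧ O = O' ∧ EqOn F F' O := by
  obtain ⟨f', hf', hft, -, -⟩ := S.germ_inv (h'.germ t ht)
  rw [← hst] at hf' hft
  have hc := hf'.comp (h.germ s hs)
  have htriv := S.germ_trivial hI hD hDo hc hsD (by simpa only [hft] using htD)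
  have hst' : s = t := by
    have : f' (F s) = s := htriv.eq_of_nhds
    rw [← this, hft]
  subst hst'
  have hcls : cls γ I k = cls γ I g := by
    rw [cls_eq_iff_inv_mul_mem]
    exact hD _ _ _ hc hsD (by simpa only [hft] using htD)
  exact ⟨rfl, hcls.symm, h.unique S h' hcls.symm hs ht hst⟩

end Free

/-! ### The neighbor of a maximal interval -/

section Neighbor

variable {G : Type*} [Group G] {M : Type*} [MulAction G M] [TopologicalSpace M] [T2Space M]
  {γ : ℝ → M} {I : Set ℝ} {g : G} {F F' f : ℝ → ℝ} {O A : Set ℝ} {s x b : ℝ}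

lemma mem_interior_of_union_Icc {ε z : ℝ} (hz : z ∈ interior (A ∪ Icc b (b + ε)))
    (hzb : z < b) : z ∈ interior A := by
  rw [mem_interior_iff_mem_nhds] at hz ⊢
  filter_upwards [hz, Iio_mem_nhds hzb] with y hy hyb
  exact hy.resolve_right fun h => absurd h.1 (not_le.2 hyb)

lemma lt_of_mem_interior_Iic {b z : ℝ} (hA : A ⊆ Iic b) (hz : z ∈ interior A) : z < b := by
  have := interior_mono hA hz
  rwa [interior_Iic] at this

variable (S : Setting G γ I)
include S

/-- If both ends of a nontrivial germ lie slightly to the right of the free interval `A`,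
then there is also a germ from the interior of `A` to a point slightly to its right. Otherwise some
element of `G` would shrink a fixed piece of the curve to a point. -/
lemma Setting.exists_crossing_of_right (hA : FreeOn G γ I A) (hAo : A.OrdConnected) (hAI : A ⊆ I)
    (hb : IsGreatest A b) {a₀ : ℝ} (ha₀ : a₀ ∈ interior A) {η : ℝ} (hη : 0 < η)
    (hηI : b + η ∈ I) : ∃ ε > 0, ∀ g F O, IsComp γ I g F O → g ∉ curveStabilizer G γ I →
      ∀ s ∈ O, b < s → s < F s → F s < b + ε →
        ∃ s ∈ O, s ∈ interior A ∧ b < F s ∧ F s < b + η := by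
  have hbI := hAI hb.1
  have ha₀b : a₀ < b := lt_of_mem_interior_Iic hb.2 ha₀
  obtain ⟨ε₁, hε₁, h1⟩ := S.not_shrink hbI ha₀b
    (hAo.out (interior_subset ha₀) hb.1 |>.trans hAI)
  have hsubη : Icc b (b + η) ⊆ I := S.mem_Icc_subset hbI hηI
  obtain ⟨ε₂, hε₂, h2⟩ := S.not_shrink hbI (show b + η / 4 < b + η / 2 by linarith)
    fun x hx => hsubη ⟨by linarith [hx.1], by linarith [hx.2]⟩
  refine ⟨min (η / 4) (min ε₁ ε₂), by positivity, fun g F O hF hg s hs hbs hsF hFε => ?_⟩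
  have hFη : F s < b + η / 4 := hFε.trans_le (by gcongr; exact min_le_left _ _)
  have hFε₁ : F s < b + ε₁ := hFε.trans_le (by
    gcongr; exact (min_le_right _ _).trans (min_le_left _ _))
  have hFε₂ : F s < b + ε₂ := hFε.trans_le (by
    gcongr; exact (min_le_right _ _).trans (min_le_right _ _))
  have ha₀s : a₀ ≤ s := (ha₀b.trans hbs).le
  have ha₀I : a₀ ∈ I := hAI (interior_subset ha₀)
  rcases hF.strictMonoOn_or_strictAntiOn with hm | ha
  · exfalso
    have hfix : ∀ c ∈ O, F c ≠ c := fun c hc hcc => by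
      have hid := hF.eqOn_id_of_fixed S hm hc hcc
      exact hsF.ne (hid hs).symm
    have hlt : ∀ x ∈ O, x < F x :=
      (lt_or_gt_of_no_fixed hF.ordConnected hF.continuousOn hfix).resolve_right fun h =>
        absurd (h s hs) (not_lt.2 hsF.le)
    have ha₀O : a₀ ∈ O := by
      rcases hF.exit S.ordConnected hs ha₀I ha₀I (Or.inr ⟨ha₀s.trans hsF.le, fun y hy hys =>
        hm.monotoneOn hy hs (by rw [uIcc_of_ge ha₀s] at hys; exact hys.2)⟩)
        with h | ⟨y, hy, hys, hyF⟩
      · exact h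
      · rw [uIcc_of_ge ha₀s] at hys
        exact absurd (hlt y hy) (not_lt.2 (hyF.trans_le hys.1))
    -- `F` is defined at `a₀` and takes it beyond `b`, as `A` is free: all of `[a₀, b]` would be
    -- moved into the small interval `[b, F s]`
    have hFa₀ : b ≤ F a₀ := by
      by_contra hlt'
      exact hg (hA g F a₀ (hF.germ a₀ ha₀O) ha₀
        (mem_interior_of_lt hAo (interior_subset ha₀) hb.1 (hlt a₀ ha₀O) (not_le.1 hlt')))
    refine h1 g fun r hr => ?_
    have hrO : r ∈ O := hF.ordConnected.out ha₀O hs ⟨hr.1, hr.2.trans hbs.le⟩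
    refine ⟨F r, hF.mapsTo hrO, ?_, hF.smul_eq hrO⟩
    have := hm.monotoneOn ha₀O hrO hr.1
    have := hm.monotoneOn hrO hs (hr.2.trans hbs.le)
    rw [abs_of_nonneg (by linarith)]
    linarith
  · have hmI : b + η / 2 ∈ I := hsubη ⟨by linarith, by linarith⟩
    -- a decreasing `F` attains the value `b + η / 2` to the left of `b`, or is defined up to `a₀`;
    -- otherwise `g⁻¹` would shrink the piece over `[b + η / 4, b + η / 2]`
    have hFm : F s ≤ b + η / 2 := by linarith
    have hcase : (a₀ ∈ O ∧ F a₀ ≤ b + η / 2) ∨ ∃ y ∈ O, y ∈ Icc a₀ s ∧ F y = b + η / 2 := by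
      rcases hF.exit S.ordConnected hs ha₀I hmI (Or.inl ⟨hFm, fun y hy hys =>
        ha.antitoneOn hy hs (by rw [uIcc_of_ge ha₀s] at hys; exact hys.2)⟩)
        with h | ⟨y, hy, hys, hyF⟩
      · rcases le_total (F a₀) (b + η / 2) with hle | hle
        · exact Or.inl ⟨h, hle⟩
        · have hsub := hF.ordConnected.out h hs
          obtain ⟨y, hy, hyF⟩ := intermediate_value_Icc' ha₀s (hF.continuousOn.mono hsub)
            ⟨hFm, hle⟩
          exact Or.inr ⟨y, hsub hy, hy, hyF⟩
      · rw [uIcc_of_ge ha₀s] at hys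
        exact Or.inr ⟨y, hy, hys, hyF⟩
    rcases hcase with ⟨hO, hle⟩ | ⟨y, hy, hys, hyF⟩
    · have := ha.antitoneOn hO hs ha₀s
      exact ⟨a₀, hO, ha₀, by linarith, by linarith⟩
    · rcases lt_or_ge y b with hyb | hyb
      · refine ⟨y, hy, ?_, by linarith, by linarith⟩
        rcases hys.1.eq_or_lt with h | h
        · exact h ▸ ha₀
        · exact mem_interior_of_lt hAo (interior_subset ha₀) hb.1 h hyb
      · exfalso
        refine h2 g⁻¹ fun r hr => ?_
        have hsub := hF.ordConnected.out hy hs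
        obtain ⟨x, hx, hxr⟩ := intermediate_value_Icc' hys.2 (hF.continuousOn.mono hsub)
          (show r ∈ Icc (F s) (F y) from ⟨by linarith [hr.1], by linarith [hr.2]⟩)
        refine ⟨x, hF.subset (hsub hx), ?_, ?_⟩
        · have := hyb.trans hx.1
          rw [abs_of_nonneg (by linarith)]
          linarith [hx.2]
        · rw [inv_smul_eq_iff, hF.smul_eq (hsub hx), hxr]

/-- If the free interval `A` cannot be extended beyond its right end `b`, then germs lead from
the interior of `A` to points arbitrarily close to `b` on its right. -/
lemma Setting.exists_crossing (hA : FreeOn G γ I A) (hAo : A.OrdConnected) (hAI : A ⊆ I)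
    (hb : IsGreatest A b) (hAi : (interior A).Nonempty)
    (hmax : ∀ ε > 0, ¬ FreeOn G γ I (A ∪ Icc b (b + ε))) {η : ℝ} (hη : 0 < η) :
    ∃ g F O, IsComp γ I g F O ∧ g ∉ curveStabilizer G γ I ∧
      ∃ s ∈ O, s ∈ interior A ∧ b < F s ∧ F s < b + η := by
  obtain ⟨a₀, ha₀⟩ := hAi
  wlog hηI : b + η ∈ I generalizing η
  · obtain ⟨δ, hδ, hδI⟩ := Metric.isOpen_iff.1 S.isOpen b (hAI hb.1)
    have hmin : 0 < min η (δ / 2) := lt_min hη (by linarith)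
    have hle : min η (δ / 2) ≤ δ / 2 := min_le_right _ _
    obtain ⟨g, F, O, h1, h2, s, h3, h4, h5, h6⟩ := this hmin (hδI (by
      rw [Metric.mem_ball, Real.dist_eq, add_sub_cancel_left, abs_of_pos hmin]
      linarith))
    exact ⟨g, F, O, h1, h2, s, h3, h4, h5, h6.trans_le (by gcongr; exact min_le_left _ _)⟩
  obtain ⟨ε₀, hε₀, hcr⟩ := S.exists_crossing_of_right hA hAo hAI hb ha₀ hη hηI
  set ε := min ε₀ η with hε
  have hεp : 0 < ε := lt_min hε₀ hη
  have hno := hmax ε hεp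
  simp only [FreeOn, not_forall] at hno
  obtain ⟨g, f, s₀, hf₀, hs₀, hfs₀, hg⟩ := hno
  -- move the base point to avoid `b` and the diagonal
  obtain ⟨s, hf, hs, hfs, hsb, hfsb, hsf⟩ : ∃ s, Germ γ I g f s ∧
      s ∈ interior (A ∪ Icc b (b + ε)) ∧ f s ∈ interior (A ∪ Icc b (b + ε)) ∧ s ≠ b ∧
      f s ≠ b ∧ f s ≠ s := by
    have h1 := hf₀.eventually_ne S.isOpen b b
    have h2 : ∀ᶠ x in 𝓝[≠] s₀, f x ≠ x := by
      rcases hf₀.analyticAt.eventually_eq_or_eventually_ne analyticAt_id with h | h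
      · exact absurd (S.mem_stabilizer_of_germ_id hf₀ h) hg
      · exact h
    have h3 : ∀ᶠ x in 𝓝[≠] s₀, x ∈ interior (A ∪ Icc b (b + ε)) ∧
        f x ∈ interior (A ∪ Icc b (b + ε)) :=
      eventually_nhdsWithin_of_eventually_nhds
        (Filter.Eventually.and (isOpen_interior.mem_nhds hs₀)
          (hf₀.continuousAt.eventually (isOpen_interior.mem_nhds hfs₀)))
    obtain ⟨s, ⟨h4, h5, h6⟩, h7, h8, h9⟩ := (h1.and (h2.and h3)).exists
    exact ⟨s, h4, h8, h9, h5, h6, h7⟩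
  have hup : ∀ z ∈ interior (A ∪ Icc b (b + ε)), z < b + ε := fun z hz => by
    refine lt_of_mem_interior_Iic ?_ hz
    rintro y (hy | hy)
    · exact (hb.2 hy).trans (by linarith)
    · exact hy.2
  have hin : ∀ z ∈ interior (A ∪ Icc b (b + ε)), z < b → z ∈ interior A :=
    fun z hz hzb => mem_interior_of_union_Icc hz hzb
  obtain ⟨F, O, hF, hsO, hFf⟩ := S.exists_comp hf
  rw [← hFf.eq_of_nhds] at hfs hfsb hsf
  obtain ⟨F', hF', hinv, him, -⟩ := hF.inv S
  have hg' : g⁻¹ ∉ curveStabilizer G γ I := fun h => hg (inv_mem_iff.1 h)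
  have hεη : ε ≤ η := min_le_right _ _
  have hεε₀ : ε ≤ ε₀ := min_le_left _ _
  -- the germ crosses `b`, its inverse does, or both of its ends lie beyond `b`
  rcases lt_or_gt_of_ne hsb with h1 | h1 <;> rcases lt_or_gt_of_ne hfsb with h2 | h2
  · exact absurd (hA g F s (hF.germ s hsO) (hin _ hs h1) (hin _ hfs h2)) hg
  · exact ⟨g, F, O, hF, hg, s, hsO, hin _ hs h1, h2, (hup _ hfs).trans_le (by linarith)⟩
  · refine ⟨g⁻¹, F', _, hF', hg', F s, ⟨s, hsO, rfl⟩, hin _ hfs h2, ?_⟩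
    rw [hinv s hsO]
    exact ⟨h1, (hup _ hs).trans_le (by linarith)⟩
  · rcases lt_or_gt_of_ne hsf with h3 | h3
    · refine ⟨g⁻¹, F', _, hF', hg', hcr g⁻¹ F' _ hF' hg' (F s) ⟨s, hsO, rfl⟩ h2 ?_ ?_⟩
      · rwa [hinv s hsO]
      · rw [hinv s hsO]
        exact (hup _ hs).trans_le (by linarith)
    · exact ⟨g, F, O, hF, hg, hcr g F O hF hg s hsO h1 h3 ((hup _ hfs).trans_le (by linarith))⟩

/-- Beyond the right end `b ∈ I` of a maximal interval `A` there is a translate of `A`, or of a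
part of it, which begins at `b`. For otherwise, infinitely many disjoint translates of `A` would
accumulate at `b`, which satedness excludes. -/
lemma Setting.exists_right_neighbor (hI : ¬ FreeOn G γ I I) (hA : FreeOn G γ I A)
    (hAo : A.OrdConnected) (hAI : A ⊆ I)
    (hb : IsGreatest A b) (hAi : (interior A).Nonempty)
    (hmax : ∀ ε > 0, ¬ FreeOn G γ I (A ∪ Icc b (b + ε))) :
    ∃ g F O, IsComp γ I g F O ∧ g ∉ curveStabilizer G γ I ∧ (O ∩ interior A).Nonempty ∧
      F '' (O ∩ interior A) ⊆ Ioi b ∧ ∀ ε > 0, ∃ y ∈ F '' (O ∩ interior A), y < b + ε := by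
  have hAoi := ordConnected_interior hAo
  have hbI := hAI hb.1
  -- the translates lie to the right of `b`
  have hright : ∀ g F O, IsComp γ I g F O → g ∉ curveStabilizer G γ I →
      ∀ s ∈ O, s ∈ interior A → b < F s → F '' (O ∩ interior A) ⊆ Ioi b := by
    intro g F O hF hg s hs hsA hbs
    have hdisj : ∀ x ∈ O, x ∈ interior A → F x ∉ interior A := fun x hx hxA hFx =>
      hg (hA g F x (hF.germ x hx) hxA hFx)
    have hLo : (F '' (O ∩ interior A)).OrdConnected :=
      hF.ordConnected_image (hF.ordConnected.inter hAoi) inter_subset_left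
    have hLop : IsOpen (F '' (O ∩ interior A)) :=
      hF.isOpen_image (hF.isOpen.inter isOpen_interior) inter_subset_left
    have hlt : ∀ y ∈ F '' (O ∩ interior A), ¬ y < b := by
      intro y hy hyb
      have hsb := lt_of_mem_interior_Iic hb.2 hsA
      obtain ⟨z, hz1, hz2⟩ := exists_between (max_lt hyb hsb)
      have hzA : z ∈ interior A := mem_interior_of_lt hAo (interior_subset hsA) hb.1
        ((le_max_right _ _).trans_lt hz1) hz2
      obtain ⟨x, hx, hxz⟩ := hLo.out hy ⟨s, ⟨hs, hsA⟩, rfl⟩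
        ⟨((le_max_left _ _).trans_lt hz1).le, (hz2.trans hbs).le⟩
      exact hdisj x hx.1 hx.2 (hxz ▸ hzA)
    intro y hy
    rcases (not_lt.1 (hlt y hy)).eq_or_lt with h | h
    · obtain ⟨δ, hδ, hb'⟩ := Metric.isOpen_iff.1 hLop y hy
      refine absurd (?_ : y - δ / 2 < b) (hlt _ (hb' ?_))
      · linarith
      · simp [abs_of_pos hδ, hδ]
    · exact h
  obtain ⟨p, q, hp, hq, hpq⟩ : ∃ p q, p ∈ interior A ∧ q ∈ interior A ∧ p < q := by
    obtain ⟨a₀, ha₀⟩ := hAi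
    have hab := lt_of_mem_interior_Iic hb.2 ha₀
    exact ⟨a₀, (a₀ + b) / 2, ha₀, mem_interior_of_lt hAo (interior_subset ha₀) hb.1 (by linarith)
      (by linarith), by linarith⟩
  obtain ⟨ε₀, hε₀, hshr⟩ := S.not_shrink hbI hpq (hAoi.out hp hq |>.trans
    (interior_subset.trans hAI))
  by_contra! hcon
  obtain ⟨g₁, F₁, O₁, hF₁, hg₁, s₁, hs₁, hs₁A, hb₁, hlt₁⟩ :=
    S.exists_crossing hA hAo hAI hb hAi hmax hε₀
  obtain ⟨ε₁, hε₁, hL₁⟩ := hcon g₁ F₁ O₁ hF₁ hg₁ ⟨s₁, hs₁, hs₁A⟩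
    (hright g₁ F₁ O₁ hF₁ hg₁ s₁ hs₁ hs₁A hb₁)
  obtain ⟨g₂, F₂, O₂, hF₂, hg₂, s₂, hs₂, hs₂A, hb₂, hlt₂⟩ :=
    S.exists_crossing hA hAo hAI hb hAi hmax hε₁
  -- the translate by `g₂` begins before the one by `g₁`, is disjoint from it, and thus lies between
  -- `b` and `F₁ s₁`, too close to `b` by the choice of `ε₀`
  have hlt21 : F₂ s₂ < F₁ s₁ := hlt₂.trans_le (hL₁ _ ⟨s₁, ⟨hs₁, hs₁A⟩, rfl⟩)
  have hL₂o : (F₂ '' (O₂ ∩ interior A)).OrdConnected :=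
    hF₂.ordConnected_image (hF₂.ordConnected.inter hAoi) inter_subset_left
  have hbd : ∀ x ∈ O₂, x ∈ interior A → F₂ x < F₁ s₁ := by
    intro x hx hxA
    by_contra hle
    obtain ⟨r, hr, hrF⟩ := hL₂o.out ⟨s₂, ⟨hs₂, hs₂A⟩, rfl⟩ ⟨x, ⟨hx, hxA⟩, rfl⟩
      ⟨hlt21.le, not_lt.1 hle⟩
    obtain ⟨-, -, hO, hEq⟩ := hF₂.eq_of_eq S hI hA hAo hF₁ hr.1 hs₁ hr.2 hs₁A hrF
    have := hL₁ _ ⟨s₂, ⟨hO ▸ hs₂, hs₂A⟩, (hEq hs₂).symm⟩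
    linarith
  have hsub : interior A ⊆ O₂ := fun x hx =>
    hF₂.mem_of_compact S.ordConnected hs₂ (hAI (interior_subset hx)) (K := Icc b (F₁ s₁))
      isCompact_Icc (S.mem_Icc_subset hbI (hF₁.mapsTo hs₁)) fun y hy hyx =>
        have hyA := hAoi.uIcc_subset hs₂A hx hyx
        ⟨(hright g₂ F₂ O₂ hF₂ hg₂ s₂ hs₂ hs₂A hb₂ ⟨y, ⟨hy, hyA⟩, rfl⟩).le, (hbd y hy hyA).le⟩
  refine hshr g₂ fun r hr => ?_
  have hrA : r ∈ interior A := hAoi.out hp hq hr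
  refine ⟨F₂ r, hF₂.mapsTo (hsub hrA), ?_, hF₂.smul_eq (hsub hrA)⟩
  have h1 : b < F₂ r := hright g₂ F₂ O₂ hF₂ hg₂ s₂ hs₂ hs₂A hb₂ ⟨r, ⟨hsub hrA, hrA⟩, rfl⟩
  rw [abs_of_pos (by linarith)]
  linarith [hbd r (hsub hrA) hrA]

end Neighbor

/-! ### Translations along the curve -/

section Shift

variable {G : Type*} [Group G] {M : Type*} [MulAction G M] {γ : ℝ → M} {I : Set ℝ} {g k : G}
  {F F' f e : ℝ → ℝ} {O A D D' U₁ U₂ : Set ℝ} {s t x y z p : ℝ}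

lemma IsComp.strictMonoOn_iff (h : IsComp γ I g F O) (hx : x ∈ O) :
    StrictMonoOn F O ↔ 0 < deriv F x := by
  have hd := (h.germ x hx).analyticAt.differentiableAt.hasDerivAt
  have hne := (h.germ x hx).deriv_ne
  have hO := h.isOpen.mem_nhds hx
  constructor
  · intro hm
    refine lt_of_le_of_ne ?_ hne.symm
    exact hm.monotoneOn.derivWithin_nonneg.trans_eq (derivWithin_of_mem_nhds hO)
  · intro hpos
    refine h.strictMonoOn_or_strictAntiOn.resolve_right fun ha => ?_
    have h1 := ha.antitoneOn.derivWithin_nonpos (x := x)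
    rw [derivWithin_of_mem_nhds hO] at h1
    linarith

lemma IsComp.strictAntiOn_iff (h : IsComp γ I g F O) (hx : x ∈ O) :
    StrictAntiOn F O ↔ deriv F x < 0 := by
  have hne := (h.germ x hx).deriv_ne
  have h1 := h.strictMonoOn_iff hx
  constructor
  · intro ha
    have h2 := ha.antitoneOn.derivWithin_nonpos (x := x)
    rw [derivWithin_of_mem_nhds (h.isOpen.mem_nhds hx)] at h2
    exact lt_of_le_of_ne h2 hne
  · intro hneg
    exact h.strictMonoOn_or_strictAntiOn.resolve_left fun hm => (h1.1 hm).not_gt hneg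

lemma IsComp.not_mono_anti (h : IsComp γ I g F O) (hm : StrictMonoOn F O)
    (ha : StrictAntiOn F O) : False := by
  obtain ⟨x, hx⟩ := h.nonempty
  exact ((h.strictMonoOn_iff hx).1 hm).not_gt ((h.strictAntiOn_iff hx).1 ha)

lemma IsComp.interior_image (h : IsComp γ I g F O) {U : Set ℝ} (hU : U ⊆ O) :
    interior (F '' U) = F '' interior U := by
  apply Subset.antisymm
  · intro y hy
    obtain ⟨x, hx, rfl⟩ := interior_subset hy
    refine ⟨x, mem_interior_iff_mem_nhds.2 ?_, rfl⟩
    have h1 := (h.germ x (hU hx)).continuousAt (isOpen_interior.mem_nhds hy)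
    filter_upwards [h1, h.isOpen.mem_nhds (hU hx)] with z hz hzO
    obtain ⟨w, hw, hwz⟩ := interior_subset hz
    rwa [← h.injOn (hU hw) hzO hwz]
  · exact interior_maximal (image_mono interior_subset)
      (h.isOpen_image isOpen_interior (interior_subset.trans hU))

/-- The domain of a transition that moves all points to the right is closed to the left in `I`. -/
lemma IsComp.mem_of_le (h : IsComp γ I g F O) (hI : I.OrdConnected) (hm : StrictMonoOn F O)
    (hlt : ∀ x ∈ O, x < F x) (hx : x ∈ O) (hy : y ∈ I) (hyx : y ≤ x) : y ∈ O := by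
  rcases h.exit hI hx hy hy (Or.inr ⟨hyx.trans (hlt x hx).le, fun z hz hzs =>
    hm.monotoneOn hz hx (by rw [uIcc_of_ge hyx] at hzs; exact hzs.2)⟩) with h1 | ⟨z, hz, hzs, hzF⟩
  · exact h1
  · rw [uIcc_of_ge hyx] at hzs
    exact absurd (hlt z hz) (not_lt.2 (hzF.trans_le hzs.1))

variable [TopologicalSpace M]

lemma Setting.exists_gt (S : Setting G γ I) (ht : t ∈ I) : ∃ u ∈ I, t < u := by
  obtain ⟨u, hu, hsub⟩ := mem_nhdsGE_iff_exists_Icc_subset.1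
    (mem_nhdsWithin_of_mem_nhds (S.isOpen.mem_nhds ht))
  exact ⟨u, hsub (right_mem_Icc.2 (le_of_lt hu)), hu⟩

/-- A transition that moves all points to the right reaches points beyond each `t ∈ I`. -/
lemma IsComp.exists_lt_map (h : IsComp γ I g F O) (S : Setting G γ I) (hm : StrictMonoOn F O)
    (hlt : ∀ x ∈ O, x < F x) (ht : t ∈ I) : ∃ x ∈ O, t < F x := by
  by_cases htO : t ∈ O
  · exact ⟨t, htO, hlt t htO⟩
  obtain ⟨x, hx⟩ := h.nonempty
  obtain ⟨u, hu, htu⟩ := S.exists_gt ht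
  have hxt : x ≤ t := by
    by_contra hle
    exact htO (h.mem_of_le S.ordConnected hm hlt hx ht (not_le.1 hle).le)
  rcases le_or_gt (F x) u with hle | hgt
  · rcases h.exit S.ordConnected hx ht hu (Or.inl ⟨hle, fun z hz hzs =>
      hm.monotoneOn hx hz (by rw [uIcc_of_le hxt] at hzs; exact hzs.1)⟩) with h1 | ⟨z, hz, -, hzF⟩
    · exact absurd h1 htO
    · exact ⟨z, hz, hzF ▸ htu⟩
  · exact ⟨x, hx, htu.trans hgt⟩

variable [T2Space M] (S : Setting G γ I)
include S

/-- Freeness is transferred from `D` to `D'` if `D'` is cut by a point `p` into a part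
`U₁` inside `D` and a part `U₂` that a transition moves into `D`, away from `U₁`. -/
lemma Setting.freeOn_of_transfer (hI : ¬ FreeOn G γ I I) (hD : FreeOn G γ I D)
    (hDo : D.OrdConnected) (hU : ∀ z ∈ interior D', z ≠ p → z ∈ U₁ ∨ z ∈ U₂)
    (h₁ : ∀ z ∈ U₁, z ∈ interior D)
    (h₂ : ∀ z ∈ U₂, Germ γ I k e z ∧ e z ∈ interior D ∧ e z ∉ U₁) : FreeOn G γ I D' := by
  intro g f s₀ hf₀ hs₀ hfs₀
  -- move the base point off the cut
  obtain ⟨s, hf, hs, hfs, hsp, hfsp⟩ : ∃ s, Germ γ I g f s ∧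
      s ∈ interior D' ∧ f s ∈ interior D' ∧ s ≠ p ∧ f s ≠ p := by
    have h1 := hf₀.eventually_ne S.isOpen p p
    have h3 : ∀ᶠ x in 𝓝[≠] s₀, x ∈ interior D' ∧ f x ∈ interior D' :=
      eventually_nhdsWithin_of_eventually_nhds
        (Filter.Eventually.and (isOpen_interior.mem_nhds hs₀)
          (hf₀.continuousAt.eventually (isOpen_interior.mem_nhds hfs₀)))
    obtain ⟨s, ⟨h4, h5, h6⟩, h8, h9⟩ := (h1.and h3).exists
    exact ⟨s, h4, h8, h9, h5, h6⟩
  -- transport both ends of the germ into `D`, where germs are trivial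
  have key : ∀ (k₁ k₂ : G) (e₁ e₂ : ℝ → ℝ), Germ γ I k₁ e₁ s → e₁ s ∈ interior D →
      Germ γ I k₂ e₂ (f s) → e₂ (f s) ∈ interior D →
        k₂ * g * k₁⁻¹ ∈ curveStabilizer G γ I ∧ e₂ (f s) = e₁ s := by
    intro k₁ k₂ e₁ e₂ he₁ hs₁ he₂ hs₂
    obtain ⟨e₁', he₁', hes, -, -⟩ := S.germ_inv he₁
    have h1 := Germ.comp (f := e₁') (s := e₁ s) (e := f) (by rwa [hes]) he₁'
    have h2 := Germ.comp (f := fun x => f (e₁' x)) (s := e₁ s) (e := e₂)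
      (by simpa only [hes] using he₂) h1
    have h3 : e₂ (f (e₁' (e₁ s))) ∈ interior D := by simpa only [hes] using hs₂
    refine ⟨?_, ?_⟩
    · simpa only [mul_assoc] using hD _ _ _ h2 hs₁ h3
    · simpa only [hes, id] using (S.germ_trivial hI hD hDo h2 hs₁ h3).eq_of_nhds
  rcases hU s hs hsp with h1 | h1 <;> rcases hU (f s) hfs hfsp with h2 | h2
  · simpa using (key 1 1 id id (Germ.id hf.mem) (h₁ _ h1) (Germ.id hf.map_mem) (h₁ _ h2)).1
  · obtain ⟨h3, h4, h5⟩ := h₂ _ h2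
    have := (key 1 k id e (Germ.id hf.mem) (h₁ _ h1) h3 h4).2
    exact absurd (this ▸ h1) h5
  · obtain ⟨h3, h4, h5⟩ := h₂ _ h1
    have := (key k 1 e id h3 h4 (Germ.id hf.map_mem) (h₁ _ h2)).2
    exact absurd (this ▸ h2) h5
  · obtain ⟨h3, h4, -⟩ := h₂ _ h1
    obtain ⟨h3', h4', -⟩ := h₂ _ h2
    have := S.conj_mem h3 (key k k e e h3 h4 h3' h4').1
    simpa [mul_assoc] using this

/-- For a translation `F` along the curve, all the intervals `[x, F x]` are free as soon as one
of them is. -/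
lemma IsComp.freeOn_Icc (h : IsComp γ I g F O) (hI : ¬ FreeOn G γ I I) (hm : StrictMonoOn F O)
    (hlt : ∀ x ∈ O, x < F x) {x₀ : ℝ} (hx₀ : x₀ ∈ O) (h₀ : FreeOn G γ I (Icc x₀ (F x₀)))
    (hx : x ∈ O) : FreeOn G γ I (Icc x (F x)) := by
  obtain ⟨F', hF', hinv, -, hinv'⟩ := h.inv S
  have hm' := strictMonoOn_inverse hm hinv
  -- `[y, F y]` arises from `[x, F x]` by moving the part `[x, y]` to the other end
  have up : ∀ x ∈ O, ∀ y ∈ O, x < y → y < F x → FreeOn G γ I (Icc x (F x)) →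
      FreeOn G γ I (Icc y (F y)) := by
    intro x hx y hy hxy hyF hfree
    refine S.freeOn_of_transfer hI hfree ordConnected_Icc (p := F x) (U₁ := Ioo y (F x))
      (U₂ := Ioo (F x) (F y)) (k := g⁻¹) (e := F') ?_ ?_ ?_
    · rw [interior_Icc]
      intro z hz hzp
      rcases lt_or_gt_of_ne hzp with h1 | h1
      · exact Or.inl ⟨hz.1, h1⟩
      · exact Or.inr ⟨h1, hz.2⟩
    · rw [interior_Icc]
      exact fun z hz => ⟨hxy.trans hz.1, hz.2⟩
    · rintro z ⟨hz1, hz2⟩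
      obtain ⟨w, hw, rfl⟩ := (h.ordConnected_image h.ordConnected subset_rfl).out
        (mem_image_of_mem _ hx) (mem_image_of_mem _ hy) ⟨hz1.le, hz2.le⟩
      rw [hinv w hw, interior_Icc]
      have h1 : x < w := (hm.lt_iff_lt hx hw).1 hz1
      have h2 : w < y := (hm.lt_iff_lt hw hy).1 hz2
      exact ⟨hF'.germ _ ⟨w, hw, rfl⟩, ⟨h1, h2.trans hyF⟩, fun h3 => h2.not_gt h3.1⟩
  have down : ∀ x ∈ O, ∀ y ∈ O, x < y → y < F x → FreeOn G γ I (Icc y (F y)) →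
      FreeOn G γ I (Icc x (F x)) := by
    intro x hx y hy hxy hyF hfree
    refine S.freeOn_of_transfer hI hfree ordConnected_Icc (p := y) (U₁ := Ioo y (F x))
      (U₂ := Ioo x y) (k := g) (e := F) ?_ ?_ ?_
    · rw [interior_Icc]
      intro z hz hzp
      rcases lt_or_gt_of_ne hzp with h1 | h1
      · exact Or.inr ⟨hz.1, h1⟩
      · exact Or.inl ⟨h1, hz.2⟩
    · rw [interior_Icc]
      exact fun z hz => ⟨hz.1, hz.2.trans (hm hx hy hxy)⟩
    · rintro z ⟨hz1, hz2⟩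
      have hz : z ∈ O := h.ordConnected.out hx hy ⟨hz1.le, hz2.le⟩
      rw [interior_Icc]
      have h1 := hm hx hz hz1
      exact ⟨h.germ z hz, ⟨hyF.trans h1, hm hz hy hz2⟩, fun h3 => h1.not_gt h3.2⟩
  -- the set of all `x` with `[x, F x]` free is relatively open and closed in `O`
  have hnear : ∀ x ∈ O, ∀ᶠ y in 𝓝 x, y ∈ O ∧ x < F y ∧ y < F x := fun x hx => by
    filter_upwards [h.isOpen.mem_nhds hx, (h.germ x hx).continuousAt.eventually
      (lt_mem_nhds (hlt x hx)), gt_mem_nhds (hlt x hx)] with y h1 h2 h3 using ⟨h1, h2, h3⟩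
  have hiff : ∀ x ∈ O, ∀ᶠ y in 𝓝 x, FreeOn G γ I (Icc y (F y)) ↔ FreeOn G γ I (Icc x (F x)) :=
    fun x hx => by
      filter_upwards [hnear x hx] with y ⟨hy, h1, h2⟩
      rcases lt_trichotomy x y with hxy | rfl | hxy
      · exact ⟨down x hx y hy hxy h2, up x hx y hy hxy h2⟩
      · rfl
      · exact ⟨up y hy x hx hxy h1, down y hy x hx hxy h1⟩
  have hsub : O ⊆ {x | x ∈ O ∧ FreeOn G γ I (Icc x (F x))} := by
    refine h.ordConnected.isPreconnected.subset_of_closure_inter_subset ?_ ⟨x₀, hx₀, hx₀, h₀⟩ ?_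
    · rw [isOpen_iff_mem_nhds]
      rintro x ⟨hx, hfx⟩
      filter_upwards [h.isOpen.mem_nhds hx, hiff x hx] with y hy hyx using ⟨hy, hyx.2 hfx⟩
    · rintro x ⟨hxc, hx⟩
      obtain ⟨y, hy, hyx⟩ := ((mem_closure_iff_frequently.1 hxc).and_eventually (hiff x hx)).exists
      exact ⟨hx, hyx.1 hy.2⟩
  exact (hsub hx).2

/-- A free interval does not contain in its interior both a point and its image under a transition
that moves this point. -/
lemma IsComp.not_freeOn (h : IsComp γ I g F O) (hI : ¬ FreeOn G γ I I) (hx : x ∈ O)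
    (hne : F x ≠ x) (hDo : D.OrdConnected) (h1 : x ∈ interior D) (h2 : F x ∈ interior D) :
    ¬ FreeOn G γ I D :=
  fun hD => hne (S.germ_trivial hI hD hDo (h.germ x hx) h1 h2).eq_of_nhds

/-- A free interval does not contain a fixed point of a decreasing transition in its interior. -/
lemma IsComp.not_freeOn_of_fixed (h : IsComp γ I g F O) (hI : ¬ FreeOn G γ I I) (hx : x ∈ O)
    (ha : StrictAntiOn F O) (hfx : F x = x) (hDo : D.OrdConnected) (h1 : x ∈ interior D) :
    ¬ FreeOn G γ I D := by
  intro hD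
  have h2 := S.germ_trivial hI hD hDo (h.germ x hx) h1 (hfx.symm ▸ h1)
  have h3 := (h.strictAntiOn_iff hx).1 ha
  rw [h2.deriv_eq] at h3
  simp at h3
  linarith

/-- An increasing transition that moves a point to the right moves all points to the right. -/
lemma IsComp.lt_map (h : IsComp γ I g F O) (hm : StrictMonoOn F O) (hx : x ∈ O) (hlt : x < F x) :
    ∀ y ∈ O, y < F y := by
  refine (lt_or_gt_of_no_fixed h.ordConnected h.continuousOn fun c hc hcc => ?_).resolve_right
    fun h' => (h' x hx).not_gt hlt
  exact hlt.ne (h.eqOn_id_of_fixed S hm hc hcc hx).symm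

end Shift

/-! ### Translates of a compact maximal interval -/

/-- `[a, b]` is a maximal interval, in terms of germs. -/
structure MaxIcc (G : Type*) [Group G] {M : Type*} [MulAction G M] (γ : ℝ → M) (I : Set ℝ)
    (a b : ℝ) : Prop where
  lt : a < b
  sub : Icc a b ⊆ I
  free : FreeOn G γ I (Icc a b)
  right : ∀ ε > 0, ¬ FreeOn G γ I (Icc a (b + ε))
  left : ∀ ε > 0, ¬ FreeOn G γ I (Icc (a - ε) b)

/-- The transition `F` carries `[a, b]`, or a part of it, to an interval with left end `u`. -/
def Starts {G : Type*} [Group G] {M : Type*} [MulAction G M] (γ : ℝ → M) (I : Set ℝ)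
    (a b : ℝ) (g : G) (F : ℝ → ℝ) (O : Set ℝ) (u : ℝ) : Prop :=
  IsComp γ I g F O ∧ ((StrictMonoOn F O ∧ a ∈ O ∧ F a = u) ∨ (StrictAntiOn F O ∧ b ∈ O ∧ F b = u))

/-- The transition `F` carries `[a, b]`, or a part of it, to an interval with right end `u`. -/
def Ends {G : Type*} [Group G] {M : Type*} [MulAction G M] (γ : ℝ → M) (I : Set ℝ)
    (a b : ℝ) (g : G) (F : ℝ → ℝ) (O : Set ℝ) (u : ℝ) : Prop :=
  IsComp γ I g F O ∧ ((StrictMonoOn F O ∧ b ∈ O ∧ F b = u) ∨ (StrictAntiOn F O ∧ a ∈ O ∧ F a = u))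

section Tile

variable {G : Type*} [Group G] {M : Type*} [MulAction G M] {γ : ℝ → M} {I : Set ℝ} {g k l : G}
  {F F' K L : ℝ → ℝ} {O O' A P Q : Set ℝ} {s t x y a b u v : ℝ}

lemma neg_Icc' (a b : ℝ) : -Icc a b = Icc (-b) (-a) := by
  ext x
  simp only [Set.mem_neg, mem_Icc]
  constructor <;> rintro ⟨h1, h2⟩ <;> constructor <;> linarith

lemma MaxIcc.mirror (h : MaxIcc G γ I a b) : MaxIcc G (fun t => γ (-t)) (-I) (-b) (-a) := by
  refine ⟨neg_lt_neg h.lt, ?_, ?_, fun ε hε hf => ?_, fun ε hε hf => ?_⟩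
  · rw [← neg_Icc']
    exact neg_subset_neg.2 h.sub
  · rw [← neg_Icc']
    exact h.free.mirror
  · rw [show Icc (-b) (-a + ε) = -Icc (a - ε) b by rw [neg_Icc']; congr 1; ring,
      freeOn_mirror_iff] at hf
    exact h.left ε hε hf
  · rw [show Icc (-b - ε) (-a) = -Icc a (b + ε) by rw [neg_Icc']; congr 1; ring,
      freeOn_mirror_iff] at hf
    exact h.right ε hε hf

lemma Starts.mirror (h : Starts γ I a b g F O u) :
    Ends (fun t => γ (-t)) (-I) (-b) (-a) g (fun x => -F (-x)) (-O) (-u) := by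
  refine ⟨h.1.mirror, ?_⟩
  rcases h.2 with ⟨h1, h2, h3⟩ | ⟨h1, h2, h3⟩
  · exact Or.inl ⟨strictMonoOn_mirror h1, by simpa using h2, by simp [h3]⟩
  · exact Or.inr ⟨strictAntiOn_mirror h1, by simpa using h2, by simp [h3]⟩

lemma Ends.mirror (h : Ends γ I a b g F O u) :
    Starts (fun t => γ (-t)) (-I) (-b) (-a) g (fun x => -F (-x)) (-O) (-u) := by
  refine ⟨h.1.mirror, ?_⟩
  rcases h.2 with ⟨h1, h2, h3⟩ | ⟨h1, h2, h3⟩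
  · exact Or.inl ⟨strictMonoOn_mirror h1, by simpa using h2, by simp [h3]⟩
  · exact Or.inr ⟨strictAntiOn_mirror h1, by simpa using h2, by simp [h3]⟩

lemma isOpen_exists_gt (hO : IsOpen O) (hx : x ∈ O) (hxy : x < y) :
    ∃ c, x < c ∧ c < y ∧ Icc x c ⊆ O := by
  obtain ⟨c, hc, hsub⟩ := mem_nhdsGE_iff_exists_Icc_subset.1
    (mem_nhdsWithin_of_mem_nhds (hO.mem_nhds hx))
  have hc : x < c := hc
  obtain ⟨d, hd1, hd2⟩ := exists_between (lt_min hc hxy)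
  exact ⟨d, hd1, hd2.trans_le (min_le_right _ _),
    (Icc_subset_Icc_right (hd2.le.trans (min_le_left _ _))).trans hsub⟩

lemma isOpen_exists_lt (hO : IsOpen O) (hx : x ∈ O) (hxy : y < x) :
    ∃ c, y < c ∧ c < x ∧ Icc c x ⊆ O := by
  obtain ⟨c, hc, hsub⟩ := mem_nhdsLE_iff_exists_Icc_subset.1
    (mem_nhdsWithin_of_mem_nhds (hO.mem_nhds hx))
  have hc : c < x := hc
  obtain ⟨d, hd1, hd2⟩ := exists_between (max_lt hc hxy)
  exact ⟨d, (le_max_right _ _).trans_lt hd1, hd2,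
    (Icc_subset_Icc_left ((le_max_left _ _).trans hd1.le)).trans hsub⟩

lemma Starts.of_mono (h : Starts γ I a b g F O u) (hm : StrictMonoOn F O) : a ∈ O ∧ F a = u :=
  h.2.elim (fun h => h.2) fun h' => (h.1.not_mono_anti hm h'.1).elim

lemma Starts.of_anti (h : Starts γ I a b g F O u) (hm : StrictAntiOn F O) : b ∈ O ∧ F b = u :=
  h.2.elim (fun h' => (h.1.not_mono_anti h'.1 hm).elim) fun h => h.2

lemma Ends.of_mono (h : Ends γ I a b g F O u) (hm : StrictMonoOn F O) : b ∈ O ∧ F b = u :=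
  h.2.elim (fun h => h.2) fun h' => (h.1.not_mono_anti hm h'.1).elim

lemma Ends.of_anti (h : Ends γ I a b g F O u) (hm : StrictAntiOn F O) : a ∈ O ∧ F a = u :=
  h.2.elim (fun h' => (h.1.not_mono_anti h'.1 hm).elim) fun h => h.2

/-- A translate of `[a, b]` beginning at `u` covers a right neighborhood of `u`. -/
lemma Starts.exists_Ioo (h : Starts γ I a b g F O u) (hab : a < b) :
    ∃ w > u, ∀ y ∈ Ioo u w, ∃ s ∈ O, s ∈ Ioo a b ∧ F s = y := by
  rcases h with ⟨hF, ⟨hm, ha, rfl⟩ | ⟨hm, hb, rfl⟩⟩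
  · obtain ⟨c, hac, hcb, hsub⟩ := isOpen_exists_gt hF.isOpen ha hab
    have hcO := hsub (right_mem_Icc.2 hac.le)
    refine ⟨F c, hm ha hcO hac, fun y hy => ?_⟩
    obtain ⟨s, hs, rfl⟩ := intermediate_value_Icc hac.le (hF.continuousOn.mono hsub)
      (Ioo_subset_Icc_self hy)
    exact ⟨s, hsub hs, ⟨(hm.lt_iff_lt ha (hsub hs)).1 hy.1, hs.2.trans_lt hcb⟩, rfl⟩
  · obtain ⟨c, hac, hcb, hsub⟩ := isOpen_exists_lt hF.isOpen hb hab
    have hcO := hsub (left_mem_Icc.2 hcb.le)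
    refine ⟨F c, hm hcO hb hcb, fun y hy => ?_⟩
    obtain ⟨s, hs, rfl⟩ := intermediate_value_Icc' hcb.le (hF.continuousOn.mono hsub)
      (Ioo_subset_Icc_self hy)
    exact ⟨s, hsub hs, ⟨hac.trans_le hs.1, (hm.lt_iff_gt hb (hsub hs)).1 hy.1⟩, rfl⟩

lemma Starts.isLeast (h : Starts γ I a b g F O u) (hab : a < b) :
    IsLeast (F '' (O ∩ Icc a b)) u := by
  rcases h with ⟨hF, ⟨hm, ha, rfl⟩ | ⟨hm, hb, rfl⟩⟩
  · refine ⟨⟨a, ⟨ha, left_mem_Icc.2 hab.le⟩, rfl⟩, ?_⟩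
    rintro _ ⟨x, hx, rfl⟩
    exact hm.monotoneOn ha hx.1 hx.2.1
  · refine ⟨⟨b, ⟨hb, right_mem_Icc.2 hab.le⟩, rfl⟩, ?_⟩
    rintro _ ⟨x, hx, rfl⟩
    exact hm.antitoneOn hx.1 hb hx.2.2

lemma Ends.isGreatest (h : Ends γ I a b g F O u) (hab : a < b) :
    IsGreatest (F '' (O ∩ Icc a b)) u := by
  rcases h with ⟨hF, ⟨hm, ha, rfl⟩ | ⟨hm, hb, rfl⟩⟩
  · refine ⟨⟨b, ⟨ha, right_mem_Icc.2 hab.le⟩, rfl⟩, ?_⟩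
    rintro _ ⟨x, hx, rfl⟩
    exact hm.monotoneOn hx.1 ha hx.2.2
  · refine ⟨⟨a, ⟨hb, left_mem_Icc.2 hab.le⟩, rfl⟩, ?_⟩
    rintro _ ⟨x, hx, rfl⟩
    exact hm.antitoneOn hb hx.1 hx.2.1

/-- If the translate of `[a, b]` has a least element, then this is the image of an end of
`[a, b]`. -/
lemma IsComp.starts_of_isLeast (h : IsComp γ I g F O) (hab : a < b)
    (hu : IsLeast (F '' (O ∩ Icc a b)) u) : Starts γ I a b g F O u := by
  obtain ⟨⟨s, ⟨hs, hsa⟩, rfl⟩, hle⟩ := hu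
  refine ⟨h, ?_⟩
  rcases h.strictMonoOn_or_strictAntiOn with hm | hm
  · left
    rcases hsa.1.eq_or_lt with rfl | hlt
    · exact ⟨hm, hs, rfl⟩
    obtain ⟨c, hac, hcb, hsub⟩ := isOpen_exists_lt h.isOpen hs hlt
    have hcO := hsub (left_mem_Icc.2 hcb.le)
    exact absurd (hle ⟨c, ⟨hcO, hac.le, hcb.le.trans hsa.2⟩, rfl⟩) (not_le.2 (hm hcO hs hcb))
  · right
    rcases hsa.2.eq_or_lt with rfl | hlt
    · exact ⟨hm, hs, rfl⟩
    obtain ⟨c, hac, hcb, hsub⟩ := isOpen_exists_gt h.isOpen hs hlt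
    have hcO := hsub (right_mem_Icc.2 hac.le)
    exact absurd (hle ⟨c, ⟨hcO, hsa.1.trans hac.le, hcb.le⟩, rfl⟩) (not_le.2 (hm hs hcO hac))

/-- A translate of `[a, b]` with left end `u` is either compact, and then all of `[a, b]` is
translated, or it reaches the right end of `I`. -/
lemma Starts.image (h : Starts γ I a b g F O u) (hI : I.OrdConnected) (hab : Icc a b ⊆ I)
    (hlt : a < b) :
    (∃ v ∈ I, Ends γ I a b g F O v ∧ u < v ∧ Icc a b ⊆ O ∧ F '' (O ∩ Icc a b) = Icc u v) ∨
      F '' (O ∩ Icc a b) = I ∩ Ici u := by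
  have ha := hab (left_mem_Icc.2 hlt.le)
  have hb := hab (right_mem_Icc.2 hlt.le)
  by_cases hfull : a ∈ O ∧ b ∈ O
  · left
    have hsub : Icc a b ⊆ O := h.1.ordConnected.out hfull.1 hfull.2
    rw [inter_eq_right.2 hsub]
    rcases h with ⟨hF, ⟨hm, ha, rfl⟩ | ⟨hm, hb, rfl⟩⟩
    · refine ⟨F b, hF.mapsTo hfull.2, ⟨hF, Or.inl ⟨hm, hfull.2, rfl⟩⟩,
        hm hfull.1 hfull.2 hlt, hsub, ?_⟩
      apply Subset.antisymm
      · rintro _ ⟨x, hx, rfl⟩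
        exact ⟨hm.monotoneOn hfull.1 (hsub hx) hx.1, hm.monotoneOn (hsub hx) hfull.2 hx.2⟩
      · exact intermediate_value_Icc hlt.le (hF.continuousOn.mono hsub)
    · refine ⟨F a, hF.mapsTo hfull.1, ⟨hF, Or.inr ⟨hm, hfull.1, rfl⟩⟩,
        hm hfull.1 hfull.2 hlt, hsub, ?_⟩
      apply Subset.antisymm
      · rintro _ ⟨x, hx, rfl⟩
        exact ⟨hm.antitoneOn (hsub hx) hfull.2 hx.2, hm.antitoneOn hfull.1 (hsub hx) hx.1⟩
      · exact intermediate_value_Icc' hlt.le (hF.continuousOn.mono hsub)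
  · right
    apply Subset.antisymm
    · intro y hy
      exact ⟨(h.1.mapsTo.mono_left inter_subset_left).image_subset hy, (h.isLeast hlt).2 hy⟩
    · rintro t ⟨htI, hut⟩
      rcases h with ⟨hF, ⟨hm, ha, rfl⟩ | ⟨hm, hb, rfl⟩⟩
      · rcases hF.exit hI ha hb htI (Or.inl ⟨hut, fun y hy hys =>
          hm.monotoneOn ha hy (by rw [uIcc_of_le hlt.le] at hys; exact hys.1)⟩) with
          h1 | ⟨y, hy, hys, hyF⟩
        · exact absurd ⟨ha, h1⟩ hfull
        · exact ⟨y, ⟨hy, by rwa [uIcc_of_le hlt.le] at hys⟩, hyF⟩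
      · rcases hF.exit hI hb ha htI (Or.inl ⟨hut, fun y hy hys =>
          hm.antitoneOn hy hb (by rw [uIcc_of_ge hlt.le] at hys; exact hys.2)⟩) with
          h1 | ⟨y, hy, hys, hyF⟩
        · exact absurd ⟨h1, hb⟩ hfull
        · exact ⟨y, ⟨hy, by rwa [uIcc_of_ge hlt.le] at hys⟩, hyF⟩

variable [TopologicalSpace M] [T2Space M] (S : Setting G γ I)
include S

omit [T2Space M] in
/-- A decreasing transition that carries `A` to an interval beginning at its right end `b` is a
reflection in `b`. -/
lemma IsComp.fixed_of_neighbor (h : IsComp γ I g F O) (ha : StrictAntiOn F O)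
    (hAo : A.OrdConnected) (hAI : A ⊆ I) (hb : IsGreatest A b)
    (hne : (O ∩ interior A).Nonempty) (hgt : F '' (O ∩ interior A) ⊆ Ioi b)
    (hinf : ∀ ε > 0, ∃ y ∈ F '' (O ∩ interior A), y < b + ε) : b ∈ O ∧ F b = b := by
  obtain ⟨s, hs, hsA⟩ := hne
  have hsb := lt_of_mem_interior_Iic hb.2 hsA
  have hint : ∀ y, s ≤ y → y < b → y ∈ interior A := fun y h1 h2 => by
    rcases h1.eq_or_lt with rfl | h1
    · exact hsA
    · exact mem_interior_of_lt hAo (interior_subset hsA) hb.1 h1 h2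
  have hbO : b ∈ O := by
    by_contra hbO
    refine hbO (h.mem_of_compact S.ordConnected hs (hAI hb.1) (K := Icc b (F s)) isCompact_Icc
      (S.mem_Icc_subset (hAI hb.1) (h.mapsTo hs)) fun y hy hyb => ?_)
    rw [uIcc_of_le hsb.le] at hyb
    have hyb' : y < b := lt_of_le_of_ne hyb.2 fun h => hbO (h ▸ hy)
    exact ⟨(hgt ⟨y, ⟨hy, hint y hyb.1 hyb'⟩, rfl⟩).le, ha.antitoneOn hs hy hyb.1⟩
  refine ⟨hbO, le_antisymm ?_ ?_⟩
  · refine le_of_forall_pos_lt_add fun ε hε => ?_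
    obtain ⟨_, ⟨x, hx, rfl⟩, hlt⟩ := hinf ε hε
    exact (ha hx.1 hbO (lt_of_mem_interior_Iic hb.2 hx.2)).trans hlt
  · refine ge_of_tendsto ((h.germ b hbO).continuousAt.tendsto.mono_left
      (nhdsWithin_le_nhds (s := Iio b))) ?_
    filter_upwards [mem_nhdsWithin_of_mem_nhds (h.isOpen.mem_nhds hbO),
      mem_nhdsWithin_of_mem_nhds (lt_mem_nhds hsb), self_mem_nhdsWithin] with x h1 h2 h3
    exact (hgt ⟨x, ⟨h1, hint x h2.le h3⟩, rfl⟩).le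

omit [T2Space M] in
/-- An increasing transition that carries `[a, b]` to an interval beginning at `b` takes `a`
to `b`. -/
lemma IsComp.map_left_of_neighbor (h : IsComp γ I g F O) (hm : StrictMonoOn F O)
    (hab : a < b) (hsub : Icc a b ⊆ I)
    (hne : (O ∩ Ioo a b).Nonempty) (hgt : F '' (O ∩ Ioo a b) ⊆ Ioi b)
    (hinf : ∀ ε > 0, ∃ y ∈ F '' (O ∩ Ioo a b), y < b + ε) : a ∈ O ∧ F a = b := by
  obtain ⟨s, hs, hsA⟩ := hne
  have haO : a ∈ O := by
    by_contra haO
    refine haO (h.mem_of_compact S.ordConnected hs (hsub (left_mem_Icc.2 hab.le))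
      (K := Icc b (F s)) isCompact_Icc
      (S.mem_Icc_subset (hsub (right_mem_Icc.2 hab.le)) (h.mapsTo hs)) fun y hy hya => ?_)
    rw [uIcc_of_ge hsA.1.le] at hya
    have hay : a < y := lt_of_le_of_ne hya.1 fun h => haO (h ▸ hy)
    exact ⟨(hgt ⟨y, ⟨hy, hay, hya.2.trans_lt hsA.2⟩, rfl⟩).le, hm.monotoneOn hy hs hya.2⟩
  refine ⟨haO, le_antisymm ?_ ?_⟩
  · refine le_of_forall_pos_lt_add fun ε hε => ?_
    obtain ⟨_, ⟨x, hx, rfl⟩, hlt⟩ := hinf ε hε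
    exact (hm haO hx.1 hx.2.1).trans hlt
  · refine ge_of_tendsto ((h.germ a haO).continuousAt.tendsto.mono_left
      (nhdsWithin_le_nhds (s := Ioi a))) ?_
    filter_upwards [mem_nhdsWithin_of_mem_nhds (h.isOpen.mem_nhds haO),
      mem_nhdsWithin_of_mem_nhds (gt_mem_nhds hab), self_mem_nhdsWithin] with x h1 h2 h3
    exact (hgt ⟨x, ⟨h1, h3, h2⟩, rfl⟩).le

/-- A nontrivial translate of a compact maximal interval begins at its right end. -/
lemma MaxIcc.exists_starts (h : MaxIcc G γ I a b) (hI : ¬ FreeOn G γ I I) :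
    ∃ g F O, Starts γ I a b g F O b ∧ g ∉ curveStabilizer G γ I := by
  obtain ⟨g, F, O, hF, hg, hne, hgt, hinf⟩ := S.exists_right_neighbor hI h.free ordConnected_Icc
    h.sub (isGreatest_Icc h.lt.le) (by rw [interior_Icc]; exact nonempty_Ioo.2 h.lt)
    fun ε hε => by
      rw [Icc_union_Icc_eq_Icc h.lt.le (by linarith)]
      exact h.right ε hε
  refine ⟨g, F, O, ⟨hF, ?_⟩, hg⟩
  rcases hF.strictMonoOn_or_strictAntiOn with hm | ha
  · rw [interior_Icc] at hne hgt hinf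
    exact Or.inl ⟨hm, hF.map_left_of_neighbor S hm h.lt h.sub hne hgt hinf⟩
  · exact Or.inr ⟨ha, hF.fixed_of_neighbor S ha ordConnected_Icc h.sub (isGreatest_Icc h.lt.le)
      hne hgt hinf⟩

lemma MaxIcc.exists_ends (h : MaxIcc G γ I a b) (hI : ¬ FreeOn G γ I I) :
    ∃ g F O, Ends γ I a b g F O a ∧ g ∉ curveStabilizer G γ I := by
  obtain ⟨g, F, O, hF, hg⟩ := h.mirror.exists_starts S.mirror (by rwa [freeOn_mirror_iff])
  refine ⟨g, fun x => -F (-x), -O, by simpa using hF.mirror, ?_⟩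
  rwa [curveStabilizer_mirror] at hg

/-- The translate of a free interval that begins at a given point is unique. -/
lemma Starts.unique (h : Starts γ I a b g F O u) (h' : Starts γ I a b k F' O' u)
    (hI : ¬ FreeOn G γ I I) (hA : FreeOn G γ I (Icc a b)) (hab : a < b) :
    cls γ I g = cls γ I k ∧ O = O' ∧ EqOn F F' O := by
  obtain ⟨w, hw, hy⟩ := h.exists_Ioo hab
  obtain ⟨w', hw', hy'⟩ := h'.exists_Ioo hab
  obtain ⟨y, hy1, hy2⟩ := exists_between (lt_min hw hw')
  obtain ⟨s, hs, hsa, hsy⟩ := hy y ⟨hy1, hy2.trans_le (min_le_left _ _)⟩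
  obtain ⟨t, ht, hta, hty⟩ := hy' y ⟨hy1, hy2.trans_le (min_le_right _ _)⟩
  exact (h.1.eq_of_eq S hI hA ordConnected_Icc h'.1 hs ht (by rwa [interior_Icc])
    (by rwa [interior_Icc]) (hsy.trans hty.symm)).2

lemma Ends.unique (h : Ends γ I a b g F O u) (h' : Ends γ I a b k F' O' u)
    (hI : ¬ FreeOn G γ I I) (hA : FreeOn G γ I (Icc a b)) (hab : a < b) :
    cls γ I g = cls γ I k ∧ O = O' ∧ EqOn F F' O := by
  obtain ⟨h1, h2, h3⟩ := h.mirror.unique S.mirror h'.mirror (by rwa [freeOn_mirror_iff])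
    (by rw [← neg_Icc']; exact hA.mirror) (neg_lt_neg hab)
  refine ⟨cls_mirror.1 h1, neg_inj.1 h2, fun x hx => ?_⟩
  simpa using h3 (show -x ∈ -O by simpa using hx)

omit [T2Space M] in
/-- The inverse of a translation from `[a, b]` to its right neighbor leads to the left neighbor. -/
lemma Starts.inv (h : Starts γ I a b g F O b) (hm : StrictMonoOn F O) :
    ∃ F' O', Ends γ I a b g⁻¹ F' O' a ∧ StrictMonoOn F' O' := by
  obtain ⟨haO, hab⟩ := h.of_mono hm
  obtain ⟨F', hF', hinv, -, -⟩ := h.1.inv S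
  have hm' := strictMonoOn_inverse hm hinv
  refine ⟨F', _, ⟨hF', Or.inl ⟨hm', ⟨a, haO, hab⟩, ?_⟩⟩, hm'⟩
  rw [← hab, hinv a haO]

omit [T2Space M] in
lemma Ends.inv (h : Ends γ I a b g F O a) (hm : StrictMonoOn F O) :
    ∃ F' O', Starts γ I a b g⁻¹ F' O' b ∧ StrictMonoOn F' O' := by
  obtain ⟨F', O', h1, h2⟩ := (h.mirror).inv S.mirror (strictMonoOn_mirror hm)
  refine ⟨_, _, ?_, strictMonoOn_mirror h2⟩
  simpa using h1.mirror

/-- The translate of `[a, b]` that follows an increasing translate is obtained from the right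
neighbor of `[a, b]`. -/
lemma Ends.next_of_mono (h : Ends γ I a b g F O u) (hm : StrictMonoOn F O)
    (hk : Starts γ I a b k K P b) : ∃ E Q, Starts γ I a b (g * k) E Q u ∧
      (StrictMonoOn E Q ↔ StrictMonoOn K P) := by
  have hF := h.1
  obtain ⟨hbO, rfl⟩ := h.of_mono hm
  have hd := (hF.strictMonoOn_iff hbO).1 hm
  have key : ∀ c ∈ P, K c = b → ∃ E Q, IsComp γ I (g * k) E Q ∧ c ∈ Q ∧ E c = F b ∧
      (StrictMonoOn E Q ↔ StrictMonoOn K P) ∧ (StrictAntiOn E Q ↔ StrictAntiOn K P) := by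
    intro c hc hcb
    have hgK := hk.1.germ c hc
    have hgF : Germ γ I g F (K c) := by rw [hcb]; exact hF.germ b hbO
    obtain ⟨E, Q, hE, hcQ, hEF⟩ := S.exists_comp (hgF.comp hgK)
    have hder : deriv E c = deriv F b * deriv K c := by
      rw [hEF.deriv_eq]
      have := HasDerivAt.comp c hgF.analyticAt.differentiableAt.hasDerivAt
        hgK.analyticAt.differentiableAt.hasDerivAt
      rw [hcb] at this
      exact this.deriv
    refine ⟨E, Q, hE, hcQ, by rw [hEF.eq_of_nhds, hcb], ?_, ?_⟩
    · rw [hE.strictMonoOn_iff hcQ, hk.1.strictMonoOn_iff hc, hder, mul_pos_iff_of_pos_left hd]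
    · rw [hE.strictAntiOn_iff hcQ, hk.1.strictAntiOn_iff hc, hder]
      exact ⟨fun h => by nlinarith, fun h => mul_neg_of_pos_of_neg hd h⟩
  rcases hk.2 with ⟨h1, h2, h3⟩ | ⟨h1, h2, h3⟩
  · obtain ⟨E, Q, hE, hcQ, hEc, hiff, -⟩ := key a h2 h3
    exact ⟨E, Q, ⟨hE, Or.inl ⟨hiff.2 h1, hcQ, hEc⟩⟩, hiff⟩
  · obtain ⟨E, Q, hE, hcQ, hEc, hiff, hiff'⟩ := key b h2 h3
    exact ⟨E, Q, ⟨hE, Or.inr ⟨hiff'.2 h1, hcQ, hEc⟩⟩, hiff⟩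

/-- The translate of `[a, b]` that follows a decreasing translate is obtained from the left
neighbor of `[a, b]`. -/
lemma Ends.next_of_anti (h : Ends γ I a b g F O u) (hm : StrictAntiOn F O)
    (hl : Ends γ I a b l L P a) : ∃ E Q, Starts γ I a b (g * l) E Q u ∧
      (StrictMonoOn E Q ↔ StrictAntiOn L P) := by
  have hF := h.1
  obtain ⟨haO, rfl⟩ := h.of_anti hm
  have hd := (hF.strictAntiOn_iff haO).1 hm
  have key : ∀ c ∈ P, L c = a → ∃ E Q, IsComp γ I (g * l) E Q ∧ c ∈ Q ∧ E c = F a ∧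
      (StrictMonoOn E Q ↔ StrictAntiOn L P) ∧ (StrictAntiOn E Q ↔ StrictMonoOn L P) := by
    intro c hc hca
    have hgL := hl.1.germ c hc
    have hgF : Germ γ I g F (L c) := by rw [hca]; exact hF.germ a haO
    obtain ⟨E, Q, hE, hcQ, hEF⟩ := S.exists_comp (hgF.comp hgL)
    have hder : deriv E c = deriv F a * deriv L c := by
      rw [hEF.deriv_eq]
      have := HasDerivAt.comp c hgF.analyticAt.differentiableAt.hasDerivAt
        hgL.analyticAt.differentiableAt.hasDerivAt
      rw [hca] at this
      exact this.deriv
    refine ⟨E, Q, hE, hcQ, by rw [hEF.eq_of_nhds, hca], ?_, ?_⟩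
    · rw [hE.strictMonoOn_iff hcQ, hl.1.strictAntiOn_iff hc, hder]
      exact ⟨fun h => by nlinarith, fun h => mul_pos_of_neg_of_neg hd h⟩
    · rw [hE.strictAntiOn_iff hcQ, hl.1.strictMonoOn_iff hc, hder]
      exact ⟨fun h => by nlinarith, fun h => mul_neg_of_neg_of_pos hd h⟩
  rcases hl.2 with ⟨h1, h2, h3⟩ | ⟨h1, h2, h3⟩
  · obtain ⟨E, Q, hE, hcQ, hEc, hiff, hiff'⟩ := key b h2 h3
    exact ⟨E, Q, ⟨hE, Or.inr ⟨hiff'.2 h1, hcQ, hEc⟩⟩, hiff⟩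
  · obtain ⟨E, Q, hE, hcQ, hEc, hiff, -⟩ := key a h2 h3
    exact ⟨E, Q, ⟨hE, Or.inl ⟨hiff.2 h1, hcQ, hEc⟩⟩, hiff⟩

end Tile

/-! ### Related segments and transitions -/

section Related

variable {G : Type*} [Group G] {M : Type*} [MulAction G M] {γ : ℝ → M} {I : Set ℝ} {g : G}
  {F F' μ : ℝ → ℝ} {O O' A B D : Set ℝ} {s t x y z a b u v : ℝ}

/-- The part of `[a, b]` in an open interval that contains `a` but not `b`. -/
lemma exists_inter_Icc_eq_Ico (hO : IsOpen O) (hOc : O.OrdConnected) (ha : a ∈ O) (hb : b ∉ O)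
    (hab : a < b) : ∃ j, a < j ∧ j ≤ b ∧ O ∩ Icc a b = Ico a j := by
  have hne : (O ∩ Icc a b).Nonempty := ⟨a, ha, left_mem_Icc.2 hab.le⟩
  have hbd : BddAbove (O ∩ Icc a b) := ⟨b, fun x hx => hx.2.2⟩
  set j := sSup (O ∩ Icc a b)
  have hjb : j ≤ b := csSup_le hne fun x hx => hx.2.2
  have hgt : ∀ y ∈ O, a ≤ y → y ≤ b → y < j := by
    intro y hy hay hyb
    have hyb' : y < b := lt_of_le_of_ne hyb fun h => hb (h ▸ hy)
    obtain ⟨c, hyc, hcb, hsub⟩ := isOpen_exists_gt hO hy hyb'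
    exact hyc.trans_le (le_csSup hbd ⟨hsub (right_mem_Icc.2 hyc.le), hay.trans hyc.le, hcb.le⟩)
  refine ⟨j, hgt a ha le_rfl hab.le, hjb, Subset.antisymm ?_ ?_⟩
  · exact fun y hy => ⟨hy.2.1, hgt y hy.1 hy.2.1 hy.2.2⟩
  · intro y hy
    obtain ⟨z, hz, hyz⟩ := exists_lt_of_lt_csSup hne hy.2
    exact ⟨hOc.out ha hz.1 ⟨hy.1, hyz.le⟩, hy.1, hy.2.le.trans hjb⟩

/-- The part of `[a, b]` in an open interval that contains `b` but not `a`. -/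
lemma exists_inter_Icc_eq_Ioc (hO : IsOpen O) (hOc : O.OrdConnected) (hb : b ∈ O) (ha : a ∉ O)
    (hab : a < b) : ∃ j, a ≤ j ∧ j < b ∧ O ∩ Icc a b = Ioc j b := by
  have hne : (O ∩ Icc a b).Nonempty := ⟨b, hb, right_mem_Icc.2 hab.le⟩
  have hbd : BddBelow (O ∩ Icc a b) := ⟨a, fun x hx => hx.2.1⟩
  set j := sInf (O ∩ Icc a b)
  have hja : a ≤ j := le_csInf hne fun x hx => hx.2.1
  have hlt : ∀ y ∈ O, a ≤ y → y ≤ b → j < y := by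
    intro y hy hay hyb
    have hay' : a < y := lt_of_le_of_ne hay fun h => ha (h ▸ hy)
    obtain ⟨c, hac, hcy, hsub⟩ := isOpen_exists_lt hO hy hay'
    exact (csInf_le hbd ⟨hsub (left_mem_Icc.2 hcy.le), hac.le, hcy.le.trans hyb⟩).trans_lt hcy
  refine ⟨j, hja, hlt b hb hab.le le_rfl, Subset.antisymm ?_ ?_⟩
  · exact fun y hy => ⟨hlt y hy.1 hy.2.1 hy.2.2, hy.2.2⟩
  · intro y hy
    obtain ⟨z, hz, hyz⟩ := exists_lt_of_csInf_lt hne hy.1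
    exact ⟨hOc.out hz.1 hb ⟨hyz.le, hy.2⟩, hja.trans hy.1.le, hy.2⟩

variable [TopologicalSpace M] (S : Setting G γ I)
include S

lemma Setting.not_isGreatest_Ici (ht : t ∈ I ∩ Ici u) : ¬ IsGreatest (I ∩ Ici u) t := by
  intro h
  obtain ⟨w, hw, htw⟩ := S.exists_gt ht.1
  exact (h.2 ⟨hw, (show u ≤ t from ht.2).trans htw.le⟩).not_gt htw

lemma Setting.exists_lt (ht : t ∈ I) : ∃ u ∈ I, u < t := by
  obtain ⟨u, hu, h⟩ := S.mirror.exists_gt (t := -t) (by simpa using ht)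
  exact ⟨-u, hu, by linarith⟩

lemma Setting.not_isLeast_Iic (ht : t ∈ I ∩ Iic u) : ¬ IsLeast (I ∩ Iic u) t := by
  intro h
  obtain ⟨w, hw, htw⟩ := S.exists_lt ht.1
  exact (h.2 ⟨hw, htw.le.trans (show t ≤ u from ht.2)⟩).not_gt htw

/-- A transition restricts to an analytic diffeomorphism on each subinterval of its domain. -/
lemma IsComp.isAnalyticDiffeo (h : IsComp γ I g F O) (hB : IsInterval B) (hBO : B ⊆ O) :
    IsAnalyticDiffeo F B (F '' B) := by
  obtain ⟨F', hF', hinv, -, hinv'⟩ := h.inv S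
  have hop : ∀ {O : Set ℝ}, IsOpen O → O.OrdConnected → O.Nonempty → IsOpenInterval O :=
    fun h1 h2 h3 => ⟨⟨h2, by rwa [h1.interior_eq]⟩, h1⟩
  refine ⟨hB, ⟨h.ordConnected_image hB.1 hBO, ?_⟩, (h.injOn.mono hBO).bijOn_image, O, F '' O, F,
    F', hop h.isOpen h.ordConnected h.nonempty, hop hF'.isOpen hF'.ordConnected hF'.nonempty, hBO,
    image_mono hBO, fun x hx => (h.germ x hx).analyticAt, fun x hx => (hF'.germ x hx).analyticAt,
    mapsTo_image _ _, ?_, ⟨fun x hx => hinv x hx, fun x hx => hinv' x hx⟩, fun x _ => rfl⟩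
  · rw [h.interior_image hBO]
    exact hB.2.image F
  · rintro _ ⟨x, hx, rfl⟩
    rwa [hinv x hx]

/-- A relation between segments of the curve extends to a maximal continuation. -/
lemma Setting.exists_comp_of_relatedBy [T2Space M] (hB : B ⊆ I) (hD : D ⊆ I)
    (h : RelatedBy (fun t => g • γ t) γ B D μ) :
    ∃ F O, IsComp γ I g F O ∧ B ⊆ O ∧ EqOn F μ B ∧ F '' B = D := by
  obtain ⟨⟨hBi, hDi, hbij, Oσ, O', σ, σ', hOσ, -, hBO, -, hσ, -, -, -, -, hσμ⟩, hrel⟩ := h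
  obtain ⟨s, hs⟩ := hBi.2
  have hsB := interior_subset hs
  have hgs : Germ γ I g σ s := by
    refine S.germ_of_continuousAt (hB hsB) ?_ (hσ s (hBO hsB)).continuousAt ?_
    · rw [hσμ hsB]
      exact hD (hbij.mapsTo hsB)
    · filter_upwards [isOpen_interior.mem_nhds hs] with x hx
      rw [hσμ (interior_subset hx)]
      exact hrel x (interior_subset hx)
  obtain ⟨F, O, hF, hsO, hFσ⟩ := S.exists_comp hgs
  have hEq : EqOn F σ (O ∩ Oσ) := AnalyticOnNhd.eqOn_of_preconnected_of_eventuallyEq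
    (fun x hx => (hF.germ x hx.1).analyticAt) (fun x hx => hσ x hx.2)
    (hF.ordConnected.inter hOσ.1.1).isPreconnected ⟨hsO, hBO hsB⟩ hFσ
  have hBsub : B ⊆ O := by
    refine hBi.1.isPreconnected.subset_of_closure_inter_subset hF.isOpen ⟨s, hsB, hsO⟩ ?_
    rintro x ⟨hx, hxB⟩
    refine hF.closed x (hB hxB) (σ x) (hσμ hxB ▸ hD (hbij.mapsTo hxB)) ?_
    have hc : ContinuousWithinAt (fun x => (x, σ x)) (O ∩ Oσ) x :=
      (continuousAt_id.prodMk (hσ x (hBO hxB)).continuousAt).continuousWithinAt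
    have hx' : x ∈ closure (O ∩ Oσ) := mem_closure_iff_frequently.2
      ((mem_closure_iff_frequently.1 hx).and_eventually (hOσ.2.mem_nhds (hBO hxB)))
    refine closure_mono ?_ (hc.mem_closure_image hx')
    rintro _ ⟨y, hy, rfl⟩
    exact ⟨y, hy.1, by simp only [hEq hy]⟩
  have hFμ : EqOn F μ B := fun x hx => (hEq ⟨hBsub hx, hBO hx⟩).trans (hσμ hx)
  exact ⟨F, O, hF, hBsub, hFμ, by rw [hFμ.image_eq, hbij.image_eq]⟩

omit [TopologicalSpace M] S in
/-- If `F` carries the half-open part `B` of `[a, b]` onto a set closed in `I`, then `B` is all of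
the domain of `F` in `[a, b]`. -/
lemma IsComp.inter_eq_of_closed (h : IsComp γ I g F O) (hB : B ⊆ O) (hFB : F '' B = D)
    (hcl : ∀ t ∈ I, t ∈ closure D → t ∈ D)
    (hshape : B = Icc a b ∨ (∃ j, a < j ∧ j ≤ b ∧ B = Ico a j) ∨ ∃ j, a ≤ j ∧ j < b ∧ B = Ioc j b) :
    O ∩ Icc a b = B := by
  have hclB : ∀ x ∈ O, x ∈ closure B → x ∈ B := by
    intro x hx hxB
    have h1 := (h.germ x hx).continuousAt.continuousWithinAt.mem_closure_image hxB
    rw [hFB] at h1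
    obtain ⟨y, hy, hyx⟩ := hFB ▸ hcl _ (h.mapsTo hx) h1
    rwa [← h.injOn (hB hy) hx hyx]
  rcases hshape with rfl | ⟨j, haj, hjb, rfl⟩ | ⟨j, haj, hjb, rfl⟩
  · exact inter_eq_right.2 hB
  · apply Subset.antisymm
    · rintro x ⟨hx, hxa⟩
      refine ⟨hxa.1, ?_⟩
      by_contra hjx
      have hjO : j ∈ O := h.ordConnected.out (hB (left_mem_Ico.2 haj)) hx ⟨haj.le, not_lt.1 hjx⟩
      have := hclB j hjO (by rw [closure_Ico haj.ne]; exact right_mem_Icc.2 haj.le)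
      exact absurd this.2 (lt_irrefl _)
    · exact fun x hx => ⟨hB hx, hx.1, hx.2.le.trans hjb⟩
  · apply Subset.antisymm
    · rintro x ⟨hx, hxa⟩
      refine ⟨?_, hxa.2⟩
      by_contra hjx
      have hjO : j ∈ O := h.ordConnected.out hx (hB (right_mem_Ioc.2 hjb)) ⟨not_lt.1 hjx, hjb.le⟩
      have := hclB j hjO (by rw [closure_Ioc hjb.ne]; exact left_mem_Icc.2 hjb.le)
      exact absurd this.1 (lt_irrefl _)
    · exact fun x hx => ⟨hB hx, haj.trans hx.1.le, hx.2⟩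

/-- A positive relation between `[a, b]` and a set closed in `I` is the restriction of an
increasing transition to all of its domain in `[a, b]`. -/
lemma Setting.exists_comp_of_relatedPosWrt [T2Space M] (hab : Icc a b ⊆ I) (hD : D ⊆ I)
    (hcl : ∀ t ∈ I, t ∈ closure D → t ∈ D)
    (h : RelatedPosWrt (fun t => g • γ t) γ (Icc a b) D B μ) :
    ∃ F O, IsComp γ I g F O ∧ StrictMonoOn F O ∧ O ∩ Icc a b = B ∧ EqOn F μ B ∧
      F '' (O ∩ Icc a b) = D := by
  obtain ⟨hrel, a', b', hlt', hD', h⟩ := h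
  obtain ⟨rfl, rfl⟩ : a = a' ∧ b = b' := by
    have hne : (Icc a b).Nonempty := hD' ▸ nonempty_Icc.2 hlt'.le
    exact (Icc_eq_Icc_iff (nonempty_Icc.1 hne)).1 hD'
  have hshape : B = Icc a b ∨ (∃ j, a < j ∧ j ≤ b ∧ B = Ico a j) ∨
      ∃ j, a ≤ j ∧ j < b ∧ B = Ioc j b := by
    rcases h with ⟨_, _, -, h, -⟩ | ⟨_, j, -, h1, h2, h3, -⟩ | ⟨_, j, -, h1, h2, h3, -⟩
    · exact Or.inl h
    · exact Or.inr (Or.inl ⟨j, h1, h2, h3⟩)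
    · exact Or.inr (Or.inr ⟨j, h1, h2, h3⟩)
  have hBab : B ⊆ Icc a b := by
    rcases hshape with rfl | ⟨j, -, hj, rfl⟩ | ⟨j, hj, -, rfl⟩
    · exact subset_rfl
    · exact fun x hx => ⟨hx.1, hx.2.le.trans hj⟩
    · exact fun x hx => ⟨hj.trans hx.1.le, hx.2⟩
  obtain ⟨F, O, hF, hBO, hFμ, hFB⟩ := S.exists_comp_of_relatedBy (hBab.trans hab) hD hrel
  have hBeq := hF.inter_eq_of_closed hBO hFB hcl hshape
  refine ⟨F, O, hF, ?_, hBeq, hFμ, by rw [hBeq, hFB]⟩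
  refine hF.strictMonoOn_or_strictAntiOn.resolve_right fun hanti => ?_
  rcases h with ⟨c, d, rfl, rfl, hc⟩ | ⟨c, j, hc, h1, -, rfl, h4⟩ | ⟨c, j, hc, -, h2, rfl, h4⟩
  · have ha := left_mem_Icc.2 hlt'.le
    have hb := right_mem_Icc.2 hlt'.le
    have h1 := hanti (hBO ha) (hBO hb) hlt'
    rw [hFμ ha, hc] at h1
    exact h1.not_ge (hFB ▸ mem_image_of_mem F hb : F b ∈ Icc c d).1
  · have ha := left_mem_Ico.2 h1
    obtain ⟨m, hm1, hm2⟩ := exists_between h1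
    have hm : m ∈ Ico a j := ⟨hm1.le, hm2⟩
    have h1 := hanti (hBO ha) (hBO hm) hm1
    rw [hFμ ha, h4] at h1
    exact h1.not_ge (hc.1.2 (hFB ▸ mem_image_of_mem F hm))
  · have hb := right_mem_Ioc.2 h2
    obtain ⟨m, hm1, hm2⟩ := exists_between h2
    have hm : m ∈ Ioc j b := ⟨hm1, hm2.le⟩
    have h1 := hanti (hBO hm) (hBO hb) hm2
    rw [hFμ hb, h4] at h1
    exact h1.not_ge (hc.1.2 (hFB ▸ mem_image_of_mem F hm))

/-- A negative relation between `[a, b]` and a set closed in `I` is the restriction of a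
decreasing transition to all of its domain in `[a, b]`. -/
lemma Setting.exists_comp_of_relatedNegWrt [T2Space M] (hab : Icc a b ⊆ I) (hD : D ⊆ I)
    (hcl : ∀ t ∈ I, t ∈ closure D → t ∈ D)
    (h : RelatedNegWrt (fun t => g • γ t) γ (Icc a b) D B μ) :
    ∃ F O, IsComp γ I g F O ∧ StrictAntiOn F O ∧ O ∩ Icc a b = B ∧ EqOn F μ B ∧
      F '' (O ∩ Icc a b) = D := by
  obtain ⟨hrel, a', b', hlt', hD', h⟩ := h
  obtain ⟨rfl, rfl⟩ : a = a' ∧ b = b' := by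
    have hne : (Icc a b).Nonempty := hD' ▸ nonempty_Icc.2 hlt'.le
    exact (Icc_eq_Icc_iff (nonempty_Icc.1 hne)).1 hD'
  have hshape : B = Icc a b ∨ (∃ j, a < j ∧ j ≤ b ∧ B = Ico a j) ∨
      ∃ j, a ≤ j ∧ j < b ∧ B = Ioc j b := by
    rcases h with ⟨_, _, -, h, -⟩ | ⟨_, j, -, h1, h2, h3, -⟩ | ⟨_, j, -, h1, h2, h3, -⟩
    · exact Or.inl h
    · exact Or.inr (Or.inr ⟨j, h1, h2, h3⟩)
    · exact Or.inr (Or.inl ⟨j, h1, h2, h3⟩)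
  have hBab : B ⊆ Icc a b := by
    rcases hshape with rfl | ⟨j, -, hj, rfl⟩ | ⟨j, hj, -, rfl⟩
    · exact subset_rfl
    · exact fun x hx => ⟨hx.1, hx.2.le.trans hj⟩
    · exact fun x hx => ⟨hj.trans hx.1.le, hx.2⟩
  obtain ⟨F, O, hF, hBO, hFμ, hFB⟩ := S.exists_comp_of_relatedBy (hBab.trans hab) hD hrel
  have hBeq := hF.inter_eq_of_closed hBO hFB hcl hshape
  refine ⟨F, O, hF, ?_, hBeq, hFμ, by rw [hBeq, hFB]⟩
  refine hF.strictMonoOn_or_strictAntiOn.resolve_left fun hmono => ?_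
  rcases h with ⟨c, d, rfl, rfl, hc⟩ | ⟨c, j, hc, -, h2, rfl, h4⟩ | ⟨c, j, hc, h1, -, rfl, h4⟩
  · have ha := left_mem_Icc.2 hlt'.le
    have hb := right_mem_Icc.2 hlt'.le
    have h1 := hmono (hBO ha) (hBO hb) hlt'
    rw [hFμ ha, hc] at h1
    exact h1.not_ge (hFB ▸ mem_image_of_mem F hb : F b ∈ Icc c d).2
  · have hb := right_mem_Ioc.2 h2
    obtain ⟨m, hm1, hm2⟩ := exists_between h2
    have hm : m ∈ Ioc j b := ⟨hm1, hm2.le⟩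
    have h1 := hmono (hBO hm) (hBO hb) hm2
    rw [hFμ hb, h4] at h1
    exact h1.not_ge (hc.1.2 (hFB ▸ mem_image_of_mem F hm))
  · have ha := left_mem_Ico.2 h1
    obtain ⟨m, hm1, hm2⟩ := exists_between h1
    have hm : m ∈ Ico a j := ⟨hm1.le, hm2⟩
    have h1 := hmono (hBO ha) (hBO hm) hm1
    rw [hFμ ha, h4] at h1
    exact h1.not_ge (hc.1.2 (hFB ▸ mem_image_of_mem F hm))

omit [TopologicalSpace M] S in
lemma IsComp.isInterval_inter (h : IsComp γ I g F O) (hne : (O ∩ Ioo a b).Nonempty) :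
    IsInterval (O ∩ Icc a b) := by
  refine ⟨h.ordConnected.inter ordConnected_Icc, ?_⟩
  rw [interior_inter, h.isOpen.interior_eq, interior_Icc]
  exact hne

lemma IsComp.relatedBy (h : IsComp γ I g F O) (hne : (O ∩ Ioo a b).Nonempty) :
    RelatedBy (fun t => g • γ t) γ (O ∩ Icc a b) (F '' (O ∩ Icc a b)) F :=
  ⟨h.isAnalyticDiffeo S (h.isInterval_inter hne) inter_subset_left, fun _ ht => h.smul_eq ht.1⟩

omit [TopologicalSpace M] S in
lemma Starts.nonempty (h : Starts γ I a b g F O u) (hab : a < b) : (O ∩ Ioo a b).Nonempty := by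
  obtain ⟨w, hw, hy⟩ := h.exists_Ioo hab
  obtain ⟨y, hy1, hy2⟩ := exists_between hw
  obtain ⟨s, hs, hsa, -⟩ := hy y ⟨hy1, hy2⟩
  exact ⟨s, hs, hsa⟩

omit [TopologicalSpace M] S in
lemma Ends.nonempty (h : Ends γ I a b g F O u) (hab : a < b) : (O ∩ Ioo a b).Nonempty := by
  obtain ⟨s, hs, hsa⟩ := h.mirror.nonempty (neg_lt_neg hab)
  exact ⟨-s, hs, by linarith [hsa.2], by linarith [hsa.1]⟩

omit [TopologicalSpace M] S in
lemma neg_image_mirror (F : ℝ → ℝ) (O : Set ℝ) (a b : ℝ) :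
    (fun x => -F (-x)) '' (-O ∩ Icc (-b) (-a)) = -(F '' (O ∩ Icc a b)) := by
  rw [← neg_Icc']
  ext y
  constructor
  · rintro ⟨x, ⟨hx1, hx2⟩, rfl⟩
    exact ⟨-x, ⟨hx1, hx2⟩, by simp⟩
  · rintro ⟨x, ⟨hx1, hx2⟩, hxy⟩
    exact ⟨-x, ⟨by simpa using hx1, show - -x ∈ Icc a b by rwa [neg_neg]⟩, by simp [hxy]⟩

lemma Ends.image (h : Ends γ I a b g F O u) (hab : Icc a b ⊆ I)
    (hlt : a < b) :
    (∃ v ∈ I, Starts γ I a b g F O v ∧ v < u ∧ Icc a b ⊆ O ∧ F '' (O ∩ Icc a b) = Icc v u) ∨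
      F '' (O ∩ Icc a b) = I ∩ Iic u := by
  rcases h.mirror.image S.mirror.ordConnected (by rw [← neg_Icc']; exact neg_subset_neg.2 hab)
    (neg_lt_neg hlt) with ⟨v, hv, h1, h2, h3, h4⟩ | h4
  · left
    refine ⟨-v, hv, by simpa using h1.mirror, by linarith, ?_, ?_⟩
    · rwa [← neg_Icc', neg_subset_neg] at h3
    · rw [neg_image_mirror] at h4
      rw [← neg_neg (F '' _), h4, neg_Icc', neg_neg]
  · right
    rw [neg_image_mirror] at h4
    rw [← neg_neg (F '' _), h4]
    ext x
    simp only [Set.mem_neg, mem_inter_iff, neg_neg, mem_Ici, mem_Iic, neg_le_neg_iff]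

lemma Starts.relatedPosWrt (h : Starts γ I a b g F O u) (hab : Icc a b ⊆ I) (hlt : a < b)
    (hm : StrictMonoOn F O) :
    RelatedPosWrt (fun t => g • γ t) γ (Icc a b) (F '' (O ∩ Icc a b)) (O ∩ Icc a b) F := by
  obtain ⟨haO, hau⟩ := h.of_mono hm
  refine ⟨h.1.relatedBy S (h.nonempty hlt), a, b, hlt, rfl, ?_⟩
  rcases h.image S.ordConnected hab hlt with ⟨v, -, -, -, hsub, him⟩ | him
  · exact Or.inl ⟨u, v, him, inter_eq_right.2 hsub, hau⟩
  · refine Or.inr (Or.inl ?_)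
    have hbO : b ∉ O := fun hbO => S.not_isGreatest_Ici (t := F b)
      (him ▸ ⟨b, ⟨hbO, right_mem_Icc.2 hlt.le⟩, rfl⟩)
      (him ▸ Ends.isGreatest ⟨h.1, Or.inl ⟨hm, hbO, rfl⟩⟩ hlt)
    obtain ⟨j, hj1, hj2, hj⟩ := exists_inter_Icc_eq_Ico h.1.isOpen h.1.ordConnected haO hbO hlt
    refine ⟨u, j, ⟨h.isLeast hlt, ?_⟩, hj1, hj2, hj, hau⟩
    rw [him]
    exact fun x hx => S.not_isGreatest_Ici hx.1 hx

lemma Starts.relatedNegWrt (h : Starts γ I a b g F O u) (hab : Icc a b ⊆ I) (hlt : a < b)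
    (hm : StrictAntiOn F O) :
    RelatedNegWrt (fun t => g • γ t) γ (Icc a b) (F '' (O ∩ Icc a b)) (O ∩ Icc a b) F := by
  obtain ⟨hbO, hbu⟩ := h.of_anti hm
  refine ⟨h.1.relatedBy S (h.nonempty hlt), a, b, hlt, rfl, ?_⟩
  rcases h.image S.ordConnected hab hlt with ⟨v, -, he, -, hsub, him⟩ | him
  · exact Or.inl ⟨u, v, him, inter_eq_right.2 hsub, (he.of_anti hm).2⟩
  · refine Or.inr (Or.inl ?_)
    have haO : a ∉ O := fun haO => S.not_isGreatest_Ici (t := F a)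
      (him ▸ ⟨a, ⟨haO, left_mem_Icc.2 hlt.le⟩, rfl⟩)
      (him ▸ Ends.isGreatest ⟨h.1, Or.inr ⟨hm, haO, rfl⟩⟩ hlt)
    obtain ⟨j, hj1, hj2, hj⟩ := exists_inter_Icc_eq_Ioc h.1.isOpen h.1.ordConnected hbO haO hlt
    refine ⟨u, j, ⟨h.isLeast hlt, ?_⟩, hj1, hj2, hj, hbu⟩
    rw [him]
    exact fun x hx => S.not_isGreatest_Ici hx.1 hx

lemma Ends.relatedPosWrt (h : Ends γ I a b g F O u) (hab : Icc a b ⊆ I) (hlt : a < b)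
    (hm : StrictMonoOn F O) :
    RelatedPosWrt (fun t => g • γ t) γ (Icc a b) (F '' (O ∩ Icc a b)) (O ∩ Icc a b) F := by
  obtain ⟨hbO, hbu⟩ := h.of_mono hm
  refine ⟨h.1.relatedBy S (h.nonempty hlt), a, b, hlt, rfl, ?_⟩
  rcases h.image S hab hlt with ⟨v, -, hs, -, hsub, him⟩ | him
  · exact Or.inl ⟨v, u, him, inter_eq_right.2 hsub, (hs.of_mono hm).2⟩
  · refine Or.inr (Or.inr ?_)
    have haO : a ∉ O := fun haO => S.not_isLeast_Iic (t := F a)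
      (him ▸ ⟨a, ⟨haO, left_mem_Icc.2 hlt.le⟩, rfl⟩)
      (him ▸ Starts.isLeast ⟨h.1, Or.inl ⟨hm, haO, rfl⟩⟩ hlt)
    obtain ⟨j, hj1, hj2, hj⟩ := exists_inter_Icc_eq_Ioc h.1.isOpen h.1.ordConnected hbO haO hlt
    refine ⟨u, j, ⟨h.isGreatest hlt, ?_⟩, hj1, hj2, hj, hbu⟩
    rw [him]
    exact fun x hx => S.not_isLeast_Iic hx.1 hx

lemma Ends.relatedNegWrt (h : Ends γ I a b g F O u) (hab : Icc a b ⊆ I) (hlt : a < b)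
    (hm : StrictAntiOn F O) :
    RelatedNegWrt (fun t => g • γ t) γ (Icc a b) (F '' (O ∩ Icc a b)) (O ∩ Icc a b) F := by
  obtain ⟨haO, hau⟩ := h.of_anti hm
  refine ⟨h.1.relatedBy S (h.nonempty hlt), a, b, hlt, rfl, ?_⟩
  rcases h.image S hab hlt with ⟨v, -, hs, -, hsub, him⟩ | him
  · exact Or.inl ⟨v, u, him, inter_eq_right.2 hsub, hau⟩
  · refine Or.inr (Or.inr ?_)
    have hbO : b ∉ O := fun hbO => S.not_isLeast_Iic (t := F b)
      (him ▸ ⟨b, ⟨hbO, right_mem_Icc.2 hlt.le⟩, rfl⟩)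
      (him ▸ Starts.isLeast ⟨h.1, Or.inr ⟨hm, hbO, rfl⟩⟩ hlt)
    obtain ⟨j, hj1, hj2, hj⟩ := exists_inter_Icc_eq_Ico h.1.isOpen h.1.ordConnected haO hbO hlt
    refine ⟨u, j, ⟨h.isGreatest hlt, ?_⟩, hj1, hj2, hj, hau⟩
    rw [him]
    exact fun x hx => S.not_isLeast_Iic hx.1 hx

end Related

/-! ### Tilings by translates of a compact maximal interval -/

/-- The negative of the upper end of an index set, as a lower end. -/
def negTop (x : WithTop ℤ) : WithBot ℤ :=
  WithTop.recTopCoe (C := fun _ => WithBot ℤ) ⊥ (fun n => ((-n : ℤ) : WithBot ℤ)) x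

/-- The negative of the lower end of an index set, as an upper end. -/
def negBot (x : WithBot ℤ) : WithTop ℤ :=
  WithBot.recBotCoe (C := fun _ => WithTop ℤ) ⊤ (fun n => ((-n : ℤ) : WithTop ℤ)) x

lemma negTop_coe (n : ℤ) : negTop (n : WithTop ℤ) = ((-n : ℤ) : WithBot ℤ) := rfl

lemma negBot_coe (n : ℤ) : negBot (n : WithBot ℤ) = ((-n : ℤ) : WithTop ℤ) := rfl

lemma negTop_negBot (x : WithBot ℤ) : negTop (negBot x) = x := by
  induction x using WithBot.recBotCoe with
  | bot => rfl
  | coe n => rw [negBot_coe, negTop_coe, neg_neg]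

lemma negBot_negTop (x : WithTop ℤ) : negBot (negTop x) = x := by
  induction x using WithTop.recTopCoe with
  | top => rfl
  | coe n => rw [negTop_coe, negBot_coe, neg_neg]

lemma negTop_le {x : WithTop ℤ} {n : ℤ} : negTop x ≤ (n : WithBot ℤ) ↔ ((-n : ℤ) : WithTop ℤ) ≤ x := by
  induction x using WithTop.recTopCoe with
  | top => simp [negTop]
  | coe m => rw [negTop_coe, WithBot.coe_le_coe, WithTop.coe_le_coe]; omega

lemma negTop_lt {x : WithTop ℤ} {n : ℤ} : negTop x < (n : WithBot ℤ) ↔ ((-n : ℤ) : WithTop ℤ) < x := by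
  induction x using WithTop.recTopCoe with
  | top => exact iff_of_true (WithBot.bot_lt_coe n) (WithTop.coe_lt_top _)
  | coe m => rw [negTop_coe, WithBot.coe_lt_coe, WithTop.coe_lt_coe]; omega

lemma le_negBot {x : WithBot ℤ} {n : ℤ} : (n : WithTop ℤ) ≤ negBot x ↔ x ≤ ((-n : ℤ) : WithBot ℤ) := by
  rw [← negTop_negBot x, negTop_le, negBot_negTop, neg_neg]

lemma lt_negBot {x : WithBot ℤ} {n : ℤ} : (n : WithTop ℤ) < negBot x ↔ x < ((-n : ℤ) : WithBot ℤ) := by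
  rw [← negTop_negBot x, negTop_lt, negBot_negTop, neg_neg]

lemma negBot_eq {x : WithBot ℤ} {n : ℤ} : negBot x = (n : WithTop ℤ) ↔ x = ((-n : ℤ) : WithBot ℤ) := by
  constructor
  · intro h
    rw [← negTop_negBot x, h, negTop_coe]
  · rintro rfl
    rw [negBot_coe, neg_neg]

lemma negTop_eq {x : WithTop ℤ} {n : ℤ} : negTop x = (n : WithBot ℤ) ↔ x = ((-n : ℤ) : WithTop ℤ) := by
  constructor
  · intro h
    rw [← negBot_negTop x, h, negBot_coe]
  · rintro rfl
    rw [negTop_coe, neg_neg]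

namespace Splitting

variable {G : Type*} {d : Splitting G} {I : Set ℝ} {n : ℤ}

/-- The family of splitting points and group elements for the reversed curve. -/
def mirror (d : Splitting G) : Splitting G where
  lo := negTop d.hi
  hi := negBot d.lo
  pt n := -d.pt (-n)
  elt n := d.elt (-n)

lemma mem_index_mirror : n ∈ d.mirror.index ↔ -n ∈ d.index := by
  simp only [index, mirror, mem_ofPred_eq, negTop_le, le_negBot, ne_eq, neg_eq_zero]
  tauto

lemma mem_index₀_mirror : n ∈ d.mirror.index₀ ↔ -n ∈ d.index₀ := by
  simp only [index₀, mem_insert_iff, mem_index_mirror, neg_eq_zero]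

lemma IsDecompositionOf.mirror (h : d.IsDecompositionOf I) : d.mirror.IsDecompositionOf (-I) := by
  obtain ⟨h1, h2, h3, h4⟩ := h
  refine ⟨?_, ?_, fun n hn => ?_, fun m hm n hn hmn => ?_⟩
  · exact negTop_lt.2 (by simpa using h2)
  · exact lt_negBot.2 (by simpa using h1)
  · simpa [Splitting.mirror] using h3 _ (mem_index_mirror.1 hn)
  · exact neg_lt_neg (h4 (mem_index_mirror.1 hn) (mem_index_mirror.1 hm) (by omega))

lemma piece_mirror (d : Splitting G) (I : Set ℝ) (n : ℤ) :
    d.mirror.piece (-I) n = -d.piece I (-n) := by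
  have e1 : ∀ c : ℝ, -I ∩ Iic (-c) = -(I ∩ Ici c) := fun c => by ext; simp
  have e2 : ∀ c : ℝ, -I ∩ Ici (-c) = -(I ∩ Iic c) := fun c => by ext; simp
  rcases lt_trichotomy n 0 with hn | rfl | hn
  · simp only [piece, hn, hn.ne, if_true, if_false, neg_eq_zero, not_lt.2 (neg_nonneg.2 hn.le),
      Splitting.mirror, negTop_eq]
    split_ifs
    · exact e1 _
    · rw [neg_Icc', show -(n - 1) = -n + 1 by ring]
  · simp [piece, Splitting.mirror]
  · simp only [piece, hn, hn.ne', if_true, if_false, neg_eq_zero, not_lt.2 hn.le,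
      Splitting.mirror, negBot_eq, neg_lt_zero]
    split_ifs
    · exact e2 _
    · rw [neg_Icc', neg_add']

lemma elt₀_mirror (d : Splitting G) [Group G] (n : ℤ) : d.mirror.elt₀ n = d.elt₀ (-n) := by
  simp [elt₀, Splitting.mirror]

lemma step_mirror (d : Splitting G) [Group G] (hn : n ≠ 0) : d.mirror.step n = d.step (-n) := by
  rcases lt_or_gt_of_ne hn with h | h
  · simp only [step, h, if_true, elt₀_mirror, neg_lt_zero, not_lt.2 h.le, if_false]
    congr 3
    ring
  · simp only [step, h, if_true, elt₀_mirror, neg_lt_zero, not_lt.2 h.le, if_false]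
    congr 3
    ring

lemma altSign_neg (hn : n ≠ 0) : altSign (-n) = - altSign n := by
  rcases lt_or_gt_of_ne hn with h | h
  · obtain ⟨m, rfl⟩ : ∃ m : ℕ, n = -(m + 1) := ⟨(-n - 1).toNat, by omega⟩
    have h1 : (- -((m : ℤ) + 1) - 1).natAbs = m := by omega
    have h2 : (-((m : ℤ) + 1)).natAbs = m + 1 := by omega
    rw [altSign, altSign, if_pos (by omega), if_neg (by omega), h1, h2, pow_succ]
    ring
  · obtain ⟨m, rfl⟩ : ∃ m : ℕ, n = m + 1 := ⟨(n - 1).toNat, by omega⟩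
    have h1 : ((m : ℤ) + 1 - 1).natAbs = m := by omega
    have h2 : (-((m : ℤ) + 1)).natAbs = m + 1 := by omega
    rw [altSign, altSign, if_neg (by omega), if_pos (by omega), h1, h2, pow_succ]
    ring

lemma altProd_mirror (d : Splitting G) [Group G] (hn : n ≠ 0) :
    d.mirror.altProd n = d.altProd (-n) := by
  simp only [altProd, Int.natAbs_neg]
  congr 1
  refine List.map_congr_left fun k _ => ?_
  have h : n.sign * ((k : ℤ) + 1) ≠ 0 := mul_ne_zero (by simpa using hn) (by omega)
  rw [Int.sign_neg, neg_mul, altSign_neg h]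
  rfl

end Splitting

/-- The family `d` splits `I` into `[a, b]` and translates of it, the outer ones possibly
truncated. -/
structure Tiles {G : Type*} [Group G] {M : Type*} [MulAction G M] (γ : ℝ → M) (I : Set ℝ)
    (a b : ℝ) (d : Splitting G) : Prop where
  dec : d.IsDecompositionOf I
  left : d.pt (-1) = a
  right : d.pt 1 = b
  tile : ∀ n ∈ d.index, ∃ F O, IsComp γ I (d.elt n) F O ∧ F '' (O ∩ Icc a b) = d.piece I n

section Tiles

variable {G : Type*} [Group G] {M : Type*} [MulAction G M] {γ : ℝ → M} {I : Set ℝ} {k l : G}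
  {F F' K L : ℝ → ℝ} {O O' A P Q : Set ℝ} {t x a b v : ℝ} {d d' : Splitting G} {n m : ℤ}

lemma Tiles.mirror (h : Tiles γ I a b d) :
    Tiles (fun t => γ (-t)) (-I) (-b) (-a) d.mirror := by
  refine ⟨h.dec.mirror, by simp [Splitting.mirror, h.right], by simp [Splitting.mirror, h.left],
    fun n hn => ?_⟩
  obtain ⟨F, O, hF, him⟩ := h.tile _ (Splitting.mem_index_mirror.1 hn)
  exact ⟨_, _, hF.mirror, by rw [neg_image_mirror, him, Splitting.piece_mirror]⟩

omit [Group G] in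
lemma Splitting.IsDecompositionOf.mem_index (h : d.IsDecompositionOf I) (hn : 0 < n) :
    n ∈ d.index ↔ (n : WithTop ℤ) ≤ d.hi := by
  refine ⟨fun h => h.2.2, fun hn' => ⟨hn.ne', h.1.le.trans ?_, hn'⟩⟩
  exact_mod_cast hn.le

omit [Group G] in
lemma Splitting.IsDecompositionOf.one_mem (h : d.IsDecompositionOf I) : 1 ∈ d.index := by
  rw [h.mem_index one_pos]
  obtain ⟨-, h2, -⟩ := h
  revert h2
  induction d.hi using WithTop.recTopCoe with
  | top => simp
  | coe n =>
    intro h2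
    have : 0 < n := by exact_mod_cast h2
    exact_mod_cast this

omit [Group G] in
lemma Splitting.IsDecompositionOf.neg_one_mem (h : d.IsDecompositionOf I) : -1 ∈ d.index :=
  Splitting.mem_index_mirror.1 h.mirror.one_mem

lemma coe_add_one_le {x : WithTop ℤ} : ((n + 1 : ℤ) : WithTop ℤ) ≤ x ↔ (n : WithTop ℤ) < x := by
  induction x using WithTop.recTopCoe with
  | top => simp [WithTop.coe_lt_top]
  | coe m => rw [WithTop.coe_le_coe, WithTop.coe_lt_coe, Int.add_one_le_iff]

omit [Group G] in
lemma Splitting.IsDecompositionOf.succ_mem (h : d.IsDecompositionOf I) (hn : 0 < n)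
    (hlt : (n : WithTop ℤ) < d.hi) : n + 1 ∈ d.index :=
  (h.mem_index (by omega)).2 (coe_add_one_le.2 hlt)

omit [Group G] in
lemma Splitting.piece_of_lt (hn : 0 < n) (hlt : (n : WithTop ℤ) < d.hi) :
    d.piece I n = Icc (d.pt n) (d.pt (n + 1)) := by
  rw [Splitting.piece, if_neg hn.ne', if_neg (not_lt.2 hn.le), if_neg hlt.ne']

omit [Group G] in
lemma Splitting.piece_of_eq (hn : 0 < n) (heq : d.hi = n) :
    d.piece I n = I ∩ Ici (d.pt n) := by
  rw [Splitting.piece, if_neg hn.ne', if_neg (not_lt.2 hn.le), if_pos heq]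

omit [Group G] in
lemma Splitting.IsDecompositionOf.isLeast_piece (h : d.IsDecompositionOf I) (hn : 0 < n)
    (hnd : n ∈ d.index) : IsLeast (d.piece I n) (d.pt n) := by
  rcases hnd.2.2.lt_or_eq with hlt | heq
  · rw [piece_of_lt hn hlt]
    exact isLeast_Icc (h.2.2.2 hnd (h.succ_mem hn hlt) (by omega)).le
  · rw [piece_of_eq hn heq.symm]
    exact ⟨⟨h.2.2.1 n hnd, self_mem_Ici⟩, fun x hx => hx.2⟩

lemma Tiles.piece_zero (h : Tiles γ I a b d) : d.piece I 0 = Icc a b := by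
  rw [Splitting.piece, if_pos rfl, h.left, h.right]

lemma Tiles.lt (h : Tiles γ I a b d) : a < b := by
  rw [← h.left, ← h.right]
  exact h.dec.2.2.2 h.dec.neg_one_mem h.dec.one_mem (by norm_num)

/-- The tiles to the right of `[a, b]`. -/
lemma Tiles.starts (h : Tiles γ I a b d) (hn : 0 < n) (hnd : n ∈ d.index) :
    ∃ F O, Starts γ I a b (d.elt n) F O (d.pt n) ∧ F '' (O ∩ Icc a b) = d.piece I n := by
  obtain ⟨F, O, hF, him⟩ := h.tile n hnd
  exact ⟨F, O, hF.starts_of_isLeast h.lt (him ▸ h.dec.isLeast_piece hn hnd), him⟩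

variable [TopologicalSpace M]

lemma Tiles.sub (S : Setting G γ I) (h : Tiles γ I a b d) : Icc a b ⊆ I := by
  have h1 := h.dec.2.2.1 _ h.dec.neg_one_mem
  have h2 := h.dec.2.2.1 _ h.dec.one_mem
  rw [h.left] at h1
  rw [h.right] at h2
  exact S.mem_Icc_subset h1 h2

/-- A tile that is not the last one is a full translate of `[a, b]`. -/
lemma Tiles.ends_of_lt (S : Setting G γ I) (h : Tiles γ I a b d) (hn : 0 < n)
    (hlt : (n : WithTop ℤ) < d.hi) (hF : Starts γ I a b (d.elt n) F O (d.pt n))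
    (him : F '' (O ∩ Icc a b) = d.piece I n) :
    Ends γ I a b (d.elt n) F O (d.pt (n + 1)) ∧ Icc a b ⊆ O := by
  have hnd := (h.dec.mem_index hn).2 hlt.le
  have hle := (h.dec.2.2.2 hnd (h.dec.succ_mem hn hlt) (by omega)).le
  rw [Splitting.piece_of_lt hn hlt] at him
  rcases hF.image S.ordConnected (h.sub S) h.lt with ⟨v, -, h1, -, h2, h3⟩ | h1
  · have : v = d.pt (n + 1) := by
      have h4 := h1.isGreatest h.lt
      rw [him] at h4
      exact h4.unique (isGreatest_Icc hle)
    exact ⟨this ▸ h1, h2⟩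
  · have h2 : d.pt (n + 1) ∈ I ∩ Ici (d.pt n) := by
      rw [← h1, him]; exact right_mem_Icc.2 hle
    refine (S.not_isGreatest_Ici h2 ?_).elim
    rw [← h1, him]
    exact isGreatest_Icc hle

/-- The tile that follows an increasing translate is obtained from the right neighbor, the tile
that follows a decreasing translate from the left neighbor of `[a, b]`. -/
lemma Tiles.next [T2Space M] (S : Setting G γ I) (hI : ¬ FreeOn G γ I I) (h : Tiles γ I a b d)
    (hA : FreeOn G γ I (Icc a b)) (hn : 0 < n)
    (hlt : (n : WithTop ℤ) < d.hi) (hF : Starts γ I a b (d.elt n) F O (d.pt n))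
    (him : F '' (O ∩ Icc a b) = d.piece I n)
    (hF' : Starts γ I a b (d.elt (n + 1)) F' O' (d.pt (n + 1)))
    (hK : Starts γ I a b k K P b) (hL : Ends γ I a b l L Q a) :
    (StrictMonoOn F O → cls γ I (d.elt (n + 1)) = cls γ I (d.elt n * k) ∧
      (StrictMonoOn F' O' ↔ StrictMonoOn K P)) ∧
    (StrictAntiOn F O → cls γ I (d.elt (n + 1)) = cls γ I (d.elt n * l) ∧
      (StrictMonoOn F' O' ↔ StrictAntiOn L Q)) := by
  obtain ⟨hE, -⟩ := h.ends_of_lt S hn hlt hF him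
  constructor
  · intro hm
    obtain ⟨E, U, hEs, hiff⟩ := hE.next_of_mono S hm hK
    obtain ⟨h1, h2, h3⟩ := hF'.unique S hEs hI hA h.lt
    rw [← hiff, ← h2, h3.congr_strictMonoOn]
    exact ⟨h1, Iff.rfl⟩
  · intro hm
    obtain ⟨E, U, hEs, hiff⟩ := hE.next_of_anti S hm hL
    obtain ⟨h1, h2, h3⟩ := hF'.unique S hEs hI hA h.lt
    rw [← hiff, ← h2, h3.congr_strictMonoOn]
    exact ⟨h1, Iff.rfl⟩

/-- Tiles are translates beginning at a given point, hence each tile determines the next one. -/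
lemma Tiles.unique_right [T2Space M] (S : Setting G γ I) (hI : ¬ FreeOn G γ I I)
    (hA : FreeOn G γ I (Icc a b)) (h : Tiles γ I a b d) (h' : Tiles γ I a b d') (hn : 0 < n)
    (hnd : (n : WithTop ℤ) ≤ d.hi) :
    (n : WithTop ℤ) ≤ d'.hi ∧ d'.pt n = d.pt n ∧ cls γ I (d'.elt n) = cls γ I (d.elt n) := by
  have key : ∀ n : ℤ, 0 < n → (n : WithTop ℤ) ≤ d.hi → (n : WithTop ℤ) ≤ d'.hi →
      d'.pt n = d.pt n → cls γ I (d'.elt n) = cls γ I (d.elt n) ∧ d'.piece I n = d.piece I n := by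
    intro n hn hd hd' hpt
    obtain ⟨F, O, hF, him⟩ := h.starts hn ((h.dec.mem_index hn).2 hd)
    obtain ⟨F', O', hF', him'⟩ := h'.starts hn ((h'.dec.mem_index hn).2 hd')
    rw [hpt] at hF'
    obtain ⟨h1, rfl, h3⟩ := hF'.unique S hF hI hA h.lt
    exact ⟨h1, by rw [← him, ← him', (h3.mono inter_subset_left).image_eq]⟩
  revert hnd
  refine Int.leInduction (motive := fun n _ => (n : WithTop ℤ) ≤ d.hi → (n : WithTop ℤ) ≤ d'.hi ∧
    d'.pt n = d.pt n ∧ cls γ I (d'.elt n) = cls γ I (d.elt n)) ?_ ?_ n (show (1 : ℤ) ≤ n by omega)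
  · intro hnd
    have h1 := (h'.dec.mem_index one_pos).1 h'.dec.one_mem
    have h2 : d'.pt 1 = d.pt 1 := by rw [h.right, h'.right]
    exact ⟨h1, h2, (key 1 one_pos hnd h1 h2).1⟩
  · intro n hn ih hnd
    have hn' : 0 < n := by omega
    have hlt := coe_add_one_le.1 hnd
    obtain ⟨h1, h2, -⟩ := ih hlt.le
    have h4 := (key n hn' hlt.le h1 h2).2
    have hle := (h.dec.2.2.2 ((h.dec.mem_index hn').2 hlt.le) (h.dec.succ_mem hn' hlt)
      (by omega)).le
    rw [Splitting.piece_of_lt hn' hlt] at h4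
    have hlt' : (n : WithTop ℤ) < d'.hi := by
      -- the piece of `d` is compact, whereas the last piece of `d'` has no greatest element
      refine lt_of_le_of_ne h1 fun heq => ?_
      rw [Splitting.piece_of_eq hn' heq.symm] at h4
      have h5 : d.pt (n + 1) ∈ I ∩ Ici (d'.pt n) := by rw [h4]; exact right_mem_Icc.2 hle
      refine S.not_isGreatest_Ici h5 ?_
      rw [h4]
      exact isGreatest_Icc hle
    have hle' := (h'.dec.2.2.2 ((h'.dec.mem_index hn').2 hlt'.le) (h'.dec.succ_mem hn' hlt')
      (by omega)).le
    rw [Splitting.piece_of_lt hn' hlt'] at h4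
    have h5 : d'.pt (n + 1) = d.pt (n + 1) :=
      (h4 ▸ isGreatest_Icc hle').unique (isGreatest_Icc hle)
    have h6 := coe_add_one_le.2 hlt'
    exact ⟨h6, h5, (key (n + 1) (by omega) hnd h6 h5).1⟩

/-- A compact maximal interval has at most one tiling by its translates. -/
lemma Tiles.unique [T2Space M] (S : Setting G γ I) (hI : ¬ FreeOn G γ I I)
    (hA : FreeOn G γ I (Icc a b)) (h : Tiles γ I a b d) (h' : Tiles γ I a b d') :
    SameDecomposition γ I d d' := by
  have hhi : ∀ {γ : ℝ → M} {I : Set ℝ} {a b : ℝ} {d d' : Splitting G}, Setting G γ I →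
      ¬ FreeOn G γ I I → FreeOn G γ I (Icc a b) → Tiles γ I a b d → Tiles γ I a b d' →
      d'.hi = d.hi := by
    intro γ I a b d d' S hI hA h h'
    refine WithTop.eq_of_forall_coe_le_iff fun n => ?_
    rcases le_or_gt n 0 with hn | hn
    · have hn' : (n : WithTop ℤ) ≤ 0 := by exact_mod_cast hn
      exact iff_of_true (hn'.trans h'.dec.2.1.le) (hn'.trans h.dec.2.1.le)
    · exact ⟨fun h1 => (h'.unique_right S hI hA h hn h1).1,
        fun h1 => (h.unique_right S hI hA h' hn h1).1⟩
  have hIm : ¬ FreeOn G (fun t => γ (-t)) (-I) (-I) := by rwa [freeOn_mirror_iff]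
  have hAm : FreeOn G (fun t => γ (-t)) (-I) (Icc (-b) (-a)) := by
    rw [← neg_Icc']; exact hA.mirror
  refine ⟨?_, hhi S hI hA h h', fun n hn => ?_⟩
  · have := hhi S.mirror hIm hAm h.mirror h'.mirror
    rw [← negTop_negBot d'.lo, ← negTop_negBot d.lo]
    exact congrArg negTop this
  · rcases lt_or_gt_of_ne hn.1 with h0 | h0
    · obtain ⟨-, h1, h2⟩ := h.mirror.unique_right S.mirror hIm hAm h'.mirror (n := -n) (by omega)
        (le_negBot.2 (by simpa using hn.2.1))
      simp only [Splitting.mirror, neg_neg, neg_inj] at h1 h2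
      exact ⟨h1, cls_mirror.1 h2⟩
    · exact (h.unique_right S hI hA h' h0 hn.2.2).2

end Tiles

/-! ### Covering and existence of tilings -/

section TilesExist

variable {G : Type*} [Group G] {M : Type*} [MulAction G M] {γ : ℝ → M} {I : Set ℝ} {k l : G}
  {F K L : ℝ → ℝ} {O A P Q : Set ℝ} {s t x p a b v : ℝ} {d d' : Splitting G} {n m : ℤ}

/-- The splitting points accumulate at no point of `I`, since translates of `[a, b]` do not shrink
to a point: the tiles to the right of `[a, b]` cover the rest of `I`. -/
lemma Tiles.cover_right [TopologicalSpace M] (S : Setting G γ I) (h : Tiles γ I a b d) (ht : t ∈ I)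
    (hbt : b ≤ t) : ∃ n > 0, n ∈ d.index ∧ t ∈ d.piece I n := by
  by_contra! hno
  have hle : ∀ n : ℤ, 0 < n → (n : WithTop ℤ) ≤ d.hi → d.pt n ≤ t := by
    intro n hn
    refine Int.leInduction (motive := fun n _ => (n : WithTop ℤ) ≤ d.hi → d.pt n ≤ t) ?_ ?_ n
      (show (1 : ℤ) ≤ n by omega)
    · intro _
      rwa [h.right]
    · intro n hn ih hnd
      have hlt := coe_add_one_le.1 hnd
      have hn' : 0 < n := by omega
      by_contra hcon
      refine hno n hn' ((h.dec.mem_index hn').2 hlt.le) ?_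
      rw [Splitting.piece_of_lt hn' hlt]
      exact ⟨ih hlt.le, (not_le.1 hcon).le⟩
  induction hhi : d.hi using WithTop.recTopCoe with
  | coe N =>
    have hN : 0 < N := by
      have := h.dec.2.1
      rw [hhi] at this
      exact_mod_cast this
    refine hno N hN ((h.dec.mem_index hN).2 hhi.ge) ?_
    rw [Splitting.piece_of_eq hN hhi]
    exact ⟨ht, hle N hN hhi.ge⟩
  | top =>
    have hlt : ∀ n : ℤ, (n : WithTop ℤ) < d.hi := fun n => hhi ▸ WithTop.coe_lt_top n
    have hidx : ∀ n : ℤ, 0 < n → n ∈ d.index := fun n hn => (h.dec.mem_index hn).2 (hlt n).le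
    set q : ℕ → ℝ := fun k => d.pt (k + 1) with hq
    have hmono : Monotone q := monotone_nat_of_le_succ fun k =>
      (h.dec.2.2.2 (hidx _ (by omega)) (hidx _ (by omega)) (by push_cast; omega)).le
    have hbdd : BddAbove (range q) := ⟨t, by
      rintro _ ⟨k, rfl⟩
      exact hle _ (by omega) (hlt _).le⟩
    have htend := tendsto_atTop_ciSup hmono hbdd
    -- infinitely many full translates of `[a, b]` would converge to the limit `c` of the splitting
    -- points
    set c := ⨆ k, q k
    have hqc : ∀ k, q k ≤ c := le_ciSup hbdd
    have hbc : b ≤ c := by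
      have := hqc 0
      simpa [hq, h.right] using this
    have hct : c ≤ t := ciSup_le fun k => hle _ (by omega) (hlt _).le
    have hcI : c ∈ I := S.mem_Icc_subset (h.sub S (right_mem_Icc.2 h.lt.le)) ht ⟨hbc, hct⟩
    obtain ⟨ε, hε, hns⟩ := S.not_shrink hcI h.lt (h.sub S)
    obtain ⟨k, hk⟩ := (htend.eventually (lt_mem_nhds (show c - ε < c by linarith))).exists
    have hk1 : (0 : ℤ) < k + 1 := by omega
    obtain ⟨F, O, hF, him⟩ := h.starts hk1 (hidx _ hk1)
    obtain ⟨-, hsub⟩ := h.ends_of_lt S hk1 (hlt _) hF him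
    refine hns (d.elt (k + 1)) fun s hs => ?_
    have h1 : F s ∈ d.piece I (k + 1) := him ▸ ⟨s, ⟨hsub hs, hs⟩, rfl⟩
    rw [Splitting.piece_of_lt hk1 (hlt _)] at h1
    have h2 : F s ≤ c := h1.2.trans (by simpa [hq] using hqc (k + 1))
    have h3 : c - ε < F s := hk.trans_le h1.1
    exact ⟨F s, hF.1.mapsTo (hsub hs), abs_lt.2 ⟨by linarith, by linarith⟩,
      hF.1.smul_eq (hsub hs)⟩

lemma Tiles.cover [TopologicalSpace M] (S : Setting G γ I) (h : Tiles γ I a b d) (ht : t ∈ I) :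
    ∃ n ∈ d.index₀, t ∈ d.piece I n := by
  rcases le_total b t with hbt | hbt
  · obtain ⟨n, -, hn, htn⟩ := h.cover_right S ht hbt
    exact ⟨n, Or.inr hn, htn⟩
  rcases le_total t a with hta | hta
  · obtain ⟨n, -, hn, htn⟩ := h.mirror.cover_right S.mirror (t := -t) (by simpa using ht)
      (neg_le_neg hta)
    rw [Splitting.piece_mirror] at htn
    exact ⟨-n, Or.inr (Splitting.mem_index_mirror.1 hn), by simpa using htn⟩
  · exact ⟨0, Or.inl rfl, by rw [h.piece_zero]; exact ⟨hta, hbt⟩⟩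

/-- The part to the right of `[a, b]` of a tiling. -/
structure RightTiles (γ : ℝ → M) (I : Set ℝ) (a b : ℝ) (d : Splitting G) : Prop where
  pos : 0 < d.hi
  right : d.pt 1 = b
  tile : ∀ n : ℤ, 0 < n → (n : WithTop ℤ) ≤ d.hi → d.pt n ∈ I ∧
    ((n : WithTop ℤ) < d.hi → d.pt n < d.pt (n + 1)) ∧
    ∃ F O, IsComp γ I (d.elt n) F O ∧ F '' (O ∩ Icc a b) = d.piece I n

lemma RightTiles.congr (h : RightTiles γ I a b d) (hhi : d'.hi = d.hi)
    (hpt : ∀ n > 0, d'.pt n = d.pt n) (helt : ∀ n > 0, d'.elt n = d.elt n) :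
    RightTiles γ I a b d' := by
  refine ⟨hhi ▸ h.pos, by rw [hpt 1 one_pos, h.right], fun n hn hnd => ?_⟩
  rw [hhi] at hnd
  have hp : d'.piece I n = d.piece I n := by
    rcases hnd.lt_or_eq with hlt | heq
    · rw [Splitting.piece_of_lt hn hlt, Splitting.piece_of_lt hn (hhi.symm ▸ hlt), hpt n hn,
        hpt (n + 1) (by omega)]
    · rw [Splitting.piece_of_eq hn heq.symm, Splitting.piece_of_eq hn (hhi.trans heq.symm),
        hpt n hn]
  rw [hhi, hpt n hn, hpt (n + 1) (by omega), hp, helt n hn]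
  exact h.tile n hn hnd

lemma RightTiles.lt (h : RightTiles γ I a b d) (hn : 0 < n) (hnm : n < m)
    (hm : (m : WithTop ℤ) ≤ d.hi) : d.pt n < d.pt m := by
  revert hm
  refine Int.leInduction (motive := fun m _ => (m : WithTop ℤ) ≤ d.hi → d.pt n < d.pt m) ?_ ?_ m
    (show n + 1 ≤ m by omega)
  · intro hm
    have hlt := coe_add_one_le.1 hm
    exact (h.tile n hn hlt.le).2.1 hlt
  · intro m hm' ih hm
    have hlt := coe_add_one_le.1 hm
    exact (ih hlt.le).trans ((h.tile m (by omega) hlt.le).2.1 hlt)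

/-- A tiling of the part to the right and a tiling, for the reversed curve, of the part to the
left make up a tiling. -/
lemma Tiles.of_halves (hab : a < b) (h : RightTiles γ I a b d)
    (h' : RightTiles (fun t => γ (-t)) (-I) (-b) (-a) d.mirror) : Tiles γ I a b d := by
  have hl : d.pt (-1) = a := by simpa [Splitting.mirror] using h'.right
  have hidx : ∀ {n : ℤ}, n ∈ d.index → n < 0 → ((-n : ℤ) : WithTop ℤ) ≤ d.mirror.hi := fun hn _ =>
    le_negBot.2 (by simpa using hn.2.1)
  have hneg : ∀ {m n : ℤ}, m ∈ d.index → m < n → n < 0 → d.pt m < d.pt n := by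
    intro m n hm hmn hn
    have := h'.lt (n := -n) (m := -m) (by omega) (by omega) (hidx hm (by omega))
    simpa [Splitting.mirror] using this
  have hle1 : ∀ {n : ℤ}, n ∈ d.index → 0 < n → b ≤ d.pt n := by
    intro n hn hn0
    rcases (show (1 : ℤ) ≤ n by omega).eq_or_lt with rfl | h1
    · exact h.right.ge
    · exact h.right.ge.trans (h.lt one_pos h1 hn.2.2).le
  have hle2 : ∀ {n : ℤ}, n ∈ d.index → n < 0 → d.pt n ≤ a := by
    intro n hn hn0
    rcases (show n ≤ -1 by omega).eq_or_lt with rfl | h1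
    · exact hl.le
    · exact (hneg hn h1 (by norm_num)).le.trans hl.le
  refine ⟨⟨?_, h.pos, fun n hn => ?_, fun m hm n hn hmn => ?_⟩, hl, h.right, fun n hn => ?_⟩
  · have := lt_negBot.1 (show ((0 : ℤ) : WithTop ℤ) < negBot d.lo from h'.pos)
    simpa using this
  · rcases lt_or_gt_of_ne hn.1 with h0 | h0
    · simpa [Splitting.mirror] using (h'.tile (-n) (by omega) (hidx hn h0)).1
    · exact (h.tile n h0 hn.2.2).1
  · rcases lt_or_gt_of_ne hm.1 with h0 | h0
    · rcases lt_or_gt_of_ne hn.1 with h1 | h1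
      · exact hneg hm hmn h1
      · exact (hle2 hm h0).trans_lt (hab.trans_le (hle1 hn h1))
    · exact h.lt h0 hmn hn.2.2
  · rcases lt_or_gt_of_ne hn.1 with h0 | h0
    · obtain ⟨-, -, F, O, hF, him⟩ := h'.tile (-n) (by omega) (hidx hn h0)
      refine ⟨fun x => -F (-x), -O, by simpa [Splitting.mirror] using hF.mirror, ?_⟩
      have := neg_image_mirror F O (-b) (-a)
      rw [neg_neg, neg_neg, him, Splitting.piece_mirror, neg_neg, neg_neg] at this
      exact this
    · exact (h.tile n h0 hn.2.2).2.2

variable [TopologicalSpace M]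

/-- Successive neighbors lead to the tiles to the right of `[a, b]`. -/
lemma Setting.exists_rightTiles [T2Space M] (S : Setting G γ I) (hab : Icc a b ⊆ I) (hlt : a < b)
    (hK : Starts γ I a b k K P b) (hL : Ends γ I a b l L Q a) :
    ∃ d : Splitting G, RightTiles γ I a b d := by
  classical
  -- a pair `(u, g)` stands for the translate by `g` that begins at `u`; `C p q` says that the
  -- translate `p` is compact and ends where `q` begins
  set V : ℝ × G → Prop := fun p => ∃ F O, Starts γ I a b p.2 F O p.1
  set C : ℝ × G → ℝ × G → Prop := fun p q => p.1 < q.1 ∧ ∃ F O, Starts γ I a b p.2 F O p.1 ∧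
    F '' (O ∩ Icc a b) = Icc p.1 q.1
  have hnext : ∀ p, V p → (∃ q, V q ∧ C p q) ∨
      ∃ F O, Starts γ I a b p.2 F O p.1 ∧ F '' (O ∩ Icc a b) = I ∩ Ici p.1 := by
    rintro p ⟨F, O, hF⟩
    rcases hF.image S.ordConnected hab hlt with ⟨v, hv, hE, huv, -, him⟩ | him
    · left
      rcases hF.1.strictMonoOn_or_strictAntiOn with hm | hm
      · obtain ⟨E, U, hEs, -⟩ := hE.next_of_mono S hm hK
        exact ⟨(v, _), ⟨E, U, hEs⟩, huv, F, O, hF, him⟩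
      · obtain ⟨E, U, hEs, -⟩ := hE.next_of_anti S hm hL
        exact ⟨(v, _), ⟨E, U, hEs⟩, huv, F, O, hF, him⟩
    · exact Or.inr ⟨F, O, hF, him⟩
  set nx : ℝ × G → ℝ × G := fun p => if h : ∃ q, V q ∧ C p q then h.choose else p
  set st : ℕ → ℝ × G := fun n => nx^[n] (b, k)
  have hst : ∀ n, st (n + 1) = nx (st n) := fun n => Function.iterate_succ_apply' _ _ _
  have hV : ∀ n, V (st n) := by
    intro n
    induction n with
    | zero => exact ⟨K, P, hK⟩
    | succ n ih =>
      rw [hst]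
      by_cases h : ∃ q, V q ∧ C (st n) q
      · simp only [nx, dif_pos h]
        exact h.choose_spec.1
      · simpa only [nx, dif_neg h] using ih
  set E : ℕ → Prop := fun n => ∃ q, V q ∧ C (st n) q
  have hC : ∀ n, E n → C (st n) (st (n + 1)) := by
    intro n h
    rw [hst]
    simp only [nx, dif_pos (show ∃ q, V q ∧ C (st n) q from h)]
    exact (show ∃ q, V q ∧ C (st n) q from h).choose_spec.2
  -- the process goes on until a translate reaches the end of `I`, if ever
  obtain ⟨hi, h0, h1, h2⟩ : ∃ hi : WithTop ℤ, 0 < hi ∧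
      (∀ m : ℕ, ((m + 1 : ℤ) : WithTop ℤ) < hi → E m) ∧
      ∀ m : ℕ, hi = ((m + 1 : ℤ) : WithTop ℤ) → ¬ E m := by
    by_cases hE : ∀ n, E n
    · exact ⟨⊤, WithTop.coe_lt_top 0, fun m _ => hE m, fun m hm => (WithTop.top_ne_coe hm).elim⟩
    · push Not at hE
      refine ⟨((Nat.find hE + 1 : ℤ) : WithTop ℤ), ?_, fun m hm => ?_, fun m hm => ?_⟩
      · have : (0 : ℤ) < Nat.find hE + 1 := by omega
        exact_mod_cast this
      · rw [WithTop.coe_lt_coe] at hm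
        exact not_not.1 (Nat.find_min hE (m := m) (by omega))
      · rw [WithTop.coe_inj] at hm
        rw [show m = Nat.find hE by omega]
        exact Nat.find_spec hE
  refine ⟨⟨0, hi, fun n => (st (n - 1).toNat).1, fun n => (st (n - 1).toNat).2⟩, h0, rfl,
    fun n hn hnd => ?_⟩
  obtain ⟨m, rfl⟩ : ∃ m : ℕ, n = m + 1 := ⟨(n - 1).toNat, by omega⟩
  have hm1 : ((m : ℤ) + 1 - 1).toNat = m := by omega
  have hm2 : ((m : ℤ) + 1 + 1 - 1).toNat = m + 1 := by omega
  have hnd : ((m + 1 : ℤ) : WithTop ℤ) ≤ hi := hnd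
  simp only [hm1, hm2]
  refine ⟨?_, fun hlt' => (hC m (h1 m hlt')).1, ?_⟩
  · obtain ⟨F, O, hF⟩ := hV m
    obtain ⟨x, hx, hxu⟩ := (hF.isLeast hlt).1
    rw [← hxu]
    exact hF.1.mapsTo hx.1
  · rcases hnd.lt_or_eq with hlt' | heq
    · rw [Splitting.piece_of_lt hn hlt']
      obtain ⟨-, F, O, hF, him⟩ := hC m (h1 m hlt')
      exact ⟨F, O, hF.1, by simpa only [hm1, hm2] using him⟩
    · rw [Splitting.piece_of_eq hn heq.symm]
      obtain ⟨F, O, hF, him⟩ := (hnext _ (hV m)).resolve_left (h2 m heq.symm)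
      exact ⟨F, O, hF.1, by simpa only [hm1] using him⟩

/-- A compact interval with a neighboring translate on each side splits `I` into translates. -/
lemma Setting.exists_tiles [T2Space M] (S : Setting G γ I) (hab : Icc a b ⊆ I) (hlt : a < b)
    (hK : Starts γ I a b k K P b) (hL : Ends γ I a b l L Q a) :
    ∃ d : Splitting G, Tiles γ I a b d := by
  obtain ⟨r, hr⟩ := S.exists_rightTiles hab hlt hK hL
  obtain ⟨q, hq⟩ := S.mirror.exists_rightTiles (by rw [← neg_Icc']; exact neg_subset_neg.2 hab)
    (neg_lt_neg hlt) hL.mirror hK.mirror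
  refine ⟨⟨negTop q.hi, r.hi, fun n => if 0 < n then r.pt n else -q.pt (-n),
    fun n => if 0 < n then r.elt n else q.elt (-n)⟩, Tiles.of_halves hlt (hr.congr rfl ?_ ?_)
      (hq.congr (negBot_negTop _) ?_ ?_)⟩
  · exact fun n hn => if_pos hn
  · exact fun n hn => if_pos hn
  · intro n hn
    simp [Splitting.mirror, not_lt.2 (le_of_lt hn)]
  · intro n hn
    simp [Splitting.mirror, not_lt.2 (le_of_lt hn)]

end TilesExist

/-! ### Decompositions -/

section Pieces

variable {G : Type*} {d : Splitting G} {I : Set ℝ} {n m : ℤ} {t x y : ℝ}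

lemma Splitting.mem_piece_of_mem_closure (d : Splitting G) (ht : t ∈ I)
    (h : t ∈ closure (d.piece I n)) : t ∈ d.piece I n := by
  rw [Splitting.piece] at h ⊢
  split_ifs at h ⊢
  · rwa [isClosed_Icc.closure_eq] at h
  · exact ⟨ht, isClosed_Iic.closure_subset (closure_mono inter_subset_right h)⟩
  · rwa [isClosed_Icc.closure_eq] at h
  · exact ⟨ht, isClosed_Ici.closure_subset (closure_mono inter_subset_right h)⟩
  · rwa [isClosed_Icc.closure_eq] at h

lemma Splitting.IsDecompositionOf.le_of_mem_piece (h : d.IsDecompositionOf I)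
    (hn : 0 < n) (hnd : n ∈ d.index) (hx : x ∈ d.piece I n) : d.pt n ≤ x :=
  (h.isLeast_piece hn hnd).2 hx

lemma Splitting.IsDecompositionOf.of_mem_piece_of_lt (h : d.IsDecompositionOf I)
    (hn : 0 ≤ n) (hm : m ∈ d.index) (hnm : n < m) (hx : x ∈ d.piece I n) :
    x ≤ d.pt (n + 1) ∧ n + 1 ∈ d.index := by
  rcases hn.eq_or_lt with rfl | hn
  · rw [piece, if_pos rfl] at hx
    exact ⟨hx.2, h.one_mem⟩
  · have hlt : (n : WithTop ℤ) < d.hi := (WithTop.coe_lt_coe.2 hnm).trans_le hm.2.2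
    rw [piece_of_lt hn hlt] at hx
    exact ⟨hx.2, h.succ_mem hn hlt⟩

lemma Splitting.IsDecompositionOf.mem_piece_le (h : d.IsDecompositionOf I)
    (hn : n < 0) (hnd : n ∈ d.index) (hx : x ∈ d.piece I n) : x ≤ d.pt n := by
  have := h.mirror.le_of_mem_piece (n := -n) (x := -x) (by omega)
    (mem_index_mirror.2 (by simpa using hnd)) (by simpa [piece_mirror] using hx)
  simpa [Splitting.mirror] using this

lemma Splitting.IsDecompositionOf.of_mem_piece_of_gt (h : d.IsDecompositionOf I)
    (hm : m ≤ 0) (hn : n ∈ d.index) (hnm : n < m) (hx : x ∈ d.piece I m) :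
    d.pt (m - 1) ≤ x ∧ m - 1 ∈ d.index := by
  obtain ⟨h1, h2⟩ := h.mirror.of_mem_piece_of_lt (n := -m) (m := -n) (x := -x) (by omega)
    (mem_index_mirror.2 (by simpa using hn)) (by omega) (by simpa [piece_mirror] using hx)
  rw [mem_index_mirror, show -(-m + 1) = m - 1 by ring] at h2
  simp only [Splitting.mirror, show -(-m + 1) = m - 1 by ring, neg_le_neg_iff] at h1
  exact ⟨h1, h2⟩

/-- Two pieces are separated by a splitting point. -/
lemma Splitting.IsDecompositionOf.exists_pt_between (h : d.IsDecompositionOf I) (hn : n ∈ d.index₀)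
    (hm : m ∈ d.index₀) (hnm : n < m) (hx : x ∈ d.piece I n) (hy : y ∈ d.piece I m) :
    ∃ i ∈ d.index, x ≤ d.pt i ∧ d.pt i ≤ y := by
  rcases lt_or_ge n 0 with h0 | h0
  · have hn' : n ∈ d.index := hn.resolve_left h0.ne
    refine ⟨n, hn', h.mem_piece_le h0 hn' hx, ?_⟩
    rcases le_or_gt m 0 with h1 | h1
    · obtain ⟨h2, h3⟩ := h.of_mem_piece_of_gt h1 hn' hnm hy
      exact (h.2.2.2.monotoneOn hn' h3 (by omega)).trans h2
    · have hm' : m ∈ d.index := hm.resolve_left h1.ne'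
      exact (h.2.2.2.monotoneOn hn' hm' hnm.le).trans (h.le_of_mem_piece h1 hm' hy)
  · have hm' : m ∈ d.index := hm.resolve_left (by omega)
    obtain ⟨h2, h3⟩ := h.of_mem_piece_of_lt h0 hm' hnm hx
    exact ⟨n + 1, h3, h2, (h.2.2.2.monotoneOn h3 hm' (by omega)).trans
      (h.le_of_mem_piece (by omega) hm' hy)⟩

lemma Splitting.IsDecompositionOf.piece_le (h : d.IsDecompositionOf I) (hn : n ∈ d.index₀)
    (hm : m ∈ d.index₀) (hnm : n < m) (hx : x ∈ d.piece I n) (hy : y ∈ d.piece I m) : x ≤ y := by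
  obtain ⟨i, -, h1, h2⟩ := h.exists_pt_between hn hm hnm hx hy
  exact h1.trans h2

/-- A piece is determined by an interior point. -/
lemma Splitting.IsDecompositionOf.eq_of_mem_piece (h : d.IsDecompositionOf I) (hn : n ∈ d.index₀)
    (hm : m ∈ d.index₀) (hx : x ∈ interior (d.piece I n)) (hxm : x ∈ d.piece I m) : n = m := by
  obtain ⟨u, hu, hxu⟩ := mem_nhdsGE_iff_exists_Icc_subset.1
    (mem_nhdsWithin_of_mem_nhds (mem_interior_iff_mem_nhds.1 hx))
  obtain ⟨l, hl, hlx⟩ := mem_nhdsLE_iff_exists_Icc_subset.1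
    (mem_nhdsWithin_of_mem_nhds (mem_interior_iff_mem_nhds.1 hx))
  rcases lt_trichotomy n m with hlt | heq | hlt
  · exact absurd (h.piece_le hn hm hlt (hxu (right_mem_Icc.2 (le_of_lt hu))) hxm) (not_le.2 hu)
  · exact heq
  · exact absurd (h.piece_le hm hn hlt hxm (hlx (left_mem_Icc.2 (le_of_lt hl)))) (not_le.2 hl)

end Pieces

section Decomposition

variable {G : Type*} [Group G] {M : Type*} [MulAction G M] {γ : ℝ → M} {I : Set ℝ} {g k l : G}
  {F F' K L μ ρ : ℝ → ℝ} {O O' A B J J' P Q : Set ℝ} {s t x y z a b u : ℝ} {d : Splitting G}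
  {n m : ℤ}

lemma Tiles.starts_or_ends (h : Tiles γ I a b d) (hn : n ∈ d.index)
    (hF : IsComp γ I g F O) (him : F '' (O ∩ Icc a b) = d.piece I n) :
    Starts γ I a b g F O (d.pt n) ∧ 0 < n ∨ Ends γ I a b g F O (d.pt n) ∧ n < 0 := by
  rcases lt_or_gt_of_ne hn.1 with h0 | h0
  · refine Or.inr ⟨?_, h0⟩
    have h1 := hF.mirror.starts_of_isLeast (neg_lt_neg h.lt) (u := -d.pt n) <| by
      have h2 := h.mirror.dec.isLeast_piece (n := -n) (by omega)
        (Splitting.mem_index_mirror.2 (by simpa using hn))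
      rw [Splitting.piece_mirror, neg_neg] at h2
      rw [neg_image_mirror, him]
      simpa [Splitting.mirror] using h2
    simpa using h1.mirror
  · exact Or.inl ⟨hF.starts_of_isLeast h.lt (him ▸ h.dec.isLeast_piece h0 hn), h0⟩

/-- A transition to a piece is defined on an interval of positive length. -/
lemma Tiles.inter_nonempty (h : Tiles γ I a b d) (hn : n ∈ d.index₀)
    (hF : IsComp γ I g F O) (him : F '' (O ∩ Icc a b) = d.piece I n) : (O ∩ Ioo a b).Nonempty := by
  rcases hn with rfl | hn
  · rw [h.piece_zero] at him
    have key : ∀ x ∈ O ∩ Icc a b, ∀ y ∈ O ∩ Icc a b, x < y → (O ∩ Ioo a b).Nonempty := by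
      intro x hx y hy hxy
      obtain ⟨z, hxz, hzy⟩ := exists_between hxy
      exact ⟨z, hF.ordConnected.out hx.1 hy.1 ⟨hxz.le, hzy.le⟩, hx.2.1.trans_lt hxz,
        hzy.trans_le hy.2.2⟩
    obtain ⟨x, hx, hxa⟩ := him.ge (left_mem_Icc.2 h.lt.le)
    obtain ⟨y, hy, hyb⟩ := him.ge (right_mem_Icc.2 h.lt.le)
    rcases lt_trichotomy x y with hxy | rfl | hxy
    · exact key x hx y hy hxy
    · exact absurd (hxa.symm.trans hyb) h.lt.ne
    · exact key y hy x hx hxy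
  · rcases h.starts_or_ends hn hF him with ⟨h1, -⟩ | ⟨h1, -⟩
    · exact h1.nonempty h.lt
    · exact h1.nonempty h.lt

variable [TopologicalSpace M]

lemma Tiles.isInterval_piece (S : Setting G γ I) (h : Tiles γ I a b d) (hn : n ∈ d.index₀) :
    IsInterval (d.piece I n) := by
  obtain ⟨F, O, hF, him⟩ : ∃ F O, IsComp γ I (d.elt₀ n) F O ∧
      F '' (O ∩ Icc a b) = d.piece I n := by
    rcases hn with rfl | hn
    · exact ⟨id, I, by simpa [Splitting.elt₀] using S.isComp_id, by
        rw [image_id, inter_eq_right.2 (h.sub S), h.piece_zero]⟩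
    · obtain ⟨F, O, hF, him⟩ := h.tile n hn
      exact ⟨F, O, by rwa [Splitting.elt₀, if_neg hn.1], him⟩
  rw [← him]
  refine ⟨hF.ordConnected_image (hF.ordConnected.inter ordConnected_Icc) inter_subset_left, ?_⟩
  rw [hF.interior_image inter_subset_left, image_nonempty, interior_inter,
    hF.isOpen.interior_eq, interior_Icc]
  exact h.inter_nonempty hn hF him

lemma Tiles.piece_subset (S : Setting G γ I) (h : Tiles γ I a b d) (hn : n ∈ d.index₀) :
    d.piece I n ⊆ I := by
  rcases hn with rfl | hn
  · rw [h.piece_zero]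
    exact h.sub S
  · obtain ⟨F, O, hF, him⟩ := h.tile n hn
    rw [← him]
    exact (hF.mapsTo.mono_left inter_subset_left).image_subset

lemma Tiles.iUnion_piece (S : Setting G γ I) (h : Tiles γ I a b d) :
    I = ⋃ n ∈ d.index₀, d.piece I n := by
  apply Subset.antisymm
  · intro t ht
    obtain ⟨n, hn, htn⟩ := h.cover S ht
    exact mem_biUnion hn htn
  · exact iUnion₂_subset fun n hn => h.piece_subset S hn

variable [T2Space M] (S : Setting G γ I)
include S

/-- An interval with a translate beginning at its right end is not free beyond this end. -/
lemma Starts.not_freeOn (h : Starts γ I a b g F O b) (hlt : a < b)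
    (hI : ¬ FreeOn G γ I I) : ∀ ε > 0, ¬ FreeOn G γ I (Icc a (b + ε)) := by
  intro ε hε
  rcases h with ⟨hF, ⟨hm, ha, hab⟩ | ⟨hm, hb, hbb⟩⟩
  · have hc := (hF.germ a ha).continuousAt
    obtain ⟨s, hsO, has, hsb, hs⟩ : ∃ s ∈ O, a < s ∧ s < b ∧ F s < b + ε := by
      have h1 : ∀ᶠ s in 𝓝[>] a, s ∈ O ∧ s < b ∧ F s < b + ε :=
        nhdsWithin_le_nhds (Filter.Eventually.and (hF.isOpen.mem_nhds ha) ((gt_mem_nhds hlt).and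
          (hc.eventually (gt_mem_nhds (by linarith)))))
      obtain ⟨s, ⟨h1, h2, h3⟩, h4⟩ := (h1.and self_mem_nhdsWithin).exists
      exact ⟨s, h1, h4, h2, h3⟩
    have hbs : b < F s := hab ▸ hm ha hsO has
    refine hF.not_freeOn S hI hsO (hsb.trans hbs).ne' ordConnected_Icc ?_ ?_
    · rw [interior_Icc]; exact ⟨has, by linarith⟩
    · rw [interior_Icc]; exact ⟨by linarith, hs⟩
  · exact hF.not_freeOn_of_fixed S hI hb hm hbb ordConnected_Icc
      (by rw [interior_Icc]; exact ⟨hlt, by linarith⟩)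

/-- An interval with a translate ending at its left end is not free beyond this end. -/
lemma Ends.not_freeOn (h : Ends γ I a b g F O a) (hlt : a < b)
    (hI : ¬ FreeOn G γ I I) : ∀ ε > 0, ¬ FreeOn G γ I (Icc (a - ε) b) := by
  intro ε hε hf
  refine h.mirror.not_freeOn S.mirror (neg_lt_neg hlt) (by rwa [freeOn_mirror_iff]) ε hε ?_
  rw [show Icc (-b) (-a + ε) = -Icc (a - ε) b by rw [neg_Icc']; congr 1; ring]
  exact hf.mirror

/-- Compact maximal intervals in terms of germs. -/
lemma Setting.isMaximalInterval_Icc_iff :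
    (a < b ∧ IsMaximalInterval G γ I (Icc a b)) ↔ MaxIcc G γ I a b := by
  constructor
  · rintro ⟨hlt, hsub, hfree, hmax⟩
    have ha := hsub (left_mem_Icc.2 hlt.le)
    have hb := hsub (right_mem_Icc.2 hlt.le)
    refine ⟨hlt, hsub, ((S.isFreeSegment_iff hsub).1 hfree).2, fun ε hε hf => ?_,
      fun ε hε hf => ?_⟩
    · obtain ⟨c, hbc, hcε, hc⟩ := isOpen_exists_gt S.isOpen hb (show b < b + ε by linarith)
      have hsub' := S.mem_Icc_subset ha (hc (right_mem_Icc.2 hbc.le))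
      have := hmax (Icc a c) hsub' ((S.isFreeSegment_iff hsub').2 ⟨⟨ordConnected_Icc, by
        rw [interior_Icc]; exact nonempty_Ioo.2 (hlt.trans hbc)⟩,
        hf.mono (Icc_subset_Icc_right hcε.le)⟩) (Icc_subset_Icc_right hbc.le)
      exact ((Icc_eq_Icc_iff (hlt.trans hbc).le).1 this).2.not_gt hbc
    · obtain ⟨c, hac, hcε, hc⟩ := isOpen_exists_lt S.isOpen ha (show a - ε < a by linarith)
      have hsub' := S.mem_Icc_subset (hc (left_mem_Icc.2 hcε.le)) hb
      have := hmax (Icc c b) hsub' ((S.isFreeSegment_iff hsub').2 ⟨⟨ordConnected_Icc, by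
        rw [interior_Icc]; exact nonempty_Ioo.2 (hcε.trans hlt)⟩,
        hf.mono (Icc_subset_Icc_left hac.le)⟩) (Icc_subset_Icc_left hcε.le)
      exact ((Icc_eq_Icc_iff (hcε.trans hlt).le).1 this).1.not_lt hcε
  · intro h
    refine ⟨h.lt, h.sub, (S.isFreeSegment_iff h.sub).2 ⟨⟨ordConnected_Icc, by
      rw [interior_Icc]; exact nonempty_Ioo.2 h.lt⟩, h.free⟩, fun A' hA' hf hsub => ?_⟩
    obtain ⟨hA'i, hf⟩ := (S.isFreeSegment_iff hA').1 hf
    refine Subset.antisymm (fun x hx => ⟨?_, ?_⟩) hsub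
    · by_contra hxa
      refine h.left (a - x) (by linarith) (hf.mono ?_)
      rw [sub_sub_cancel]
      exact hA'i.1.out hx (hsub (right_mem_Icc.2 h.lt.le))
    · by_contra hxb
      refine h.right (x - b) (by linarith) (hf.mono ?_)
      rw [add_sub_cancel]
      exact hA'i.1.out (hsub (left_mem_Icc.2 h.lt.le)) hx

omit [T2Space M] S in
lemma exists_Icc_of_isCompact (hA : IsInterval A) (hc : IsCompact A) : ∃ a b, a < b ∧ A = Icc a b := by
  obtain ⟨x, hx⟩ := hA.2
  have hA' := eq_Icc_of_connected_compact
    ⟨⟨x, interior_subset hx⟩, hA.1.isPreconnected⟩ hc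
  refine ⟨_, _, ?_, hA'⟩
  rw [hA', interior_Icc] at hx
  exact hx.1.trans hx.2

lemma Setting.isMaximalInterval_iff (hc : IsCompact A) :
    IsMaximalInterval G γ I A ↔ ∃ a b, A = Icc a b ∧ MaxIcc G γ I a b := by
  constructor
  · intro h
    obtain ⟨a, b, hlt, rfl⟩ := exists_Icc_of_isCompact h.2.1.1 hc
    exact ⟨a, b, rfl, S.isMaximalInterval_Icc_iff.1 ⟨hlt, h⟩⟩
  · rintro ⟨a, b, rfl, h⟩
    exact (S.isMaximalInterval_Icc_iff.2 h).2

/-- The transition that carries `[a, b]` to a given piece is unique. -/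
lemma Tiles.comp_unique (hI : ¬ FreeOn G γ I I) (hA : FreeOn G γ I (Icc a b))
    (h : Tiles γ I a b d) (hn : n ∈ d.index)
    (hF : IsComp γ I g F O) (him : F '' (O ∩ Icc a b) = d.piece I n)
    (hF' : IsComp γ I k F' O') (him' : F' '' (O' ∩ Icc a b) = d.piece I n) :
    cls γ I g = cls γ I k ∧ O = O' ∧ EqOn F F' O := by
  rcases h.starts_or_ends hn hF him with ⟨h1, h0⟩ | ⟨h1, h0⟩ <;>
  rcases h.starts_or_ends hn hF' him' with ⟨h2, h0'⟩ | ⟨h2, h0'⟩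
  · exact h1.unique S h2 hI hA h.lt
  · omega
  · omega
  · exact h1.unique S h2 hI hA h.lt

omit [T2Space M] in
lemma Tiles.relatedPosWrt (h : Tiles γ I a b d) (hn : n ∈ d.index)
    (hF : IsComp γ I g F O) (him : F '' (O ∩ Icc a b) = d.piece I n) (hm : StrictMonoOn F O) :
    RelatedPosWrt (fun t => g • γ t) γ (Icc a b) (d.piece I n) (O ∩ Icc a b) F := by
  rw [← him]
  rcases h.starts_or_ends hn hF him with ⟨h1, -⟩ | ⟨h1, -⟩
  · exact h1.relatedPosWrt S (h.sub S) h.lt hm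
  · exact h1.relatedPosWrt S (h.sub S) h.lt hm

omit [T2Space M] in
lemma Tiles.relatedNegWrt (h : Tiles γ I a b d) (hn : n ∈ d.index)
    (hF : IsComp γ I g F O) (him : F '' (O ∩ Icc a b) = d.piece I n) (hm : StrictAntiOn F O) :
    RelatedNegWrt (fun t => g • γ t) γ (Icc a b) (d.piece I n) (O ∩ Icc a b) F := by
  rw [← him]
  rcases h.starts_or_ends hn hF him with ⟨h1, -⟩ | ⟨h1, -⟩
  · exact h1.relatedNegWrt S (h.sub S) h.lt hm
  · exact h1.relatedNegWrt S (h.sub S) h.lt hm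

lemma Tiles.relatedPos_iff (hI : ¬ FreeOn G γ I I) (hA : FreeOn G γ I (Icc a b))
    (h : Tiles γ I a b d) (hn : n ∈ d.index)
    (hF : IsComp γ I g F O) (him : F '' (O ∩ Icc a b) = d.piece I n) :
    RelatedPos (fun t => g • γ t) γ (Icc a b) (d.piece I n) ↔ StrictMonoOn F O := by
  constructor
  · rintro ⟨B, μ, hrel⟩
    obtain ⟨F', O', hF', hm, -, -, him'⟩ := S.exists_comp_of_relatedPosWrt (h.sub S)
      (h.piece_subset S (Or.inr hn)) (fun t ht htc => d.mem_piece_of_mem_closure ht htc) hrel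
    obtain ⟨-, h2, h3⟩ := h.comp_unique S hI hA hn hF him hF' him'
    rw [h3.congr_strictMonoOn, h2]
    exact hm
  · exact fun hm => ⟨_, _, h.relatedPosWrt S hn hF him hm⟩

lemma Tiles.relatedNeg_iff (hI : ¬ FreeOn G γ I I) (hA : FreeOn G γ I (Icc a b))
    (h : Tiles γ I a b d) (hn : n ∈ d.index)
    (hF : IsComp γ I g F O) (him : F '' (O ∩ Icc a b) = d.piece I n) :
    RelatedNeg (fun t => g • γ t) γ (Icc a b) (d.piece I n) ↔ StrictAntiOn F O := by
  constructor
  · rintro ⟨B, μ, hrel⟩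
    obtain ⟨F', O', hF', hm, -, -, him'⟩ := S.exists_comp_of_relatedNegWrt (h.sub S)
      (h.piece_subset S (Or.inr hn)) (fun t ht htc => d.mem_piece_of_mem_closure ht htc) hrel
    obtain ⟨-, h2, h3⟩ := h.comp_unique S hI hA hn hF him hF' him'
    rw [h3.congr_strictAntiOn, h2]
    exact hm
  · exact fun hm => ⟨_, _, h.relatedNegWrt S hn hF him hm⟩

/-- A compact free interval with a decomposition is maximal, and the decomposition is a tiling. -/
lemma Setting.tiles_of_isADecomposition (hI : ¬ FreeOn G γ I I) (h : IsADecomposition γ I A d) :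
    ∃ a b, A = Icc a b ∧ MaxIcc G γ I a b ∧ Tiles γ I a b d := by
  obtain ⟨hAI, -, hfree, hdec, rfl, -, -, hrel⟩ := h
  have h0 : d.piece I 0 = Icc (d.pt (-1)) (d.pt 1) := if_pos rfl
  rw [h0] at hAI hfree hrel ⊢
  have ht : Tiles γ I (d.pt (-1)) (d.pt 1) d := by
    refine ⟨hdec, rfl, rfl, fun n hn => ?_⟩
    have hsub : d.piece I n ⊆ I := by
      have hout : ∀ {i j}, i ∈ d.index → j ∈ d.index → Icc (d.pt i) (d.pt j) ⊆ I := fun hi hj =>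
        S.mem_Icc_subset (hdec.2.2.1 _ hi) (hdec.2.2.1 _ hj)
      rcases hrel n hn with ⟨B, μ, hr, -⟩ | ⟨B, μ, hr, -⟩ <;> clear hr
      all_goals
        rw [Splitting.piece]
        split_ifs with h1 h2 h3 h4
        · exact hAI
        · exact inter_subset_left
        · refine hout ?_ hn
          have := hdec.mirror.succ_mem (n := -n) (by omega) (lt_negBot.2 (by
            simpa using lt_of_le_of_ne hn.2.1 h3))
          simpa [Splitting.mem_index_mirror, sub_eq_neg_add, add_comm] using this
        · exact inter_subset_left
        · exact hout hn (hdec.succ_mem (by omega) (lt_of_le_of_ne hn.2.2 (Ne.symm h4)))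
    have hcl : ∀ t ∈ I, t ∈ closure (d.piece I n) → t ∈ d.piece I n := fun t ht htc =>
      d.mem_piece_of_mem_closure ht htc
    rcases hrel n hn with ⟨B, μ, hr⟩ | ⟨B, μ, hr⟩
    · obtain ⟨F, O, hF, -, -, -, him⟩ := S.exists_comp_of_relatedPosWrt hAI hsub hcl hr
      exact ⟨F, O, hF, him⟩
    · obtain ⟨F, O, hF, -, -, -, him⟩ := S.exists_comp_of_relatedNegWrt hAI hsub hcl hr
      exact ⟨F, O, hF, him⟩
  refine ⟨_, _, rfl, ⟨ht.lt, hAI, ((S.isFreeSegment_iff hAI).1 hfree).2, ?_, ?_⟩, ht⟩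
  · obtain ⟨F, O, hF, -⟩ := ht.starts one_pos hdec.one_mem
    exact hF.not_freeOn S ht.lt hI
  · obtain ⟨F, O, hF, him⟩ := ht.tile _ hdec.neg_one_mem
    rcases ht.starts_or_ends hdec.neg_one_mem hF him with ⟨-, h1⟩ | ⟨h1, -⟩
    · norm_num at h1
    · exact h1.not_freeOn S ht.lt hI

/-- The tiling of a maximal interval is a decomposition; the elements for the neighbors are
nontrivial by `MaxIcc.exists_starts` and `MaxIcc.exists_ends`. -/
lemma Tiles.isADecomposition (hI : ¬ FreeOn G γ I I) (hA : MaxIcc G γ I a b)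
    (h : Tiles γ I a b d) : IsADecomposition γ I (Icc a b) d := by
  have hone : ∀ n, n ∈ d.index → ∀ k, (∃ F O, IsComp γ I k F O ∧
      F '' (O ∩ Icc a b) = d.piece I n) → k ∉ curveStabilizer G γ I →
      cls γ I (d.elt n) ≠ cls γ I 1 := by
    rintro n hn k ⟨F', O', hF', him'⟩ hk h1
    obtain ⟨F, O, hF, him⟩ := h.tile n hn
    rw [(h.comp_unique S hI hA.free hn hF him hF' him').1] at h1
    exact hk (cls_eq_one_iff.1 h1)
  refine ⟨hA.sub, isCompact_Icc, (S.isFreeSegment_iff hA.sub).2 ⟨⟨ordConnected_Icc, by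
    rw [interior_Icc]; exact nonempty_Ioo.2 h.lt⟩, hA.free⟩, h.dec, h.piece_zero.symm, ?_, ?_,
    fun n hn => ?_⟩
  · obtain ⟨k, K, P, hK, hk⟩ := hA.exists_starts S hI
    obtain ⟨F, O, hF, him⟩ := h.starts one_pos h.dec.one_mem
    rw [h.right] at hF
    intro h1
    rw [(hF.unique S hK hI hA.free h.lt).1] at h1
    exact hk (cls_eq_one_iff.1 h1)
  · obtain ⟨k, K, P, hK, hk⟩ := hA.exists_ends S hI
    obtain ⟨F, O, hF, him⟩ := h.tile _ h.dec.neg_one_mem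
    rcases h.starts_or_ends h.dec.neg_one_mem hF him with ⟨-, h1⟩ | ⟨hE, -⟩
    · norm_num at h1
    rw [h.left] at hE
    intro h1
    rw [(hE.unique S hK hI hA.free h.lt).1] at h1
    exact hk (cls_eq_one_iff.1 h1)
  · obtain ⟨F, O, hF, him⟩ := h.tile n hn
    rcases hF.strictMonoOn_or_strictAntiOn with hm | hm
    · exact Or.inl ⟨_, _, h.relatedPosWrt S hn hF him hm⟩
    · exact Or.inr ⟨_, _, h.relatedNegWrt S hn hF him hm⟩

lemma MaxIcc.exists_tiles (hA : MaxIcc G γ I a b) (hI : ¬ FreeOn G γ I I) :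
    ∃ d : Splitting G, Tiles γ I a b d := by
  obtain ⟨k, K, P, hK, -⟩ := hA.exists_starts S hI
  obtain ⟨l, L, Q, hL, -⟩ := hA.exists_ends S hI
  exact S.exists_tiles hA.sub hA.lt hK hL

omit [T2Space M] in
/-- Each piece of a tiling, `[a, b]` included, comes with its transition. -/
lemma Tiles.exists_isTransition (h : Tiles γ I a b d) (hn : n ∈ d.index₀) :
    ∃ F O, IsComp γ I (d.elt₀ n) F O ∧ F '' (O ∩ Icc a b) = d.piece I n ∧
      IsTransition γ I (Icc a b) d n (O ∩ Icc a b) F := by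
  rcases hn with rfl | hn
  · have h1 : I ∩ Icc a b = Icc a b := inter_eq_right.2 (h.sub S)
    exact ⟨id, I, by simpa [Splitting.elt₀] using S.isComp_id, by rw [image_id, h1, h.piece_zero],
      Or.inl ⟨rfl, h1, fun _ _ => rfl⟩⟩
  · obtain ⟨F, O, hF, him⟩ := h.tile n hn
    refine ⟨F, O, by rwa [Splitting.elt₀, if_neg hn.1], him, Or.inr ⟨hn.1, ?_⟩⟩
    rcases hF.strictMonoOn_or_strictAntiOn with hm | hm
    · exact Or.inl (h.relatedPosWrt S hn hF him hm)
    · exact Or.inr (h.relatedNegWrt S hn hF him hm)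

/-- The transition maps of a decomposition are restrictions of maximal continuations. -/
lemma Tiles.comp_of_isTransition (h : Tiles γ I a b d) (hn : n ∈ d.index₀)
    (ht : IsTransition γ I (Icc a b) d n B μ) :
    ∃ F O, IsComp γ I (d.elt₀ n) F O ∧ F '' (O ∩ Icc a b) = d.piece I n ∧
      O ∩ Icc a b = B ∧ EqOn F μ B := by
  rcases ht with ⟨rfl, rfl, hμ⟩ | ⟨hn0, ht⟩
  · have h1 : I ∩ Icc a b = Icc a b := inter_eq_right.2 (h.sub S)
    exact ⟨id, I, by simpa [Splitting.elt₀] using S.isComp_id, by rw [image_id, h1, h.piece_zero],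
      h1, hμ.symm⟩
  · rw [Splitting.elt₀, if_neg hn0]
    rcases ht with ht | ht
    · obtain ⟨F, O, h1, -, h2, h3, h4⟩ := S.exists_comp_of_relatedPosWrt (h.sub S)
        (h.piece_subset S hn) (fun t ht htc => d.mem_piece_of_mem_closure ht htc) ht
      exact ⟨F, O, h1, h4, h2, h3⟩
    · obtain ⟨F, O, h1, -, h2, h3, h4⟩ := S.exists_comp_of_relatedNegWrt (h.sub S)
        (h.piece_subset S hn) (fun t ht htc => d.mem_piece_of_mem_closure ht htc) ht
      exact ⟨F, O, h1, h4, h2, h3⟩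

omit [T2Space M] in
/-- If an analytic immersive extension of a diffeomorphism on `J ⊆ [a, b]` with values in `I`
agrees with `F` on the part of `[a, b]` where `F` is defined, then `F` is defined on `J`. -/
lemma IsComp.subset_of_maxExtensionEq (h : IsComp γ I g F O) (hab : Icc a b ⊆ I)
    (hJ : J ⊆ Icc a b) (hρ : MapsTo ρ J I) (hne : (O ∩ Icc a b).Nonempty)
    (hm : MaxExtensionEq ρ J μ (O ∩ Icc a b)) (hμ : EqOn F μ (O ∩ Icc a b)) :
    J ⊆ O ∧ EqOn F ρ J := by
  obtain ⟨U, σ, hU, hJU, hσ, hσ', hσρ, hBU, hσμ⟩ := hm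
  have hc : ContinuousOn σ U := fun x hx => (hσ x hx).continuousAt.continuousWithinAt
  have hmon : StrictMonoOn σ U ∨ StrictAntiOn σ U := by
    have hcv : Convex ℝ U := hU.1.1.convex
    rcases hasDerivWithinAt_forall_lt_or_forall_gt_of_forall_ne hcv (fun x hx =>
      (hσ x hx).differentiableAt.hasDerivAt.hasDerivWithinAt) hσ' with h | h
    · exact Or.inr (strictAntiOn_of_deriv_neg hcv hc fun x hx => h x (interior_subset hx))
    · exact Or.inl (strictMonoOn_of_deriv_pos hcv hc fun x hx => h x (interior_subset hx))
  obtain ⟨s, hs⟩ := hne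
  have hFσ : EqOn F σ (O ∩ Icc a b) := hμ.trans hσμ.symm
  have hsub : J ⊆ O := by
    intro t ht
    have hst : uIcc s t ⊆ Icc a b := ordConnected_Icc.uIcc_subset hs.2 (hJ ht)
    have hstU : uIcc s t ⊆ U := hU.1.1.uIcc_subset (hBU hs) (hJU ht)
    have hsI : σ s ∈ I := hFσ hs ▸ h.mapsTo hs.1
    have htI : σ t ∈ I := hσρ ht ▸ hρ ht
    refine h.mem_of_compact S.ordConnected hs.1 (hab (hJ ht)) (K := uIcc (σ s) (σ t))
      isCompact_uIcc (S.ordConnected.uIcc_subset hsI htI) fun y hy hyst => ?_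
    rw [hFσ ⟨hy, hst hyst⟩]
    rcases hmon with hm | hm
    · exact (hm.monotoneOn.mono hstU).mapsTo_uIcc hyst
    · exact (hm.antitoneOn.mono hstU).mapsTo_uIcc hyst
  exact ⟨hsub, fun t ht => (hFσ ⟨hsub ht, hJ ht⟩).trans (hσρ ht)⟩

/-- Each overlap of a translate of `[a, b]` with the curve comes from a unique piece: an interior
point of the overlap can be chosen in the interior of a piece, and there transitions agree. -/
lemma Tiles.isFaithful (hI : ¬ FreeOn G γ I I) (hA : MaxIcc G γ I a b) (h : Tiles γ I a b d) :
    IsFaithful γ I (Icc a b) d := by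
  rintro g ρ J J' ⟨hJ, hJ', hJA, hJI, -, -, hρ, hrel⟩
  obtain ⟨F, O, hF, hJO, hFρ, him⟩ := S.exists_comp_of_relatedBy (hJA.trans hA.sub) hJI ⟨hρ, hrel⟩
  have hJab : J ⊆ interior (Icc a b) := interior_maximal hJA hJ.2
  have hpieces : ∀ n ∈ d.index₀, ∀ B μ, IsTransition γ I (Icc a b) d n B μ →
      MaxExtensionEq ρ J μ B → F '' (O ∩ Icc a b) = d.piece I n := by
    intro n hn B μ ht hm
    obtain ⟨E, Q, hE, hEim, rfl, hEμ⟩ := h.comp_of_isTransition S hn ht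
    obtain ⟨s, hs⟩ := hJ.1.2
    replace hs := interior_subset hs
    obtain ⟨h1, h2⟩ := hE.subset_of_maxExtensionEq S hA.sub hJA
      (fun t ht => hJI (hρ.2.2.1.mapsTo ht))
      ((h.inter_nonempty hn hE hEim).mono (inter_subset_inter_right _ Ioo_subset_Icc_self)) hm hEμ
    obtain ⟨-, -, rfl, h4⟩ := hF.eq_of_eq S hI hA.free ordConnected_Icc hE (hJO hs) (h1 hs)
      (hJab hs) (hJab hs) ((hFρ hs).trans (h2 hs).symm)
    rw [← hEim, (h4.mono inter_subset_left).image_eq]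
  have hFJ : ∀ s ∈ J, F '' J ∈ 𝓝 (F s) := fun s hs =>
    hF.image_mem_nhds (hJO hs) (hJ.2.mem_nhds hs)
  -- the pieces cover `I`, so some point of `F '' J` lies in the interior of a piece
  obtain ⟨n, hn, s, hs, hsn⟩ : ∃ n ∈ d.index₀, ∃ s ∈ J, F s ∈ interior (d.piece I n) := by
    obtain ⟨s, hs⟩ := hJ.1.2
    replace hs := interior_subset hs
    obtain ⟨n, hn, hsn⟩ := h.cover S (hF.mapsTo (hJO hs))
    have hint : F s ∈ closure (interior (d.piece I n)) := by
      obtain ⟨hord, hne⟩ := h.isInterval_piece S hn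
      rw [(hord.convex : Convex ℝ _).closure_interior_eq_closure_of_nonempty_interior hne]
      exact subset_closure hsn
    obtain ⟨y, ⟨s', hs', rfl⟩, hy⟩ := mem_closure_iff_nhds.1 hint _ (hFJ s hs)
    exact ⟨n, hn, s', hs', hy⟩
  obtain ⟨E, Q, hE, hEim, hEt⟩ := h.exists_isTransition S hn
  have hsn' := hsn
  rw [← hEim, hE.interior_image inter_subset_left, interior_inter, hE.isOpen.interior_eq] at hsn'
  obtain ⟨s', hs', hss'⟩ := hsn'
  obtain ⟨rfl, h2, rfl, h4⟩ := hF.eq_of_eq S hI hA.free ordConnected_Icc hE (hJO hs) hs'.1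
    (hJab hs) hs'.2 hss'.symm
  refine ⟨n, ⟨hn, h2, _, _, hEt, O, F, ⟨⟨hF.ordConnected, ?_⟩, hF.isOpen⟩, hJO,
    fun x hx => (hF.germ x hx).analyticAt, fun x hx => (hF.germ x hx).deriv_ne, hFρ,
    inter_subset_left, h4.mono inter_subset_left⟩, ?_⟩
  · rw [hF.isOpen.interior_eq]
    exact hF.nonempty
  · rintro m ⟨hm, -, B, μ, hmt, hmext⟩
    -- two pieces with the same transition coincide
    have hpm := hpieces m hm B μ hmt hmext
    rw [(h4.mono inter_subset_left).image_eq, hEim] at hpm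
    exact (h.dec.eq_of_mem_piece hn hm hsn (hpm ▸ interior_subset hsn)).symm

end Decomposition

/-! ### Positive curves -/

section Positive

variable {G : Type*} [Group G] {M : Type*} [MulAction G M] {γ : ℝ → M} {I : Set ℝ} {g h : G}
  {F F' f E : ℝ → ℝ} {O O' A D Q : Set ℝ} {s t x y z p a b c u v : ℝ} {d : Splitting G} {n : ℤ}
  [TopologicalSpace M] [T2Space M] (S : Setting G γ I)
include S

/-- Translates of free intervals are free. -/
lemma IsComp.freeOn_image (hF : IsComp γ I g F O) (hD : FreeOn G γ I D) (hDO : D ⊆ O) :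
    FreeOn G γ I (F '' D) := by
  intro p f y hf hy hfy
  rw [hF.interior_image hDO] at hy hfy
  obtain ⟨s, hs, rfl⟩ := hy
  obtain ⟨t, ht, hft⟩ := hfy
  obtain ⟨f', hf', hft', -, -⟩ := S.germ_inv (hF.germ t (hDO (interior_subset ht)))
  rw [hft] at hf' hft'
  have h1 := (hf'.comp hf).comp (hF.germ s (hDO (interior_subset hs)))
  have h2 := hD _ _ s h1 hs (by simpa only [hft'] using ht)
  have h3 := S.conj_mem' (hF.germ s (hDO (interior_subset hs))) h2
  rwa [show g * (g⁻¹ * p * g) * g⁻¹ = p by group] at h3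

omit [TopologicalSpace M] [T2Space M] S in
lemma IsComp.image_Icc_of_mono (hF : IsComp γ I g F O) (hm : StrictMonoOn F O) (hab : a ≤ b)
    (hsub : Icc a b ⊆ O) : F '' Icc a b = Icc (F a) (F b) := by
  apply Subset.antisymm
  · rintro _ ⟨x, hx, rfl⟩
    exact ⟨hm.monotoneOn (hsub (left_mem_Icc.2 hab)) (hsub hx) hx.1,
      hm.monotoneOn (hsub hx) (hsub (right_mem_Icc.2 hab)) hx.2⟩
  · exact intermediate_value_Icc hab (hF.continuousOn.mono hsub)

/-- An increasing transition preserves the property of not being extendable to the right. -/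
lemma IsComp.not_freeOn_map (hF : IsComp γ I g F O) (hm : StrictMonoOn F O) (hab : a < b)
    (hsub : Icc a b ⊆ O) (hr : ∀ ε > 0, ¬ FreeOn G γ I (Icc a (b + ε))) :
    ∀ ε > 0, ¬ FreeOn G γ I (Icc (F a) (F b + ε)) := by
  intro ε hε hfree
  have hb := hsub (right_mem_Icc.2 hab.le)
  obtain ⟨c, hbc, -, hc⟩ := isOpen_exists_gt
    (hF.isOpen.inter (isOpen_Iio (a := F b + ε) |> hF.continuousOn.isOpen_inter_preimage hF.isOpen))
    ⟨hb, hb, show F b < F b + ε by linarith⟩ (lt_add_one b)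
  have hcO := hc (right_mem_Icc.2 hbc.le)
  have hsub' : Icc a c ⊆ O := hF.ordConnected.out (hsub (left_mem_Icc.2 hab.le)) hcO.1
  obtain ⟨F', hF', hinv, -, -⟩ := hF.inv S
  have h1 : FreeOn G γ I (F '' Icc a c) := by
    rw [hF.image_Icc_of_mono hm (hab.trans hbc).le hsub']
    exact hfree.mono (Icc_subset_Icc_right (le_of_lt hcO.2.2))
  have h2 := hF'.freeOn_image S h1 (image_mono hsub')
  rw [← image_comp, (show EqOn (F' ∘ F) id (Icc a c) from fun x hx => hinv x (hsub' hx)).image_eq,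
    image_id] at h2
  refine hr (c - b) (by linarith) ?_
  rwa [add_sub_cancel]

/-- Increasing translates of compact maximal intervals are maximal. -/
lemma IsComp.maxIcc_map (hF : IsComp γ I g F O) (hm : StrictMonoOn F O) (hA : MaxIcc G γ I a b)
    (hsub : Icc a b ⊆ O) : MaxIcc G γ I (F a) (F b) := by
  have him := hF.image_Icc_of_mono hm hA.lt.le hsub
  refine ⟨hm (hsub (left_mem_Icc.2 hA.lt.le)) (hsub (right_mem_Icc.2 hA.lt.le)) hA.lt, ?_, ?_,
    hF.not_freeOn_map S hm hA.lt hsub hA.right, fun ε hε hf => ?_⟩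
  · rw [← him]
    exact (hF.mapsTo.mono_left hsub).image_subset
  · rw [← him]
    exact hF.freeOn_image S hA.free hsub
  · have := hF.mirror.not_freeOn_map S.mirror (strictMonoOn_mirror hm) (neg_lt_neg hA.lt)
      (by rw [← neg_Icc']; exact neg_subset_neg.2 hsub) hA.mirror.right ε hε
    simp only [neg_neg] at this
    rw [show Icc (-F b) (-F a + ε) = -Icc (F a - ε) (F b) by rw [neg_Icc']; congr 1; ring,
      freeOn_mirror_iff] at this
    exact this hf

omit [TopologicalSpace M] [T2Space M] S in
/-- A maximal interval is determined by its left end. -/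
lemma MaxIcc.right_unique (hA : MaxIcc G γ I a b) (hA' : MaxIcc G γ I a c) : b = c := by
  rcases lt_trichotomy b c with h | h | h
  · refine (hA.right (c - b) (by linarith) ?_).elim
    rw [add_sub_cancel]
    exact hA'.free
  · exact h
  · refine (hA'.right (b - c) (by linarith) ?_).elim
    rw [add_sub_cancel]
    exact hA.free

/-- The maximal continuation `F` for `h` shifts points to the right, and the compact maximal
intervals are the intervals `[x, F x]`. -/
structure PosShift (γ : ℝ → M) (I : Set ℝ) (h : G) (F : ℝ → ℝ) (O : Set ℝ) : Prop where
  comp : IsComp γ I h F O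
  mono : StrictMonoOn F O
  lt : ∀ x ∈ O, x < F x
  max : ∀ x ∈ O, MaxIcc G γ I x (F x)

/-- If `[x, F x]` is free, then it is maximal: `F` and its inverse lead to its neighbors. -/
lemma IsComp.maxIcc_of_freeOn (hI : ¬ FreeOn G γ I I) (hF : IsComp γ I g F O)
    (hm : StrictMonoOn F O) (hx : x ∈ O) (hlt : x < F x) (hfree : FreeOn G γ I (Icc x (F x))) :
    MaxIcc G γ I x (F x) := by
  have hs : Starts γ I x (F x) g F O (F x) := ⟨hF, Or.inl ⟨hm, hx, rfl⟩⟩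
  obtain ⟨F', O', h1, -⟩ := hs.inv S hm
  exact ⟨hlt, S.mem_Icc_subset (hF.subset hx) (hF.mapsTo hx), hfree, hs.not_freeOn S hlt hI,
    h1.not_freeOn S hlt hI⟩

/-- An increasing transition to the right neighbor of a maximal interval `[a, b]` is a shift. -/
lemma Starts.posShift (hI : ¬ FreeOn G γ I I) (hF : Starts γ I a b h F O b)
    (hm : StrictMonoOn F O) (hA : MaxIcc G γ I a b) : PosShift γ I h F O := by
  obtain ⟨haO, rfl⟩ := hF.of_mono hm
  have hlt := hF.1.lt_map S hm haO hA.lt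
  exact ⟨hF.1, hm, hlt, fun x hx => hF.1.maxIcc_of_freeOn S hI hm hx (hlt x hx)
    (hF.1.freeOn_Icc S hI hm hlt haO hA.free hx)⟩

omit [T2Space M] in
/-- The inverse of the shift, for the reversed curve. -/
lemma PosShift.mirror (h₁ : PosShift γ I h F O) : ∃ F' : ℝ → ℝ, (∀ x ∈ O, F' (F x) = x) ∧
    PosShift (fun t => γ (-t)) (-I) h⁻¹ (fun x => -F' (-x)) (-(F '' O)) := by
  obtain ⟨F', hF', hinv, -, -⟩ := h₁.comp.inv S
  refine ⟨F', hinv, hF'.mirror, strictMonoOn_mirror (strictMonoOn_inverse h₁.mono hinv), ?_, ?_⟩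
  · rintro x ⟨y, hy, hyx⟩
    have := h₁.lt y hy
    simp only [← hyx, hinv y hy]
    linarith
  · rintro x ⟨y, hy, hyx⟩
    simp only [← hyx, hinv y hy]
    rw [← neg_neg x, ← hyx]
    exact (h₁.max y hy).mirror

omit [T2Space M] in
/-- The shift takes the left end of each compact maximal interval to its right end. -/
lemma PosShift.eq_of_maxIcc (h₁ : PosShift γ I h F O) (hA : MaxIcc G γ I a b) :
    a ∈ O ∧ F a = b := by
  have haI := hA.sub (left_mem_Icc.2 hA.lt.le)
  have hbI := hA.sub (right_mem_Icc.2 hA.lt.le)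
  have haO : a ∈ O := by
    obtain ⟨x, hx, hbx⟩ := h₁.comp.exists_lt_map S h₁.mono h₁.lt hbI
    by_contra haO
    have hxa : x < a := by
      by_contra hax
      exact haO (h₁.comp.mem_of_le S.ordConnected h₁.mono h₁.lt hx haI (not_lt.1 hax))
    refine hA.left (a - x) (by linarith) ((h₁.max x hx).free.mono ?_)
    rw [sub_sub_cancel]
    exact Icc_subset_Icc_right hbx.le
  exact ⟨haO, (h₁.max a haO).right_unique hA⟩

omit [T2Space M] in
/-- Each point lies in the interior of a compact maximal interval. -/
lemma PosShift.exists_mem_Ioo (h₁ : PosShift γ I h F O) (ht : t ∈ I) :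
    ∃ x ∈ O, t ∈ Ioo x (F x) := by
  obtain ⟨x, hx, htx⟩ := h₁.comp.exists_lt_map S h₁.mono h₁.lt ht
  rcases lt_or_ge x t with hxt | hxt
  · exact ⟨x, hx, hxt, htx⟩
  have htO := h₁.comp.mem_of_le S.ordConnected h₁.mono h₁.lt hx ht hxt
  obtain ⟨y, -, hyt, hy⟩ := isOpen_exists_lt
    (h₁.comp.continuousOn.isOpen_inter_preimage h₁.comp.isOpen (isOpen_Ioi (a := t)))
    ⟨htO, h₁.lt t htO⟩ (sub_one_lt t)
  have := hy (left_mem_Icc.2 hyt.le)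
  exact ⟨y, this.1, hyt, this.2⟩

/-- The shift of a point `b` of the interior of a free interval `D` lies beyond the right end of
`D`. -/
lemma PosShift.exists_right (hI : ¬ FreeOn G γ I I) (h₁ : PosShift γ I h F O) (hu : u ∈ O)
    (hD : FreeOn G γ I D) (hDo : D.OrdConnected) (hDI : D ⊆ I) (hDu : IsGreatest D u)
    (hb : b ∈ interior D) : ∃ c ∈ Ioo u (F u), MaxIcc G γ I b c := by
  have hbu := lt_of_mem_interior_Iic hDu.2 hb
  have hbO := h₁.comp.mem_of_le S.ordConnected h₁.mono h₁.lt hu (hDI (interior_subset hb)) hbu.le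
  refine ⟨F b, ⟨?_, h₁.mono hbO hu hbu⟩, h₁.max b hbO⟩
  by_contra hle
  obtain ⟨y, -, hyb, hy⟩ := isOpen_exists_lt isOpen_interior hb (sub_one_lt b)
  have hyD := hy (left_mem_Icc.2 hyb.le)
  have hyO := h₁.comp.mem_of_le S.ordConnected h₁.mono h₁.lt hbO (hDI (interior_subset hyD)) hyb.le
  have h2 : F y < u := (h₁.mono hyO hbO hyb).trans_le (not_lt.1 hle)
  exact h₁.comp.not_freeOn S hI hyO (h₁.lt y hyO).ne' hDo hyD
    (mem_interior_of_lt hDo (interior_subset hyD) hDu.1 (h₁.lt y hyO) h2) hD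

/-- The tiles to the right are the translates by the powers of the shift. -/
lemma PosShift.tile_right (hI : ¬ FreeOn G γ I I) (h₁ : PosShift γ I h F O) (ha : a ∈ O)
    (ht : Tiles γ I a (F a) d) (hn : 0 < n) (hnd : n ∈ d.index) :
    cls γ I (d.elt n) = cls γ I (h ^ n) ∧ ∃ E Q, Starts γ I a (F a) (d.elt n) E Q (d.pt n) ∧
      StrictMonoOn E Q ∧ E '' (Q ∩ Icc a (F a)) = d.piece I n := by
  have hA := h₁.max a ha
  have hK : Starts γ I a (F a) h F O (F a) := ⟨h₁.comp, Or.inl ⟨h₁.mono, ha, rfl⟩⟩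
  obtain ⟨F', O', hL, -⟩ := hK.inv S h₁.mono
  refine Int.leInduction (motive := fun n _ => n ∈ d.index →
    cls γ I (d.elt n) = cls γ I (h ^ n) ∧ ∃ E Q, Starts γ I a (F a) (d.elt n) E Q (d.pt n) ∧
      StrictMonoOn E Q ∧ E '' (Q ∩ Icc a (F a)) = d.piece I n) ?_ ?_ n
    (show (1 : ℤ) ≤ n by omega) hnd
  · intro hnd
    obtain ⟨E, Q, hE, him⟩ := ht.starts one_pos hnd
    obtain ⟨h2, h3, h4⟩ := Starts.unique S (ht.right ▸ hE) hK hI hA.free ht.lt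
    refine ⟨by rw [h2, zpow_one], E, Q, hE, ?_, him⟩
    rw [h4.congr_strictMonoOn, h3]
    exact h₁.mono
  · intro n hn ih hnd
    have hn0 : 0 < n := by omega
    have hlt := coe_add_one_le.1 ((ht.dec.mem_index (by omega)).1 hnd)
    obtain ⟨h2, E, Q, hE, hm, him⟩ := ih ((ht.dec.mem_index hn0).2 hlt.le)
    obtain ⟨E', Q', hE', him'⟩ := ht.starts (by omega) hnd
    obtain ⟨h3, h4⟩ := (ht.next S hI hA.free hn0 hlt hE him hE' hK hL).1 hm
    refine ⟨?_, E', Q', hE', h4.2 h₁.mono, him'⟩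
    rw [h3, zpow_add_one]
    exact S.cls_mul_right (h₁.comp.germ a ha) h2

lemma PosShift.tile (hI : ¬ FreeOn G γ I I) (h₁ : PosShift γ I h F O) (ha : a ∈ O)
    (ht : Tiles γ I a (F a) d) (hnd : n ∈ d.index) :
    cls γ I (d.elt n) = cls γ I (h ^ n) ∧ ∃ E Q, IsComp γ I (d.elt n) E Q ∧
      StrictMonoOn E Q ∧ E '' (Q ∩ Icc a (F a)) = d.piece I n := by
  rcases lt_or_gt_of_ne hnd.1 with h0 | h0
  · obtain ⟨F', hinv, h₂⟩ := h₁.mirror S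
    have hIm : ¬ FreeOn G (fun t => γ (-t)) (-I) (-I) := by rwa [freeOn_mirror_iff]
    have ht' := ht.mirror
    have hFa : -F' (- -F a) = -a := by rw [neg_neg, hinv a ha]
    rw [← hFa] at ht'
    obtain ⟨h3, E, Q, hE, hm, him⟩ := h₂.tile_right S.mirror hIm (a := -F a)
      (by rw [Set.mem_neg, neg_neg]; exact mem_image_of_mem F ha) ht' (n := -n) (by omega)
      (Splitting.mem_index_mirror.2 (by rwa [neg_neg]))
    rw [hFa, ← neg_Icc'] at him
    rw [Splitting.piece_mirror, neg_neg] at him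
    simp only [Splitting.mirror, neg_neg, inv_zpow', cls_mirror] at h3 hE
    refine ⟨h3, fun x => -E (-x), -Q, by simpa using hE.1.mirror, strictMonoOn_mirror hm, ?_⟩
    have := neg_image_mirror E Q (-F a) (-a)
    rw [neg_neg, neg_neg, ← neg_Icc', him, neg_neg] at this
    exact this
  · obtain ⟨h2, E, Q, hE, hm, him⟩ := h₁.tile_right S hI ha ht h0 hnd
    exact ⟨h2, E, Q, hE.1, hm, him⟩

/-- All tiles but the outer ones are maximal intervals. -/
lemma PosShift.maxIcc_piece_of_nonneg (hI : ¬ FreeOn G γ I I) (h₁ : PosShift γ I h F O)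
    (ha : a ∈ O) (ht : Tiles γ I a (F a) d) (hn : 0 ≤ n) (hlt : (n : WithTop ℤ) < d.hi) :
    ∃ v, d.piece I n = Icc v (d.pt (n + 1)) ∧ MaxIcc G γ I v (d.pt (n + 1)) := by
  rcases hn.eq_or_lt with rfl | hn
  · refine ⟨a, ?_, ?_⟩
    · rw [ht.piece_zero, zero_add, ht.right]
    · rw [zero_add, ht.right]
      exact h₁.max a ha
  · obtain ⟨-, E, Q, hE, hm, him⟩ := h₁.tile_right S hI ha ht hn ((ht.dec.mem_index hn).2 hlt.le)
    obtain ⟨hEnd, hsub⟩ := ht.ends_of_lt S hn hlt hE him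
    refine ⟨d.pt n, Splitting.piece_of_lt hn hlt, ?_⟩
    rw [← (hE.of_mono hm).2, ← (hEnd.of_mono hm).2]
    exact hE.1.maxIcc_map S hm (h₁.max a ha) hsub

/-- Each interior point `b` of the piece after the piece `n ≥ 0` is the right end of a compact
maximal interval that begins in the interior of that piece. -/
lemma PosShift.exists_left_of_piece (hI : ¬ FreeOn G γ I I) (h₁ : PosShift γ I h F O)
    (ha : a ∈ O) (ht : Tiles γ I a (F a) d) (hn : 0 ≤ n) (hlt : (n : WithTop ℤ) < d.hi)
    (hb : b ∈ interior (d.piece I (n + 1))) :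
    ∃ c ∈ interior (d.piece I n), MaxIcc G γ I c b := by
  obtain ⟨v, hv, hmax⟩ := h₁.maxIcc_piece_of_nonneg S hI ha ht hn hlt
  have hn1 : n + 1 ∈ d.index := (ht.dec.mem_index (by omega)).2 (coe_add_one_le.2 hlt)
  obtain ⟨-, E, Q, hE, -, him⟩ := h₁.tile_right S hI ha ht (by omega) hn1
  obtain ⟨hvO, hFv⟩ := h₁.eq_of_maxIcc S hmax
  obtain ⟨F', hinv, h₂⟩ := h₁.mirror S
  have hfree : FreeOn G γ I (d.piece I (n + 1)) := him ▸ hE.1.freeOn_image S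
    ((h₁.max a ha).free.mono inter_subset_right) inter_subset_left
  have hord : (d.piece I (n + 1)).OrdConnected := him ▸ hE.1.ordConnected_image
    (hE.1.ordConnected.inter ordConnected_Icc) inter_subset_left
  have hleast := ht.dec.isLeast_piece (by omega) hn1
  obtain ⟨c, hc, hmc⟩ := h₂.exists_right S.mirror (u := -d.pt (n + 1)) (D := -d.piece I (n + 1))
    (b := -b) (by rwa [freeOn_mirror_iff])
    (by rw [Set.mem_neg, neg_neg, ← hFv]; exact mem_image_of_mem F hvO)
    hfree.mirror
    ⟨fun x hx y hy z hz => hord.out hy hx ⟨neg_le_neg hz.2, neg_le_neg hz.1⟩⟩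
    (neg_subset_neg.2 (ht.piece_subset S (Or.inr hn1)))
    ⟨by rw [Set.mem_neg, neg_neg]; exact hleast.1, fun x hx => by linarith [hleast.2 hx]⟩
    (by rwa [interior_neg_set, Set.mem_neg, neg_neg])
  simp only [neg_neg, ← hFv, hinv v hvO] at hc
  refine ⟨-c, ?_, by simpa using hmc.mirror⟩
  rw [hv, interior_Icc, ← hFv]
  exact ⟨by linarith [hc.2], by linarith [hc.1]⟩

end Positive

/-! ### Negative curves -/

/-- Some element of `G` reflects the curve at `γ c`. -/
def IsReflectionPoint (G : Type*) [Group G] {M : Type*} [MulAction G M] (γ : ℝ → M) (I : Set ℝ)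
    (c : ℝ) : Prop :=
  ∃ (g : G) (F : ℝ → ℝ) (O : Set ℝ), IsComp γ I g F O ∧ StrictAntiOn F O ∧ c ∈ O ∧ F c = c

section Negative

variable {G : Type*} [Group G] {M : Type*} [MulAction G M] {γ : ℝ → M} {I : Set ℝ} {g h k l : G}
  {F F' f E K L : ℝ → ℝ} {O O' A B D P Q : Set ℝ} {s t x y z a b c : ℝ} {d : Splitting G} {n m : ℤ}

lemma IsReflectionPoint.mirror (h : IsReflectionPoint G γ I c) :
    IsReflectionPoint G (fun t => γ (-t)) (-I) (-c) := by
  obtain ⟨g, F, O, hF, hm, hc, hcc⟩ := h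
  exact ⟨g, _, _, hF.mirror, strictAntiOn_mirror hm, by simpa using hc, by simp [hcc]⟩

variable [TopologicalSpace M] [T2Space M] (S : Setting G γ I)
include S

/-- Transitions preserve reflection points: conjugate the reflection. -/
lemma IsReflectionPoint.map (h : IsReflectionPoint G γ I c) (hF : IsComp γ I g F O) (hc : c ∈ O) :
    IsReflectionPoint G γ I (F c) := by
  obtain ⟨k, K, P, hK, hm, hcP, hKc⟩ := h
  obtain ⟨f', hf', hfc, -, hFf⟩ := S.germ_inv (hF.germ c hc)
  have h1 : Germ γ I k K (f' (F c)) := by rw [hfc]; exact hK.germ c hcP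
  have h2 := h1.comp hf'
  have h3 : Germ γ I g F (K (f' (F c))) := by rw [hfc, hKc]; exact hF.germ c hc
  have h4 := h3.comp (f := fun x => K (f' x)) h2
  obtain ⟨E, Q, hE, hcQ, hEe⟩ := S.exists_comp h4
  refine ⟨_, E, Q, hE, ?_, hcQ, ?_⟩
  · rw [hE.strictAntiOn_iff hcQ, hEe.deriv_eq]
    have hd : HasDerivAt (fun x => F (K (f' x)))
        (deriv F c * (deriv K c * deriv f' (F c))) (F c) := by
      have e1 := h1.analyticAt.differentiableAt.hasDerivAt
      have e3 := h3.analyticAt.differentiableAt.hasDerivAt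
      rw [hfc, hKc] at e3
      have := HasDerivAt.comp (F c) (h₂ := F) (h := fun x => K (f' x)) (by rwa [hfc, hKc])
        (HasDerivAt.comp (F c) e1 hf'.analyticAt.differentiableAt.hasDerivAt)
      rwa [hfc] at this
    -- a conjugate of `K` has the same derivative at the fixed point as `K`
    have hd' : deriv F c * deriv f' (F c) = 1 := by
      have e3 : HasDerivAt F (deriv F c) (f' (F c)) := by
        rw [hfc]; exact (hF.germ c hc).analyticAt.differentiableAt.hasDerivAt
      have := (HasDerivAt.comp (F c) e3 hf'.analyticAt.differentiableAt.hasDerivAt).deriv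
      rw [← this, (show F ∘ f' =ᶠ[𝓝 (F c)] id from hFf).deriv_eq, deriv_id]
    rw [hd.deriv, show deriv F c * (deriv K c * deriv f' (F c)) =
      deriv K c * (deriv F c * deriv f' (F c)) by ring, hd', mul_one]
    exact (hK.strictAntiOn_iff hcP).1 hm
  · rw [hEe.eq_of_nhds, hfc, hKc]

/-- A free interval contains no reflection point in its interior. -/
lemma IsReflectionPoint.not_freeOn (h : IsReflectionPoint G γ I c) (hI : ¬ FreeOn G γ I I)
    (hDo : D.OrdConnected) (hc : c ∈ interior D) : ¬ FreeOn G γ I D := by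
  obtain ⟨k, K, P, hK, hm, hcP, hKc⟩ := h
  exact hK.not_freeOn_of_fixed S hI hcP hm hKc hDo hc

/-- A compact maximal interval has increasing translates on both sides, or is bounded by reflection
points on both sides. -/
lemma MaxIcc.pos_or_neg (hA : MaxIcc G γ I a b) (hI : ¬ FreeOn G γ I I) :
    (∃ h F O, PosShift (G := G) γ I h F O) ∨
      IsReflectionPoint G γ I a ∧ IsReflectionPoint G γ I b := by
  obtain ⟨k, K, P, hK, -⟩ := hA.exists_starts S hI
  obtain ⟨l, L, Q, hL, -⟩ := hA.exists_ends S hI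
  rcases hK.1.strictMonoOn_or_strictAntiOn with hm | hm
  · exact Or.inl ⟨k, K, P, hK.posShift S hI hm hA⟩
  rcases hL.1.strictMonoOn_or_strictAntiOn with hm' | hm'
  · obtain ⟨F', O', h1, h2⟩ := hL.inv S hm'
    exact Or.inl ⟨_, _, _, h1.posShift S hI h2 hA⟩
  · exact Or.inr ⟨⟨l, L, Q, hL.1, hm', hL.of_anti hm'⟩, ⟨k, K, P, hK.1, hm, hK.of_anti hm⟩⟩

/-- A curve with a shift has no reflection points, since each point is interior to a free
interval. -/
lemma PosShift.not_isReflectionPoint (h₁ : PosShift γ I h F O) (hI : ¬ FreeOn G γ I I)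
    (hc : IsReflectionPoint G γ I c) : False := by
  have hcI : c ∈ I := by
    obtain ⟨k, K, P, hK, -, hcP, -⟩ := hc
    exact hK.subset hcP
  obtain ⟨x, hx, hcx⟩ := h₁.exists_mem_Ioo S hcI
  exact hc.not_freeOn S hI ordConnected_Icc (by rwa [interior_Icc]) (h₁.max x hx).free

/-- The positive intervals are the compact maximal intervals of a curve with a shift. -/
lemma Setting.isPositiveInterval_iff (hI : ¬ FreeOn G γ I I) :
    IsPositiveInterval G γ I A ↔
      ∃ a b, A = Icc a b ∧ MaxIcc G γ I a b ∧ ∃ h F O, PosShift (G := G) γ I h F O := by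
  constructor
  · rintro ⟨d, hd, h1, -⟩
    obtain ⟨a, b, rfl, hA, ht⟩ := S.tiles_of_isADecomposition hI hd
    refine ⟨a, b, rfl, hA, ?_⟩
    obtain ⟨F, O, hF, him⟩ := ht.starts one_pos ht.dec.one_mem
    have hm := (ht.relatedPos_iff S hI hA.free ht.dec.one_mem hF.1 him).1 h1
    rw [ht.right] at hF
    exact ⟨_, _, _, hF.posShift S hI hm hA⟩
  · rintro ⟨a, b, rfl, hA, h, F, O, h₁⟩
    obtain ⟨haO, rfl⟩ := h₁.eq_of_maxIcc S hA
    obtain ⟨d, ht⟩ := hA.exists_tiles S hI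
    refine ⟨d, ht.isADecomposition S hI hA, ?_, ?_⟩
    · obtain ⟨-, E, Q, hE, hm, him⟩ := h₁.tile S hI haO ht ht.dec.one_mem
      exact ⟨_, _, ht.relatedPosWrt S ht.dec.one_mem hE him hm⟩
    · obtain ⟨-, E, Q, hE, hm, him⟩ := h₁.tile S hI haO ht ht.dec.neg_one_mem
      exact ⟨_, _, ht.relatedPosWrt S ht.dec.neg_one_mem hE him hm⟩

/-- The tiles to the right of an interval bounded by reflection points are alternately decreasing
and increasing translates. -/
lemma Tiles.alternate_right (hI : ¬ FreeOn G γ I I) (hA : FreeOn G γ I (Icc a b))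
    (ha : IsReflectionPoint G γ I a) (hb : IsReflectionPoint G γ I b)
    (ht : Tiles γ I a b d) (hn : 0 < n) (hnd : n ∈ d.index) :
    cls γ I (d.elt n) = cls γ I (d.altProd n) ∧ IsReflectionPoint G γ I (d.pt n) ∧
      ∃ E Q, Starts γ I a b (d.elt n) E Q (d.pt n) ∧ E '' (Q ∩ Icc a b) = d.piece I n ∧
        (Even n → StrictMonoOn E Q) ∧ (Odd n → StrictAntiOn E Q) := by
  obtain ⟨F₁, O₁, hF₁, him₁⟩ := ht.starts one_pos ht.dec.one_mem
  obtain ⟨F₂, O₂, hF₂, him₂⟩ := ht.tile _ ht.dec.neg_one_mem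
  have hE₂ : Ends γ I a b (d.elt (-1)) F₂ O₂ a := by
    rcases ht.starts_or_ends ht.dec.neg_one_mem hF₂ him₂ with ⟨-, h1⟩ | ⟨h1, -⟩
    · norm_num at h1
    · rwa [ht.left] at h1
  have hS₁ : Starts γ I a b (d.elt 1) F₁ O₁ b := by rwa [ht.right] at hF₁
  have hm₁ : StrictAntiOn F₁ O₁ := by
    obtain ⟨k, K, P, hK, hm, hbP, hKb⟩ := hb
    obtain ⟨-, h2, h3⟩ := hS₁.unique S ⟨hK, Or.inr ⟨hm, hbP, hKb⟩⟩ hI hA ht.lt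
    rwa [h3.congr_strictAntiOn, h2]
  have hm₂ : StrictAntiOn F₂ O₂ := by
    obtain ⟨k, K, P, hK, hm, hbP, hKb⟩ := ha
    obtain ⟨-, h2, h3⟩ := hE₂.unique S ⟨hK, Or.inr ⟨hm, hbP, hKb⟩⟩ hI hA ht.lt
    rwa [h3.congr_strictAntiOn, h2]
  refine Int.leInduction (motive := fun n _ => n ∈ d.index →
    cls γ I (d.elt n) = cls γ I (d.altProd n) ∧ IsReflectionPoint G γ I (d.pt n) ∧
      ∃ E Q, Starts γ I a b (d.elt n) E Q (d.pt n) ∧ E '' (Q ∩ Icc a b) = d.piece I n ∧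
        (Even n → StrictMonoOn E Q) ∧ (Odd n → StrictAntiOn E Q)) ?_ ?_ n
    (show (1 : ℤ) ≤ n by omega) hnd
  · intro _
    refine ⟨by simp [Splitting.altProd, Splitting.altSign], by rwa [ht.right], F₁, O₁, hF₁, him₁,
      fun h => ?_, fun _ => hm₁⟩
    exact absurd h (by decide)
  · intro n hn ih hnd
    have hn0 : 0 < n := by omega
    have hlt := coe_add_one_le.1 ((ht.dec.mem_index (by omega)).1 hnd)
    obtain ⟨h2, -, E, Q, hE, him, hev, hodd⟩ := ih ((ht.dec.mem_index hn0).2 hlt.le)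
    obtain ⟨E', Q', hE', him'⟩ := ht.starts (by omega) hnd
    obtain ⟨h3, h4⟩ := ht.next S hI hA hn0 hlt hE him hE' hS₁ hE₂
    obtain ⟨hEnd, -⟩ := ht.ends_of_lt S hn0 hlt hE him
    -- the next tile arises from the right neighbor if `n` is even, and from the left neighbor if
    -- `n` is odd
    have halt : d.altProd (n + 1) = d.altProd n * d.elt (Splitting.altSign (n + 1)) := by
      obtain ⟨j, rfl⟩ : ∃ j : ℕ, n = j := ⟨n.toNat, by omega⟩
      have hs1 : ((j : ℤ) + 1).sign = 1 := Int.sign_eq_one_of_pos (by omega)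
      have hs2 : (j : ℤ).sign = 1 := Int.sign_eq_one_of_pos (by omega)
      have hj1 : ((j : ℤ) + 1).natAbs = j + 1 := by omega
      rw [Splitting.altProd, Splitting.altProd, hj1, Int.natAbs_natCast, List.range_succ,
        List.map_append, List.prod_append, hs1, hs2]
      simp
    obtain ⟨z, hz⟩ := hF₁.nonempty ht.lt
    obtain ⟨z', hz'⟩ := hE₂.nonempty ht.lt
    rcases Int.even_or_odd n with hpar | hpar
    · have hm := hev hpar
      obtain ⟨h5, h6⟩ := h3 hm
      have hodd' : Odd (n + 1) := hpar.add_one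
      have hsign : Splitting.altSign (n + 1) = 1 := by
        rw [Splitting.altSign, if_pos (by omega), add_sub_cancel_right,
          (Int.natAbs_even.2 hpar).neg_one_pow]
      refine ⟨?_, ?_, E', Q', hE', him', fun h => (Int.not_even_iff_odd.2 hodd' h).elim,
        fun _ => ?_⟩
      · rw [h5, halt, hsign]
        exact S.cls_mul_right (hF₁.1.germ z hz.1) h2
      · obtain ⟨h7, h8⟩ := hEnd.of_mono hm
        rw [← h8]
        exact hb.map S hE.1 h7
      · refine hE'.1.strictMonoOn_or_strictAntiOn.resolve_left fun h => ?_
        exact hF₁.1.not_mono_anti (h6.1 h) hm₁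
    · have hm := hodd hpar
      obtain ⟨h5, h6⟩ := h4 hm
      have hev' : Even (n + 1) := hpar.add_one
      have hsign : Splitting.altSign (n + 1) = -1 := by
        rw [Splitting.altSign, if_pos (by omega), add_sub_cancel_right,
          (Int.natAbs_odd.2 hpar).neg_one_pow]
      refine ⟨?_, ?_, E', Q', hE', him', fun _ => h6.2 hm₂,
        fun h => (Int.not_even_iff_odd.2 h hev').elim⟩
      · rw [h5, halt, hsign]
        exact S.cls_mul_right (hE₂.1.germ z' hz'.1) h2
      · obtain ⟨h7, h8⟩ := hEnd.of_anti hm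
        rw [← h8]
        exact ha.map S hE.1 h7

lemma Tiles.alternate (hI : ¬ FreeOn G γ I I) (hA : FreeOn G γ I (Icc a b))
    (ha : IsReflectionPoint G γ I a) (hb : IsReflectionPoint G γ I b)
    (ht : Tiles γ I a b d) (hnd : n ∈ d.index) :
    cls γ I (d.elt n) = cls γ I (d.altProd n) ∧ IsReflectionPoint G γ I (d.pt n) ∧
      ∃ E Q, IsComp γ I (d.elt n) E Q ∧ E '' (Q ∩ Icc a b) = d.piece I n ∧
        (Even n → StrictMonoOn E Q) ∧ (Odd n → StrictAntiOn E Q) := by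
  rcases lt_or_gt_of_ne hnd.1 with h0 | h0
  · obtain ⟨h1, h2, E, Q, hE, him, h3, h4⟩ := ht.mirror.alternate_right S.mirror
      (by rwa [freeOn_mirror_iff]) (by rw [← neg_Icc']; exact hA.mirror) hb.mirror ha.mirror
      (n := -n) (by omega) (Splitting.mem_index_mirror.2 (by rwa [neg_neg]))
    rw [Splitting.altProd_mirror _ (by omega), cls_mirror, neg_neg] at h1
    rw [Splitting.piece_mirror, neg_neg] at him
    simp only [Splitting.mirror, neg_neg] at h1 h2 hE
    refine ⟨h1, by simpa using h2.mirror, fun x => -E (-x), -Q, by simpa using hE.1.mirror, ?_,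
      fun h => strictMonoOn_mirror (h3 (by simpa using h)),
      fun h => strictAntiOn_mirror (h4 (by simpa using h))⟩
    have := neg_image_mirror E Q (-b) (-a)
    rw [neg_neg, neg_neg, him, neg_neg] at this
    exact this
  · obtain ⟨h1, h2, E, Q, hE, h3⟩ := ht.alternate_right S hI hA ha hb h0 hnd
    exact ⟨h1, h2, E, Q, hE.1, h3⟩

/-- The negative intervals are the compact maximal intervals bounded by reflection points. -/
lemma Setting.isNegativeInterval_iff (hI : ¬ FreeOn G γ I I) :
    IsNegativeInterval G γ I A ↔ ∃ a b, A = Icc a b ∧ MaxIcc G γ I a b ∧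
      IsReflectionPoint G γ I a ∧ IsReflectionPoint G γ I b := by
  constructor
  · rintro ⟨d, hd, h1, h2⟩
    obtain ⟨a, b, rfl, hA, ht⟩ := S.tiles_of_isADecomposition hI hd
    refine ⟨a, b, rfl, hA, ?_, ?_⟩
    · obtain ⟨F, O, hF, him⟩ := ht.tile _ ht.dec.neg_one_mem
      have hm := (ht.relatedNeg_iff S hI hA.free ht.dec.neg_one_mem hF him).1 h2
      rcases ht.starts_or_ends ht.dec.neg_one_mem hF him with ⟨-, h3⟩ | ⟨hE, -⟩
      · norm_num at h3
      · exact ⟨_, _, _, hF, hm, (ht.left ▸ hE : Ends γ I a b _ F O a).of_anti hm⟩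
    · obtain ⟨F, O, hF, him⟩ := ht.starts one_pos ht.dec.one_mem
      have hm := (ht.relatedNeg_iff S hI hA.free ht.dec.one_mem hF.1 him).1 h1
      rw [ht.right] at hF
      exact ⟨_, _, _, hF.1, hm, hF.of_anti hm⟩
  · rintro ⟨a, b, rfl, hA, ha, hb⟩
    obtain ⟨d, ht⟩ := hA.exists_tiles S hI
    refine ⟨d, ht.isADecomposition S hI hA, ?_, ?_⟩
    · obtain ⟨-, -, E, Q, hE, him, -, hm⟩ := ht.alternate S hI hA.free ha hb ht.dec.one_mem
      exact ⟨_, _, ht.relatedNegWrt S ht.dec.one_mem hE him (hm (by decide))⟩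
    · obtain ⟨-, -, E, Q, hE, him, -, hm⟩ := ht.alternate S hI hA.free ha hb ht.dec.neg_one_mem
      exact ⟨_, _, ht.relatedNegWrt S ht.dec.neg_one_mem hE him (hm (by decide))⟩

/-- A free interval cannot pass a splitting point. -/
lemma Tiles.mem_piece_of_lt (hI : ¬ FreeOn G γ I I) (ht : Tiles γ I a b d)
    (hpt : ∀ i ∈ d.index, IsReflectionPoint G γ I (d.pt i)) (hD : FreeOn G γ I D)
    (hDo : D.OrdConnected) (hDI : D ⊆ I) (hs : s ∈ D) (hn : n ∈ d.index₀)
    (hsn : s ∈ interior (d.piece I n)) (hx : x ∈ D) (hsx : s < x) : x ∈ d.piece I n := by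
  by_contra hxn
  -- points of `D` between `s` and `x` outside of the piece give a splitting point inside of `D`
  obtain ⟨y, hy, hyn⟩ : ∃ y ∈ Ioo s x, y ∉ d.piece I n := by
    by_contra! hall
    refine hxn (d.mem_piece_of_mem_closure (hDI hx) (closure_mono hall ?_))
    rw [closure_Ioo hsx.ne]
    exact right_mem_Icc.2 hsx.le
  have hyD : y ∈ D := hDo.out hs hx (Ioo_subset_Icc_self hy)
  obtain ⟨m, hm, hym⟩ := ht.cover S (hDI hyD)
  have hsn' := interior_subset hsn
  rcases lt_trichotomy n m with hnm | rfl | hnm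
  · obtain ⟨z, hz, hsz⟩ := mem_nhdsGE_iff_exists_Icc_subset.1
      (mem_nhdsWithin_of_mem_nhds (mem_interior_iff_mem_nhds.1 hsn))
    obtain ⟨i, hi, h1, h2⟩ := ht.dec.exists_pt_between hn hm hnm
      (hsz (right_mem_Icc.2 (le_of_lt hz))) hym
    exact (hpt i hi).not_freeOn S hI hDo (mem_interior_of_lt hDo hs hx (lt_of_lt_of_le hz h1)
      (h2.trans_lt hy.2)) hD
  · exact hyn hym
  · exact hy.1.not_ge (ht.dec.piece_le hm hn hnm hym hsn')

/-- If all splitting points are reflection points, then each free interval lies in a single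
piece. -/
lemma Tiles.exists_subset_piece (hI : ¬ FreeOn G γ I I) (ht : Tiles γ I a b d)
    (hpt : ∀ i ∈ d.index, IsReflectionPoint G γ I (d.pt i)) (hD : FreeOn G γ I D)
    (hDi : IsInterval D) (hDI : D ⊆ I) : ∃ n ∈ d.index₀, D ⊆ d.piece I n := by
  obtain ⟨n, hn, s, hs, hsn⟩ : ∃ n ∈ d.index₀, ∃ s ∈ interior D, s ∈ interior (d.piece I n) := by
    obtain ⟨s, hs⟩ := hDi.2
    obtain ⟨n, hn, hsn⟩ := ht.cover S (hDI (interior_subset hs))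
    obtain ⟨hord, hne⟩ := ht.isInterval_piece S hn
    have hint : s ∈ closure (interior (d.piece I n)) := by
      rw [(hord.convex : Convex ℝ _).closure_interior_eq_closure_of_nonempty_interior hne]
      exact subset_closure hsn
    obtain ⟨y, hy1, hy2⟩ := mem_closure_iff_nhds.1 hint _ (isOpen_interior.mem_nhds hs)
    exact ⟨n, hn, y, hy1, hy2⟩
  have hs' := interior_subset hs
  refine ⟨n, hn, fun x hx => ?_⟩
  rcases lt_trichotomy s x with hsx | rfl | hsx
  · exact ht.mem_piece_of_lt S hI hpt hD hDi.1 hDI hs' hn hsn hx hsx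
  · exact interior_subset hsn
  · have := ht.mirror.mem_piece_of_lt S.mirror (by rwa [freeOn_mirror_iff])
      (fun i hi => (hpt _ (Splitting.mem_index_mirror.1 hi)).mirror) hD.mirror
      ⟨fun x hx y hy z hz => hDi.1.out hy hx ⟨neg_le_neg hz.2, neg_le_neg hz.1⟩⟩
      (neg_subset_neg.2 hDI) (s := -s) (by rwa [Set.mem_neg, neg_neg]) (n := -n)
      (Splitting.mem_index₀_mirror.2 (by rwa [neg_neg]))
      (by rwa [Splitting.piece_mirror, interior_neg_set, Set.mem_neg, neg_neg, neg_neg])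
      (x := -x) (by rwa [Set.mem_neg, neg_neg]) (neg_lt_neg hsx)
    rwa [Splitting.piece_mirror, Set.mem_neg, neg_neg, neg_neg] at this

lemma Tiles.isFreeSegment_piece (hA : FreeOn G γ I (Icc a b)) (ht : Tiles γ I a b d)
    (hn : n ∈ d.index₀) : IsFreeSegment G γ (d.piece I n) := by
  obtain ⟨E, Q, hE, him, -⟩ := ht.exists_isTransition S hn
  refine (S.isFreeSegment_iff (ht.piece_subset S hn)).2 ⟨ht.isInterval_piece S hn, ?_⟩
  rw [← him]
  exact hE.freeOn_image S (hA.mono inter_subset_right) inter_subset_left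

/-- If all splitting points are reflection points, then the maximal intervals are the pieces. -/
lemma Tiles.isMaximalInterval_iff (hI : ¬ FreeOn G γ I I) (hA : FreeOn G γ I (Icc a b))
    (ht : Tiles γ I a b d) (hpt : ∀ i ∈ d.index, IsReflectionPoint G γ I (d.pt i)) :
    IsMaximalInterval G γ I B ↔ ∃ n ∈ d.index₀, B = d.piece I n := by
  have hsub : ∀ D ⊆ I, IsFreeSegment G γ D → ∃ n ∈ d.index₀, D ⊆ d.piece I n := fun D hDI hD =>
    ht.exists_subset_piece S hI hpt ((S.isFreeSegment_iff hDI).1 hD).2 hD.1 hDI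
  constructor
  · rintro ⟨hBI, hB, hmax⟩
    obtain ⟨n, hn, hBn⟩ := hsub B hBI hB
    exact ⟨n, hn, (hmax _ (ht.piece_subset S hn) (ht.isFreeSegment_piece S hA hn) hBn).symm⟩
  · rintro ⟨n, hn, rfl⟩
    refine ⟨ht.piece_subset S hn, ht.isFreeSegment_piece S hA hn, fun A' hA'I hA' hnA' => ?_⟩
    obtain ⟨m, hm, hA'm⟩ := hsub A' hA'I hA'
    obtain ⟨x, hx⟩ := (ht.isInterval_piece S hn).2
    obtain rfl := ht.dec.eq_of_mem_piece hn hm hx (hA'm (hnA' (interior_subset hx)))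
    exact hA'm.antisymm hnA'

end Negative

/-! ### Curves without compact maximal intervals -/

/-- The interval `A` is maximal among the free intervals in `I`, in terms of germs. -/
structure MaxFree (G : Type*) [Group G] {M : Type*} [MulAction G M] (γ : ℝ → M) (I A : Set ℝ) :
    Prop where
  sub : A ⊆ I
  interval : IsInterval A
  free : FreeOn G γ I A
  max : ∀ A' ⊆ I, A'.OrdConnected → FreeOn G γ I A' → A ⊆ A' → A' ⊆ A

/-- The curve is free on both sides of the reflection point `τ`. -/
structure FreeSides (G : Type*) [Group G] {M : Type*} [MulAction G M] (γ : ℝ → M) (I : Set ℝ)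
    (τ : ℝ) : Prop where
  mem : τ ∈ I
  reflection : IsReflectionPoint G γ I τ
  left : FreeOn G γ I (I ∩ Iic τ)
  right : FreeOn G γ I (I ∩ Ici τ)

section Half

variable {G : Type*} [Group G] {M : Type*} [MulAction G M] {γ : ℝ → M} {I : Set ℝ} {g h k l : G}
  {F F' f e E μ ρ : ℝ → ℝ} {O A B D J J' Q : Set ℝ} {s t x y z p a b c u v τ τ' : ℝ}

lemma ordConnected_neg (hD : D.OrdConnected) : (-D).OrdConnected :=
  ⟨fun _ hx _ hy _ hz => hD.out hy hx ⟨neg_le_neg hz.2, neg_le_neg hz.1⟩⟩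

lemma IsInterval.neg (hD : IsInterval D) : IsInterval (-D) := by
  refine ⟨ordConnected_neg hD.1, ?_⟩
  rw [interior_neg_set]
  exact hD.2.neg

lemma MaxFree.mirror (h : MaxFree G γ I A) : MaxFree G (fun t => γ (-t)) (-I) (-A) := by
  refine ⟨neg_subset_neg.2 h.sub, h.interval.neg, h.free.mirror, fun A' h1 h2 h3 h4 => ?_⟩
  rw [← neg_neg A', freeOn_mirror_iff] at h3
  have := h.max (-A') (by rwa [← neg_subset_neg, neg_neg]) (ordConnected_neg h2) h3
    (by rwa [← neg_subset_neg, neg_neg])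
  rwa [← neg_subset_neg, neg_neg]

lemma FreeSides.mirror (h : FreeSides G γ I τ) : FreeSides G (fun t => γ (-t)) (-I) (-τ) := by
  have e1 : -I ∩ Iic (-τ) = -(I ∩ Ici τ) := by ext; simp
  have e2 : -I ∩ Ici (-τ) = -(I ∩ Iic τ) := by ext; simp
  exact ⟨by simpa using h.mem, h.reflection.mirror, e1 ▸ h.right.mirror, e2 ▸ h.left.mirror⟩

/-- A free interval with non-empty interior lies in a maximal one. -/
lemma FreeOn.exists_maxFree (hD : FreeOn G γ I D) (hDi : IsInterval D) (hDI : D ⊆ I) :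
    ∃ A, MaxFree G γ I A ∧ D ⊆ A := by
  obtain ⟨A, hDA, ⟨hAI, hAo, hA⟩, hmax⟩ := zorn_subset_nonempty
    {A : Set ℝ | A ⊆ I ∧ A.OrdConnected ∧ FreeOn G γ I A} (fun c hc hchain hne => by
      have hpair : ∀ {x y}, x ∈ ⋃₀ c → y ∈ ⋃₀ c → ∃ A ∈ c, x ∈ A ∧ y ∈ A := by
        rintro x y ⟨A₁, h1, hx⟩ ⟨A₂, h2, hy⟩
        rcases hchain.total h1 h2 with h | h
        · exact ⟨A₂, h2, h hx, hy⟩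
        · exact ⟨A₁, h1, hx, h hy⟩
      have hint : ∀ {x}, x ∈ interior (⋃₀ c) → ∃ A ∈ c, x ∈ interior A := by
        intro x hx
        obtain ⟨u, hxu, hu⟩ := mem_nhdsGE_iff_exists_Icc_subset.1
          (mem_nhdsWithin_of_mem_nhds (mem_interior_iff_mem_nhds.1 hx))
        obtain ⟨l, hlx, hl⟩ := mem_nhdsLE_iff_exists_Icc_subset.1
          (mem_nhdsWithin_of_mem_nhds (mem_interior_iff_mem_nhds.1 hx))
        obtain ⟨A, hA, h1, h2⟩ := hpair (hl (left_mem_Icc.2 (le_of_lt hlx)))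
          (hu (right_mem_Icc.2 (le_of_lt hxu)))
        exact ⟨A, hA, mem_interior_of_lt (hc hA).2.1 h1 h2 hlx hxu⟩
      refine ⟨⋃₀ c, ⟨sUnion_subset fun A hA => (hc hA).1, ⟨fun x hx y hy => ?_⟩, ?_⟩,
        fun A hA => subset_sUnion_of_mem hA⟩
      · obtain ⟨A, hA, h1, h2⟩ := hpair hx hy
        exact ((hc hA).2.1.out h1 h2).trans (subset_sUnion_of_mem hA)
      · intro g f s hf hs hfs
        obtain ⟨A₁, h1, hs⟩ := hint hs
        obtain ⟨A₂, h2, hfs⟩ := hint hfs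
        rcases hchain.total h1 h2 with h | h
        · exact (hc h2).2.2 g f s hf (interior_mono h hs) hfs
        · exact (hc h1).2.2 g f s hf hs (interior_mono h hfs)) D ⟨hDI, hDi.1, hD⟩
  exact ⟨A, ⟨hAI, ⟨hAo, hDi.2.mono (interior_mono hDA)⟩, hA,
    fun A' h1 h2 h3 h4 => hmax ⟨h1, h2, h3⟩ h4⟩, hDA⟩

variable [TopologicalSpace M] (S : Setting G γ I)
include S

/-- Maximal free intervals are closed in `I`, since freeness only concerns the interior. -/
lemma MaxFree.mem_of_mem_closure (h : MaxFree G γ I A) (ht : t ∈ I) (htA : t ∈ closure A) :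
    t ∈ A := by
  have hcv : Convex ℝ A := h.interval.1.convex
  refine h.max (I ∩ closure A) inter_subset_left
    (S.ordConnected.inter hcv.closure.ordConnected) (fun g f s hf hs hfs => ?_)
    (fun x hx => ⟨h.sub hx, subset_closure hx⟩) ⟨ht, htA⟩
  have hsub : interior (I ∩ closure A) ⊆ interior A := by
    rw [← hcv.interior_closure_eq_interior_of_nonempty_interior h.interval.2]
    exact interior_mono inter_subset_right
  exact h.free g f s hf (hsub hs) (hsub hfs)

/-- A maximal free interval that does not reach the right end of `I` has a greatest element. -/
lemma MaxFree.exists_isGreatest (h : MaxFree G γ I A) (hx : x ∈ I) (hxA : x ∉ A) (hy : y ∈ A)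
    (hyx : y < x) : ∃ b, IsGreatest A b := by
  have hle : ∀ z ∈ A, z ≤ x := by
    intro z hz
    by_contra hxz
    exact hxA (h.interval.1.out hy hz ⟨hyx.le, (not_le.1 hxz).le⟩)
  have hbd : BddAbove A := ⟨x, hle⟩
  have hcl := csSup_mem_closure ⟨y, hy⟩ hbd
  refine ⟨sSup A, h.mem_of_mem_closure S (S.mem_Icc_subset (h.sub hy) hx ?_) hcl,
    fun z hz => le_csSup hbd hz⟩
  exact ⟨le_csSup hbd hy, csSup_le ⟨y, hy⟩ hle⟩

lemma MaxFree.exists_isLeast (h : MaxFree G γ I A) (hx : x ∈ I) (hxA : x ∉ A) (hy : y ∈ A)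
    (hxy : x < y) : ∃ a, IsLeast A a := by
  obtain ⟨b, hb, hle⟩ := h.mirror.exists_isGreatest S.mirror (x := -x) (y := -y) (by simpa using hx)
    (by simpa using hxA) (by simpa using hy) (neg_lt_neg hxy)
  exact ⟨-b, hb, fun z hz => by linarith [hle (show -z ∈ -A by simpa using hz)]⟩

variable [T2Space M]

lemma MaxFree.maxIcc (h : MaxFree G γ I A) (ha : IsLeast A a) (hb : IsGreatest A b) :
    MaxIcc G γ I a b := by
  have hA : A = Icc a b := Subset.antisymm (fun x hx => ⟨ha.2 hx, hb.2 hx⟩)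
    (h.interval.1.out ha.1 hb.1)
  subst hA
  have hlt : a < b := by
    obtain ⟨x, hx⟩ := h.interval.2
    rw [interior_Icc] at hx
    exact hx.1.trans hx.2
  refine S.isMaximalInterval_Icc_iff.1 ⟨hlt, h.sub, (S.isFreeSegment_iff h.sub).2
    ⟨h.interval, h.free⟩, fun A' hA' hf hsub => ?_⟩
  obtain ⟨h1, h2⟩ := (S.isFreeSegment_iff hA').1 hf
  exact (h.max A' hA' h1.1 h2 hsub).antisymm hsub

/-- If the neighboring translate of `I ∩ Iic b` is increasing, then `[x, F x]` is free for points
`x` close to the place where `F` takes the value `b`. -/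
lemma MaxFree.exists_maxIcc_of_mono (hI : ¬ FreeOn G γ I I) (h : MaxFree G γ I A)
    (hb : IsGreatest A b) (hF : IsComp γ I g F O) (hm : StrictMonoOn F O)
    (hne : (O ∩ interior A).Nonempty) (hgt : F '' (O ∩ interior A) ⊆ Ioi b)
    (hinf : ∀ ε > 0, ∃ y ∈ F '' (O ∩ interior A), y < b + ε) : ∃ x y, MaxIcc G γ I x y := by
  obtain ⟨x, hx, hxA⟩ := hne
  have hxb := lt_of_mem_interior_Iic hb.2 hxA
  have hbF : b < F x := hgt ⟨x, ⟨hx, hxA⟩, rfl⟩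
  refine ⟨x, F x, hF.maxIcc_of_freeOn S hI hm hx (hxb.trans hbF) ?_⟩
  obtain ⟨F', hF', hinv, -, -⟩ := hF.inv S
  refine S.freeOn_of_transfer hI h.free h.interval.1 (p := b) (U₁ := Ioo x b) (U₂ := Ioo b (F x))
    (k := g⁻¹) (e := F') ?_ ?_ ?_
  · intro z hz hzb
    rw [interior_Icc] at hz
    rcases lt_or_gt_of_ne hzb with h1 | h1
    · exact Or.inl ⟨hz.1, h1⟩
    · exact Or.inr ⟨h1, hz.2⟩
  · exact fun z hz => mem_interior_of_lt h.interval.1 (interior_subset hxA) hb.1 hz.1 hz.2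
  · intro z hz
    obtain ⟨_, ⟨w, hw, rfl⟩, hwz⟩ := hinf (z - b) (by linarith [hz.1])
    have hord := hF.ordConnected_image (U := O ∩ interior A)
      (hF.ordConnected.inter (ordConnected_interior h.interval.1)) inter_subset_left
    obtain ⟨v, hv, rfl⟩ := hord.out ⟨w, hw, rfl⟩ ⟨x, ⟨hx, hxA⟩, rfl⟩
      (show z ∈ Icc (F w) (F x) from ⟨by linarith, hz.2.le⟩)
    rw [hinv v hv.1]
    exact ⟨hF'.germ _ ⟨v, hv.1, rfl⟩, hv.2, fun h3 =>
      absurd ((hm.lt_iff_lt hv.1 hx).1 hz.2) (not_lt.2 h3.1.le)⟩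

/-- Without compact maximal intervals, a maximal free interval that ends inside of `I` is one of
the two sides of a reflection point. -/
lemma MaxFree.exists_freeSides_of_gt (hI : ¬ FreeOn G γ I I) (hno : ∀ a b, ¬ MaxIcc G γ I a b)
    (h : MaxFree G γ I A) (hx : x ∈ I) (hxA : x ∉ A) (hy : y ∈ A) (hyx : y < x) :
    ∃ τ, FreeSides G γ I τ := by
  obtain ⟨b, hb⟩ := h.exists_isGreatest S hx hxA hy hyx
  have hAeq : A = I ∩ Iic b := by
    refine Subset.antisymm (fun z hz => ⟨h.sub hz, hb.2 hz⟩) fun z hz => ?_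
    by_contra hzA
    rcases (show z ≤ b from hz.2).lt_or_eq with hlt | rfl
    · obtain ⟨a, ha⟩ := h.exists_isLeast S hz.1 hzA hb.1 hlt
      exact hno a b (h.maxIcc S ha hb)
    · exact hzA hb.1
  have hbI := h.sub hb.1
  obtain ⟨g, F, O, hF, -, hne, hgt, hinf⟩ := S.exists_right_neighbor hI h.free h.interval.1 h.sub hb
    h.interval.2 fun ε hε hf => by
      obtain ⟨c, hbc, hcε, hc⟩ := isOpen_exists_gt S.isOpen hbI (show b < b + ε by linarith)
      have hcI := hc (right_mem_Icc.2 hbc.le)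
      have hsub : I ∩ Iic c ⊆ A ∪ Icc b (b + ε) := by
        intro z hz
        rcases le_total z b with h1 | h1
        · exact Or.inl (hAeq ▸ ⟨hz.1, h1⟩)
        · exact Or.inr ⟨h1, (show z ≤ c from hz.2).trans hcε.le⟩
      have := h.max (I ∩ Iic c) inter_subset_left (S.ordConnected.inter ordConnected_Iic)
        (hf.mono hsub) (by rw [hAeq]; exact inter_subset_inter_right _ (Iic_subset_Iic.2 hbc.le))
      exact (hb.2 (this ⟨hcI, self_mem_Iic⟩)).not_gt hbc
  rcases hF.strictMonoOn_or_strictAntiOn with hm | ha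
  · obtain ⟨a, c, hac⟩ := h.exists_maxIcc_of_mono S hI hb hF hm hne hgt hinf
    exact (hno a c hac).elim
  obtain ⟨hbO, hFb⟩ := hF.fixed_of_neighbor S ha h.interval.1 h.sub hb hne hgt hinf
  have hrefl : IsReflectionPoint G γ I b := ⟨g, F, O, hF, ha, hbO, hFb⟩
  refine ⟨b, hbI, hrefl, hAeq ▸ h.free, ?_⟩
  -- the reflected interval lies in a maximal free interval on the other side of `b`
  have himI : F '' (O ∩ A) ⊆ I := (hF.mapsTo.mono_left inter_subset_left).image_subset
  -- it begins at the reflection point `b`, and would be a compact maximal interval if it did not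
  -- reach the right end of `I`
  obtain ⟨A', hA', hsub⟩ := (hF.freeOn_image S (h.free.mono inter_subset_right)
    inter_subset_left : FreeOn G γ I (F '' (O ∩ A))).exists_maxFree
    ⟨hF.ordConnected_image (hF.ordConnected.inter h.interval.1) inter_subset_left, by
      rw [hF.interior_image inter_subset_left, interior_inter, hF.isOpen.interior_eq]
      exact hne.image F⟩ himI
  have hbA' : b ∈ A' := hsub ⟨b, ⟨hbO, hb.1⟩, hFb⟩
  obtain ⟨w, hw⟩ := hne
  have hwA' : F w ∈ A' := hsub ⟨w, ⟨hw.1, interior_subset hw.2⟩, rfl⟩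
  have hbw : b < F w := hgt ⟨w, hw, rfl⟩
  have hleast : IsLeast A' b := by
    refine ⟨hbA', fun z hz => ?_⟩
    by_contra hzb
    exact hrefl.not_freeOn S hI hA'.interval.1 (mem_interior_of_lt hA'.interval.1 hz hwA'
      (not_le.1 hzb) hbw) hA'.free
  refine hA'.free.mono fun z hz => ?_
  by_contra hzA'
  have hbz : b < z := lt_of_le_of_ne hz.2 fun h => hzA' (h ▸ hbA')
  obtain ⟨c, hc⟩ := hA'.exists_isGreatest S hz.1 hzA' hbA' hbz
  exact hno b c (hA'.maxIcc S hleast hc)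

/-- Without compact maximal intervals, a curve that is free but not a free segment consists of
two free halves meeting in a reflection point. -/
lemma FreeOn.exists_freeSides (hI : ¬ FreeOn G γ I I) (hno : ∀ a b, ¬ MaxIcc G γ I a b)
    (hD : FreeOn G γ I D) (hDi : IsInterval D) (hDI : D ⊆ I) : ∃ τ, FreeSides G γ I τ := by
  obtain ⟨A, hA, -⟩ := hD.exists_maxFree hDi hDI
  obtain ⟨x, hx, hxA⟩ : ∃ x ∈ I, x ∉ A := by
    by_contra! hall
    exact hI (hA.free.mono hall)
  obtain ⟨y, hy⟩ := hA.interval.2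
  replace hy := interior_subset hy
  rcases lt_trichotomy y x with h1 | rfl | h1
  · exact hA.exists_freeSides_of_gt S hI hno hx hxA hy h1
  · exact (hxA hy).elim
  · obtain ⟨τ, hτ⟩ := hA.mirror.exists_freeSides_of_gt S.mirror (by rwa [freeOn_mirror_iff])
      (fun a b hab => hno (-b) (-a) (by simpa using hab.mirror)) (x := -x) (y := -y)
      (by simpa using hx) (by simpa using hxA) (by simpa using hy) (neg_lt_neg h1)
    exact ⟨-τ, by simpa using hτ.mirror⟩

/-! ### Decompositions at a reflection point -/

lemma FreeSides.isMaximalInterval_iff (hI : ¬ FreeOn G γ I I) (h : FreeSides G γ I τ) :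
    IsMaximalInterval G γ I B ↔ B = I ∩ Iic τ ∨ B = I ∩ Ici τ := by
  obtain ⟨y, hy, hτy⟩ := S.exists_gt h.mem
  obtain ⟨x, hx, hxτ⟩ := S.exists_lt h.mem
  have hI1 : IsInterval (I ∩ Iic τ) := ⟨S.ordConnected.inter ordConnected_Iic, by
    obtain ⟨z, hxz, hz⟩ := exists_between hxτ
    exact ⟨z, mem_interior_of_lt (S.ordConnected.inter ordConnected_Iic) ⟨hx, hxτ.le⟩
      ⟨h.mem, self_mem_Iic⟩ hxz hz⟩⟩
  have hI2 : IsInterval (I ∩ Ici τ) := ⟨S.ordConnected.inter ordConnected_Ici, by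
    obtain ⟨z, hxz, hz⟩ := exists_between hτy
    exact ⟨z, mem_interior_of_lt (S.ordConnected.inter ordConnected_Ici) ⟨h.mem, self_mem_Ici⟩
      ⟨hy, hτy.le⟩ hxz hz⟩⟩
  have f1 := (S.isFreeSegment_iff inter_subset_left).2 ⟨hI1, h.left⟩
  have f2 := (S.isFreeSegment_iff inter_subset_left).2 ⟨hI2, h.right⟩
  have hsub : ∀ D ⊆ I, IsFreeSegment G γ D → D ⊆ I ∩ Iic τ ∨ D ⊆ I ∩ Ici τ := by
    intro D hDI hD
    obtain ⟨hDi, hD⟩ := (S.isFreeSegment_iff hDI).1 hD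
    by_contra! hcon
    obtain ⟨h1, h2⟩ := hcon
    obtain ⟨p, hp, hp'⟩ := not_subset.1 h1
    obtain ⟨q, hq, hq'⟩ := not_subset.1 h2
    have hp1 : τ < p := not_le.1 fun h => hp' ⟨hDI hp, h⟩
    have hq1 : q < τ := not_le.1 fun h => hq' ⟨hDI hq, h⟩
    exact h.reflection.not_freeOn S hI hDi.1 (mem_interior_of_lt hDi.1 hq hp hq1 hp1) hD
  constructor
  · rintro ⟨hBI, hB, hmax⟩
    rcases hsub B hBI hB with h1 | h1
    · exact Or.inl (hmax _ inter_subset_left f1 h1).symm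
    · exact Or.inr (hmax _ inter_subset_left f2 h1).symm
  · rintro (rfl | rfl)
    · refine ⟨inter_subset_left, f1, fun A' h1 h2 h3 => ?_⟩
      rcases hsub A' h1 h2 with h4 | h4
      · exact h4.antisymm h3
      · exact absurd (h4 (h3 ⟨hx, hxτ.le⟩)).2 (not_le.2 hxτ)
    · refine ⟨inter_subset_left, f2, fun A' h1 h2 h3 => ?_⟩
      rcases hsub A' h1 h2 with h4 | h4
      · exact absurd (h4 (h3 ⟨hy, hτy.le⟩)).2 (not_le.2 hτy)
      · exact h4.antisymm h3

lemma FreeSides.not_isCompact (hI : ¬ FreeOn G γ I I) (h : FreeSides G γ I τ)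
    (hB : IsMaximalInterval G γ I B) : ¬ IsCompact B := by
  intro hc
  rcases (h.isMaximalInterval_iff S hI).1 hB with rfl | rfl
  · obtain ⟨x, hx⟩ := hc.exists_isLeast ⟨τ, h.mem, self_mem_Iic⟩
    exact S.not_isLeast_Iic hx.1 hx
  · obtain ⟨x, hx⟩ := hc.exists_isGreatest ⟨τ, h.mem, self_mem_Ici⟩
    exact S.not_isGreatest_Ici hx.1 hx

/-- A reflection point with two free sides is unique, as it cannot be interior to a free side of
another one. -/
lemma FreeSides.unique (hI : ¬ FreeOn G γ I I) (h : FreeSides G γ I τ)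
    (h' : FreeSides G γ I τ') : τ = τ' := by
  have key : ∀ {τ τ'}, FreeSides G γ I τ → FreeSides G γ I τ' → ¬ τ < τ' := by
    intro τ τ' h h' hlt
    obtain ⟨y, hy, hτy⟩ := S.exists_gt h'.mem
    have hord : (I ∩ Ici τ).OrdConnected := S.ordConnected.inter ordConnected_Ici
    exact h'.reflection.not_freeOn S hI hord (mem_interior_of_lt hord ⟨h.mem, self_mem_Ici⟩
      ⟨hy, (hlt.trans hτy).le⟩ hlt hτy) h.right
  exact le_antisymm (not_lt.1 (key h' h)) (not_lt.1 (key h h'))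

omit [T2Space M] in
lemma Setting.interior_inter_Iic : interior (I ∩ Iic τ) = I ∩ Iio τ := by
  rw [interior_inter, S.isOpen.interior_eq, interior_Iic]

omit [T2Space M] in
lemma Setting.interior_inter_Ici : interior (I ∩ Ici τ) = I ∩ Ioi τ := by
  rw [interior_inter, S.isOpen.interior_eq, interior_Ici]

/-- The reflection at `τ` is unique. -/
lemma FreeSides.reflection_unique (hI : ¬ FreeOn G γ I I) (h : FreeSides G γ I τ)
    (hF : IsComp γ I g F O) (ha : StrictAntiOn F O) (hτ : τ ∈ O) (hFτ : F τ = τ)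
    (hE : IsComp γ I k E Q) (ha' : StrictAntiOn E Q) (hτ' : τ ∈ Q) (hEτ : E τ = τ) :
    cls γ I g = cls γ I k := by
  have h1 : F '' O ∩ E '' Q ∈ 𝓝 τ := by
    have e1 := hF.image_mem_nhds hτ (hF.isOpen.mem_nhds hτ)
    have e2 := hE.image_mem_nhds hτ' (hE.isOpen.mem_nhds hτ')
    rw [hFτ] at e1
    rw [hEτ] at e2
    exact inter_mem e1 e2
  obtain ⟨t, ⟨⟨s, hs, rfl⟩, ⟨s', hs', hss'⟩⟩, ht⟩ :=
    (Filter.Eventually.and (mem_nhdsWithin_of_mem_nhds h1 : _ ∈ 𝓝[>] τ)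
      self_mem_nhdsWithin).exists
  have ht : τ < F s := ht
  have hlt : s < τ := (ha.lt_iff_gt hτ hs).1 (by rwa [hFτ])
  have hlt' : s' < τ := (ha'.lt_iff_gt hτ' hs').1 (by rwa [hEτ, hss'])
  exact (hF.eq_of_eq S hI h.left (S.ordConnected.inter ordConnected_Iic) hE hs hs'
    (by rw [S.interior_inter_Iic]; exact ⟨hF.subset hs, hlt⟩)
    (by rw [S.interior_inter_Iic]; exact ⟨hE.subset hs', hlt'⟩) hss'.symm).2.1

omit [T2Space M] in
/-- If a reflection at `τ` is not defined on all of the left side, then its values exhaust the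
right side. -/
lemma IsComp.image_of_reflection (hF : IsComp γ I g F O) (ha : StrictAntiOn F O) (hτ : τ ∈ O)
    (hFτ : F τ = τ) (hs : s ∈ I) (hsτ : s ≤ τ) (hsO : s ∉ O) :
    F '' (O ∩ Iic τ) = I ∩ Ici τ := by
  apply Subset.antisymm
  · rintro _ ⟨x, hx, rfl⟩
    exact ⟨hF.mapsTo hx.1, hFτ ▸ ha.antitoneOn hx.1 hτ hx.2⟩
  · rintro t ⟨htI, hτt⟩
    rcases hF.exit S.ordConnected hτ hs htI (Or.inl ⟨hFτ.le.trans hτt, fun y hy hys =>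
      ha.antitoneOn hy hτ (by rw [uIcc_of_ge hsτ] at hys; exact hys.2)⟩) with h1 | ⟨y, hy, hys, hyF⟩
    · exact (hsO h1).elim
    · rw [uIcc_of_ge hsτ] at hys
      exact ⟨y, ⟨hy, hys.2⟩, hyF⟩

omit [T2Space M] in
/-- A reflection at `τ` relates the two sides of `τ`. The sides may have different lengths, in
which case the reflection carries a part of the longer one to the other. -/
lemma IsComp.halfRelated (hF : IsComp γ I g F O) (ha : StrictAntiOn F O) (hτ : τ ∈ O)
    (hFτ : F τ = τ) : HalfRelated (fun t => g • γ t) γ I τ (O ∩ Iic τ) F := by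
  have hτI := hF.subset hτ
  have hint : IsInterval (O ∩ Iic τ) := by
    obtain ⟨c, -, hcτ, hc⟩ := isOpen_exists_lt hF.isOpen hτ (sub_one_lt τ)
    obtain ⟨z, hcz, hz⟩ := exists_between hcτ
    have hord : (O ∩ Iic τ).OrdConnected := hF.ordConnected.inter ordConnected_Iic
    exact ⟨hord, z, mem_interior_of_lt hord ⟨hc (left_mem_Icc.2 hcτ.le), hcτ.le⟩
      ⟨hτ, self_mem_Iic⟩ hcz hz⟩
  refine ⟨F '' (O ∩ Iic τ), ⟨hF.isAnalyticDiffeo S hint inter_subset_left,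
    fun t ht => hF.smul_eq ht.1⟩, hFτ, ?_⟩
  by_cases hfull : I ∩ Iic τ ⊆ O
  · have hB : O ∩ Iic τ = I ∩ Iic τ := Subset.antisymm
      (inter_subset_inter_left _ hF.subset) fun x hx => ⟨hfull hx, hx.2⟩
    have him : F '' (O ∩ Iic τ) = F '' O ∩ Ici τ := by
      apply Subset.antisymm
      · rintro _ ⟨x, hx, rfl⟩
        exact ⟨⟨x, hx.1, rfl⟩, hFτ ▸ ha.antitoneOn hx.1 hτ hx.2⟩
      · rintro _ ⟨⟨x, hx, rfl⟩, hxτ⟩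
        exact ⟨x, ⟨hx, (ha.le_iff_ge hτ hx).1 (by rwa [hFτ])⟩, rfl⟩
    by_cases hright : I ∩ Ici τ ⊆ F '' O
    · refine Or.inl ⟨hB, ?_⟩
      rw [him]
      exact Subset.antisymm (inter_subset_inter_left _ hF.mapsTo.image_subset)
        fun x hx => ⟨hright hx, hx.2⟩
    · obtain ⟨t, ht, htO⟩ := not_subset.1 hright
      have hτ' : τ ∈ F '' O := ⟨τ, hτ, hFτ⟩
      have hτt : τ < t := lt_of_le_of_ne ht.2 fun h => htO (h ▸ hτ')
      have hord : (F '' O).OrdConnected := hF.ordConnected_image hF.ordConnected subset_rfl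
      obtain ⟨j, hτj, hjt, hj⟩ := exists_inter_Icc_eq_Ico (hF.isOpen_image hF.isOpen subset_rfl)
        hord hτ' htO hτt
      refine Or.inr (Or.inr ⟨j, S.mem_Icc_subset hτI ht.1 ⟨hτj.le, hjt⟩, hτj, hB, ?_⟩)
      rw [him, ← hj]
      refine Subset.antisymm (fun x hx => ⟨hx.1, hx.2, ?_⟩)
        (inter_subset_inter_right _ Icc_subset_Ici_self)
      by_contra hxt
      exact htO (hord.out hτ' hx.1 ⟨hτt.le, (not_le.1 hxt).le⟩)
  · obtain ⟨s, hs, hsO⟩ := not_subset.1 hfull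
    have hsτ : s < τ := lt_of_le_of_ne hs.2 fun h => hsO (h ▸ hτ)
    obtain ⟨j, hsj, hjτ, hj⟩ := exists_inter_Icc_eq_Ioc hF.isOpen hF.ordConnected hτ hsO hsτ
    refine Or.inr (Or.inl ⟨j, S.mem_Icc_subset hs.1 hτI ⟨hsj, hjτ.le⟩, hjτ, ?_,
      hF.image_of_reflection S ha hτ hFτ hs.1 hs.2 hsO⟩)
    rw [← hj]
    refine Subset.antisymm (fun x hx => ⟨hx.1, ?_, hx.2⟩)
      (inter_subset_inter_right _ Icc_subset_Iic_self)
    by_contra hxs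
    exact hsO (hF.ordConnected.out hx.1 hτ ⟨(not_le.1 hxs).le, hsτ.le⟩)

/-- Conversely, a relation between the two sides of `τ` is the germ of a reflection at `τ`. -/
lemma Setting.exists_comp_of_halfRelated (hτI : τ ∈ I)
    (h : HalfRelated (fun t => g • γ t) γ I τ B μ) :
    ∃ F O, IsComp γ I g F O ∧ StrictAntiOn F O ∧ τ ∈ O ∧ F τ = τ := by
  obtain ⟨B', hrel, hμ, hshape⟩ := h
  have hB : B ⊆ I ∩ Iic τ ∧ τ ∈ B := by
    rcases hshape with ⟨rfl, -⟩ | ⟨j, hj, hjτ, rfl, -⟩ | ⟨j, -, -, rfl, -⟩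
    · exact ⟨subset_rfl, hτI, self_mem_Iic⟩
    · exact ⟨fun x hx => ⟨S.mem_Icc_subset hj hτI (Ioc_subset_Icc_self hx), hx.2⟩,
        right_mem_Ioc.2 hjτ⟩
    · exact ⟨subset_rfl, hτI, self_mem_Iic⟩
  have hB' : B' ⊆ I ∩ Ici τ := by
    rcases hshape with ⟨-, rfl⟩ | ⟨j, -, -, -, rfl⟩ | ⟨j, hj, hjτ, -, rfl⟩
    · exact subset_rfl
    · exact subset_rfl
    · exact fun x hx => ⟨S.mem_Icc_subset hτI hj (Ico_subset_Icc_self hx), hx.1⟩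
  obtain ⟨F, O, hF, hBO, hFμ, him⟩ := S.exists_comp_of_relatedBy (hB.1.trans inter_subset_left)
    (hB'.trans inter_subset_left) hrel
  have hFτ : F τ = τ := (hFμ hB.2).trans hμ
  refine ⟨F, O, hF, hF.strictMonoOn_or_strictAntiOn.resolve_left fun hm => ?_, hBO hB.2, hFτ⟩
  obtain ⟨s, hs⟩ := hrel.1.1.2
  have hsτ := lt_of_mem_interior_Iic (fun x hx => (hB.1 hx).2) hs
  have hsB := interior_subset hs
  have h1 := hm (hBO hsB) (hBO hB.2) hsτ
  rw [hFτ] at h1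
  exact h1.not_ge (hB' (him ▸ mem_image_of_mem F hsB)).2

/-- The `τ`-decompositions are the reflections at a point with two free sides. -/
lemma Setting.isTauDecomposition_iff (hI : ¬ FreeOn G γ I I) :
    IsTauDecomposition γ I τ g ↔ FreeSides G γ I τ ∧
      ∃ F O, IsComp γ I g F O ∧ StrictAntiOn F O ∧ τ ∈ O ∧ F τ = τ := by
  constructor
  · rintro ⟨hτ, h1, h2, -, B, μ, h⟩
    obtain ⟨F, O, hF⟩ := S.exists_comp_of_halfRelated hτ h
    exact ⟨⟨hτ, ⟨g, F, O, hF⟩, ((S.isFreeSegment_iff inter_subset_left).1 h1).2,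
      ((S.isFreeSegment_iff inter_subset_left).1 h2).2⟩, F, O, hF⟩
  · rintro ⟨h, F, O, hF, ha, hτ, hFτ⟩
    refine ⟨h.mem, ((h.isMaximalInterval_iff S hI).2 (Or.inl rfl)).2.1,
      ((h.isMaximalInterval_iff S hI).2 (Or.inr rfl)).2.1, fun hcls => ?_, _, _,
      hF.halfRelated S ha hτ hFτ⟩
    -- an element of the stabilizer cannot reflect the curve, since `γ` is injective near `τ`
    have hg := cls_eq_one_iff.1 hcls
    obtain ⟨U, hU, hinj⟩ := S.exists_injOn h.mem
    have hc := (hF.germ τ hτ).continuousAt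
    obtain ⟨s, ⟨hs, hsU, hFU⟩, hsτ⟩ := (Filter.Eventually.and
      (mem_nhdsWithin_of_mem_nhds (inter_mem (hF.isOpen.mem_nhds hτ)
        (inter_mem hU (hc (by rwa [hFτ])))) : _ ∈ 𝓝[<] τ) self_mem_nhdsWithin).exists
    have hsτ : s < τ := hsτ
    have h1 := ha hs hτ hsτ
    rw [hFτ] at h1
    have h2 := hF.smul_eq hs
    rw [hg s (hF.subset hs)] at h2
    exact (hsτ.trans h1).ne (hinj hsU hFU h2)

/-- Each overlap of a translate of the left side with the curve comes from the identity or from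
the reflection. -/
lemma FreeSides.isFaithfulTau (hI : ¬ FreeOn G γ I I) (h : FreeSides G γ I τ)
    (hF : IsComp γ I g F O) (ha : StrictAntiOn F O) (hτ : τ ∈ O) (hFτ : F τ = τ) :
    IsFaithfulTau γ I τ g := by
  rintro g' ρ J J' ⟨hJ, -, hJL, hJI, -, -, hρ, hrel⟩
  obtain ⟨E, Q, hE, hJQ, hEρ, -⟩ := S.exists_comp_of_relatedBy (hJL.trans inter_subset_left) hJI
    ⟨hρ, hrel⟩
  have hordL : (I ∩ Iic τ).OrdConnected := S.ordConnected.inter ordConnected_Iic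
  have hopen : ∀ {O : Set ℝ} {F : ℝ → ℝ} {g : G}, IsComp γ I g F O → IsOpenInterval O := fun hF =>
    ⟨⟨hF.ordConnected, by rw [hF.isOpen.interior_eq]; exact hF.nonempty⟩, hF.isOpen⟩
  obtain ⟨s, hs, hsτ⟩ : ∃ s ∈ J, E s ≠ τ := by
    obtain ⟨s, hs⟩ := hJ.1.2
    rw [hJ.2.interior_eq] at hs
    by_contra! hall
    obtain ⟨c, hsc, -, hc⟩ := isOpen_exists_gt hJ.2 hs (lt_add_one s)
    have hcJ := hc (right_mem_Icc.2 hsc.le)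
    exact hsc.ne (hE.injOn (hJQ hs) (hJQ hcJ) ((hall s hs).trans (hall c hcJ).symm))
  have hsL : s ∈ interior (I ∩ Iic τ) := interior_maximal hJL hJ.2 hs
  have hsL' : s ∈ I ∩ Iio τ := S.interior_inter_Iic ▸ hsL
  have hEs := hE.mapsTo (hJQ hs)
  rcases lt_or_gt_of_ne hsτ with hlt | hgt
  · left
    obtain ⟨-, h2, rfl, h4⟩ := hE.eq_of_eq S hI h.left hordL S.isComp_id (hJQ hs) hEs hsL
      (by rw [S.interior_inter_Iic]; exact ⟨hEs, hlt⟩) rfl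
    exact ⟨h2, Q, E, hopen hE, hJQ, fun x hx => (hE.germ x hx).analyticAt,
      fun x hx => (hE.germ x hx).deriv_ne, hEρ, inter_subset_left, h4.mono inter_subset_left⟩
  · right
    obtain ⟨s', hs', hs'L, hss'⟩ : ∃ s' ∈ O, s' ∈ I ∩ Iio τ ∧ F s' = E s := by
      by_cases hsO : s ∈ O
      · -- both `E` and `F` take `s` to the right side, which is free
        refine ⟨s, hsO, hsL', ?_⟩
        have hFs : τ < F s := hFτ ▸ ha hsO hτ hsL'.2
        obtain ⟨e, he, hes, -, -⟩ := S.germ_inv (hE.germ s (hJQ hs))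
        have hc := (show Germ γ I g F (e (E s)) by rw [hes]; exact hF.germ s hsO).comp he
        have := (S.germ_trivial hI h.right (S.ordConnected.inter ordConnected_Ici) hc
          (by rw [S.interior_inter_Ici]; exact ⟨hEs, hgt⟩)
          (by rw [S.interior_inter_Ici, hes]; exact ⟨hF.mapsTo hsO, hFs⟩)).eq_of_nhds
        rwa [hes] at this
      · have him := hF.image_of_reflection S ha hτ hFτ hsL'.1 (le_of_lt hsL'.2) hsO
        obtain ⟨s', hs', hss'⟩ : E s ∈ F '' (O ∩ Iic τ) := him ▸ ⟨hEs, le_of_lt hgt⟩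
        have hne : s' ≠ τ := by
          rintro rfl
          exact hsτ (hss'.symm.trans hFτ)
        exact ⟨s', hs'.1, ⟨hF.subset hs'.1, lt_of_le_of_ne hs'.2 hne⟩, hss'⟩
    obtain ⟨-, h2, rfl, h4⟩ := hE.eq_of_eq S hI h.left hordL hF (hJQ hs) hs' hsL
      (by rwa [S.interior_inter_Iic]) hss'.symm
    exact ⟨h2, _, _, hF.halfRelated S ha hτ hFτ, Q, E, hopen hE, hJQ,
      fun x hx => (hE.germ x hx).analyticAt, fun x hx => (hE.germ x hx).deriv_ne, hEρ,
      inter_subset_left, h4.mono inter_subset_left⟩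

end Half

/-! ### The two types of curves with compact maximal intervals -/

section Conclusion

variable {G : Type*} [Group G] {M : Type*} [MulAction G M] {γ : ℝ → M} {I : Set ℝ} {g h k : G}
  {F F' E K : ℝ → ℝ} {O A B D P Q : Set ℝ} {t x a b c v τ : ℝ} {d d' : Splitting G} {n : ℤ}
  [TopologicalSpace M] [T2Space M] (S : Setting G γ I)
include S

/-- The shift is nontrivial: its class is the one of the right neighbor of any maximal interval. -/
lemma PosShift.cls_ne_one (hI : ¬ FreeOn G γ I I) (h₁ : PosShift γ I h F O) :
    cls γ I h ≠ cls γ I 1 := by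
  obtain ⟨x, hx⟩ := h₁.comp.nonempty
  have hA := h₁.max x hx
  obtain ⟨k, K, P, hK, hk⟩ := hA.exists_starts S hI
  have hh : Starts γ I x (F x) h F O (F x) := ⟨h₁.comp, Or.inl ⟨h₁.mono, hx, rfl⟩⟩
  rw [← (hK.unique S hh hI hA.free hA.lt).1]
  exact fun h0 => hk (cls_eq_one_iff.1 h0)

/-- The quotient of the elements for consecutive tiles represents the class of the shift. -/
lemma PosShift.step_of_pos (hI : ¬ FreeOn G γ I I) (h₁ : PosShift γ I h F O) (ha : a ∈ O)
    (ht : Tiles γ I a (F a) d) (hn : 0 < n) (hnd : n ∈ d.index) :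
    cls γ I (d.step n) = cls γ I h := by
  have hm : n - 1 ∈ d.index₀ := by
    rcases (show 0 ≤ n - 1 by omega).eq_or_lt with h0 | h0
    · rw [← h0]
      exact Or.inl rfl
    · refine Or.inr ((ht.dec.mem_index h0).2 (le_trans ?_ ((ht.dec.mem_index hn).1 hnd)))
      exact_mod_cast (by omega : n - 1 ≤ n)
  have h2 : cls γ I (d.elt₀ (n - 1)) = cls γ I (h ^ (n - 1)) := by
    rcases hm with h0 | hm
    · rw [h0, zpow_zero, Splitting.elt₀, if_pos rfl]
    · rw [Splitting.elt₀, if_neg hm.1]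
      exact (h₁.tile S hI ha ht hm).1
  have h3 : cls γ I (d.elt₀ n) = cls γ I (h * d.elt₀ (n - 1)) := by
    rw [Splitting.elt₀, if_neg hn.ne', (h₁.tile S hI ha ht hnd).1, cls_mul_left h2, ← zpow_one_add]
    congr 2
    ring
  obtain ⟨E, Q, hE, -, -⟩ := ht.exists_isTransition S hm
  obtain ⟨x, hx⟩ := hE.nonempty
  obtain ⟨E', hE', -, -⟩ := S.germ_inv (hE.germ x hx)
  rw [Splitting.step, if_neg (by omega), S.cls_mul_right hE' h3, mul_inv_cancel_right]

omit [T2Space M] in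
/-- The data of the reversed curve: the base interval `[a, F a]` becomes `[-F a, -a]`, which is
again of the form `[c, F₁ c]` for the shift `F₁` of the reversed curve. -/
lemma PosShift.exists_mirror (h₁ : PosShift γ I h F O) (ha : a ∈ O) (ht : Tiles γ I a (F a) d) :
    ∃ F₁ O₁, PosShift (fun t => γ (-t)) (-I) h⁻¹ F₁ O₁ ∧ -F a ∈ O₁ ∧
      Tiles (fun t => γ (-t)) (-I) (-F a) (F₁ (-F a)) d.mirror := by
  obtain ⟨F', hinv, h₂⟩ := h₁.mirror S
  refine ⟨_, _, h₂, ?_, ?_⟩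
  · rw [Set.mem_neg, neg_neg]
    exact mem_image_of_mem F ha
  · have := ht.mirror
    rwa [show -a = -F' (- -F a) by rw [neg_neg, hinv a ha]] at this

lemma PosShift.step (hI : ¬ FreeOn G γ I I) (h₁ : PosShift γ I h F O) (ha : a ∈ O)
    (ht : Tiles γ I a (F a) d) (hnd : n ∈ d.index) :
    cls γ I (d.step n) = cls γ I (h ^ n.sign) := by
  rcases lt_or_gt_of_ne hnd.1 with h0 | h0
  · obtain ⟨F₁, O₁, h₂, ha₁, ht₁⟩ := h₁.exists_mirror S ha ht
    have := h₂.step_of_pos S.mirror (by rwa [freeOn_mirror_iff]) ha₁ ht₁ (n := -n) (by omega)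
      (Splitting.mem_index_mirror.2 (by rwa [neg_neg]))
    rw [Splitting.step_mirror _ (by omega), neg_neg, cls_mirror] at this
    rw [this, Int.sign_eq_neg_one_of_neg h0, zpow_neg_one]
  · rw [h₁.step_of_pos S hI ha ht h0 hnd, Int.sign_eq_one_of_pos h0, zpow_one]

/-- All decompositions of positive intervals are made from the shift. -/
lemma PosShift.tiles_of_isADecomposition (hI : ¬ FreeOn G γ I I) (h₁ : PosShift γ I h F O)
    (hd : IsADecomposition γ I A d) : ∃ a ∈ O, A = Icc a (F a) ∧ Tiles γ I a (F a) d := by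
  obtain ⟨a, b, rfl, hA, ht⟩ := S.tiles_of_isADecomposition hI hd
  obtain ⟨haO, rfl⟩ := h₁.eq_of_maxIcc S hA
  exact ⟨a, haO, rfl, ht⟩

lemma PosShift.isPositiveInterval (hI : ¬ FreeOn G γ I I) (h₁ : PosShift γ I h F O)
    (hA : MaxIcc G γ I a b) : IsPositiveInterval G γ I (Icc a b) :=
  (S.isPositiveInterval_iff hI).2 ⟨a, b, rfl, hA, h, F, O, h₁⟩

lemma PosShift.isShiftClass (hI : ¬ FreeOn G γ I I) (h₁ : PosShift γ I h F O) :
    IsShiftClass γ I h := by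
  refine ⟨h₁.cls_ne_one S hI, fun A d _ hd n hn => ?_⟩
  obtain ⟨a, ha, rfl, ht⟩ := h₁.tiles_of_isADecomposition S hI hd
  exact h₁.step S hI ha ht hn

lemma PosShift.cls_eq_of_isShiftClass (hI : ¬ FreeOn G γ I I) (h₁ : PosShift γ I h F O)
    (hk : IsShiftClass γ I k) : cls γ I k = cls γ I h := by
  obtain ⟨x, hx⟩ := h₁.comp.nonempty
  have hA := h₁.max x hx
  obtain ⟨d, ht⟩ := hA.exists_tiles S hI
  have h2 := hk.2 _ d (h₁.isPositiveInterval S hI hA) (ht.isADecomposition S hI hA) 1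
    ht.dec.one_mem
  rw [h₁.step S hI hx ht ht.dec.one_mem] at h2
  simpa using h2.symm

lemma PosShift.relatedPos (hI : ¬ FreeOn G γ I I) (h₁ : PosShift γ I h F O) (ha : a ∈ O)
    (ht : Tiles γ I a (F a) d) (hn : n ∈ d.index) :
    RelatedPos (fun t => h ^ n • γ t) γ (Icc a (F a)) (d.piece I n) := by
  obtain ⟨h2, E, Q, hE, hm, him⟩ := h₁.tile S hI ha ht hn
  exact ⟨_, _, ht.relatedPosWrt S hn (hE.congr_elt S.isOpen (cls_eq_iff.1 h2)) him hm⟩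

lemma PosShift.isPositiveInterval_piece (hI : ¬ FreeOn G γ I I) (h₁ : PosShift γ I h F O)
    (ha : a ∈ O) (ht : Tiles γ I a (F a) d) (hlo : d.lo < (n : WithBot ℤ))
    (hhi : (n : WithTop ℤ) < d.hi) : IsPositiveInterval G γ I (d.piece I n) := by
  rcases le_total 0 n with hn | hn
  · obtain ⟨v, hv, hmax⟩ := h₁.maxIcc_piece_of_nonneg S hI ha ht hn hhi
    rw [hv]
    exact h₁.isPositiveInterval S hI hmax
  · obtain ⟨F₁, O₁, h₂, ha₁, ht₁⟩ := h₁.exists_mirror S ha ht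
    obtain ⟨v, hv, hmax⟩ := h₂.maxIcc_piece_of_nonneg S.mirror (by rwa [freeOn_mirror_iff]) ha₁
      ht₁ (n := -n) (by omega) (lt_negBot.2 (by rwa [neg_neg]))
    rw [Splitting.piece_mirror, neg_neg, neg_eq_iff_eq_neg, neg_Icc'] at hv
    rw [hv]
    exact h₁.isPositiveInterval S hI (by simpa using hmax.mirror)

lemma PosShift.exists_right_of_piece (hI : ¬ FreeOn G γ I I) (h₁ : PosShift γ I h F O)
    (ha : a ∈ O) (ht : Tiles γ I a (F a) d) (hn : n ≤ 0) (hlo : d.lo < (n : WithBot ℤ))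
    (hb : b ∈ interior (d.piece I (n - 1))) :
    ∃ c ∈ interior (d.piece I n), MaxIcc G γ I b c := by
  obtain ⟨F₁, O₁, h₂, ha₁, ht₁⟩ := h₁.exists_mirror S ha ht
  obtain ⟨c, hc, hmax⟩ := h₂.exists_left_of_piece S.mirror (by rwa [freeOn_mirror_iff]) ha₁ ht₁
    (n := -n) (b := -b) (by omega) (lt_negBot.2 (by rwa [neg_neg])) (by
      rwa [Splitting.piece_mirror, interior_neg_set, Set.mem_neg, neg_neg,
        show -(-n + 1) = n - 1 by ring])
  rw [Splitting.piece_mirror, interior_neg_set, Set.mem_neg, neg_neg] at hc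
  exact ⟨-c, hc, by simpa using hmax.mirror⟩

lemma FreeSides.not_maxIcc (hI : ¬ FreeOn G γ I I) (h : FreeSides G γ I τ) :
    ¬ MaxIcc G γ I a b := fun hA =>
  h.not_isCompact S hI ((S.isMaximalInterval_iff isCompact_Icc).2 ⟨a, b, rfl, hA⟩) isCompact_Icc

lemma Setting.xor_isTauDecomposition (hI : ¬ FreeOn G γ I I) (hfree : IsFreeCurve G γ I) :
    Xor (∃ (τ : ℝ) (g : G), IsTauDecomposition γ I τ g)
      (∃ A, IsCompact A ∧ IsMaximalInterval G γ I A) := by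
  by_cases hno : ∃ a b, MaxIcc G γ I a b
  · obtain ⟨a, b, hA⟩ := hno
    refine Or.inr ⟨⟨_, isCompact_Icc, (S.isMaximalInterval_iff isCompact_Icc).2 ⟨a, b, rfl, hA⟩⟩, ?_⟩
    rintro ⟨τ, g, hτ⟩
    exact ((S.isTauDecomposition_iff hI).1 hτ).1.not_maxIcc S hI hA
  · push Not at hno
    obtain ⟨D, hDI, hD⟩ := hfree
    obtain ⟨τ, hτ⟩ := FreeOn.exists_freeSides S hI hno ((S.isFreeSegment_iff hDI).1 hD).2 hD.1 hDI
    refine Or.inl ⟨?_, ?_⟩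
    · obtain ⟨g, F, O, hF, ha, hτO, hFτ⟩ := hτ.reflection
      exact ⟨τ, g, (S.isTauDecomposition_iff hI).2 ⟨hτ, F, O, hF, ha, hτO, hFτ⟩⟩
    · rintro ⟨A, hc, hA⟩
      exact hτ.not_isCompact S hI hA hc

lemma Setting.tauDecomposition (hI : ¬ FreeOn G γ I I) (h : IsTauDecomposition γ I τ g) :
    IsFaithfulTau γ I τ g ∧
      (∀ B, IsMaximalInterval G γ I B ↔ (B = I ∩ Iic τ ∨ B = I ∩ Ici τ)) ∧
      ∀ (τ' : ℝ) (g' : G), IsTauDecomposition γ I τ' g' → τ' = τ ∧ cls γ I g' = cls γ I g := by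
  obtain ⟨hs, F, O, hF, ha, hτ, hFτ⟩ := (S.isTauDecomposition_iff hI).1 h
  refine ⟨hs.isFaithfulTau S hI hF ha hτ hFτ, fun B => hs.isMaximalInterval_iff S hI,
    fun τ' g' h' => ?_⟩
  obtain ⟨hs', E, Q, hE, ha', hτ', hEτ⟩ := (S.isTauDecomposition_iff hI).1 h'
  obtain rfl := hs'.unique S hI hs
  exact ⟨rfl, hs.reflection_unique S hI hE ha' hτ' hEτ hF ha hτ hFτ⟩

lemma Setting.exists_isADecomposition (hI : ¬ FreeOn G γ I I) (hc : IsCompact A)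
    (hA : IsMaximalInterval G γ I A) :
    ∃ d : Splitting G, IsADecomposition γ I A d ∧ IsFaithful γ I A d ∧
      (I = ⋃ n ∈ d.index₀, d.piece I n) ∧
      ∀ d' : Splitting G, IsADecomposition γ I A d' → SameDecomposition γ I d d' := by
  obtain ⟨a, b, rfl, hm⟩ := (S.isMaximalInterval_iff hc).1 hA
  obtain ⟨d, ht⟩ := hm.exists_tiles S hI
  refine ⟨d, ht.isADecomposition S hI hm, ht.isFaithful S hI hm, ht.iUnion_piece S,
    fun d' hd' => ?_⟩
  obtain ⟨a', b', hab, -, ht'⟩ := S.tiles_of_isADecomposition hI hd'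
  obtain ⟨rfl, rfl⟩ := (Icc_eq_Icc_iff hm.lt.le).1 hab
  exact ht.unique S hI hm.free ht'

lemma Setting.xor_positive_negative (hI : ¬ FreeOn G γ I I) (hA : MaxIcc G γ I a b) :
    Xor (IsPositiveCurve G γ I) (IsNegativeCurve G γ I) := by
  have hexcl : IsPositiveCurve G γ I → ¬ IsNegativeCurve G γ I := by
    rintro ⟨A, hA⟩ ⟨B, hB⟩
    obtain ⟨-, -, -, -, h, F, O, h₁⟩ := (S.isPositiveInterval_iff hI).1 hA
    obtain ⟨a, b, -, -, ha, -⟩ := (S.isNegativeInterval_iff hI).1 hB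
    exact h₁.not_isReflectionPoint S hI ha
  rcases hA.pos_or_neg S hI with h | h
  · have h1 : IsPositiveCurve G γ I := ⟨_, (S.isPositiveInterval_iff hI).2 ⟨a, b, rfl, hA, h⟩⟩
    exact Or.inl ⟨h1, hexcl h1⟩
  · have h1 : IsNegativeCurve G γ I := ⟨_, (S.isNegativeInterval_iff hI).2 ⟨a, b, rfl, hA, h⟩⟩
    exact Or.inr ⟨h1, fun h2 => hexcl h2 h1⟩

lemma Setting.exists_posShift (hI : ¬ FreeOn G γ I I) (hpos : IsPositiveCurve G γ I) :
    ∃ (h : G) (F : ℝ → ℝ) (O : Set ℝ), PosShift γ I h F O := by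
  obtain ⟨A, hA⟩ := hpos
  obtain ⟨-, -, -, -, h⟩ := (S.isPositiveInterval_iff hI).1 hA
  exact h

/-- All compact maximal intervals of a negative curve end in reflection points. -/
lemma MaxIcc.isReflectionPoint_of_isNegativeCurve (hI : ¬ FreeOn G γ I I)
    (hneg : IsNegativeCurve G γ I) (hA : MaxIcc G γ I a b) :
    IsReflectionPoint G γ I a ∧ IsReflectionPoint G γ I b := by
  obtain ⟨B, hB⟩ := hneg
  obtain ⟨c, -, -, -, hc, -⟩ := (S.isNegativeInterval_iff hI).1 hB
  rcases hA.pos_or_neg S hI with ⟨h, F, O, h₁⟩ | h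
  · exact (h₁.not_isReflectionPoint S hI hc).elim
  · exact h

end Conclusion

end FreeCurve

theorem mainTheorem3
    {EG : Type*} [NormedAddCommGroup EG] [NormedSpace ℝ EG] [FiniteDimensional ℝ EG]
    {EM : Type*} [NormedAddCommGroup EM] [NormedSpace ℝ EM] [FiniteDimensional ℝ EM]
    {G : Type*} [Group G] [TopologicalSpace G] [ChartedSpace EG G] [LieGroup 𝓘(ℝ, EG) ω G]
    [T2Space G] [SecondCountableTopology G]
    {M : Type*} [TopologicalSpace M] [ChartedSpace EM M] [IsManifold 𝓘(ℝ, EM) ω M]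
    [T2Space M] [SecondCountableTopology M]
    [MulAction G M]
    (hG : ∀ x : M, ContMDiff 𝓘(ℝ, EG) 𝓘(ℝ, EM) ω (fun g : G => g • x))
    (hM : ∀ g : G, ContMDiff 𝓘(ℝ, EM) 𝓘(ℝ, EM) ω (fun x : M => g • x))
    (hsated : IsSated G M)
    (I : Set ℝ) (hI : IsOpenInterval I)
    (γ : ℝ → M) (hγ : IsAnalyticImmersion (E := EM) γ I)
    (hfree : IsFreeCurve G γ I) (hseg : ¬ IsFreeSegment G γ I) :
    -- either a `τ`-decomposition or a compact maximal interval exists, but not both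
    Xor (∃ (τ : ℝ) (g : G), IsTauDecomposition γ I τ g)
      (∃ A, IsCompact A ∧ IsMaximalInterval G γ I A) ∧
    -- a `τ`-decomposition is unique and faithful
    (∀ (τ : ℝ) (g : G), IsTauDecomposition γ I τ g →
      IsFaithfulTau γ I τ g ∧
      (∀ B, IsMaximalInterval G γ I B ↔ (B = I ∩ Iic τ ∨ B = I ∩ Ici τ)) ∧
      ∀ (τ' : ℝ) (g' : G), IsTauDecomposition γ I τ' g' → τ' = τ ∧ cls γ I g' = cls γ I g) ∧
    -- each compact maximal `A` has a unique `A`-decomposition, it is faithful and exhausts `I`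
    (∀ A, IsCompact A → IsMaximalInterval G γ I A →
      ∃ d : Splitting G, IsADecomposition γ I A d ∧ IsFaithful γ I A d ∧
        (I = ⋃ n ∈ d.index₀, d.piece I n) ∧
        ∀ d' : Splitting G, IsADecomposition γ I A d' → SameDecomposition γ I d d') ∧
    -- if there is a compact maximal interval, `γ` is either positive or negative
    ((∃ A, IsCompact A ∧ IsMaximalInterval G γ I A) →
      Xor (IsPositiveCurve G γ I) (IsNegativeCurve G γ I)) ∧
    -- the positive case
    (IsPositiveCurve G γ I →
      (∀ A, IsCompact A → IsMaximalInterval G γ I A → IsPositiveInterval G γ I A) ∧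
      (∃ h : G, IsShiftClass γ I h ∧
        (∀ h' : G, IsShiftClass γ I h' → cls γ I h' = cls γ I h) ∧
        ∀ (A : Set ℝ) (d : Splitting G), IsPositiveInterval G γ I A → IsADecomposition γ I A d →
          ∀ n ∈ d.index, cls γ I (d.elt n) = cls γ I (h ^ n) ∧
            RelatedPos (fun t => h ^ n • γ t) γ A (d.piece I n)) ∧
      (∀ t ∈ I, ∃ A, IsPositiveInterval G γ I A ∧ t ∈ interior A) ∧
      (∀ (A : Set ℝ) (d : Splitting G), IsPositiveInterval G γ I A → IsADecomposition γ I A d →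
        (∀ n : ℤ, d.lo < (n : WithBot ℤ) → (n : WithTop ℤ) < d.hi →
          IsPositiveInterval G γ I (d.piece I n)) ∧
        (∀ n : ℤ, d.lo < (n : WithBot ℤ) → n ≤ 0 → ∀ b' ∈ interior (d.piece I (n - 1)),
          ∃ b ∈ interior (d.piece I n), IsPositiveInterval G γ I (Icc b' b)) ∧
        (∀ n : ℤ, 0 ≤ n → (n : WithTop ℤ) < d.hi → ∀ b ∈ interior (d.piece I (n + 1)),
          ∃ b' ∈ interior (d.piece I n), IsPositiveInterval G γ I (Icc b' b)))) ∧
    -- the negative case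
    (IsNegativeCurve G γ I →
      (∀ A, IsCompact A → IsMaximalInterval G γ I A → IsNegativeInterval G γ I A) ∧
      (∀ (A : Set ℝ) (d : Splitting G), IsNegativeInterval G γ I A → IsADecomposition γ I A d →
        (∀ B, IsMaximalInterval G γ I B ↔ ∃ n ∈ d.index₀, B = d.piece I n) ∧
        ∀ n ∈ d.index,
          (Even n → RelatedPos (fun t => d.elt n • γ t) γ A (d.piece I n)) ∧
          (Odd n → RelatedNeg (fun t => d.elt n • γ t) γ A (d.piece I n)) ∧
          cls γ I (d.elt n) = cls γ I (d.altProd n))) := by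
  have : CompleteSpace EM := FiniteDimensional.complete ℝ EM
  have S : Setting G γ I :=
    { isOpen := hI.2
      ordConnected := hI.1.1
      nonempty := hI.1.2.mono interior_subset
      cont := fun t ht => (hγ.contMDiffAt hI.2 ht).continuousAt
      act := fun g => (hM g).continuous
      sated := hsated
      compare := fun g s t hs ht hst =>
        exists_local_comparison hI.2 (hγ.smul hM hI.2 g) hγ hs ht hst }
  have hFI : ¬ FreeOn G γ I I := fun h => hseg ((S.isFreeSegment_iff subset_rfl).2 ⟨hI.1, h⟩)
  refine ⟨S.xor_isTauDecomposition hFI hfree, fun τ g h => S.tauDecomposition hFI h,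
    fun A hc hA => S.exists_isADecomposition hFI hc hA, ?_, fun hpos => ?_, fun hneg => ?_⟩
  · rintro ⟨A, hc, hA⟩
    obtain ⟨a, b, -, hm⟩ := (S.isMaximalInterval_iff hc).1 hA
    exact S.xor_positive_negative hFI hm
  · obtain ⟨h, F, O, h₁⟩ := S.exists_posShift hFI hpos
    refine ⟨fun A hc hA => ?_, ⟨h, h₁.isShiftClass S hFI,
      fun k hk => h₁.cls_eq_of_isShiftClass S hFI hk, fun A d _ hd n hn => ?_⟩, fun t ht => ?_,
      fun A d _ hd => ?_⟩
    · obtain ⟨a, b, rfl, hm⟩ := (S.isMaximalInterval_iff hc).1 hA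
      exact h₁.isPositiveInterval S hFI hm
    · obtain ⟨a, ha, rfl, hT⟩ := h₁.tiles_of_isADecomposition S hFI hd
      exact ⟨(h₁.tile S hFI ha hT hn).1, h₁.relatedPos S hFI ha hT hn⟩
    · obtain ⟨x, hx, htx⟩ := h₁.exists_mem_Ioo S ht
      exact ⟨_, h₁.isPositiveInterval S hFI (h₁.max x hx), by rwa [interior_Icc]⟩
    · obtain ⟨a, ha, rfl, hT⟩ := h₁.tiles_of_isADecomposition S hFI hd
      refine ⟨fun n hlo hhi => h₁.isPositiveInterval_piece S hFI ha hT hlo hhi,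
        fun n hlo hn b hb => ?_, fun n hn hhi b hb => ?_⟩
      · obtain ⟨c, hc, hm⟩ := h₁.exists_right_of_piece S hFI ha hT hn hlo hb
        exact ⟨c, hc, h₁.isPositiveInterval S hFI hm⟩
      · obtain ⟨c, hc, hm⟩ := h₁.exists_left_of_piece S hFI ha hT hn hhi hb
        exact ⟨c, hc, h₁.isPositiveInterval S hFI hm⟩
  · refine ⟨fun A hc hA => ?_, fun A d _ hd => ?_⟩
    · obtain ⟨a, b, rfl, hm⟩ := (S.isMaximalInterval_iff hc).1 hA
      exact (S.isNegativeInterval_iff hFI).2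
        ⟨a, b, rfl, hm, hm.isReflectionPoint_of_isNegativeCurve S hFI hneg⟩
    · obtain ⟨a, b, rfl, hm, hT⟩ := S.tiles_of_isADecomposition hFI hd
      obtain ⟨ha, hb⟩ := hm.isReflectionPoint_of_isNegativeCurve S hFI hneg
      refine ⟨fun B => hT.isMaximalInterval_iff S hFI hm.free
        fun i hi => (hT.alternate S hFI hm.free ha hb hi).2.1, fun n hn => ?_⟩
      obtain ⟨h1, -, E, Q, hE, him, hev, hodd⟩ := hT.alternate S hFI hm.free ha hb hn
      exact ⟨fun h => ⟨_, _, hT.relatedPosWrt S hn hE him (hev h)⟩,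
        fun h => ⟨_, _, hT.relatedNegWrt S hn hE him (hodd h)⟩, h1⟩
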